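/- **Setting.** Let $0<\alpha<1$, $\mu\ge 0$, $d\in\{1,2\}$, and let $\Omega\subset\mathbb{R}^d$ be a bounded domain. Let $A$ be a self-adjoint positive definite second-order elliptic operator on $\Omega$ with homogeneous Dirichlet boundary condition, $Av=-\sum_{i,j}\partial_i(a_{ij}\partial_j v)+c_0v$, where $a_{ij},c_0\in L^\infty(\Omega)$, $(a_{ij})$ is symmetric and uniformly elliptic, and the associated bilinear form $$A(v,w)=\int_\Omega\Big(\sum_{i,j}a_{ij}\,\partial_jv\,\partial_iw+c_0\,v\,w\Big)\,dx$$ satisfies $A(v,v)>0$ for all $0\ne v\in H^1_0(\Omega)$. Let $(\cdot,\cdot)$ and $\|\cdot\|$ be the inner product and norm of $L^2(\Omega)$. Let $X_h\subset H^1_0(\Omega)$ be the space of continuous piecewise linear functions on a finite conforming simplicial triangulation of $\overline\Omega$, let $P_h:L^2(\Omega)\to X_h$ be the $L^2$-projection, and let $A_h:X_h\to X_h$ be defined by $(A_h\varphi,\psi)=A(\varphi,\psi)$ for all $\varphi,\psi\in X_h$. Let $T>0$, $u^0\in L^2(\Omega)$ and $f(t)=t^{\mu}g(t)$ with $g\in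 W^{1,\infty}(0,T;L^2(\Omega))$ such that $g'$ has a weak derivative $g''$ with $\int_0^T\|g''(\zeta)\|\,d\zeta<\infty$; $g$ and $g'$ are identified with their continuous representatives on $[0,T]$. Let $u_h:[0,T]\to X_h$ be the solution of the semidiscrete problem $${}^{C}\!D_t^{\alpha}u_h(t)+A_hu_h(t)=P_hf(t),\qquad u_h(0)=P_hu^0,$$ that is, $u_h$ is absolutely continuous, takes this initial value and satisfies the equation for almost every $t\in(0,T]$, where ${}^{C}\!D_t^{\alpha}u(t)=\frac1{\Gamma(1-\alpha)}\int_0^t(t-\zeta)^{-\alpha}u'(\zeta)\,d\zeta$ is the Caputo derivative. **Scheme CN-I.** Let $N\ge1$, $\tau=T/N$, $t_n=n\tau$, $\sigma_0=1$, $\sigma_j=\big(1-\frac{\alpha+1}{j}\big)\sigma_{j-1}$ for $j\ge1$, and $F_h(t)=\int_0^tP_hf(\zeta)\,d\zeta$. For a sequence $V$ let $D_\tau V^n=\frac1\tau\big(\frac32V^n-2V^{n-1}+\frac12V^{n-2}\big)$; let $\rho^n=\frac{t_n^{2-\alpha}}{\Gamma(3-\alpha)}$ for $n\ge1$ and $\rho^n=0$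 for $n\le0$. The approximations $\tilde U_h^n,\tilde u_h^n\in X_h$ satisfy $\tilde U_h^n=0$ for $n\le0$ and, for $1\le n\le N$, $$\tau^{-\alpha}\sum_{j=0}^n\sigma_j\tilde U_h^{n-j}+\big(1-\tfrac\alpha2\big)A_h\tilde U_h^n+\tfrac\alpha2A_h\tilde U_h^{n-1}=\big(1-\tfrac\alpha2\big)F_h(t_n)+\tfrac\alpha2F_h(t_{n-1})+\Big(\big(1-\tfrac\alpha2\big)D_\tau\rho^n+\tfrac\alpha2D_\tau\rho^{n-1}\Big)P_hu^0,$$ $$\tilde u_h^n=D_\tau\tilde U_h^n .$$ **Theorem.** There is a constant $c>0$ depending only on $\alpha$ and $\mu$ (in particular not on $\Omega$, $A$, the triangulation, $T$, $N$, $n$, $u^0$ or $g$) such that, for every $1\le n\le N$ with $\int_0^{t_n}(t_n-\zeta)^{\alpha-1}\zeta^{\mu}\|g''(\zeta)\|\,d\zeta<\infty$, $$\|u_h(t_n)-\tilde u_h^n\|\le c\,\tau^2\Big(t_n^{-2}\|u^0\|+t_n^{\alpha+\mu-2}\|g(0)\|+t_n^{\alpha+\mu-1}\|g'(0)\|+t_n^{\alpha+\mu-1}\int_0^{t_n}\|g''(\zeta)\|\,d\zeta+\int_0^{t_n}(t_n-\zeta)^{\alpha-1}\zeta^{\mu}\|g''(\zeta)\|\,d\zeta\Big).$$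 -/

import Mathlib

open MeasureTheory Set Filter Topology TopologicalSpace
open scoped ENNReal ContDiff

noncomputable section

namespace SubDiffusion

/-! ### Sobolev spaces on a domain -/

/-- Euclidean space `ℝ^d`. -/
abbrev Space (d : ℕ) : Type := EuclideanSpace ℝ (Fin d)

/-- The real Hilbert space `L²(Ω)`. -/
abbrev L2 {d : ℕ} (Ω : Opens (Space d)) : Type :=
  Lp ℝ 2 (volume.restrict (Ω : Set (Space d)))

/-- `φ ∈ C_c^∞(Ω)`. -/
structure IsTestFunction {d : ℕ} (Ω : Opens (Space d)) (φ : Space d → ℝ) : Prop where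
  contDiff : ContDiff ℝ ∞ φ
  hasCompactSupport : HasCompactSupport φ
  tsupport_subset : tsupport φ ⊆ (Ω : Set (Space d))

/-- The classical partial derivative `∂_i φ`. -/
def pderiv {d : ℕ} (i : Fin d) (φ : Space d → ℝ) (x : Space d) : ℝ :=
  fderiv ℝ φ x (EuclideanSpace.single i 1)

/-- `w ∈ L²(Ω)` is the weak partial derivative `∂_i v` of `v ∈ L²(Ω)` on `Ω`. -/
def HasWeakPartial {d : ℕ} (Ω : Opens (Space d)) (i : Fin d) (v w : L2 Ω) : Prop :=
  ∀ φ : Space d → ℝ, IsTestFunction Ω φ →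
    ∫ x in (Ω : Set (Space d)), v x * pderiv i φ x = -∫ x in (Ω : Set (Space d)), w x * φ x

open Classical in
/-- The weak partial derivative `∂_i v ∈ L²(Ω)` (and `0` if `v` has none). -/
def weakPartial {d : ℕ} (Ω : Opens (Space d)) (i : Fin d) (v : L2 Ω) : L2 Ω :=
  if h : ∃ w : L2 Ω, HasWeakPartial Ω i v w then h.choose else 0

/-- `v ∈ H₀¹(Ω)`: all weak partial derivatives of `v` exist in `L²(Ω)`, and `v` is a limit of
functions of `C_c^∞(Ω)` in the norm of `H¹(Ω)`. -/
structure MemH10 {d : ℕ} (Ω : Opens (Space d)) (v : L2 Ω) : Prop where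
  exists_weakPartial : ∀ i, ∃ w : L2 Ω, HasWeakPartial Ω i v w
  exists_approx : ∀ ε : ℝ, 0 < ε → ∃ φ : Space d → ℝ, IsTestFunction Ω φ ∧
    eLpNorm (fun x => v x - φ x) 2 (volume.restrict (Ω : Set (Space d))) < ENNReal.ofReal ε ∧
    ∀ i, eLpNorm (fun x => weakPartial Ω i v x - pderiv i φ x) 2
      (volume.restrict (Ω : Set (Space d))) < ENNReal.ofReal ε

section Facts

variable {d : ℕ} {Ω : Opens (Space d)}

theorem IsTestFunction.memLp {φ : Space d → ℝ} (hφ : IsTestFunction Ω φ) :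
    MemLp φ 2 (volume.restrict (Ω : Set (Space d))) :=
  (hφ.contDiff.continuous.memLp_of_hasCompactSupport hφ.hasCompactSupport).restrict _

theorem IsTestFunction.memLp_pderiv {φ : Space d → ℝ} (hφ : IsTestFunction Ω φ) (i : Fin d) :
    MemLp (pderiv i φ) 2 (volume.restrict (Ω : Set (Space d))) := by
  have h1 : Continuous (pderiv i φ) :=
    (hφ.contDiff.continuous_fderiv (by simp)).clm_apply continuous_const
  have h2 : HasCompactSupport (pderiv i φ) :=
    hφ.hasCompactSupport.fderiv_apply ℝ _
  exact (h1.memLp_of_hasCompactSupport h2).restrict _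

theorem IsTestFunction.add {φ ψ : Space d → ℝ} (hφ : IsTestFunction Ω φ)
    (hψ : IsTestFunction Ω ψ) : IsTestFunction Ω (φ + ψ) where
  contDiff := hφ.contDiff.add hψ.contDiff
  hasCompactSupport := hφ.hasCompactSupport.add hψ.hasCompactSupport
  tsupport_subset := (tsupport_add φ ψ).trans
    (union_subset hφ.tsupport_subset hψ.tsupport_subset)

theorem IsTestFunction.const_smul {φ : Space d → ℝ} (hφ : IsTestFunction Ω φ) (r : ℝ) :
    IsTestFunction Ω (r • φ) where
  contDiff := hφ.contDiff.const_smul r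
  hasCompactSupport := hφ.hasCompactSupport.smul_left (f := fun _ => r)
  tsupport_subset := (closure_mono (Function.support_const_smul_subset r φ)).trans
    hφ.tsupport_subset

theorem isTestFunction_zero : IsTestFunction Ω (0 : Space d → ℝ) where
  contDiff := contDiff_const
  hasCompactSupport := HasCompactSupport.zero
  tsupport_subset := by simp [tsupport]

theorem pderiv_add {φ ψ : Space d → ℝ} (hφ : IsTestFunction Ω φ) (hψ : IsTestFunction Ω ψ)
    (i : Fin d) (x : Space d) : pderiv i (φ + ψ) x = pderiv i φ x + pderiv i ψ x := by
  unfold pderiv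
  rw [fderiv_add (hφ.contDiff.differentiable (by simp) x)
    (hψ.contDiff.differentiable (by simp) x)]
  rfl

theorem pderiv_smul {φ : Space d → ℝ} (hφ : IsTestFunction Ω φ) (r : ℝ)
    (i : Fin d) (x : Space d) : pderiv i (r • φ) x = r * pderiv i φ x := by
  unfold pderiv
  rw [fderiv_const_smul (hφ.contDiff.differentiable (by simp) x)]
  rfl

theorem HasWeakPartial.unique {i : Fin d} {v w w' : L2 Ω} (h : HasWeakPartial Ω i v w)
    (h' : HasWeakPartial Ω i v w') : w = w' := by
  have hli : LocallyIntegrableOn (fun x => w x - w' x) (Ω : Set (Space d)) := by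
    have h1 : LocallyIntegrable (fun x => w x - w' x) (volume.restrict (Ω : Set (Space d))) :=
      ((Lp.memLp w).sub (Lp.memLp w')).locallyIntegrable (by norm_num)
    exact locallyIntegrableOn_of_locallyIntegrable_restrict h1
  have key := Ω.isOpen.ae_eq_zero_of_integral_contDiff_smul_eq_zero hli (fun φ h1 h2 h3 => by
    have hφ : IsTestFunction Ω φ := ⟨h1, h2, h3⟩
    have e := (h φ hφ).symm.trans (h' φ hφ)
    have i1 : IntegrableOn (fun x => w x * φ x) (Ω : Set (Space d)) :=
      (Lp.memLp w).integrable_mul hφ.memLp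
    have i2 : IntegrableOn (fun x => w' x * φ x) (Ω : Set (Space d)) :=
      (Lp.memLp w').integrable_mul hφ.memLp
    have e2 : ∫ x in (Ω : Set (Space d)), φ x • (w x - w' x) = 0 := by
      have : (fun x => φ x • (w x - w' x)) = fun x => w x * φ x - w' x * φ x := by
        ext x; simp only [smul_eq_mul]; ring
      rw [this, integral_sub i1 i2]
      linarith
    rw [← e2]
    refine (setIntegral_eq_integral_of_forall_compl_eq_zero fun x hx => ?_).symm
    have : φ x = 0 := image_eq_zero_of_notMem_tsupport fun hx' => hx (h3 hx')
    simp [this])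
  refine Lp.ext ?_
  rw [Filter.EventuallyEq, ae_restrict_iff' Ω.isOpen.measurableSet]
  filter_upwards [key] with x hx hxΩ
  exact sub_eq_zero.1 (hx hxΩ)

theorem HasWeakPartial.weakPartial_eq {i : Fin d} {v w : L2 Ω} (h : HasWeakPartial Ω i v w) :
    weakPartial Ω i v = w := by
  have h' : ∃ w : L2 Ω, HasWeakPartial Ω i v w := ⟨w, h⟩
  rw [weakPartial, dif_pos h']
  exact h'.choose_spec.unique h

theorem MemH10.hasWeakPartial {v : L2 Ω} (hv : MemH10 Ω v) (i : Fin d) :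
    HasWeakPartial Ω i v (weakPartial Ω i v) := by
  obtain ⟨w, hw⟩ := hv.exists_weakPartial i
  rwa [hw.weakPartial_eq]

theorem HasWeakPartial.add {i : Fin d} {v v' w w' : L2 Ω} (h : HasWeakPartial Ω i v w)
    (h' : HasWeakPartial Ω i v' w') : HasWeakPartial Ω i (v + v') (w + w') := by
  intro φ hφ
  have e1 : ∫ x in (Ω : Set (Space d)), (v + v' : L2 Ω) x * pderiv i φ x =
      ∫ x in (Ω : Set (Space d)), (v x * pderiv i φ x + v' x * pderiv i φ x) := by
    refine integral_congr_ae ?_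
    filter_upwards [Lp.coeFn_add v v'] with x hx
    rw [hx, Pi.add_apply, add_mul]
  have e2 : ∫ x in (Ω : Set (Space d)), (w + w' : L2 Ω) x * φ x =
      ∫ x in (Ω : Set (Space d)), (w x * φ x + w' x * φ x) := by
    refine integral_congr_ae ?_
    filter_upwards [Lp.coeFn_add w w'] with x hx
    rw [hx, Pi.add_apply, add_mul]
  have e3 := integral_add ((Lp.memLp v).integrable_mul (hφ.memLp_pderiv i))
    ((Lp.memLp v').integrable_mul (hφ.memLp_pderiv i))
  have e4 := integral_add ((Lp.memLp w).integrable_mul hφ.memLp)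
    ((Lp.memLp w').integrable_mul hφ.memLp)
  simp only [Pi.mul_apply] at e3 e4
  rw [e1, e2, e3, e4, h φ hφ, h' φ hφ]
  ring

theorem HasWeakPartial.const_smul {i : Fin d} {v w : L2 Ω} (h : HasWeakPartial Ω i v w) (r : ℝ) :
    HasWeakPartial Ω i (r • v) (r • w) := by
  intro φ hφ
  have e1 : ∫ x in (Ω : Set (Space d)), (r • v : L2 Ω) x * pderiv i φ x =
      ∫ x in (Ω : Set (Space d)), r * (v x * pderiv i φ x) := by
    refine integral_congr_ae ?_
    filter_upwards [Lp.coeFn_smul r v] with x hx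
    rw [hx, Pi.smul_apply, smul_eq_mul, mul_assoc]
  have e2 : ∫ x in (Ω : Set (Space d)), (r • w : L2 Ω) x * φ x =
      ∫ x in (Ω : Set (Space d)), r * (w x * φ x) := by
    refine integral_congr_ae ?_
    filter_upwards [Lp.coeFn_smul r w] with x hx
    rw [hx, Pi.smul_apply, smul_eq_mul, mul_assoc]
  rw [e1, e2, integral_const_mul, integral_const_mul, h φ hφ]
  ring

theorem MemH10.weakPartial_add {v v' : L2 Ω} (hv : MemH10 Ω v) (hv' : MemH10 Ω v') (i : Fin d) :
    weakPartial Ω i (v + v') = weakPartial Ω i v + weakPartial Ω i v' :=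
  ((hv.hasWeakPartial i).add (hv'.hasWeakPartial i)).weakPartial_eq

theorem MemH10.weakPartial_smul {v : L2 Ω} (hv : MemH10 Ω v) (r : ℝ) (i : Fin d) :
    weakPartial Ω i (r • v) = r • weakPartial Ω i v :=
  ((hv.hasWeakPartial i).const_smul r).weakPartial_eq

theorem memH10_zero : MemH10 Ω (0 : L2 Ω) := by
  have h0 : ∀ i, HasWeakPartial Ω i (0 : L2 Ω) 0 := by
    intro i φ _
    have h : (fun x => (0 : L2 Ω) x) =ᵐ[volume.restrict (Ω : Set (Space d))] 0 :=
      Lp.coeFn_zero ℝ 2 _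
    have e1 : ∫ x in (Ω : Set (Space d)), (0 : L2 Ω) x * pderiv i φ x = 0 := by
      refine integral_eq_zero_of_ae ?_
      filter_upwards [h] with x hx
      rw [hx]
      simp
    have e2 : ∫ x in (Ω : Set (Space d)), (0 : L2 Ω) x * φ x = 0 := by
      refine integral_eq_zero_of_ae ?_
      filter_upwards [h] with x hx
      rw [hx]
      simp
    rw [e1, e2, neg_zero]
  refine ⟨fun i => ⟨0, h0 i⟩, fun ε hε => ⟨0, isTestFunction_zero, ?_, fun i => ?_⟩⟩
  · have : (fun x => (0 : L2 Ω) x - (0 : Space d → ℝ) x)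
        =ᵐ[volume.restrict (Ω : Set (Space d))] 0 := by
      filter_upwards [Lp.coeFn_zero ℝ 2 (volume.restrict (Ω : Set (Space d)))] with x hx
      rw [hx]
      simp
    rw [eLpNorm_congr_ae this]
    simpa using hε
  · have : (fun x => weakPartial Ω i (0 : L2 Ω) x - pderiv i (0 : Space d → ℝ) x)
        =ᵐ[volume.restrict (Ω : Set (Space d))] 0 := by
      rw [(h0 i).weakPartial_eq]
      filter_upwards [Lp.coeFn_zero ℝ 2 (volume.restrict (Ω : Set (Space d)))] with x hx
      rw [hx]
      simp [pderiv]
    rw [eLpNorm_congr_ae this]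
    simpa using hε

theorem eLpNorm_sub_add_lt {v v' : L2 Ω} {p q : Space d → ℝ} {ε : ℝ} (hε : 0 < ε)
    (hp : MemLp p 2 (volume.restrict (Ω : Set (Space d))))
    (hq : MemLp q 2 (volume.restrict (Ω : Set (Space d))))
    (h : eLpNorm (fun x => v x - p x) 2 (volume.restrict (Ω : Set (Space d))) <
      ENNReal.ofReal (ε / 2))
    (h' : eLpNorm (fun x => v' x - q x) 2 (volume.restrict (Ω : Set (Space d))) <
      ENNReal.ofReal (ε / 2)) :
    eLpNorm (fun x => (v + v' : L2 Ω) x - (p x + q x)) 2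
      (volume.restrict (Ω : Set (Space d))) < ENNReal.ofReal ε := by
  have : (fun x => (v + v' : L2 Ω) x - (p x + q x)) =ᵐ[volume.restrict (Ω : Set (Space d))]
      (fun x => v x - p x) + fun x => v' x - q x := by
    filter_upwards [Lp.coeFn_add v v'] with x hx
    simp only [hx, Pi.add_apply]
    ring
  rw [eLpNorm_congr_ae this]
  refine (eLpNorm_add_le ((Lp.memLp v).sub hp).1 ((Lp.memLp v').sub hq).1 (by norm_num)).trans_lt ?_
  refine (ENNReal.add_lt_add h h').trans_eq ?_
  rw [← ENNReal.ofReal_add (by positivity) (by positivity), add_halves]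

theorem eLpNorm_sub_smul_lt {v : L2 Ω} {p : Space d → ℝ} {ε r : ℝ} (hε : 0 < ε)
    (h : eLpNorm (fun x => v x - p x) 2 (volume.restrict (Ω : Set (Space d))) <
      ENNReal.ofReal (ε / (|r| + 1))) :
    eLpNorm (fun x => (r • v : L2 Ω) x - r * p x) 2
      (volume.restrict (Ω : Set (Space d))) < ENNReal.ofReal ε := by
  have : (fun x => (r • v : L2 Ω) x - r * p x) =ᵐ[volume.restrict (Ω : Set (Space d))]
      r • fun x => v x - p x := by
    filter_upwards [Lp.coeFn_smul r v] with x hx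
    simp only [hx, Pi.smul_apply, smul_eq_mul]
    ring
  rw [eLpNorm_congr_ae this, eLpNorm_const_smul]
  have hr : (0 : ℝ) < |r| + 1 := by positivity
  calc ‖r‖ₑ * eLpNorm (fun x => v x - p x) 2 (volume.restrict (Ω : Set (Space d)))
      ≤ ENNReal.ofReal |r| * ENNReal.ofReal (ε / (|r| + 1)) := by
        gcongr
        rw [← Real.norm_eq_abs, ofReal_norm]
    _ = ENNReal.ofReal (|r| * (ε / (|r| + 1))) := (ENNReal.ofReal_mul (abs_nonneg r)).symm
    _ < ENNReal.ofReal ε := by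
        rw [ENNReal.ofReal_lt_ofReal_iff hε, mul_div_assoc', div_lt_iff₀ hr]
        nlinarith

theorem MemH10.add {v v' : L2 Ω} (hv : MemH10 Ω v) (hv' : MemH10 Ω v') : MemH10 Ω (v + v') := by
  refine ⟨fun i => ⟨_, (hv.hasWeakPartial i).add (hv'.hasWeakPartial i)⟩, fun ε hε => ?_⟩
  obtain ⟨φ, hφ, h1, h2⟩ := hv.exists_approx (ε / 2) (by positivity)
  obtain ⟨ψ, hψ, h1', h2'⟩ := hv'.exists_approx (ε / 2) (by positivity)
  refine ⟨φ + ψ, hφ.add hψ, eLpNorm_sub_add_lt hε hφ.memLp hψ.memLp h1 h1', fun i => ?_⟩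
  simp only [hv.weakPartial_add hv' i, pderiv_add hφ hψ]
  exact eLpNorm_sub_add_lt hε (hφ.memLp_pderiv i) (hψ.memLp_pderiv i) (h2 i) (h2' i)

theorem MemH10.const_smul {v : L2 Ω} (hv : MemH10 Ω v) (r : ℝ) : MemH10 Ω (r • v) := by
  refine ⟨fun i => ⟨_, (hv.hasWeakPartial i).const_smul r⟩, fun ε hε => ?_⟩
  obtain ⟨φ, hφ, h1, h2⟩ := hv.exists_approx (ε / (|r| + 1)) (by positivity)
  refine ⟨r • φ, hφ.const_smul r, eLpNorm_sub_smul_lt hε h1, fun i => ?_⟩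
  simp only [hv.weakPartial_smul r i, pderiv_smul hφ]
  exact eLpNorm_sub_smul_lt hε (h2 i)

end Facts

/-! ### The elliptic operator -/

/-- The Dirichlet form `∫_Ω (∑_{i,j} a_{ij} ∂_j v ∂_i w + c v w)` of the operator
`v ↦ -∑_{i,j} ∂_i (a_{ij} ∂_j v) + c v`. -/
def dirichletForm {d : ℕ} (Ω : Opens (Space d)) (a : Space d → Matrix (Fin d) (Fin d) ℝ)
    (c : Space d → ℝ) (v w : L2 Ω) : ℝ :=
  ∫ x in (Ω : Set (Space d)),
    ((∑ i, ∑ j, a x i j * weakPartial Ω j v x * weakPartial Ω i w x) + c x * v x * w x)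

/-- A self-adjoint positive definite second-order elliptic operator
`A v = -∑_{i,j} ∂_i (a_{ij} ∂_j v) + c v` on `Ω` with homogeneous Dirichlet condition: the
coefficients are bounded and measurable, `(a_{ij})` is symmetric and uniformly elliptic, and the
form of `A` is positive definite on `H₀¹(Ω)`. -/
structure EllipticOperator {d : ℕ} (Ω : Opens (Space d)) where
  a : Space d → Matrix (Fin d) (Fin d) ℝ
  c : Space d → ℝ
  memLp_a : ∀ i j, MemLp (fun x => a x i j) ∞ (volume.restrict (Ω : Set (Space d)))
  memLp_c : MemLp c ∞ (volume.restrict (Ω : Set (Space d)))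
  symm : ∀ᵐ x ∂(volume.restrict (Ω : Set (Space d))), (a x).IsSymm
  elliptic : ∃ κ : ℝ, 0 < κ ∧ ∀ᵐ x ∂(volume.restrict (Ω : Set (Space d))),
    ∀ ξ : Fin d → ℝ, κ * ∑ i, ξ i ^ 2 ≤ ∑ i, ∑ j, a x i j * ξ j * ξ i
  posDef : ∀ v : L2 Ω, MemH10 Ω v → v ≠ 0 → 0 < dirichletForm Ω a c v v

/-- The bilinear form `A(·,·)` associated with the operator `A`. -/
def EllipticOperator.form {d : ℕ} {Ω : Opens (Space d)} (A : EllipticOperator Ω)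
    (v w : L2 Ω) : ℝ :=
  dirichletForm Ω A.a A.c v w

section FormFacts

variable {d : ℕ} {Ω : Opens (Space d)} (A : EllipticOperator Ω)

theorem integrable_coeff_mul_mul {b : Space d → ℝ}
    (hb : MemLp b ∞ (volume.restrict (Ω : Set (Space d)))) (v w : L2 Ω) :
    Integrable (fun x => b x * v x * w x) (volume.restrict (Ω : Set (Space d))) := by
  have h1 : Integrable (fun x => v x * w x) (volume.restrict (Ω : Set (Space d))) :=
    (Lp.memLp v).integrable_mul (Lp.memLp w)
  have h2 : MemLp (b * fun x => v x * w x) 1 (volume.restrict (Ω : Set (Space d))) :=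
    (memLp_one_iff_integrable.2 h1).mul hb
  refine (memLp_one_iff_integrable.1 h2).congr (Eventually.of_forall fun x => ?_)
  simp [mul_assoc]

theorem EllipticOperator.integrable_form (v w : L2 Ω) :
    Integrable (fun x => (∑ i, ∑ j, A.a x i j * weakPartial Ω j v x * weakPartial Ω i w x) +
      A.c x * v x * w x) (volume.restrict (Ω : Set (Space d))) :=
  (integrable_finsetSum _ fun i _ => integrable_finsetSum _ fun j _ =>
    integrable_coeff_mul_mul (A.memLp_a i j) _ _).add (integrable_coeff_mul_mul A.memLp_c _ _)

theorem EllipticOperator.form_add_right (v : L2 Ω) {w w' : L2 Ω} (hw : MemH10 Ω w)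
    (hw' : MemH10 Ω w') : A.form v (w + w') = A.form v w + A.form v w' := by
  unfold EllipticOperator.form dirichletForm
  rw [← integral_add (A.integrable_form v w) (A.integrable_form v w')]
  refine integral_congr_ae ?_
  have hp : ∀ᵐ x ∂(volume.restrict (Ω : Set (Space d))), ∀ i,
      weakPartial Ω i (w + w') x = weakPartial Ω i w x + weakPartial Ω i w' x := by
    rw [ae_all_iff]
    intro i
    rw [hw.weakPartial_add hw' i]
    exact Lp.coeFn_add _ _
  filter_upwards [hp, Lp.coeFn_add w w'] with x h1 h2
  simp only [h1, h2, Pi.add_apply, mul_add, Finset.sum_add_distrib]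
  ring

theorem EllipticOperator.form_smul_right (v : L2 Ω) {w : L2 Ω} (hw : MemH10 Ω w) (r : ℝ) :
    A.form v (r • w) = r * A.form v w := by
  unfold EllipticOperator.form dirichletForm
  rw [← integral_const_mul]
  refine integral_congr_ae ?_
  have hp : ∀ᵐ x ∂(volume.restrict (Ω : Set (Space d))), ∀ i,
      weakPartial Ω i (r • w) x = r * weakPartial Ω i w x := by
    rw [ae_all_iff]
    intro i
    rw [hw.weakPartial_smul r i]
    exact Lp.coeFn_smul _ _
  filter_upwards [hp, Lp.coeFn_smul r w] with x h1 h2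
  simp only [h1, h2, Pi.smul_apply, smul_eq_mul, mul_add, Finset.mul_sum]
  congr 1
  · exact Finset.sum_congr rfl fun i _ => Finset.sum_congr rfl fun j _ => by ring
  · ring

theorem EllipticOperator.form_symm (v w : L2 Ω) : A.form v w = A.form w v := by
  unfold EllipticOperator.form dirichletForm
  refine integral_congr_ae ?_
  filter_upwards [A.symm] with x hx
  rw [Finset.sum_comm]
  congr 1
  · exact Finset.sum_congr rfl fun i _ => Finset.sum_congr rfl fun j _ => by
      rw [hx.apply]; ring
  · ring

end FormFacts

/-! ### The finite element space and the discrete operator -/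

/-- A (finite, conforming, simplicial) triangulation of the closure of `Ω`. -/
structure Triangulation {d : ℕ} (Ω : Opens (Space d)) where
  complex : Geometry.SimplicialComplex ℝ (Space d)
  finite_faces : complex.faces.Finite
  space_eq : complex.space = closure (Ω : Set (Space d))

/-- `w` is continuous on the closure of `Ω` and affine on every simplex of the triangulation. -/
structure Triangulation.IsPiecewiseLinear {d : ℕ} {Ω : Opens (Space d)} (K : Triangulation Ω)
    (w : Space d → ℝ) : Prop where
  continuousOn : ContinuousOn w (closure (Ω : Set (Space d)))
  affineOn : ∀ s ∈ K.complex.faces, ∃ (b : ℝ) (ℓ : Space d →ₗ[ℝ] ℝ),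
    ∀ x ∈ convexHull ℝ (s : Set (Space d)), w x = b + ℓ x

/-- The space `X_h ⊂ H₀¹(Ω)` of all continuous piecewise linear functions on the triangulation
that belong to `H₀¹(Ω)`, with the inner product of `L²(Ω)`. -/
def Triangulation.femSpace {d : ℕ} {Ω : Opens (Space d)} (K : Triangulation Ω) :
    Submodule ℝ (L2 Ω) where
  carrier := {v | MemH10 Ω v ∧ ∃ w : Space d → ℝ, K.IsPiecewiseLinear w ∧
    v =ᵐ[volume.restrict (Ω : Set (Space d))] w}
  zero_mem' := ⟨memH10_zero, 0, ⟨continuousOn_const, fun _ _ => ⟨0, 0, fun _ _ => by simp⟩⟩,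
    Lp.coeFn_zero ℝ 2 _⟩
  add_mem' := by
    rintro v v' ⟨hv, w, hw, e⟩ ⟨hv', w', hw', e'⟩
    refine ⟨hv.add hv', w + w', ⟨hw.continuousOn.add hw'.continuousOn, fun s hs => ?_⟩,
      (Lp.coeFn_add v v').trans (e.add e')⟩
    obtain ⟨b, ℓ, h⟩ := hw.affineOn s hs
    obtain ⟨b', ℓ', h'⟩ := hw'.affineOn s hs
    refine ⟨b + b', ℓ + ℓ', fun x hx => ?_⟩
    simp only [Pi.add_apply, h x hx, h' x hx, LinearMap.add_apply]
    ring
  smul_mem' := by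
    rintro r v ⟨hv, w, hw, e⟩
    refine ⟨hv.const_smul r, r • w, ⟨hw.continuousOn.const_smul r, fun s hs => ?_⟩,
      (Lp.coeFn_smul r v).trans (e.const_smul r)⟩
    obtain ⟨b, ℓ, h⟩ := hw.affineOn s hs
    refine ⟨r * b, r • ℓ, fun x hx => ?_⟩
    simp only [Pi.smul_apply, h x hx, LinearMap.smul_apply, smul_eq_mul]
    ring

instance Triangulation.finiteDimensional_femSpace {d : ℕ} {Ω : Opens (Space d)}
    (K : Triangulation Ω) : FiniteDimensional ℝ K.femSpace := by
  classical
  have : Finite K.complex.faces := K.finite_faces.to_subtype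
  have : Fintype K.complex.faces := Fintype.ofFinite _
  have hcov : ∀ x : (Ω : Set (Space d)), ∃ s : K.complex.faces,
      (x : Space d) ∈ convexHull ℝ ((s : Finset (Space d)) : Set (Space d)) := by
    intro x
    have hx : (x : Space d) ∈ K.complex.space := K.space_eq ▸ subset_closure x.2
    obtain ⟨s, hs, h⟩ := Geometry.SimplicialComplex.mem_space_iff.1 hx
    exact ⟨⟨s, hs⟩, h⟩
  choose σ hσ using hcov
  let Φ : (K.complex.faces → ℝ × (Space d →ₗ[ℝ] ℝ)) →ₗ[ℝ] (Space d → ℝ) :=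
    { toFun := fun p x => if hx : x ∈ Ω then
        (p (σ ⟨x, hx⟩)).1 + (p (σ ⟨x, hx⟩)).2 x else 0
      map_add' := by
        intro p q
        ext x
        by_cases hx : x ∈ Ω
        · simp only [Pi.add_apply, hx, dif_pos, Prod.fst_add, Prod.snd_add, LinearMap.add_apply]
          ring
        · simp [hx]
      map_smul' := by
        intro r p
        ext x
        by_cases hx : x ∈ Ω
        · simp only [Pi.smul_apply, hx, dif_pos, Prod.smul_fst, Prod.smul_snd,
            LinearMap.smul_apply, smul_eq_mul, RingHom.id_apply]
          ring
        · simp [hx] }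
  let S : Submodule ℝ (K.complex.faces → ℝ × (Space d →ₗ[ℝ] ℝ)) :=
    { carrier := {p | MemLp (Φ p) 2 (volume.restrict (Ω : Set (Space d)))}
      zero_mem' := by simp
      add_mem' := by
        intro p q hp hq
        simp only [mem_ofPred_eq, map_add] at *
        exact hp.add hq
      smul_mem' := by
        intro r p hp
        simp only [mem_ofPred_eq, map_smul] at *
        exact hp.const_smul r }
  let Ψ : S →ₗ[ℝ] L2 Ω :=
    { toFun := fun p => MemLp.toLp (Φ p.1) p.2
      map_add' := by
        intro p q
        rw [← MemLp.toLp_add]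
        congr 1
        simp
      map_smul' := by
        intro r p
        rw [RingHom.id_apply, ← MemLp.toLp_const_smul]
        congr 1
        simp }
  have hle : K.femSpace ≤ LinearMap.range Ψ := by
    rintro v ⟨_, w, hw, e⟩
    have hch : ∀ s : K.complex.faces, ∃ q : ℝ × (Space d →ₗ[ℝ] ℝ),
        ∀ x ∈ convexHull ℝ ((s : Finset (Space d)) : Set (Space d)), w x = q.1 + q.2 x := by
      intro s
      obtain ⟨b, ℓ, h⟩ := hw.affineOn s.1 s.2
      exact ⟨(b, ℓ), h⟩
    choose p hp using hch
    have hae : v =ᵐ[volume.restrict (Ω : Set (Space d))] Φ p := by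
      filter_upwards [e, ae_restrict_mem Ω.isOpen.measurableSet] with x hx hxΩ
      rw [hx, hp (σ ⟨x, hxΩ⟩) x (hσ ⟨x, hxΩ⟩)]
      have hxΩ' : x ∈ Ω := hxΩ
      simp [Φ, hxΩ']
    have hmem : MemLp (Φ p) 2 (volume.restrict (Ω : Set (Space d))) :=
      (memLp_congr_ae hae).1 (Lp.memLp v)
    refine ⟨⟨p, hmem⟩, ?_⟩
    refine Lp.ext ?_
    exact (MemLp.coeFn_toLp hmem).trans hae.symm
  exact Submodule.finiteDimensional_of_le hle

/-- The `L²`-projection `P_h : L²(Ω) → X_h`. -/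
def Triangulation.proj {d : ℕ} {Ω : Opens (Space d)} (K : Triangulation Ω) :
    L2 Ω →L[ℝ] K.femSpace :=
  K.femSpace.orthogonalProjectionOnto

/-- The functional `ψ ↦ A(φ, ψ)` on `X_h`. -/
def discreteFunctional {d : ℕ} {Ω : Opens (Space d)} (A : EllipticOperator Ω)
    (K : Triangulation Ω) (φ : K.femSpace) : StrongDual ℝ K.femSpace :=
  LinearMap.toContinuousLinearMap
    { toFun := fun ψ : K.femSpace => A.form φ ψ
      map_add' := fun ψ ψ' => A.form_add_right φ ψ.2.1 ψ'.2.1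
      map_smul' := fun r ψ => A.form_smul_right φ ψ.2.1 r }

/-- The discrete operator `A_h : X_h → X_h`, defined by `(A_h φ, ψ) = A(φ, ψ)` for all
`φ, ψ ∈ X_h`. -/
def discreteOp {d : ℕ} {Ω : Opens (Space d)} (A : EllipticOperator Ω) (K : Triangulation Ω)
    (φ : K.femSpace) : K.femSpace :=
  (InnerProductSpace.toDual ℝ K.femSpace).symm (discreteFunctional A K φ)

theorem inner_discreteOp {d : ℕ} {Ω : Opens (Space d)} (A : EllipticOperator Ω)
    (K : Triangulation Ω) (φ ψ : K.femSpace) :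
    inner ℝ (discreteOp A K φ) ψ = A.form φ ψ := by
  rw [discreteOp, InnerProductSpace.toDual_symm_apply]
  rfl

/-! ### Functions of time -/

/-- `g'` is the weak derivative of `g` on the interval `(0,T)`. -/
structure HasTimeWeakDeriv {X : Type*} [NormedAddCommGroup X] [NormedSpace ℝ X] (T : ℝ)
    (g g' : ℝ → X) : Prop where
  integrable : IntegrableOn g (Ioo 0 T)
  integrable_deriv : IntegrableOn g' (Ioo 0 T)
  integral_eq : ∀ φ : ℝ → ℝ, ContDiff ℝ ∞ φ → HasCompactSupport φ → tsupport φ ⊆ Ioo 0 T →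
    ∫ t in Ioo 0 T, deriv φ t • g t = -∫ t in Ioo 0 T, φ t • g' t

/-- `g ∈ W^{1,∞}(0,T;X)`, with weak derivative `g'`. -/
structure MemW1Inf {X : Type*} [NormedAddCommGroup X] [NormedSpace ℝ X] (T : ℝ)
    (g g' : ℝ → X) : Prop where
  memLp : MemLp g ∞ (volume.restrict (Ioo 0 T))
  memLp_deriv : MemLp g' ∞ (volume.restrict (Ioo 0 T))
  hasTimeWeakDeriv : HasTimeWeakDeriv T g g'

/-- The left Caputo derivative of order `α ∈ (0,1)`. -/
def caputoDeriv {X : Type*} [NormedAddCommGroup X] [NormedSpace ℝ X] (α : ℝ) (u : ℝ → X)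
    (t : ℝ) : X :=
  (Real.Gamma (1 - α))⁻¹ • ∫ ζ in (0 : ℝ)..t, (t - ζ) ^ (-α) • deriv u ζ

/-- `u` is the solution on `[0,T]` of `D^α u + B u = f`, `u(0) = u₀`, where `D^α` is the Caputo
derivative: `u` is absolutely continuous and satisfies the equation almost everywhere. -/
structure IsSubdiffusionSolution {X : Type*} [NormedAddCommGroup X] [NormedSpace ℝ X]
    (B : X → X) (α T : ℝ) (f : ℝ → X) (u₀ : X) (u : ℝ → X) : Prop where
  absCont : AbsolutelyContinuousOnInterval u 0 T
  initial : u 0 = u₀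
  equation : ∀ᵐ t ∂(volume.restrict (Ioc 0 T)), caputoDeriv α u t + B (u t) = f t

/-! ### The Crank-Nicolson scheme -/

/-- The Grünwald-Letnikov coefficients: `σ_0 = 1`, `σ_j = (1 - (α+1)/j) σ_{j-1}`. -/
def glWeight (α : ℝ) : ℕ → ℝ
  | 0 => 1
  | j + 1 => (1 - (α + 1) / ((j : ℝ) + 1)) * glWeight α j

/-- The second-order BDF difference operator on grid functions:
`D_τ V^n = τ⁻¹ (3/2 V^n - 2 V^{n-1} + 1/2 V^{n-2})`. -/
def bdf2 {X : Type*} [AddCommGroup X] [Module ℝ X] (τ : ℝ) (V : ℤ → X) (n : ℤ) : X :=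
  τ⁻¹ • ((3 / 2 : ℝ) • V n - (2 : ℝ) • V (n - 1) + (1 / 2 : ℝ) • V (n - 2))

/-- The grid function `t_n^{2-α} / Γ(3-α)`, prescribed by zero for `t_n ≤ 0`. -/
def initialKernel (α τ : ℝ) (n : ℤ) : ℝ :=
  (max ((n : ℝ) * τ) 0) ^ (2 - α) / Real.Gamma (3 - α)

/-- The scheme CN-I with `N` steps of size `τ`, for the operator `B`, the integrated source
`F` and the initial value `u₀`; `U` and `u` are the approximations to the integral of the
solution and to the solution. `U` is prescribed by zero for `t_n ≤ 0`. -/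
structure IsCrankNicolsonI {X : Type*} [AddCommGroup X] [Module ℝ X] (B : X → X) (α τ : ℝ)
    (N : ℕ) (F : ℝ → X) (u₀ : X) (U : ℤ → X) (u : ℕ → X) : Prop where
  nonpos : ∀ n : ℤ, n ≤ 0 → U n = 0
  step : ∀ n : ℕ, 1 ≤ n → n ≤ N →
    (τ ^ (-α)) • ∑ j ∈ Finset.range (n + 1), glWeight α j • U ((n : ℤ) - (j : ℤ))
        + (1 - α / 2) • B (U (n : ℤ)) + (α / 2) • B (U ((n : ℤ) - 1))
      = (1 - α / 2) • F ((n : ℝ) * τ) + (α / 2) • F (((n : ℝ) - 1) * τ)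
        + (1 - α / 2) • bdf2 τ (initialKernel α τ) (n : ℤ) • u₀
        + (α / 2) • bdf2 τ (initialKernel α τ) ((n : ℤ) - 1) • u₀
  output : ∀ n : ℕ, 1 ≤ n → n ≤ N → u n = bdf2 τ U (n : ℤ)

end SubDiffusion

end

/-!
The operator `A_h` is symmetric and positive definite on the finite-dimensional space `X_h`, so it
has an orthonormal eigenbasis, and it suffices to bound the error in each component by a constant
that does not depend on the eigenvalue `lam` (`component_error_eq`, `exists_error_le`). Rescaling
time replaces `τ` by `1` and `lam` by `lam τ^α`, which may be any positive number.

*The two solutions.* For a source `f` and initial value `u₀`, the scalar equation has the solution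
`u(t) = (1 - lam ∫₀ᵗ e) u₀ + (e * f)(t)`, where the resolvent kernel `e` (`resKernel`) is the
Laplace integral of an explicit density (`ae_integral_resKernel_mul`, `eq_of_caputo_equation`).
Generating series solve the scheme in the same form, with weights `K_m` (`srcCoeff`) for the
integrals of `f` over the time steps and factors `initCoeff` for the initial value
(`IsCrankNicolsonI.eq_initCoeff_add`). Deforming Cauchy's contour onto the branch cut writes the
coefficients of the scheme, too, as Laplace integrals of a density, up to an exponentially small
term (`exists_resCoeff_eq`, `exists_srcCoeff_eq`). The two densities agree to second order at the
origin, uniformly in `lam` (`exists_dens_sub_le`); this yields the decay of the difference of `e`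
and the step function `K_⌊x⌋` (`kernErr`, `exists_kernErr_le`).

*The error in the source* is `∫₀ⁿ f(n - x) kernErr(x) dx`. The Laplace transform of `kernErr`
vanishes to second order at the origin, so `kernErr` and its antiderivative have integral zero over
`(0, ∞)` (`integral_kernErr`, `integral_kernErrInt`), and the first and second antiderivatives are
`O(x^(α-2))` and `O(x^(α-1))`. Expanding `g` by Taylor's formula with integral remainder, and
integrating twice by parts, gives the contributions of `g 0`, `g' 0` and `g''`
(`integral_source_mul_kernErr`, `exists_integral_rpow_mul_kernErr_le`, `exists_peanoErr_le`).

*The error in the initial value* is, up to a constant for `n = 1`, made up of `lam` times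
the antiderivative of `kernErr` and a convolution of
the resolvent coefficients with a sequence that does not depend on `lam` (`initDefect`). The sequence
and its iterated partial sums decay like `n^(-α-2)`, `n^(-α-1)`, `n^(-α)`, since the leading terms in
the expansions of its two parts cancel; the resolvent coefficients and their differences decay like
`n^(α-1)`, `n^(α-2)`, `n^(α-3)`. Summation by parts makes the convolution `O(n^(-2))`
(`abs_conv_le`, `exists_initCoeff_sub_le`).
-/

namespace SubDiffusion

/-! ### The spectral density -/

/-- The jump across the negative axis of `1 / (a e^{iπα} + lam)`, up to normalization: the density
of the Laplace representation of the resolvent kernels. -/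
noncomputable def kern (α lam a : ℝ) : ℝ :=
  Real.sin (Real.pi * α) / Real.pi * (a / (a ^ 2 + 2 * lam * a * Real.cos (Real.pi * α) + lam ^ 2))

theorem sin_pi_mul_pos {α : ℝ} (hα : 0 < α) (hα' : α < 1) : 0 < Real.sin (Real.pi * α) :=
  Real.sin_pos_of_pos_of_lt_pi (by positivity) (by nlinarith [Real.pi_pos])

theorem one_add_cos_pi_mul_pos {α : ℝ} (hα : 0 < α) (hα' : α < 1) :
    0 < 1 + Real.cos (Real.pi * α) := by
  have h := sin_pi_mul_pos hα hα'
  have h2 := Real.sin_sq_add_cos_sq (Real.pi * α)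
  nlinarith [Real.neg_one_le_cos (Real.pi * α), Real.cos_le_one (Real.pi * α)]

/-- Uniform coercivity of the quadratic form in the denominator: it would degenerate for `α = 1`. -/
theorem kern_den_ge (α lam a : ℝ) :
    (1 + Real.cos (Real.pi * α)) / 2 * (a + lam) ^ 2 ≤
      a ^ 2 + 2 * lam * a * Real.cos (Real.pi * α) + lam ^ 2 := by
  have h1 := Real.cos_le_one (Real.pi * α)
  nlinarith [mul_nonneg (sub_nonneg.2 h1) (sq_nonneg (a - lam))]

theorem kern_den_pos {α : ℝ} (hα : 0 < α) (hα' : α < 1) {lam a : ℝ} (hl : 0 < lam) (ha : 0 ≤ a) :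
    0 < a ^ 2 + 2 * lam * a * Real.cos (Real.pi * α) + lam ^ 2 := by
  have := one_add_cos_pi_mul_pos hα hα'
  exact lt_of_lt_of_le (by positivity) (kern_den_ge α lam a)

theorem kern_nonneg {α : ℝ} (hα : 0 < α) (hα' : α < 1) {lam a : ℝ} (hl : 0 < lam) (ha : 0 ≤ a) :
    0 ≤ kern α lam a := by
  have h1 := sin_pi_mul_pos hα hα'
  have h2 := kern_den_pos hα hα' hl ha
  unfold kern
  have := Real.pi_pos
  positivity

theorem kern_le {α : ℝ} (hα : 0 < α) (hα' : α < 1) : ∃ C : ℝ, 0 < C ∧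
    ∀ lam a : ℝ, 0 < lam → 0 ≤ a →
    kern α lam a ≤ C * (a / (a + lam) ^ 2) := by
  have h1 := sin_pi_mul_pos hα hα'
  have h2 := one_add_cos_pi_mul_pos hα hα'
  have hp := Real.pi_pos
  refine ⟨Real.sin (Real.pi * α) / Real.pi * (2 / (1 + Real.cos (Real.pi * α))), by positivity,
    fun lam a hl ha => ?_⟩
  unfold kern
  rw [mul_assoc (Real.sin (Real.pi * α) / Real.pi) (2 / _)]
  refine mul_le_mul_of_nonneg_left ?_ (by positivity)
  have h3 := kern_den_ge α lam a
  calc a / (a ^ 2 + 2 * lam * a * Real.cos (Real.pi * α) + lam ^ 2)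
      ≤ a / ((1 + Real.cos (Real.pi * α)) / 2 * (a + lam) ^ 2) := by gcongr
    _ = _ := by field_simp

/-- The density is Lipschitz in the symbol; the weight in the bound is what keeps all later estimates
uniform in `lam`. -/
theorem kern_sub_le {α : ℝ} (hα : 0 < α) (hα' : α < 1) : ∃ C : ℝ, 0 < C ∧
    ∀ lam a a' : ℝ, 0 < lam → 0 ≤ a → 0 ≤ a' →
      |kern α lam a - kern α lam a'| ≤ C * (|a - a'| / ((a + lam) * (a' + lam))) := by
  have h1 := sin_pi_mul_pos hα hα'
  have h2 := one_add_cos_pi_mul_pos hα hα'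
  have hp := Real.pi_pos
  refine ⟨Real.sin (Real.pi * α) / Real.pi * (2 / (1 + Real.cos (Real.pi * α))) ^ 2, by positivity,
    fun lam a a' hl ha ha' => ?_⟩
  have d1 := kern_den_pos hα hα' hl ha
  have d2 := kern_den_pos hα hα' hl ha'
  have g1 := kern_den_ge α lam a
  have g2 := kern_den_ge α lam a'
  set p := a ^ 2 + 2 * lam * a * Real.cos (Real.pi * α) + lam ^ 2 with hpdef
  set q := a' ^ 2 + 2 * lam * a' * Real.cos (Real.pi * α) + lam ^ 2 with hqdef
  have e : kern α lam a - kern α lam a' =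
      Real.sin (Real.pi * α) / Real.pi * ((a - a') * (lam ^ 2 - a * a') / (p * q)) := by
    unfold kern
    rw [← hpdef, ← hqdef, ← mul_sub, div_sub_div _ _ d1.ne' d2.ne']
    congr 2
    rw [hpdef, hqdef]
    ring
  rw [e, abs_mul, abs_of_pos (show 0 < Real.sin (Real.pi * α) / Real.pi by positivity), mul_assoc]
  refine mul_le_mul_of_nonneg_left ?_ (by positivity)
  rw [abs_div, abs_mul, abs_of_pos (mul_pos d1 d2)]
  have h3 : |lam ^ 2 - a * a'| ≤ (a + lam) * (a' + lam) := by
    rw [abs_le]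
    constructor <;> nlinarith [mul_nonneg ha ha', mul_nonneg ha hl.le, mul_nonneg ha' hl.le, sq_nonneg lam]
  calc |a - a'| * |lam ^ 2 - a * a'| / (p * q)
      ≤ |a - a'| * ((a + lam) * (a' + lam)) /
        (((1 + Real.cos (Real.pi * α)) / 2 * (a + lam) ^ 2) *
          ((1 + Real.cos (Real.pi * α)) / 2 * (a' + lam) ^ 2)) := by gcongr
    _ = _ := by field_simp

/-! ### Expansions at zero -/

theorem abs_one_add_rpow_sub_le {α : ℝ} (hα : 0 < α) (hα' : α < 1) {q : ℝ} (hq : -(3 / 4) ≤ q) :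
    |(1 + q) ^ α - 1 - α * q| ≤ 2 * q ^ 2 := by
  have h1 : (1 + q) ^ α ≤ 1 + α * q :=
    rpow_one_add_le_one_add_mul_self (by linarith) hα.le hα'.le
  have h2 : (1 + q) ^ (1 - α) ≤ 1 + (1 - α) * q :=
    rpow_one_add_le_one_add_mul_self (by linarith) (by linarith) (by linarith)
  have hp : 0 < 1 + (1 - α) * q := by nlinarith
  have h3 : (1 + q) / (1 + (1 - α) * q) ≤ (1 + q) ^ α := by
    rw [div_le_iff₀ hp]
    calc 1 + q = (1 + q) ^ α * (1 + q) ^ (1 - α) := by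
          rw [← Real.rpow_add (by linarith)]; simp
      _ ≤ _ := by gcongr; exact Real.rpow_nonneg (by linarith) _
  have h4 : 1 + α * q - 2 * q ^ 2 ≤ (1 + q) / (1 + (1 - α) * q) := by
    rw [le_div_iff₀ hp]
    have h5 : 0 ≤ 2 - α * (1 - α) + 2 * (1 - α) * q := by nlinarith
    nlinarith [mul_nonneg (sq_nonneg q) h5]
  rw [abs_le]
  constructor <;> nlinarith [sq_nonneg q]

/-- `(e^r - 1) / r`. -/
noncomputable def expQuot (r : ℝ) : ℝ := (Real.exp r - 1) / r

theorem abs_exp_sub_quadratic_le {r : ℝ} (hr : |r| ≤ 1) :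
    |Real.exp r - (1 + r + r ^ 2 / 2)| ≤ |r| ^ 3 * (2 / 9) := by
  have h := Real.exp_bound hr (n := 3) (by norm_num)
  simp only [Finset.sum_range_succ, Finset.sum_range_zero, Nat.factorial] at h
  norm_num at h
  have e : Real.exp r - (1 + r + r ^ 2 / 2) = Real.exp r - (1 + r + r ^ 2 / 2) := rfl
  simpa using h

theorem abs_expQuot_sub_le {r : ℝ} (hr : |r| ≤ 1) (h0 : r ≠ 0) :
    |expQuot r - 1 - r / 2| ≤ 2 / 9 * r ^ 2 := by
  have h := abs_exp_sub_quadratic_le hr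
  have e : expQuot r - 1 - r / 2 = (Real.exp r - (1 + r + r ^ 2 / 2)) / r := by
    unfold expQuot; field_simp; ring
  rw [e, abs_div, div_le_iff₀ (abs_pos.2 h0)]
  refine h.trans_eq ?_
  rw [← sq_abs r]; ring

theorem expQuot_pos {r : ℝ} (h0 : r ≠ 0) : 0 < expQuot r := by
  unfold expQuot
  rcases lt_or_gt_of_ne h0 with h | h
  · exact div_pos_of_neg_of_neg (by have := Real.exp_lt_exp.2 h; rw [Real.exp_zero] at this; linarith) h
  · exact div_pos (by have := Real.one_lt_exp_iff.2 h; linarith) h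

/-- The ratio of the symbol of the scheme on the negative axis to the continuous symbol. -/
noncomputable def symbolRatio (α r : ℝ) : ℝ := expQuot r ^ α / (1 + α / 2 * (Real.exp r - 1))

theorem one_add_half_mul_exp_pos {α : ℝ} (hα : 0 < α) (hα' : α < 1) (r : ℝ) :
    1 / 2 ≤ 1 + α / 2 * (Real.exp r - 1) := by
  nlinarith [Real.exp_pos r]

theorem expQuot_rpow_expansion {α : ℝ} (hα : 0 < α) (hα' : α < 1) {r : ℝ} (hr : |r| ≤ 1)
    (h0 : r ≠ 0) : |expQuot r ^ α - 1 - α / 2 * r| ≤ 3 * r ^ 2 := by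
  have h1 := abs_expQuot_sub_le hr h0
  have hr2 : r ^ 2 ≤ 1 := by rw [← sq_abs]; nlinarith [abs_nonneg r]
  have h1' := abs_le.1 h1
  have hr' := abs_le.1 hr
  have hq : -(3 / 4) ≤ expQuot r - 1 := by nlinarith
  have h2 := abs_one_add_rpow_sub_le hα hα' hq
  rw [add_sub_cancel] at h2
  have h3 : (expQuot r - 1) ^ 2 ≤ r ^ 2 * (13 / 18) ^ 2 := by
    rw [← sq_abs (expQuot r - 1), ← sq_abs r, ← mul_pow]
    refine pow_le_pow_left₀ (abs_nonneg _) ?_ 2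
    calc |expQuot r - 1| = |(expQuot r - 1 - r / 2) + r / 2| := by ring_nf
      _ ≤ |expQuot r - 1 - r / 2| + |r / 2| := abs_add_le _ _
      _ ≤ 2 / 9 * |r| ^ 2 + |r| / 2 := by
          rw [sq_abs, abs_div, abs_two]; gcongr
      _ ≤ _ := by nlinarith [abs_nonneg r]
  have h2' := abs_le.1 h2
  rw [abs_le]
  constructor <;> nlinarith [sq_nonneg r, mul_nonneg hα.le (sq_nonneg r), mul_le_mul_of_nonneg_left h1'.1 hα.le, mul_le_mul_of_nonneg_left h1'.2 hα.le, mul_le_mul_of_nonneg_right hα'.le (sq_nonneg r)]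

theorem abs_exp_sub_one_sub_id_le_sq {r : ℝ} (hr : |r| ≤ 1) : |Real.exp r - 1 - r| ≤ r ^ 2 :=
  Real.abs_exp_sub_one_sub_id_le hr

theorem abs_symbolRatio_sub_one_le {α : ℝ} (hα : 0 < α) (hα' : α < 1) {r : ℝ} (hr : |r| ≤ 1)
    (h0 : r ≠ 0) : |symbolRatio α r - 1| ≤ 8 * r ^ 2 := by
  have h1 := expQuot_rpow_expansion hα hα' hr h0
  have h2 := abs_exp_sub_one_sub_id_le_sq hr
  have hd := one_add_half_mul_exp_pos hα hα' r
  have e : symbolRatio α r - 1 = (expQuot r ^ α - 1 - α / 2 * r - α / 2 * (Real.exp r - 1 - r)) /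
      (1 + α / 2 * (Real.exp r - 1)) := by
    unfold symbolRatio
    rw [div_sub_one (by linarith)]
    congr 1; ring
  rw [e, abs_div, abs_of_pos (by linarith : 0 < 1 + α / 2 * (Real.exp r - 1)),
    div_le_iff₀ (by linarith)]
  have h1' := abs_le.1 h1
  have h2' := abs_le.1 h2
  have hb : |expQuot r ^ α - 1 - α / 2 * r - α / 2 * (Real.exp r - 1 - r)| ≤ 4 * r ^ 2 := by
    rw [abs_le]
    constructor <;> nlinarith [sq_nonneg r, mul_nonneg hα.le (sq_nonneg r)]
  nlinarith [sq_nonneg r]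

/-- The multiplier `r (3 - e^r) / (2 (1 - e^{-r}))` is `1 + O(r²)`. -/
theorem abs_multiplier_sub_one_le {r : ℝ} (hr : |r| ≤ 1) (h0 : r ≠ 0) :
    |r * (3 - Real.exp r) / (2 * (1 - Real.exp (-r))) - 1| ≤ 6 * r ^ 2 := by
  have h1 := abs_le.1 (abs_exp_sub_quadratic_le hr)
  have h2 := abs_le.1 (abs_exp_sub_quadratic_le (r := -r) (by rwa [abs_neg]))
  have h3 : expQuot (-r) ≥ 1 / 4 := by
    have := abs_le.1 (abs_expQuot_sub_le (r := -r) (by rwa [abs_neg]) (by simpa))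
    have hr2 : r ^ 2 ≤ 1 := by rw [← sq_abs]; nlinarith [abs_nonneg r]
    have hr' := abs_le.1 hr
    nlinarith
  have e3 : 1 - Real.exp (-r) = r * expQuot (-r) := by unfold expQuot; field_simp; ring
  have e : r * (3 - Real.exp r) / (2 * (1 - Real.exp (-r))) - 1 =
      (r * (3 - Real.exp r) - 2 * (1 - Real.exp (-r))) / r / (2 * expQuot (-r)) := by
    rw [e3]
    have : expQuot (-r) ≠ 0 := by linarith
    field_simp
  rw [e, abs_div, abs_of_pos (by linarith : 0 < 2 * expQuot (-r)), div_le_iff₀ (by linarith)]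
  rw [abs_div, div_le_iff₀ (abs_pos.2 h0)]
  rw [abs_neg] at h2
  have k3 : |r| ^ 3 ≥ 0 := by positivity
  have hc : |r * (3 - Real.exp r) - 2 * (1 - Real.exp (-r))| ≤ 2 * |r| ^ 3 := by
    have e4 : r * (3 - Real.exp r) - 2 * (1 - Real.exp (-r)) =
      -(r ^ 3 / 2) - r * (Real.exp r - (1 + r + r ^ 2 / 2)) + 2 * (Real.exp (-r) - (1 + -r + (-r) ^ 2 / 2)) := by ring
    rw [e4]
    refine (abs_add_le _ _).trans ?_
    refine (add_le_add (abs_sub _ _) le_rfl).trans ?_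
    rw [abs_neg, abs_mul, abs_mul, abs_div, abs_pow, abs_two]
    have a1 := abs_exp_sub_quadratic_le hr
    have a2 := abs_exp_sub_quadratic_le (r := -r) (by rwa [abs_neg])
    rw [abs_neg] at a2
    have : |r| * |Real.exp r - (1 + r + r ^ 2 / 2)| ≤ 1 * (|r| ^ 3 * (2 / 9)) :=
      mul_le_mul hr a1 (abs_nonneg _) zero_le_one
    linarith
  calc _ ≤ 2 * |r| ^ 3 := hc
    _ = 2 * r ^ 2 * |r| := by rw [← sq_abs r]; ring
    _ ≤ _ := by
      refine mul_le_mul_of_nonneg_right ?_ (abs_nonneg r)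
      nlinarith [sq_nonneg r]

/-! ### The symbol of the scheme -/

theorem ring_choose_succ (a : ℝ) (n : ℕ) :
    Ring.choose a (n + 1) = (a - n) / ((n : ℝ) + 1) * Ring.choose a n := by
  rw [Ring.choose_eq_smul, Ring.choose_eq_smul, descPochhammer_succ_right, Polynomial.smeval_mul,
    Nat.factorial_succ]
  simp only [Polynomial.smeval_sub, Polynomial.smeval_X, Polynomial.smeval_natCast, smul_eq_mul,
    nsmul_eq_mul, pow_one, pow_zero, mul_one]
  push_cast
  have : (n.factorial : ℝ) ≠ 0 := by positivity
  field_simp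

theorem glWeight_eq_choose (α : ℝ) (n : ℕ) : glWeight α n = (-1) ^ n * Ring.choose α n := by
  induction n with
  | zero => simp [glWeight]
  | succ n ih =>
    rw [glWeight, ih, ring_choose_succ, pow_succ]
    have : ((n : ℝ) + 1) ≠ 0 := by positivity
    field_simp
    ring

theorem hasSum_glWeight (α : ℝ) {z : ℂ} (hz : ‖z‖ < 1) :
    HasSum (fun n => (glWeight α n : ℂ) * z ^ n) ((1 - z) ^ (α : ℂ)) := by
  have h := (Complex.one_add_cpow_hasFPowerSeriesOnBall_zero (a := (α : ℂ))).hasSum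
    (y := -z) (by simpa [enorm_eq_nnnorm, ← NNReal.coe_lt_coe] using hz)
  simp only [binomialSeries_apply, List.ofFn_const, List.prod_replicate, zero_add, smul_eq_mul] at h
  rw [← sub_eq_add_neg] at h
  refine h.congr_fun fun n => ?_
  rw [glWeight_eq_choose, neg_pow]
  push_cast
  ring

theorem hasSum_glWeight_real (α : ℝ) {x : ℝ} (hx : |x| < 1) :
    HasSum (fun n => glWeight α n * x ^ n) ((1 - x) ^ α) := by
  have h := hasSum_glWeight α (z := (x : ℂ)) (by simpa using hx)
  have e : (1 - (x : ℂ)) ^ (α : ℂ) = (((1 - x) ^ α : ℝ) : ℂ) := by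
    rw [Complex.ofReal_cpow (by linarith [(abs_lt.1 hx).2])]
    push_cast; rfl
  rw [e] at h
  exact_mod_cast h

/-- The Grünwald–Letnikov generating series `(1 - z)^α`. -/
noncomputable def glSeries (α : ℝ) : PowerSeries ℝ := PowerSeries.mk (glWeight α)

/-- The averaging polynomial `(1 - α/2) + (α/2) z` of the Crank–Nicolson step. -/
noncomputable def avgSeries (α : ℝ) : PowerSeries ℝ :=
  PowerSeries.C (1 - α / 2) + PowerSeries.C (α / 2) * PowerSeries.X

/-- The resolvent series `1 / ((1 - z)^α + lam ((1 - α/2) + (α/2) z))` of the scheme. -/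
noncomputable def resolvent (α lam : ℝ) : PowerSeries ℝ :=
  (glSeries α + PowerSeries.C lam * avgSeries α)⁻¹

/-- The coefficients of the resolvent series. -/
noncomputable def resCoeff (α lam : ℝ) (n : ℕ) : ℝ := PowerSeries.coeff n (resolvent α lam)

theorem coeff_avgSeries (α : ℝ) (n : ℕ) : PowerSeries.coeff n (avgSeries α) =
    (if n = 0 then 1 - α / 2 else 0) + (if n = 1 then α / 2 else 0) := by
  rw [avgSeries, map_add, PowerSeries.coeff_C, PowerSeries.coeff_C_mul, PowerSeries.coeff_X]
  simp

theorem symbol_mul_resolvent {α lam : ℝ} (hα' : α < 1) (hl : 0 ≤ lam) :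
    (glSeries α + PowerSeries.C lam * avgSeries α) * resolvent α lam = 1 := by
  refine PowerSeries.mul_inv_cancel _ ?_
  have : PowerSeries.constantCoeff (glSeries α) = 1 := by
    rw [← PowerSeries.coeff_zero_eq_constantCoeff_apply, glSeries, PowerSeries.coeff_mk, glWeight]
  simp only [map_add, map_mul, this, avgSeries, PowerSeries.constantCoeff_C,
    PowerSeries.constantCoeff_X]
  nlinarith

theorem hasSum_avgSeries (α : ℝ) (z : ℂ) :
    HasSum (fun n => ((PowerSeries.coeff n (avgSeries α) : ℝ) : ℂ) * z ^ n)
      (1 - α / 2 * (1 - z)) := by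
  have h := hasSum_sum_of_ne_finset_zero (L := SummationFilter.unconditional ℕ) (s := Finset.range 2)
    (f := fun n => ((PowerSeries.coeff n (avgSeries α) : ℝ) : ℂ) * z ^ n) (by
      intro n hn
      have : 2 ≤ n := by simpa [Nat.succ_le_iff] using hn
      rw [coeff_avgSeries, if_neg (by omega), if_neg (by omega)]
      simp)
  convert h using 1
  simp [Finset.sum_range_succ, coeff_avgSeries]
  ring

theorem hasSum_symbol (α lam : ℝ) {z : ℂ} (hz : ‖z‖ < 1) :
    HasSum (fun n => ((PowerSeries.coeff n (glSeries α + PowerSeries.C lam * avgSeries α) : ℝ) : ℂ)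
      * z ^ n) ((1 - z) ^ (α : ℂ) + lam * (1 - α / 2 * (1 - z))) := by
  convert (hasSum_glWeight α hz).add ((hasSum_avgSeries α z).mul_left (lam : ℂ)) using 2 with n
  simp only [glSeries, map_add, PowerSeries.coeff_mk, PowerSeries.coeff_C_mul]
  push_cast
  ring

/-- Coefficients are determined by the sum of a power series near zero; here for an inverse of the
symbol. -/
theorem resCoeff_unique {α lam : ℝ} (hα' : α < 1) (hl : 0 ≤ lam) {a : ℕ → ℂ} {f : ℂ → ℂ} {R : ℝ}
    (hR : 0 < R) (hR1 : R ≤ 1) (hf : ∀ z : ℂ, ‖z‖ < R → HasSum (fun n => a n * z ^ n) (f z))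
    (hfd : ∀ z : ℂ, ‖z‖ < R → ((1 - z) ^ (α : ℂ) + lam * (1 - α / 2 * (1 - z))) * f z = 1) (n : ℕ) :
    a n = (resCoeff α lam n : ℂ) := by
  set d : PowerSeries ℝ := glSeries α + PowerSeries.C lam * avgSeries α with hd
  set dc : PowerSeries ℂ := PowerSeries.map Complex.ofRealHom d with hdc
  set A : PowerSeries ℂ := PowerSeries.mk a with hA
  have key : dc * A = 1 := by
    have h1 : ∀ z : ℂ, ‖z‖ < R → HasSum (fun n => z ^ n • PowerSeries.coeff n (dc * A)) 1 := by
      intro z hz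
      have s1 := hasSum_symbol α lam (hz.trans_le hR1)
      have s2 := hf z hz
      have n1 := s1.summable.norm
      have n2 := s2.summable.norm
      have hs := summable_norm_sum_mul_antidiagonal_of_summable_norm n1 n2
      have ht := tsum_mul_tsum_eq_tsum_sum_antidiagonal_of_summable_norm n1 n2
      rw [s1.tsum_eq, s2.tsum_eq, hfd z hz] at ht
      rw [ht]
      refine hs.of_norm.hasSum.congr_fun fun n => ?_
      rw [PowerSeries.coeff_mul, smul_eq_mul, Finset.mul_sum]
      refine Finset.sum_congr rfl fun p hp => ?_
      rw [← Finset.HasAntidiagonal.mem_antidiagonal.1 hp, pow_add]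
      simp only [hdc, hA, PowerSeries.coeff_map, PowerSeries.coeff_mk, Complex.ofRealHom_eq_coe]
      ring
    have h2 : HasFPowerSeriesAt (fun _ : ℂ => (1 : ℂ))
        (FormalMultilinearSeries.ofScalars ℂ fun n => PowerSeries.coeff n (dc * A)) 0 := by
      rw [hasFPowerSeriesAt_iff]
      filter_upwards [Metric.ball_mem_nhds (0 : ℂ) hR] with z hz
      simpa [FormalMultilinearSeries.coeff_ofScalars] using h1 z (by simpa using hz)
    have h3 := h2.eq_formalMultilinearSeries hasFPowerSeriesAt_const
    ext n
    have h4 := congrArg (fun p => FormalMultilinearSeries.coeff p n) h3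
    simp only [FormalMultilinearSeries.coeff_ofScalars] at h4
    rw [h4, PowerSeries.coeff_one]
    rcases Nat.eq_zero_or_pos n with rfl | hn
    · simp [FormalMultilinearSeries.coeff, constFormalMultilinearSeries]
    · obtain ⟨k, rfl⟩ := Nat.exists_eq_succ_of_ne_zero hn.ne'
      simp [FormalMultilinearSeries.coeff, constFormalMultilinearSeries]
  have key2 : dc * PowerSeries.map Complex.ofRealHom (resolvent α lam) = 1 := by
    rw [hdc, ← map_mul, hd, symbol_mul_resolvent hα' hl, map_one]
  have h5 : A = PowerSeries.map Complex.ofRealHom (resolvent α lam) := by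
    calc A = (dc * PowerSeries.map Complex.ofRealHom (resolvent α lam)) * A := by
          rw [key2, one_mul]
      _ = PowerSeries.map Complex.ofRealHom (resolvent α lam) * (dc * A) := by ring
      _ = _ := by rw [key, mul_one]
  have h6 := congrArg (PowerSeries.coeff n) h5
  simpa [hA, resCoeff] using h6

/-- On the closed upper half plane the symbol `ζ^α + lam (1 - (α/2) ζ)` does not come close to
zero, uniformly in `lam > 0`. For `arg ζ ≤ π/2` its real part is large; beyond that the imaginary
part of `ζ⁻¹` times it is. -/
theorem symbol_norm_ge {α : ℝ} (hα : 0 < α) (hα' : α < 1) : ∃ c : ℝ, 0 < c ∧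
    ∀ (lam : ℝ) (ζ : ℂ), 0 < lam → 0 ≤ ζ.im → ‖ζ‖ ≤ 3 - α →
      c * (‖ζ‖ ^ α + lam) ≤ ‖ζ ^ (α : ℂ) + lam * (1 - α / 2 * ζ)‖ := by
  have hpi := Real.pi_pos
  have hc1 : 0 < Real.cos (Real.pi / 2 * α) :=
    Real.cos_pos_of_mem_Ioo ⟨by nlinarith, by nlinarith⟩
  have hc2 : 0 < (1 - α) * (2 - α) / 2 := by nlinarith
  set s₀ := min (Real.sin ((1 - α) * (Real.pi / 2))) (Real.sin ((1 - α) * Real.pi)) with hs₀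
  have hs₀p : 0 < s₀ := lt_min
    (Real.sin_pos_of_pos_of_lt_pi (by nlinarith) (by nlinarith))
    (Real.sin_pos_of_pos_of_lt_pi (by nlinarith) (by nlinarith))
  have hs1 : s₀ ≤ 1 := (min_le_left _ _).trans (Real.sin_le_one _)
  refine ⟨min (min (Real.cos (Real.pi / 2 * α)) ((1 - α) * (2 - α) / 2)) (s₀ / 3), by positivity,
    fun lam ζ hl him hn => ?_⟩
  set c := min (min (Real.cos (Real.pi / 2 * α)) ((1 - α) * (2 - α) / 2)) (s₀ / 3) with hc
  set X := ζ ^ (α : ℂ) + lam * (1 - α / 2 * ζ) with hX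
  have hρ : 0 ≤ ‖ζ‖ ^ α := Real.rpow_nonneg (norm_nonneg _) _
  have ha0 : 0 ≤ Complex.arg ζ := Complex.arg_nonneg_iff.2 him
  have haπ := Complex.arg_le_pi ζ
  have hre : X.re = ‖ζ‖ ^ α * Real.cos (Complex.arg ζ * α) + lam * (1 - α / 2 * ζ.re) := by
    rw [hX, Complex.add_re, Complex.cpow_ofReal_re]
    simp
  have him' : X.im = ‖ζ‖ ^ α * Real.sin (Complex.arg ζ * α) - lam * (α / 2 * ζ.im) := by
    rw [hX, Complex.add_im, Complex.cpow_ofReal_im]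
    simp
    ring
  rcases le_or_gt (Complex.arg ζ) (Real.pi / 2) with hψ | hψ
  · have h1 : Real.cos (Real.pi / 2 * α) ≤ Real.cos (Complex.arg ζ * α) :=
      Real.cos_le_cos_of_nonneg_of_le_pi (by positivity) (by nlinarith) (by gcongr)
    have h2 : ζ.re ≤ 3 - α := (Complex.re_le_norm ζ).trans hn
    have h3 : (1 - α) * (2 - α) / 2 ≤ 1 - α / 2 * ζ.re := by nlinarith
    calc c * (‖ζ‖ ^ α + lam) = ‖ζ‖ ^ α * c + lam * c := by ring
      _ ≤ ‖ζ‖ ^ α * Real.cos (Complex.arg ζ * α) + lam * (1 - α / 2 * ζ.re) := by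
          gcongr
          · exact ((min_le_left _ _).trans (min_le_left _ _)).trans h1
          · exact ((min_le_left _ _).trans (min_le_right _ _)).trans h3
      _ = X.re := hre.symm
      _ ≤ ‖X‖ := Complex.re_le_norm X
  · have hζ0 : ζ ≠ 0 := by
      rintro rfl
      simp at hψ
      linarith
    have hρp : 0 < ‖ζ‖ := norm_pos_iff.2 hζ0
    have hsin : s₀ ≤ Real.sin ((1 - α) * Complex.arg ζ) := by
      have hcv := strictConcaveOn_sin_Icc.concaveOn
      refine hcv.min_le_of_mem_Icc (x := (1 - α) * (Real.pi / 2)) (y := (1 - α) * Real.pi) ?_ ?_ ?_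
      · exact ⟨by nlinarith, by nlinarith⟩
      · exact ⟨by nlinarith, by nlinarith⟩
      · exact ⟨by nlinarith, by nlinarith⟩
    have hxr : ζ.re = ‖ζ‖ * Real.cos (Complex.arg ζ) := (Complex.norm_mul_cos_arg ζ).symm
    have hxi : ζ.im = ‖ζ‖ * Real.sin (Complex.arg ζ) := (Complex.norm_mul_sin_arg ζ).symm
    have hrneg : ζ.re ≤ 0 := by
      rw [hxr]
      exact mul_nonpos_of_nonneg_of_nonpos (norm_nonneg _)
        (Real.cos_nonpos_of_pi_div_two_le_of_le hψ.le (by linarith))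
    have hb1 : ‖ζ‖ ^ α * s₀ ≤ ‖X‖ := by
      have e : X.re * Real.sin (Complex.arg ζ) - X.im * Real.cos (Complex.arg ζ) =
          ‖ζ‖ ^ α * Real.sin ((1 - α) * Complex.arg ζ) + lam * Real.sin (Complex.arg ζ) := by
        have e1 : (1 - α) * Complex.arg ζ = Complex.arg ζ - Complex.arg ζ * α := by ring
        rw [hre, him', e1, Real.sin_sub, hxr, hxi]
        ring
      have hs : 0 ≤ Real.sin (Complex.arg ζ) := Real.sin_nonneg_of_nonneg_of_le_pi ha0 haπ
      have hle : X.re * Real.sin (Complex.arg ζ) - X.im * Real.cos (Complex.arg ζ) ≤ ‖X‖ := by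
        refine le_of_sq_le_sq ?_ (norm_nonneg _)
        rw [Complex.sq_norm, Complex.normSq_apply]
        nlinarith [sq_nonneg (X.re * Real.cos (Complex.arg ζ) + X.im * Real.sin (Complex.arg ζ)),
          Real.sin_sq_add_cos_sq (Complex.arg ζ)]
      calc ‖ζ‖ ^ α * s₀ ≤ ‖ζ‖ ^ α * Real.sin ((1 - α) * Complex.arg ζ) := by gcongr
        _ ≤ _ := by rw [e] at hle; nlinarith [mul_nonneg hl.le hs]
    have hb2 : lam - ‖ζ‖ ^ α ≤ ‖X‖ := by
      have h1 : lam - ‖ζ‖ ^ α ≤ X.re := by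
        rw [hre]
        nlinarith [Real.neg_one_le_cos (Complex.arg ζ * α), mul_nonneg hl.le hα.le,
          mul_nonneg (mul_nonneg hl.le hα.le) (neg_nonneg.2 hrneg)]
      exact h1.trans (Complex.re_le_norm X)
    have hcs : c ≤ s₀ / 3 := min_le_right _ _
    calc c * (‖ζ‖ ^ α + lam) ≤ s₀ / 3 * (‖ζ‖ ^ α + lam) := by gcongr
      _ ≤ ‖X‖ := by nlinarith [norm_nonneg X]

/-! ### Contour representation of the resolvent coefficients -/

/-- The symbol `ζ^α + lam (1 - (α/2) ζ)` of the scheme in the variable `ζ = 1 - z`. -/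
noncomputable def symb (α lam : ℝ) (ζ : ℂ) : ℂ := ζ ^ (α : ℂ) + lam * (1 - α / 2 * ζ)

theorem symb_re (α lam : ℝ) (ζ : ℂ) : (symb α lam ζ).re =
    ‖ζ‖ ^ α * Real.cos (Complex.arg ζ * α) + lam * (1 - α / 2 * ζ.re) := by
  rw [symb, Complex.add_re, Complex.cpow_ofReal_re]
  simp

theorem symb_im (α lam : ℝ) (ζ : ℂ) : (symb α lam ζ).im =
    ‖ζ‖ ^ α * Real.sin (Complex.arg ζ * α) - lam * (α / 2 * ζ.im) := by
  rw [symb, Complex.add_im, Complex.cpow_ofReal_im]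
  simp
  ring

theorem symb_ofReal (α lam : ℝ) {x : ℝ} (hx : 0 ≤ x) :
    symb α lam (x : ℂ) = ((x ^ α + lam * (1 - α / 2 * x) : ℝ) : ℂ) := by
  rw [symb, ← Complex.ofReal_cpow hx]
  push_cast
  rfl

theorem symb_re_pos {α lam : ℝ} (hα : 0 < α) (hα' : α < 1) (hl : 0 < lam) {ζ : ℂ}
    (h0 : 0 < ζ.re) (h2 : ζ.re ≤ 2) : 0 < (symb α lam ζ).re := by
  have hn : 0 < ‖ζ‖ := h0.trans_le (Complex.re_le_norm ζ)
  have ha := abs_lt.1 (Complex.abs_arg_lt_pi_div_two_iff.2 (Or.inl h0))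
  have hc : 0 < Real.cos (Complex.arg ζ * α) :=
    Real.cos_pos_of_mem_Ioo ⟨by nlinarith [Real.pi_pos], by nlinarith [Real.pi_pos]⟩
  rw [symb_re]
  have : 0 < 1 - α / 2 * ζ.re := by nlinarith
  have := Real.rpow_pos_of_pos hn α
  positivity

theorem symb_conj (α lam : ℝ) {ζ : ℂ} (h0 : 0 < ζ.re) :
    symb α lam (starRingEnd ℂ ζ) = starRingEnd ℂ (symb α lam ζ) := by
  have ha : Complex.arg ζ ≠ Real.pi := by
    have := abs_lt.1 (Complex.abs_arg_lt_pi_div_two_iff.2 (Or.inl h0))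
    have := Real.pi_pos
    intro h
    linarith
  rw [symb, symb, Complex.conj_cpow _ _ ha]
  simp [map_ofNat]

theorem continuousOn_cpow_upper {α : ℝ} (hα : 0 < α) :
    ContinuousOn (fun ζ : ℂ => ζ ^ (α : ℂ)) {ζ | 0 ≤ ζ.im} := by
  intro ζ hζ
  by_cases h : 0 ≤ ζ.re ∨ ζ.im ≠ 0
  · exact (Complex.continuousAt_cpow_const_of_re_pos h (by simpa)).continuousWithinAt
  · push Not at h
    have h1 := Complex.continuousWithinAt_log_of_re_neg_of_im_zero h.1 h.2
    have h2 : ContinuousWithinAt (fun ζ : ℂ => Complex.exp (Complex.log ζ * α)) {ζ | 0 ≤ ζ.im} ζ :=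
      (h1.mul continuousWithinAt_const).cexp
    refine (h2.congr_of_eventuallyEq ?_ ?_)
    · have : ∀ᶠ z in 𝓝 ζ, z ≠ 0 := by
        refine isOpen_ne.mem_nhds ?_
        rintro rfl
        simp at h
      filter_upwards [mem_nhdsWithin_of_mem_nhds this] with z hz
      rw [Complex.cpow_def_of_ne_zero hz]
    · rw [Complex.cpow_def_of_ne_zero]
      rintro rfl
      simp at h

theorem continuousOn_symb {α : ℝ} (hα : 0 < α) (lam : ℝ) :
    ContinuousOn (symb α lam) {ζ | 0 ≤ ζ.im} := by
  unfold symb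
  exact (continuousOn_cpow_upper hα).add (by fun_prop)

theorem differentiableAt_symb (α lam : ℝ) {ζ : ℂ} (hζ : ζ ∈ Complex.slitPlane) :
    DifferentiableAt ℂ (symb α lam) ζ := by
  unfold symb
  have : DifferentiableAt ℂ (fun ζ : ℂ => ζ ^ (α : ℂ)) ζ := differentiableAt_id.cpow_const hζ
  exact this.add (by fun_prop)

/-- The integrand `z^{-n} / symb (1 - z)`, in the logarithmic variable `z = e^s`. -/
noncomputable def contourFun (α lam : ℝ) (n : ℕ) (s : ℂ) : ℂ :=
  (Complex.exp s ^ n)⁻¹ * (symb α lam (1 - Complex.exp s))⁻¹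

theorem resCoeff_eq_circle {α lam : ℝ} (hα : 0 < α) (hα' : α < 1) (hl : 0 < lam) (n : ℕ) :
    resCoeff α lam n = Real.pi⁻¹ *
      (∫ y in (-Real.pi)..0, contourFun α lam n (((-Real.log 2 : ℝ) : ℂ) + y * Complex.I)).re := by
  have hpi := Real.pi_pos
  set F : ℂ → ℂ := fun z => (symb α lam (1 - z))⁻¹ with hF
  have hre : ∀ z : ℂ, ‖z‖ ≤ 1 / 2 → 0 < (1 - z).re ∧ (1 - z).re ≤ 2 := by
    intro z hz
    have := abs_le.1 ((Complex.abs_re_le_norm z).trans hz)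
    simp only [Complex.sub_re, Complex.one_re]
    constructor <;> linarith
  have hne : ∀ z : ℂ, ‖z‖ ≤ 1 / 2 → symb α lam (1 - z) ≠ 0 := by
    intro z hz h
    have := symb_re_pos hα hα' hl (hre z hz).1 (hre z hz).2
    rw [h] at this
    simp at this
  have hd : DifferentiableOn ℂ F (Metric.closedBall 0 ((1 / 2 : NNReal) : ℝ)) := by
    intro z hz
    have hz' : ‖z‖ ≤ 1 / 2 := by simpa using hz
    have h1 : DifferentiableAt ℂ (fun z => symb α lam (1 - z)) z :=
      (differentiableAt_symb α lam (Complex.mem_slitPlane_iff.2 (Or.inl (hre z hz').1))).comp z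
        (by fun_prop)
    exact (h1.inv (hne z hz')).differentiableWithinAt
  have hps := hd.hasFPowerSeriesOnBall (by norm_num)
  have ha := resCoeff_unique hα' hl.le (a := fun n => (cauchyPowerSeries F 0 ((1 / 2 : NNReal) : ℝ)).coeff n)
    (f := F) (R := 1 / 2) (by norm_num) (by norm_num) (by
      intro z hz
      have h := hps.hasSum (y := z) (by
        rw [Metric.mem_eball, edist_zero_right, enorm_eq_nnnorm]
        have : ‖z‖₊ < 1 / 2 := by rw [← NNReal.coe_lt_coe]; simpa using hz
        exact_mod_cast this)
      rw [zero_add] at h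
      refine h.congr_fun fun k => ?_
      rw [FormalMultilinearSeries.apply_eq_pow_smul_coeff, smul_eq_mul, mul_comm])
    (fun z hz => mul_inv_cancel₀ (hne z hz.le)) n
  set G : ℝ → ℂ := fun y => contourFun α lam n (((-Real.log 2 : ℝ) : ℂ) + y * Complex.I) with hG
  have hexp : ∀ y : ℝ, Complex.exp (((-Real.log 2 : ℝ) : ℂ) + y * Complex.I) = circleMap 0 (1 / 2) y := by
    intro y
    rw [Complex.exp_add, ← Complex.ofReal_exp, Real.exp_neg, Real.exp_log (by norm_num), circleMap]
    simp
  have hnorm : ∀ y : ℝ, ‖circleMap 0 (1 / 2) y‖ = 1 / 2 := by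
    intro y
    rw [circleMap, zero_add, norm_mul, Complex.norm_exp_ofReal_mul_I]
    norm_num
  have hGc : Continuous G := by
    rw [hG]
    unfold contourFun
    simp only [hexp]
    refine Continuous.mul ?_ ?_
    · exact ((continuous_circleMap 0 (1 / 2)).pow n).inv₀ fun y => pow_ne_zero _ (by
        rw [← norm_pos_iff, hnorm]; norm_num)
    · have : ContinuousOn F (Metric.closedBall 0 ((1 / 2 : NNReal) : ℝ)) := hd.continuousOn
      exact this.comp_continuous (continuous_circleMap 0 (1 / 2)) fun y => by
        simp
  have hcoef : (cauchyPowerSeries F 0 ((1 / 2 : NNReal) : ℝ)).coeff n =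
      (2 * Real.pi : ℂ)⁻¹ * ∫ y in (0 : ℝ)..2 * Real.pi, G y := by
    have hR : ((1 / 2 : NNReal) : ℝ) = 1 / 2 := by norm_num
    rw [FormalMultilinearSeries.coeff, show (1 : Fin n → ℂ) = fun _ => 1 from rfl,
      cauchyPowerSeries_apply, circleIntegral, hR, smul_eq_mul]
    have : ∀ θ : ℝ, deriv (circleMap 0 (1 / 2)) θ • ((1 / (circleMap 0 (1 / 2) θ - 0)) ^ n •
        (circleMap 0 (1 / 2) θ - 0)⁻¹ • F (circleMap 0 (1 / 2) θ)) = Complex.I * G θ := by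
      intro θ
      have hz : circleMap 0 (1 / 2) θ ≠ 0 := by rw [← norm_pos_iff, hnorm]; norm_num
      simp only [hG, contourFun, hexp, deriv_circleMap, smul_eq_mul, sub_zero, hF, one_div, inv_pow]
      field_simp
    simp only [this]
    rw [intervalIntegral.integral_const_mul]
    field_simp
  have hper : Function.Periodic G (2 * Real.pi) := by
    intro y
    simp only [hG, contourFun]
    rw [hexp, hexp, (periodic_circleMap 0 (1 / 2)) y]
  have hsplit : (∫ y in (0 : ℝ)..2 * Real.pi, G y) =
      (∫ y in (-Real.pi)..0, G y) + ∫ y in (-Real.pi)..0, starRingEnd ℂ (G y) := by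
    have h1 := hper.intervalIntegral_add_eq 0 (-Real.pi)
    rw [zero_add, show -Real.pi + 2 * Real.pi = Real.pi by ring] at h1
    rw [h1, ← intervalIntegral.integral_add_adjacent_intervals (b := 0)
      (hGc.intervalIntegrable _ _) (hGc.intervalIntegrable _ _)]
    congr 1
    have h2 := intervalIntegral.integral_comp_neg (a := -Real.pi) (b := 0) G
    rw [neg_neg, neg_zero] at h2
    rw [← h2]
    refine intervalIntegral.integral_congr fun y _ => ?_
    simp only [hG, contourFun, hexp]
    have hc : circleMap 0 (1 / 2) (-y) = starRingEnd ℂ (circleMap 0 (1 / 2) y) := by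
      simp [circleMap, ← Complex.exp_conj, map_ofNat]
    rw [hc, ← map_pow, show (1 : ℂ) - starRingEnd ℂ (circleMap 0 (1 / 2) y) =
      starRingEnd ℂ (1 - circleMap 0 (1 / 2) y) by simp, symb_conj α lam (hre _ (hnorm y).le).1]
    simp
  have hconj : (∫ y in (-Real.pi)..0, starRingEnd ℂ (G y)) =
      starRingEnd ℂ (∫ y in (-Real.pi)..0, G y) := by
    rw [intervalIntegral.integral_of_le (by linarith), intervalIntegral.integral_of_le (by linarith)]
    exact integral_conj
  have h3 : (resCoeff α lam n : ℂ) = ((Real.pi⁻¹ * (∫ y in (-Real.pi)..0, G y).re : ℝ) : ℂ) := by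
    rw [← ha, hcoef, hsplit, hconj, Complex.add_conj]
    push_cast
    field_simp
  exact_mod_cast h3

/-- The right end of the cut segment: `e^b = 2 - α`. -/
noncomputable def cutLength (α : ℝ) : ℝ := Real.log (2 - α)

theorem exp_cutLength {α : ℝ} (hα' : α < 1) : Real.exp (cutLength α) = 2 - α :=
  Real.exp_log (by linarith)

theorem cutLength_pos {α : ℝ} (hα' : α < 1) : 0 < cutLength α := Real.log_pos (by linarith)

theorem cutLength_le_one {α : ℝ} (hα : 0 < α) (hα' : α < 1) : cutLength α ≤ 1 := by
  rw [cutLength, Real.log_le_iff_le_exp (by linarith)]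
  linarith [Real.add_one_le_exp 1]

/-- The values on the negative axis of the averaging polynomial: `1 + (α/2) (e^r - 1)`. -/
noncomputable def avgExp (α r : ℝ) : ℝ := 1 + α / 2 * (Real.exp r - 1)

/-- The symbol of the scheme on the negative axis, `(e^r - 1)^α / (1 + (α/2) (e^r - 1))`. -/
noncomputable def omega (α r : ℝ) : ℝ := r ^ α * symbolRatio α r

theorem omega_eq {α r : ℝ} (hr : 0 < r) : omega α r = (Real.exp r - 1) ^ α / avgExp α r := by
  have h1 : Real.exp r - 1 = r * expQuot r := by unfold expQuot; field_simp
  rw [omega, symbolRatio, avgExp, h1, Real.mul_rpow hr.le (expQuot_pos hr.ne').le, ← h1]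
  ring

theorem contourFun_im_of_nonpos (α lam : ℝ) (n : ℕ) {x : ℝ} (hx : x ≤ 0) :
    (contourFun α lam n x).im = 0 := by
  have h : (1 : ℂ) - Complex.exp x = ((1 - Real.exp x : ℝ) : ℂ) := by push_cast; rfl
  rw [contourFun, h, symb_ofReal α lam (by linarith [Real.exp_le_one_iff.2 hx]), ← Complex.ofReal_exp]
  rw [← Complex.ofReal_pow, ← Complex.ofReal_inv, ← Complex.ofReal_inv, ← Complex.ofReal_mul,
    Complex.ofReal_im]

theorem contourFun_im_sub_pi (α lam : ℝ) (n : ℕ) (x : ℝ) :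
    (contourFun α lam n (x + ((-Real.pi : ℝ) : ℂ) * Complex.I)).im = 0 := by
  have h0 : Complex.exp (x + ((-Real.pi : ℝ) : ℂ) * Complex.I) = ((-Real.exp x : ℝ) : ℂ) := by
    rw [Complex.exp_add]
    push_cast
    rw [neg_mul, Complex.exp_neg, Complex.exp_pi_mul_I]
    norm_num
  have h : (1 : ℂ) - ((-Real.exp x : ℝ) : ℂ) = ((1 + Real.exp x : ℝ) : ℂ) := by push_cast; ring
  rw [contourFun, h0, h, symb_ofReal α lam (by positivity)]
  rw [← Complex.ofReal_pow, ← Complex.ofReal_inv, ← Complex.ofReal_inv, ← Complex.ofReal_mul,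
    Complex.ofReal_im]

theorem contourFun_im_of_pos {α lam : ℝ} (hα : 0 < α) (hα' : α < 1) (n : ℕ) {x : ℝ} (hx : 0 < x) :
    (contourFun α lam n x).im =
      -(Real.pi * (Real.exp (-(n * x)) * (kern α lam (omega α x) / avgExp α x))) := by
  have hp : 0 < Real.exp x - 1 := by linarith [Real.one_lt_exp_iff.2 hx]
  have h : (1 : ℂ) - Complex.exp x = ((-(Real.exp x - 1) : ℝ) : ℂ) := by push_cast; ring
  have harg : Complex.arg ((-(Real.exp x - 1) : ℝ) : ℂ) = Real.pi :=
    Complex.arg_ofReal_of_neg (by linarith)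
  have hnorm : ‖((-(Real.exp x - 1) : ℝ) : ℂ)‖ = Real.exp x - 1 := by
    rw [Complex.norm_real, Real.norm_eq_abs, abs_neg, abs_of_pos hp]
  have hth : 0 < avgExp α x := by
    have := one_add_half_mul_exp_pos hα hα' x
    unfold avgExp; linarith
  have hre := symb_re α lam ((-(Real.exp x - 1) : ℝ) : ℂ)
  have him := symb_im α lam ((-(Real.exp x - 1) : ℝ) : ℂ)
  rw [harg, hnorm, Complex.ofReal_re] at hre
  rw [harg, hnorm, Complex.ofReal_im] at him
  have e1 : (Complex.exp x ^ n)⁻¹ = ((Real.exp (-(n * x)) : ℝ) : ℂ) := by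
    rw [Real.exp_neg, Real.exp_nat_mul]
    push_cast
    rfl
  rw [contourFun, e1, Complex.im_ofReal_mul, h, Complex.inv_im, Complex.normSq_apply, hre, him, kern,
    omega_eq hx]
  have e2 : 1 - α / 2 * -(Real.exp x - 1) = avgExp α x := by unfold avgExp; ring
  rw [e2]
  set p := (Real.exp x - 1) ^ α with hpdef
  have hden : (p * Real.cos (Real.pi * α) + lam * avgExp α x) *
      (p * Real.cos (Real.pi * α) + lam * avgExp α x) + (p * Real.sin (Real.pi * α) -
        lam * (α / 2 * 0)) * (p * Real.sin (Real.pi * α) - lam * (α / 2 * 0)) =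
      avgExp α x ^ 2 * ((p / avgExp α x) ^ 2 + 2 * lam * (p / avgExp α x) * Real.cos (Real.pi * α) +
        lam ^ 2) := by
    have := Real.sin_sq_add_cos_sq (Real.pi * α)
    field_simp
    linear_combination (4 * p ^ 2) * this
  rw [hden]
  have := Real.pi_pos
  field_simp
  ring


/-- The resolvent coefficients are Laplace integrals of a density on the cut, up to an
exponentially small contribution: Cauchy's theorem on the rectangle `[-log 2, b] × [-π, 0]` in the
variable `s = log z`. The integrand is real on the two horizontal sides, except on the cut. -/
theorem exists_resCoeff_eq {α : ℝ} (hα : 0 < α) (hα' : α < 1) : ∃ C : ℝ, 0 < C ∧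
    ∀ lam : ℝ, 0 < lam → ∃ ε : ℕ → ℝ,
      (∀ n, |ε n| ≤ C * Real.exp (-(n * cutLength α)) / (1 + lam)) ∧
      ∀ n, resCoeff α lam n = (∫ r in (0 : ℝ)..cutLength α,
        Real.exp (-(n * r)) * (kern α lam (omega α r) / avgExp α r)) + ε n := by
  obtain ⟨c, hc, hsymb⟩ := symbol_norm_ge hα hα'
  have hpi := Real.pi_pos
  set b := cutLength α with hb
  have hb0 : 0 < b := cutLength_pos hα'
  have hl2 : 0 < Real.log 2 := Real.log_pos (by norm_num)
  refine ⟨(c * (1 - α))⁻¹, by have : 0 < 1 - α := by linarith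
                              positivity, fun lam hl => ?_⟩
  have hrect : ∀ s : ℂ, s.re ≤ b → s.im ∈ Icc (-Real.pi) 0 →
      0 ≤ (1 - Complex.exp s).im ∧ ‖1 - Complex.exp s‖ ≤ 3 - α := by
    intro s h1 h2
    constructor
    · rw [Complex.sub_im, Complex.exp_im, Complex.one_im]
      have : Real.sin s.im ≤ 0 := Real.sin_nonpos_of_nonpos_of_neg_pi_le h2.2 h2.1
      nlinarith [Real.exp_pos s.re]
    · calc ‖1 - Complex.exp s‖ ≤ ‖(1 : ℂ)‖ + ‖Complex.exp s‖ := norm_sub_le _ _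
        _ = 1 + Real.exp s.re := by rw [Complex.norm_exp, norm_one]
        _ ≤ 1 + Real.exp b := by gcongr
        _ = 3 - α := by rw [hb, exp_cutLength hα']; ring
  have hlow : ∀ s : ℂ, s.re ≤ b → s.im ∈ Icc (-Real.pi) 0 →
      c * (‖1 - Complex.exp s‖ ^ α + lam) ≤ ‖symb α lam (1 - Complex.exp s)‖ := fun s h1 h2 =>
    hsymb lam _ hl (hrect s h1 h2).1 (hrect s h1 h2).2
  have hne : ∀ s : ℂ, s.re ≤ b → s.im ∈ Icc (-Real.pi) 0 → symb α lam (1 - Complex.exp s) ≠ 0 := by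
    intro s h1 h2 h3
    have := hlow s h1 h2
    rw [h3, norm_zero] at this
    have h4 : 0 ≤ ‖1 - Complex.exp s‖ ^ α := Real.rpow_nonneg (norm_nonneg _) _
    nlinarith [mul_pos hc hl, mul_nonneg hc.le h4]
  have hcontS : ∀ n, ContinuousOn (contourFun α lam n) {s | s.re ≤ b ∧ s.im ∈ Icc (-Real.pi) 0} := by
    intro n
    unfold contourFun
    refine ContinuousOn.mul (ContinuousOn.inv₀ (by fun_prop) fun s _ => pow_ne_zero _ (Complex.exp_ne_zero s)) ?_
    refine ContinuousOn.inv₀ ?_ fun s hs => hne s hs.1 hs.2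
    have h1 : ContinuousOn (fun s => 1 - Complex.exp s)
        {s : ℂ | s.re ≤ b ∧ s.im ∈ Icc (-Real.pi) 0} := by fun_prop
    exact (continuousOn_symb hα lam).comp h1 fun s hs => (hrect s hs.1 hs.2).1
  have hmain : ∀ n, resCoeff α lam n = (∫ r in (0 : ℝ)..b,
        Real.exp (-(n * r)) * (kern α lam (omega α r) / avgExp α r)) + Real.pi⁻¹ *
        (∫ y in (-Real.pi)..0, contourFun α lam n ((b : ℂ) + y * Complex.I)).re := by
    intro n
    have hR := Complex.integral_boundary_rect_eq_zero_of_continuousOn_of_differentiableOn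
      (contourFun α lam n) ⟨-Real.log 2, -Real.pi⟩ ⟨b, 0⟩ (by
        refine (hcontS n).mono ?_
        rintro s ⟨h1, h2⟩
        simp only [mem_preimage] at h1 h2
        rw [uIcc_of_le (by linarith)] at h1
        rw [uIcc_of_le (by linarith)] at h2
        exact ⟨h1.2, h2⟩) (by
        rintro s ⟨h1, h2⟩
        simp only [mem_preimage] at h1 h2
        rw [min_eq_left (by linarith), max_eq_right (by linarith)] at h1
        rw [min_eq_left (by linarith), max_eq_right (by linarith)] at h2
        have h2' : s.im ∈ Icc (-Real.pi) 0 := ⟨h2.1.le, h2.2.le⟩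
        have hslit : 1 - Complex.exp s ∈ Complex.slitPlane := by
          rw [Complex.mem_slitPlane_iff]
          right
          rw [Complex.sub_im, Complex.exp_im, Complex.one_im]
          have : Real.sin s.im < 0 := Real.sin_neg_of_neg_of_neg_pi_lt h2.2 h2.1
          nlinarith [Real.exp_pos s.re]
        have hd1 : DifferentiableAt ℂ (fun s => symb α lam (1 - Complex.exp s)) s :=
          (differentiableAt_symb α lam hslit).comp (f := fun s => 1 - Complex.exp s) s (by fun_prop)
        have hd2 : DifferentiableAt ℂ (fun s => Complex.exp s ^ n) s := by fun_prop
        exact ((hd2.inv (pow_ne_zero _ (Complex.exp_ne_zero s))).mul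
          (hd1.inv (hne s h1.2.le h2'))).differentiableWithinAt)
    simp only at hR
    have hint : ∀ y₀ : ℝ, y₀ ∈ Icc (-Real.pi) 0 →
        IntervalIntegrable (fun x : ℝ => contourFun α lam n (x + (y₀ : ℂ) * Complex.I)) volume (-Real.log 2) b := by
      intro y₀ hy₀
      refine ContinuousOn.intervalIntegrable ?_
      refine (hcontS n).comp (by fun_prop) ?_
      intro x hx
      rw [uIcc_of_le (by linarith)] at hx
      simpa using ⟨hx.2, hy₀⟩
    have him : ∀ (f : ℝ → ℂ) (p q : ℝ), IntervalIntegrable f volume p q →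
        (∫ x in p..q, f x).im = ∫ x in p..q, (f x).im := fun f p q hf =>
      (Complex.imCLM.intervalIntegral_comp_comm hf).symm
    have h4 := congrArg Complex.im hR
    simp only [Complex.add_im, Complex.sub_im, smul_eq_mul, Complex.I_mul_im, Complex.zero_im] at h4
    rw [him _ _ _ (hint _ ⟨le_rfl, by linarith⟩), him _ _ _ (hint 0 ⟨by linarith, le_rfl⟩)] at h4
    simp only [contourFun_im_sub_pi, intervalIntegral.integral_zero] at h4
    have h5 : (∫ x in (-Real.log 2)..b, (contourFun α lam n (x + ((0 : ℝ) : ℂ) * Complex.I)).im) =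
        -(Real.pi * ∫ r in (0 : ℝ)..b, Real.exp (-(n * r)) * (kern α lam (omega α r) / avgExp α r)) := by
      have hii : ∀ p q : ℝ, -Real.log 2 ≤ p → p ≤ q → q ≤ b → IntervalIntegrable
          (fun x : ℝ => (contourFun α lam n (x + ((0 : ℝ) : ℂ) * Complex.I)).im) volume p q := by
        intro p q hp hpq hq
        have h6 : IntervalIntegrable
          (fun x : ℝ => contourFun α lam n (x + ((0 : ℝ) : ℂ) * Complex.I)) volume p q :=
          (hint 0 ⟨by linarith, le_rfl⟩).mono_set (by
            rw [uIcc_of_le hpq, uIcc_of_le (by linarith)]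
            exact Icc_subset_Icc hp hq)
        exact ⟨h6.1.im, h6.2.im⟩
      rw [← intervalIntegral.integral_add_adjacent_intervals (b := 0)
        (hii _ _ le_rfl (by linarith) hb0.le) (hii _ _ (by linarith) hb0.le le_rfl)]
      have h7 : (∫ x in (-Real.log 2)..0, (contourFun α lam n (x + ((0 : ℝ) : ℂ) * Complex.I)).im) = 0 := by
        refine intervalIntegral.integral_zero_ae (Eventually.of_forall fun x hx => ?_)
        rw [uIoc_of_le (by linarith)] at hx
        replace hx := Ioc_subset_Icc_self hx
        simp only [Complex.ofReal_zero, zero_mul, add_zero]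
        exact contourFun_im_of_nonpos α lam n hx.2
      rw [h7, zero_add, ← intervalIntegral.integral_const_mul, ← intervalIntegral.integral_neg]
      refine intervalIntegral.integral_congr_ae (Eventually.of_forall fun x hx => ?_)
      rw [uIoc_of_le hb0.le] at hx
      simp only [Complex.ofReal_zero, zero_mul, add_zero]
      exact contourFun_im_of_pos hα hα' n hx.1
    rw [h5] at h4
    rw [resCoeff_eq_circle hα hα' hl n]
    have h8 : (∫ y in (-Real.pi)..0, contourFun α lam n (((-Real.log 2 : ℝ) : ℂ) + y * Complex.I)).re =
        (Real.pi * ∫ r in (0 : ℝ)..b, Real.exp (-(n * r)) * (kern α lam (omega α r) / avgExp α r)) +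
        (∫ y in (-Real.pi)..0, contourFun α lam n ((b : ℂ) + y * Complex.I)).re := by
      linarith
    rw [h8, mul_add, inv_mul_cancel_left₀ hpi.ne']
  refine ⟨_, fun n => ?_, hmain⟩
  have hbd : ∀ y ∈ uIoc (-Real.pi) 0, ‖contourFun α lam n ((b : ℂ) + y * Complex.I)‖ ≤
      (c * (1 - α))⁻¹ * Real.exp (-(n * b)) / (1 + lam) := by
    intro y hy
    rw [uIoc_of_le (by linarith)] at hy
    have hre : ((b : ℂ) + y * Complex.I).re = b := by simp
    have him : ((b : ℂ) + y * Complex.I).im = y := by simp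
    have h1 := hlow ((b : ℂ) + y * Complex.I) (by rw [hre]) (by rw [him]; exact ⟨hy.1.le, hy.2⟩)
    have h2 : 1 - α ≤ ‖1 - Complex.exp ((b : ℂ) + y * Complex.I)‖ := by
      have := norm_sub_norm_le (Complex.exp ((b : ℂ) + y * Complex.I)) 1
      rw [Complex.norm_exp, hre, hb, exp_cutLength hα', norm_one, norm_sub_rev] at this
      linarith
    have h3 : (1 - α) * (1 + lam) ≤ ‖1 - Complex.exp ((b : ℂ) + y * Complex.I)‖ ^ α + lam := by
      have h4 : (1 - α) ≤ ‖1 - Complex.exp ((b : ℂ) + y * Complex.I)‖ ^ α := by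
        calc 1 - α = (1 - α) ^ (1 : ℝ) := (Real.rpow_one _).symm
          _ ≤ (1 - α) ^ α := Real.rpow_le_rpow_of_exponent_ge (by linarith) (by linarith) hα'.le
          _ ≤ _ := by
            have : 0 ≤ 1 - α := by linarith
            gcongr
      nlinarith
    rw [contourFun, norm_mul, norm_inv, norm_inv, norm_pow, Complex.norm_exp, hre, ← Real.exp_nat_mul,
      ← Real.exp_neg]
    have h1α : 0 < 1 - α := by linarith
    have h5 : c * (1 - α) * (1 + lam) ≤ ‖symb α lam (1 - Complex.exp ((b : ℂ) + y * Complex.I))‖ := by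
      refine le_trans ?_ h1
      rw [mul_assoc]
      gcongr
    calc Real.exp (-(n * b)) * ‖symb α lam (1 - Complex.exp ((b : ℂ) + y * Complex.I))‖⁻¹
        ≤ Real.exp (-(n * b)) * (c * (1 - α) * (1 + lam))⁻¹ := by gcongr
      _ = _ := by field_simp
  have h6 := intervalIntegral.norm_integral_le_of_norm_le_const hbd
  rw [abs_mul, abs_of_pos (inv_pos.2 hpi)]
  calc Real.pi⁻¹ * |(∫ y in (-Real.pi)..0, contourFun α lam n ((b : ℂ) + y * Complex.I)).re|
      ≤ Real.pi⁻¹ * ((c * (1 - α))⁻¹ * Real.exp (-(n * b)) / (1 + lam) * |0 - -Real.pi|) := by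
        gcongr
        exact (Complex.abs_re_le_norm _).trans h6
    _ = _ := by
      rw [sub_neg_eq_add, zero_add, abs_of_pos hpi]
      field_simp

/-! ### Laplace integrals and decay -/

theorem integrableOn_rpow_mul_exp {p x : ℝ} (hp : -1 < p) (hx : 0 < x) :
    IntegrableOn (fun r : ℝ => r ^ p * Real.exp (-(x * r))) (Ioi 0) := by
  have h := integrableOn_rpow_mul_exp_neg_mul_rpow (p := 1) (s := p) (b := x) hp zero_lt_one hx
  refine h.congr_fun (fun r _ => ?_) measurableSet_Ioi
  simp

theorem integral_rpow_mul_exp {p x : ℝ} (hp : -1 < p) (hx : 0 < x) :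
    ∫ r in Ioi (0 : ℝ), r ^ p * Real.exp (-(x * r)) = Real.Gamma (p + 1) * x ^ (-(p + 1)) := by
  have h := Real.integral_rpow_mul_exp_neg_mul_Ioi (a := p + 1) (r := x) (by linarith) hx
  rw [add_sub_cancel_right] at h
  rw [h, one_div, Real.inv_rpow hx.le, Real.rpow_neg hx.le, mul_comm]

/-- A function bounded by `C r^p` on `(0, ∞)` has Laplace transform `O(x^{-p-1})`. -/
theorem abs_laplace_le {p C x : ℝ} (hp : -1 < p) (hx : 0 < x) {f : ℝ → ℝ}
    (hf : ∀ r, 0 < r → |f r| ≤ C * r ^ p) :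
    |∫ r in Ioi (0 : ℝ), Real.exp (-(x * r)) * f r| ≤ C * Real.Gamma (p + 1) * x ^ (-(p + 1)) := by
  have h : ‖∫ r in Ioi (0 : ℝ), Real.exp (-(x * r)) * f r‖ ≤
      ∫ r in Ioi (0 : ℝ), C * (r ^ p * Real.exp (-(x * r))) := by
    refine norm_integral_le_of_norm_le ((integrableOn_rpow_mul_exp hp hx).const_mul C) ?_
    filter_upwards [ae_restrict_mem measurableSet_Ioi] with r hr
    rw [norm_mul, Real.norm_eq_abs, Real.norm_eq_abs, abs_of_pos (Real.exp_pos _)]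
    calc Real.exp (-(x * r)) * |f r| ≤ Real.exp (-(x * r)) * (C * r ^ p) := by
          gcongr; exact hf r hr
      _ = _ := by ring
  rw [integral_const_mul, integral_rpow_mul_exp hp hx, Real.norm_eq_abs, ← mul_assoc] at h
  exact h

theorem integrableOn_laplace {p C x : ℝ} (hp : -1 < p) (hx : 0 < x) {f : ℝ → ℝ}
    (hm : Measurable f) (hf : ∀ r, 0 < r → |f r| ≤ C * r ^ p) :
    IntegrableOn (fun r => Real.exp (-(x * r)) * f r) (Ioi (0 : ℝ)) := by
  refine Integrable.mono' ((integrableOn_rpow_mul_exp hp hx).const_mul C)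
    (by fun_prop) ?_
  filter_upwards [ae_restrict_mem measurableSet_Ioi] with r hr
  rw [norm_mul, Real.norm_eq_abs, Real.norm_eq_abs, abs_of_pos (Real.exp_pos _)]
  calc Real.exp (-(x * r)) * |f r| ≤ Real.exp (-(x * r)) * (C * r ^ p) := by
        gcongr; exact hf r hr
    _ = _ := by ring

/-- A function on a bounded interval, extended by zero. -/
noncomputable def cutOff (b : ℝ) (f : ℝ → ℝ) : ℝ → ℝ := (Ioc 0 b).indicator f

theorem measurable_cutOff (b : ℝ) {f : ℝ → ℝ} (hf : Measurable f) : Measurable (cutOff b f) :=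
  hf.indicator measurableSet_Ioc

theorem intervalIntegral_eq_cutOff {b : ℝ} (hb : 0 ≤ b) (x : ℝ) (f : ℝ → ℝ) :
    ∫ r in (0 : ℝ)..b, Real.exp (-(x * r)) * f r =
      ∫ r in Ioi (0 : ℝ), Real.exp (-(x * r)) * cutOff b f r := by
  rw [intervalIntegral.integral_of_le hb]
  have : ∀ r, Real.exp (-(x * r)) * cutOff b f r =
      (Ioc 0 b).indicator (fun r => Real.exp (-(x * r)) * f r) r := by
    intro r
    unfold cutOff
    by_cases h : r ∈ Ioc 0 b <;> simp [h]
  simp only [this]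
  rw [setIntegral_indicator measurableSet_Ioc, inter_eq_self_of_subset_right Ioc_subset_Ioi_self]

theorem abs_cutOff_le {b C p : ℝ} (hC : 0 ≤ C) {f : ℝ → ℝ} (hf : ∀ r, 0 < r → r ≤ b → |f r| ≤ C * r ^ p)
    {r : ℝ} (hr : 0 < r) : |cutOff b f r| ≤ C * r ^ p := by
  unfold cutOff
  by_cases h : r ∈ Ioc 0 b
  · rw [indicator_of_mem h]; exact hf r hr h.2
  · rw [indicator_of_notMem h, abs_zero]; positivity

/-- The same decay for sequences, including `n = 0`. -/
theorem abs_intervalLaplace_le {p C b : ℝ} (hp : -1 < p) (hC : 0 ≤ C) (hb : 0 ≤ b) (hb1 : b ≤ 1)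
    {f : ℝ → ℝ} (hf : ∀ r, 0 < r → r ≤ b → |f r| ≤ C * r ^ p) (n : ℕ) :
    |∫ r in (0 : ℝ)..b, Real.exp (-(n * r)) * f r| ≤
      Real.exp 1 * C * Real.Gamma (p + 1) * ((n : ℝ) + 1) ^ (-(p + 1)) := by
  have e : (∫ r in (0 : ℝ)..b, Real.exp (-(n * r)) * f r) =
      ∫ r in Ioi (0 : ℝ), Real.exp (-(((n : ℝ) + 1) * r)) * cutOff b (fun r => Real.exp r * f r) r := by
    rw [← intervalIntegral_eq_cutOff hb]
    refine intervalIntegral.integral_congr fun r _ => ?_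
    rw [← mul_assoc, ← Real.exp_add]
    ring_nf
  rw [e]
  refine abs_laplace_le hp (by positivity) fun r hr => ?_
  refine abs_cutOff_le (by positivity) (fun r h0 h1 => ?_) hr
  rw [abs_mul, abs_of_pos (Real.exp_pos r), mul_assoc]
  have : Real.exp r ≤ Real.exp 1 := Real.exp_le_exp.2 (h1.trans hb1)
  have := hf r h0 h1
  gcongr

theorem intervalIntegrable_laplace {p C b : ℝ} (hp : -1 < p) (hb : 0 ≤ b) {f : ℝ → ℝ}
    (hm : Measurable f) (hf : ∀ r, 0 < r → r ≤ b → |f r| ≤ C * r ^ p) (x : ℝ) :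
    IntervalIntegrable (fun r => Real.exp (-(x * r)) * f r) volume 0 b := by
  have h0 : IntervalIntegrable f volume 0 b := by
    refine IntervalIntegrable.mono_fun' (g := fun r => C * r ^ p)
      ((intervalIntegral.intervalIntegrable_rpow' hp).const_mul C) hm.aestronglyMeasurable ?_
    rw [uIoc_of_le hb]
    filter_upwards [ae_restrict_mem measurableSet_Ioc] with r hr
    exact hf r hr.1 hr.2
  exact h0.continuousOn_mul (by fun_prop)

/-- Exponential decay beats every power. -/
theorem exists_exp_le_rpow {b : ℝ} (hb : 0 < b) (p : ℝ) : ∃ C : ℝ, 0 < C ∧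
    ∀ n : ℕ, Real.exp (-(n * b)) ≤ C * ((n : ℝ) + 1) ^ p := by
  have h1 : Tendsto (fun x : ℝ => x ^ (-p) * Real.exp (-b * x)) atTop (𝓝 0) :=
    tendsto_rpow_mul_exp_neg_mul_atTop_nhds_zero (-p) b hb
  have h2 : Tendsto (fun n : ℕ => ((n : ℝ) + 1)) atTop atTop :=
    tendsto_atTop_add_const_right _ _ tendsto_natCast_atTop_atTop
  obtain ⟨M, hM⟩ := (h1.comp h2).bddAbove_range
  refine ⟨Real.exp b * (|M| + 1), by positivity, fun n => ?_⟩
  have h3 : ((n : ℝ) + 1) ^ (-p) * Real.exp (-b * ((n : ℝ) + 1)) ≤ M := hM ⟨n, rfl⟩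
  have hn : (0 : ℝ) < (n : ℝ) + 1 := by positivity
  rw [Real.rpow_neg hn.le] at h3
  have h4 : Real.exp (-b * ((n : ℝ) + 1)) ≤ M * ((n : ℝ) + 1) ^ p := by
    have hp := Real.rpow_pos_of_pos hn p
    rwa [inv_mul_le_iff₀ hp, mul_comm (_ ^ p)] at h3
  calc Real.exp (-(n * b)) = Real.exp b * Real.exp (-b * ((n : ℝ) + 1)) := by
        rw [← Real.exp_add]; ring_nf
    _ ≤ Real.exp b * (M * ((n : ℝ) + 1) ^ p) := by gcongr
    _ ≤ Real.exp b * ((|M| + 1) * ((n : ℝ) + 1) ^ p) := by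
        gcongr
        linarith [le_abs_self M]
    _ = _ := by ring

/-! ### Bounds for the resolvent coefficients -/

theorem expQuot_mem {r : ℝ} (hr : 0 < r) (h1 : r ≤ 1) : 1 ≤ expQuot r ∧ expQuot r ≤ 2 := by
  unfold expQuot
  rw [le_div_iff₀ hr, div_le_iff₀ hr]
  have h := abs_le.1 (abs_exp_sub_one_sub_id_le_sq (r := r) (by rw [abs_of_pos hr]; exact h1))
  constructor
  · linarith [Real.add_one_le_exp r]
  · nlinarith

theorem avgExp_mem {α r : ℝ} (hα : 0 < α) (hα' : α < 1) (hr : 0 < r) (h1 : r ≤ 1) :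
    1 ≤ avgExp α r ∧ avgExp α r ≤ 2 := by
  have h := abs_le.1 (abs_exp_sub_one_sub_id_le_sq (r := r) (by rw [abs_of_pos hr]; exact h1))
  have h2 := Real.add_one_le_exp r
  unfold avgExp
  constructor <;> nlinarith

theorem symbolRatio_mem {α r : ℝ} (hα : 0 < α) (hα' : α < 1) (hr : 0 < r) (h1 : r ≤ 1) :
    1 / 2 ≤ symbolRatio α r ∧ symbolRatio α r ≤ 2 := by
  have h2 := expQuot_mem hr h1
  have h3 := avgExp_mem hα hα' hr h1
  have h4 : 1 ≤ expQuot r ^ α := Real.one_le_rpow h2.1 hα.le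
  have h5 : expQuot r ^ α ≤ 2 := by
    calc expQuot r ^ α ≤ expQuot r ^ (1 : ℝ) := Real.rpow_le_rpow_of_exponent_le h2.1 hα'.le
      _ ≤ 2 := by rw [Real.rpow_one]; exact h2.2
  rw [symbolRatio, ← avgExp]
  rw [le_div_iff₀ (by linarith), div_le_iff₀ (by linarith)]
  constructor <;> nlinarith

theorem omega_mem {α r : ℝ} (hα : 0 < α) (hα' : α < 1) (hr : 0 < r) (h1 : r ≤ 1) :
    r ^ α / 2 ≤ omega α r ∧ omega α r ≤ 2 * r ^ α := by
  have h := symbolRatio_mem hα hα' hr h1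
  have := Real.rpow_pos_of_pos hr α
  unfold omega
  constructor <;> nlinarith

theorem measurable_kern (α lam : ℝ) : Measurable (kern α lam) := by
  unfold kern; fun_prop

theorem measurable_avgExp (α : ℝ) : Measurable (avgExp α) := by
  unfold avgExp; fun_prop

theorem measurable_omega (α : ℝ) : Measurable (omega α) := by
  unfold omega symbolRatio expQuot
  fun_prop

/-- `a / (a + lam)²` is at most `1 / a` and at most `a / lam²`, and `lam` times it is at most `1`. -/
theorem div_sq_le {a lam : ℝ} (ha : 0 < a) (hl : 0 < lam) :
    a / (a + lam) ^ 2 ≤ 1 / a ∧ a / (a + lam) ^ 2 ≤ a / lam ^ 2 ∧ lam * (a / (a + lam) ^ 2) ≤ 1 := by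
  refine ⟨?_, ?_, ?_⟩
  · rw [div_le_div_iff₀ (by positivity) ha]; nlinarith
  · gcongr; linarith
  · rw [mul_div_assoc', div_le_one (by positivity)]; nlinarith

theorem exists_kern_omega_le {α : ℝ} (hα : 0 < α) (hα' : α < 1) : ∃ C : ℝ, 0 < C ∧
    ∀ lam r : ℝ, 0 < lam → 0 < r → r ≤ 1 →
      |kern α lam (omega α r)| ≤ C * (r ^ α / (r ^ α + lam) ^ 2) := by
  obtain ⟨C, hC, h⟩ := kern_le hα hα'
  refine ⟨C * 8, by positivity, fun lam r hl hr h1 => ?_⟩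
  have hw := omega_mem hα hα' hr h1
  have hp := Real.rpow_pos_of_pos hr α
  have hw0 : 0 < omega α r := by linarith
  rw [abs_of_nonneg (kern_nonneg hα hα' hl hw0.le)]
  refine (h lam _ hl hw0.le).trans ?_
  rw [mul_assoc]
  gcongr
  rw [mul_div_assoc', div_le_div_iff₀ (by positivity) (by positivity)]
  have h2 : (r ^ α + lam) ^ 2 ≤ 4 * (omega α r + lam) ^ 2 := by
    have : (r ^ α + lam) ≤ 2 * (omega α r + lam) := by linarith
    calc (r ^ α + lam) ^ 2 ≤ (2 * (omega α r + lam)) ^ 2 := by gcongr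
      _ = _ := by ring
  calc omega α r * (r ^ α + lam) ^ 2 ≤ (2 * r ^ α) * (4 * (omega α r + lam) ^ 2) := by
        gcongr; exact hw.2
    _ = _ := by ring

/-- The density in the representation of the resolvent coefficients. -/
noncomputable def dens (α lam r : ℝ) : ℝ := kern α lam (omega α r) / avgExp α r

theorem measurable_dens (α lam : ℝ) : Measurable (dens α lam) :=
  ((measurable_kern α lam).comp (measurable_omega α)).div (measurable_avgExp α)

theorem exists_dens_le {α : ℝ} (hα : 0 < α) (hα' : α < 1) : ∃ C : ℝ, 0 < C ∧
    ∀ lam r : ℝ, 0 < lam → 0 < r → r ≤ 1 →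
      |dens α lam r| ≤ C * (r ^ α / (r ^ α + lam) ^ 2) := by
  obtain ⟨C, hC, h⟩ := exists_kern_omega_le hα hα'
  refine ⟨C, hC, fun lam r hl hr h1 => ?_⟩
  have h3 := avgExp_mem hα hα' hr h1
  rw [dens, abs_div, abs_of_pos (by linarith : 0 < avgExp α r)]
  exact (div_le_self (abs_nonneg _) h3.1).trans (h lam r hl hr h1)

/-- A sequence with the representation of the resolvent coefficients and a density `O(r^p)` is
`O(n^{-p-1})`. -/
theorem exists_abs_repr_le {α p : ℝ} (hα : 0 < α) (hα' : α < 1) (hp : -1 < p) (C₁ C₂ : ℝ) (h1 : 0 ≤ C₁)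
    (h2 : 0 ≤ C₂) : ∃ C : ℝ, 0 < C ∧ ∀ (f : ℝ → ℝ) (ε : ℕ → ℝ),
      (∀ r, 0 < r → r ≤ cutLength α → |f r| ≤ C₁ * r ^ p) →
      (∀ n : ℕ, |ε n| ≤ C₂ * Real.exp (-(n * cutLength α))) →
      ∀ n : ℕ, |(∫ r in (0 : ℝ)..cutLength α, Real.exp (-(n * r)) * f r) + ε n| ≤
        C * ((n : ℝ) + 1) ^ (-(p + 1)) := by
  obtain ⟨C₃, hC₃, h3⟩ := exists_exp_le_rpow (cutLength_pos hα') (-(p + 1))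
  have hg := Real.Gamma_pos_of_pos (show 0 < p + 1 by linarith)
  refine ⟨Real.exp 1 * C₁ * Real.Gamma (p + 1) + C₂ * C₃ + 1, by positivity, fun f ε hf hε n => ?_⟩
  have h4 := abs_intervalLaplace_le hp h1 (cutLength_pos hα').le (cutLength_le_one hα hα') hf n
  have h5 := (hε n).trans (mul_le_mul_of_nonneg_left (h3 n) h2)
  have h6 : 0 ≤ ((n : ℝ) + 1) ^ (-(p + 1)) := by positivity
  calc _ ≤ _ := abs_add_le _ _
    _ ≤ _ := add_le_add h4 h5
    _ ≤ _ := by nlinarith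

theorem intervalIntegrable_dens {α lam : ℝ} (hα : 0 < α) (hα' : α < 1) (hl : 0 < lam) (n : ℕ) :
    IntervalIntegrable (fun r => Real.exp (-(n * r)) * dens α lam r) volume 0 (cutLength α) := by
  obtain ⟨C, hC, h⟩ := exists_dens_le hα hα'
  refine intervalIntegrable_laplace (p := -α) (C := C) (by linarith) (cutLength_pos hα').le
    (measurable_dens α lam) (fun r h0 h1 => ?_) n
  refine (h lam r hl h0 (h1.trans (cutLength_le_one hα hα'))).trans ?_
  gcongr
  rw [Real.rpow_neg h0.le, ← one_div]
  exact (div_sq_le (Real.rpow_pos_of_pos h0 α) hl).1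

/-- The resolvent coefficients and their first two differences decay like `n^{α-1}`, `n^{α-2}` and
`n^{α-3}`, uniformly in `lam`. -/
theorem exists_resCoeff_le {α : ℝ} (hα : 0 < α) (hα' : α < 1) : ∃ C : ℝ, 0 < C ∧
    ∀ lam : ℝ, 0 < lam → ∀ n : ℕ,
      |resCoeff α lam n| ≤ C * ((n : ℝ) + 1) ^ (α - 1) ∧
      |resCoeff α lam (n + 1) - resCoeff α lam n| ≤ C * ((n : ℝ) + 1) ^ (α - 2) ∧
      |resCoeff α lam (n + 2) - 2 * resCoeff α lam (n + 1) + resCoeff α lam n| ≤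
        C * ((n : ℝ) + 1) ^ (α - 3) := by
  obtain ⟨C₁, hC₁, h1⟩ := exists_dens_le hα hα'
  obtain ⟨C₂, hC₂, h2⟩ := exists_resCoeff_eq hα hα'
  obtain ⟨A, hA, hA'⟩ := exists_abs_repr_le (p := -α) hα hα' (by linarith) C₁ C₂ hC₁.le hC₂.le
  obtain ⟨B, hB, hB'⟩ := exists_abs_repr_le (p := 1 - α) hα hα' (by linarith) C₁ (2 * C₂) hC₁.le
    (by positivity)
  obtain ⟨D, hD, hD'⟩ := exists_abs_repr_le (p := 2 - α) hα hα' (by linarith) C₁ (4 * C₂) hC₁.le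
    (by positivity)
  refine ⟨A + B + D, by positivity, fun lam hl n => ?_⟩
  obtain ⟨ε, hε, hv⟩ := h2 lam hl
  have hb := cutLength_pos hα'
  have hε' : ∀ n : ℕ, |ε n| ≤ C₂ * Real.exp (-(n * cutLength α)) := fun n =>
    (hε n).trans (div_le_self (by positivity) (by linarith))
  have hεs : ∀ n k : ℕ, |ε (n + k)| ≤ C₂ * Real.exp (-(n * cutLength α)) := fun n k => by
    refine (hε' (n + k)).trans ?_
    gcongr
    simp
  have hd : ∀ r, 0 < r → r ≤ cutLength α → |dens α lam r| ≤ C₁ * r ^ (-α) := fun r h0 hr => by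
    refine (h1 lam r hl h0 (hr.trans (cutLength_le_one hα hα'))).trans ?_
    gcongr
    rw [Real.rpow_neg h0.le, ← one_div]
    exact (div_sq_le (Real.rpow_pos_of_pos h0 α) hl).1
  have hexp : ∀ r : ℝ, 0 < r → |Real.exp (-r) - 1| ≤ r := fun r hr => by
    rw [abs_sub_comm, abs_of_nonneg]
    · linarith [Real.add_one_le_exp (-r)]
    · linarith [Real.exp_lt_one_iff.2 (by linarith : -r < 0)]
  have hii := intervalIntegrable_dens hα hα' hl
  have hv' : ∀ n, resCoeff α lam n = (∫ r in (0 : ℝ)..cutLength α,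
      Real.exp (-(n * r)) * dens α lam r) + ε n := hv
  have hmono : ∀ (E F : ℝ) (q : ℝ), E ≤ F → E * ((n : ℝ) + 1) ^ q ≤ F * ((n : ℝ) + 1) ^ q :=
    fun E F q h => mul_le_mul_of_nonneg_right h (by positivity)
  have e1 : ∀ r : ℝ, Real.exp (-(((n + 1 : ℕ) : ℝ) * r)) = Real.exp (-(n * r)) * Real.exp (-r) := by
    intro r; rw [← Real.exp_add]; push_cast; ring_nf
  have e2 : ∀ r : ℝ, Real.exp (-(((n + 2 : ℕ) : ℝ) * r)) = Real.exp (-(n * r)) * Real.exp (-r) ^ 2 := by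
    intro r; rw [← Real.exp_nat_mul, ← Real.exp_add]; push_cast; ring_nf
  refine ⟨?_, ?_, ?_⟩
  · rw [hv']
    refine (hA' _ ε hd hε' n).trans ?_
    rw [show -(-α + 1) = α - 1 by ring]
    exact hmono _ _ _ (by linarith)
  · have h3 := hB' (fun r => (Real.exp (-r) - 1) * dens α lam r) (fun n => ε (n + 1) - ε n)
      (fun r h0 hr => by
        rw [abs_mul, Real.rpow_sub h0, Real.rpow_one, div_eq_mul_inv, ← Real.rpow_neg h0.le]
        calc |Real.exp (-r) - 1| * |dens α lam r| ≤ r * (C₁ * r ^ (-α)) := by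
              gcongr
              · exact hexp r h0
              · exact hd r h0 hr
          _ = _ := by ring)
      (fun n => (abs_sub _ _).trans (by linarith [hεs n 1, hε' n])) n
    rw [show -(1 - α + 1) = α - 2 by ring] at h3
    refine le_trans (le_of_eq ?_) (h3.trans (hmono _ _ _ (by linarith)))
    rw [hv', hv', add_sub_add_comm, ← intervalIntegral.integral_sub (hii _) (hii _)]
    congr 2
    refine intervalIntegral.integral_congr fun r _ => ?_
    simp only [e1]
    ring
  · have h3 := hD' (fun r => (Real.exp (-r) - 1) ^ 2 * dens α lam r)
      (fun n => ε (n + 2) - 2 * ε (n + 1) + ε n)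
      (fun r h0 hr => by
        rw [abs_mul, abs_pow, Real.rpow_sub h0, Real.rpow_two, div_eq_mul_inv, ← Real.rpow_neg h0.le]
        calc |Real.exp (-r) - 1| ^ 2 * |dens α lam r| ≤ r ^ 2 * (C₁ * r ^ (-α)) := by
              gcongr
              · exact hexp r h0
              · exact hd r h0 hr
          _ = _ := by ring)
      (fun n => by
        refine (abs_add_le _ _).trans ((add_le_add (abs_sub _ _) le_rfl).trans ?_)
        rw [abs_mul, abs_two]
        linarith [hεs n 1, hε' n, hεs n 2]) n
    rw [show -(2 - α + 1) = α - 3 by ring] at h3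
    refine le_trans (le_of_eq ?_) (h3.trans (hmono _ _ _ (by linarith)))
    have hi : (∫ r in (0 : ℝ)..cutLength α, Real.exp (-(n * r)) * ((Real.exp (-r) - 1) ^ 2 * dens α lam r)) =
        (∫ r in (0 : ℝ)..cutLength α, Real.exp (-(((n + 2 : ℕ) : ℝ) * r)) * dens α lam r) -
        2 * (∫ r in (0 : ℝ)..cutLength α, Real.exp (-(((n + 1 : ℕ) : ℝ) * r)) * dens α lam r) +
        (∫ r in (0 : ℝ)..cutLength α, Real.exp (-(n * r)) * dens α lam r) := by
      rw [← intervalIntegral.integral_const_mul, ← intervalIntegral.integral_sub (hii _) ((hii _).const_mul 2),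
        ← intervalIntegral.integral_add ((hii _).sub ((hii _).const_mul 2)) (hii _)]
      refine intervalIntegral.integral_congr fun r _ => ?_
      simp only [e1, e2]
      ring
    rw [hi, hv', hv', hv']
    congr 1
    ring

/-! ### The Stieltjes transform of the spectral density -/

theorem integrableOn_Ioi_of_rpow_bounds {f : ℝ → ℝ} {A B p q : ℝ}
    (hf : AEStronglyMeasurable f (volume.restrict (Ioi 0))) (hp : -1 < p) (hq : q < -1)
    (h0 : ∀ x, 0 < x → x ≤ 1 → |f x| ≤ A * x ^ p) (h1 : ∀ x, 1 < x → |f x| ≤ B * x ^ q) :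
    IntegrableOn f (Ioi 0) := by
  rw [← Ioc_union_Ioi_eq_Ioi (zero_le_one' ℝ)]
  refine IntegrableOn.union ?_ ?_
  · have h2 : IntegrableOn (fun x : ℝ => A * x ^ p) (Ioc 0 1) :=
      ((intervalIntegrable_iff_integrableOn_Ioc_of_le zero_le_one).1
        (intervalIntegral.intervalIntegrable_rpow' hp)).const_mul A
    refine Integrable.mono' h2 (hf.mono_set Ioc_subset_Ioi_self) ?_
    filter_upwards [ae_restrict_mem measurableSet_Ioc] with x hx
    exact h0 x hx.1 hx.2
  · refine Integrable.mono' ((integrableOn_Ioi_rpow_of_lt hq zero_lt_one).const_mul B)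
      (hf.mono_set (Ioi_subset_Ioi zero_le_one)) ?_
    filter_upwards [ae_restrict_mem measurableSet_Ioi] with x hx
    exact h1 x hx

/-- The density `kern (r^α)` of the continuous resolvent kernel. -/
noncomputable def kdens (α lam r : ℝ) : ℝ := kern α lam (r ^ α)

theorem measurable_kdens (α lam : ℝ) : Measurable (kdens α lam) :=
  (measurable_kern α lam).comp (by fun_prop)

theorem kdens_nonneg {α lam r : ℝ} (hα : 0 < α) (hα' : α < 1) (hl : 0 < lam) (hr : 0 ≤ r) :
    0 ≤ kdens α lam r := kern_nonneg hα hα' hl (Real.rpow_nonneg hr _)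

/-- The density is `O(r^{-α})` uniformly in `lam`, and `O(r^α)` for fixed `lam`. -/
theorem exists_kdens_le {α : ℝ} (hα : 0 < α) (hα' : α < 1) : ∃ C : ℝ, 0 < C ∧
    ∀ lam r : ℝ, 0 < lam → 0 < r → kdens α lam r ≤ C * (r ^ α / (r ^ α + lam) ^ 2) ∧
      |kdens α lam r| ≤ C * r ^ (-α) ∧ |kdens α lam r| ≤ C / lam ^ 2 * r ^ α := by
  obtain ⟨C, hC, h⟩ := kern_le hα hα'
  refine ⟨C, hC, fun lam r hl hr => ?_⟩
  have hp := Real.rpow_pos_of_pos hr α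
  have h1 := h lam (r ^ α) hl hp.le
  have h2 := div_sq_le hp hl
  have h0 := kdens_nonneg hα hα' hl hr.le
  refine ⟨h1, ?_, ?_⟩
  · rw [abs_of_nonneg h0, Real.rpow_neg hr.le, ← one_div]
    exact h1.trans (mul_le_mul_of_nonneg_left h2.1 hC.le)
  · rw [abs_of_nonneg h0]
    refine h1.trans ?_
    rw [div_mul_eq_mul_div, mul_div_assoc]
    exact mul_le_mul_of_nonneg_left h2.2.1 hC.le

theorem integrableOn_kdens_div {α lam : ℝ} (hα : 0 < α) (hα' : α < 1) (hl : 0 < lam) {s : ℝ}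
    (hs : 0 < s) : IntegrableOn (fun r => kdens α lam r / (r + s)) (Ioi 0) := by
  obtain ⟨C, hC, h⟩ := exists_kdens_le hα hα'
  refine integrableOn_Ioi_of_rpow_bounds (p := α) (q := -α - 1) (A := C / lam ^ 2 / s) (B := C)
    ((measurable_kdens α lam).div (by fun_prop)).aestronglyMeasurable (by linarith) (by linarith) ?_ ?_
  · intro x h0 _
    rw [abs_div, abs_of_pos (by linarith : 0 < x + s)]
    have := (h lam x hl h0).2.2
    calc |kdens α lam x| / (x + s) ≤ (C / lam ^ 2 * x ^ α) / s := by gcongr; linarith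
      _ = _ := by ring
  · intro x hx
    have h0 : 0 < x := by linarith
    rw [abs_div, abs_of_pos (by linarith : 0 < x + s)]
    have := (h lam x hl h0).2.1
    rw [Real.rpow_sub h0, Real.rpow_one, mul_div_assoc']
    gcongr
    linarith

theorem cexp_add_ne_zero {α lam : ℝ} (hα : 0 < α) (hα' : α < 1) (hl : 0 < lam) {v : ℂ}
    (hv : v.im ∈ Icc 0 Real.pi) : Complex.exp (α * v) + lam ≠ 0 := by
  intro h
  have him := congrArg Complex.im h
  have hre := congrArg Complex.re h
  simp only [Complex.add_im, Complex.exp_im, Complex.re_ofReal_mul, Complex.im_ofReal_mul,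
    Complex.ofReal_im, add_zero, Complex.zero_im] at him
  simp only [Complex.add_re, Complex.exp_re, Complex.re_ofReal_mul, Complex.im_ofReal_mul,
    Complex.ofReal_re, Complex.zero_re] at hre
  have he := Real.exp_pos (α * v.re)
  rcases hv.1.eq_or_lt with h0 | h0
  · rw [← h0, mul_zero, Real.cos_zero] at hre
    linarith
  · have : 0 < Real.sin (α * v.im) :=
      Real.sin_pos_of_pos_of_lt_pi (by positivity) (by nlinarith [hv.2, Real.pi_pos])
    exact absurd him (by positivity)

theorem one_sub_cexp_neg_ne_zero {v : ℂ} (hv : v.im ∈ Icc 0 Real.pi) (h0 : v ≠ 0) :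
    1 - Complex.exp (-v) ≠ 0 := by
  intro h
  have h1 : Complex.exp (-v) = 1 := by linear_combination -h
  obtain ⟨n, hn⟩ := Complex.exp_eq_one_iff.1 h1
  have him := congrArg Complex.im hn
  have hre := congrArg Complex.re hn
  simp at him hre
  have hpi := Real.pi_pos
  have hn0 : (n : ℝ) = 0 := by
    have h2 : (n : ℝ) ≤ 0 := by
      by_contra hc
      push Not at hc
      nlinarith [hv.1]
    have h3 : (-1 : ℝ) < n := by
      by_contra hc
      push Not at hc
      nlinarith [hv.2]
    have h2' : n ≤ 0 := by exact_mod_cast h2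
    have h3' : -1 < n := by exact_mod_cast h3
    have : n = 0 := by omega
    simp [this]
  apply h0
  apply Complex.ext
  · simpa using hre
  · rw [hn0] at him
    simpa using him

/-- The integrand `(1/(e^{αv} + lam) - 1/(1 + lam)) / (1 - e^{-v})`, with its singularity at `v = 0`
removed. -/
noncomputable def stieltjesFun (α lam : ℝ) (v : ℂ) : ℂ :=
  -(dslope (fun v : ℂ => Complex.exp (α * v)) 0 v) /
    (dslope (fun v : ℂ => 1 - Complex.exp (-v)) 0 v * ((Complex.exp (α * v) + lam) * (1 + lam)))

theorem stieltjesFun_of_ne {α lam : ℝ} {v : ℂ} (hv : v ≠ 0) : stieltjesFun α lam v =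
    (1 - Complex.exp (α * v)) / ((1 - Complex.exp (-v)) * ((Complex.exp (α * v) + lam) * (1 + lam))) := by
  rw [stieltjesFun, dslope_of_ne _ hv, dslope_of_ne _ hv, slope_def_field, slope_def_field]
  simp only [mul_zero, Complex.exp_zero, neg_zero, sub_self, sub_zero]
  rw [← neg_div, neg_sub]
  field_simp

theorem differentiableAt_stieltjesFun {α lam : ℝ} (hα : 0 < α) (hα' : α < 1) (hl : 0 < lam) {v : ℂ}
    (hv : v.im ∈ Icc 0 Real.pi) : DifferentiableAt ℂ (stieltjesFun α lam) v := by
  have hd : ∀ f : ℂ → ℂ, Differentiable ℂ f → DifferentiableAt ℂ (dslope f 0) v := fun f hf =>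
    ((Complex.differentiableOn_dslope univ_mem).2 hf.differentiableOn).differentiableAt univ_mem
  refine DifferentiableAt.div (hd _ (by fun_prop)).fun_neg
    ((hd _ (by fun_prop)).fun_mul (by fun_prop)) (mul_ne_zero ?_ (mul_ne_zero (cexp_add_ne_zero hα hα' hl hv) ?_))
  · by_cases h0 : v = 0
    · have : HasDerivAt (fun v : ℂ => 1 - Complex.exp (-v)) 1 0 := by
        have h1 := ((hasDerivAt_id (0 : ℂ)).neg.cexp).const_sub 1
        simpa using h1
      rw [h0, dslope_same, this.deriv]
      exact one_ne_zero
    · rw [dslope_of_ne _ h0, slope_def_field]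
      simp only [neg_zero, Complex.exp_zero, sub_self, sub_zero]
      exact div_ne_zero (one_sub_cexp_neg_ne_zero hv h0) h0
  · have : ((1 : ℂ) + lam) = ((1 + lam : ℝ) : ℂ) := by push_cast; rfl
    rw [this]
    exact_mod_cast (by linarith : (1 + lam) ≠ 0)

theorem stieltjesFun_im_ofReal (α lam : ℝ) {x : ℝ} (hx : x ≠ 0) : (stieltjesFun α lam x).im = 0 := by
  rw [stieltjesFun_of_ne (by exact_mod_cast hx)]
  have : (1 - Complex.exp (α * x)) / ((1 - Complex.exp (-x)) * ((Complex.exp (α * x) + lam) * (1 + lam))) =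
      (((1 - Real.exp (α * x)) / ((1 - Real.exp (-x)) * ((Real.exp (α * x) + lam) * (1 + lam))) : ℝ) : ℂ) := by
    push_cast; rfl
  rw [this, Complex.ofReal_im]

/-- On the line `Im v = π` the imaginary part of the function is, up to the factor `-π`, the integrand of the
Stieltjes transform at `1` in the variable `r = e^x`. -/
theorem stieltjesFun_im_add_pi {α lam : ℝ} (hα : 0 < α) (hα' : α < 1) (hl : 0 < lam) (x : ℝ) :
    (stieltjesFun α lam (x + (Real.pi : ℂ) * Complex.I)).im =
      -(Real.pi * (kdens α lam (Real.exp x) / (Real.exp x + 1) * Real.exp x)) := by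
  have hpi := Real.pi_pos
  have hne : (x + (Real.pi : ℂ) * Complex.I) ≠ 0 := by
    intro h
    have := congrArg Complex.im h
    simp at this
  have h1 : Complex.exp (-(x + (Real.pi : ℂ) * Complex.I)) = ((-Real.exp (-x) : ℝ) : ℂ) := by
    rw [neg_add, Complex.exp_add, Complex.exp_neg (_ * _), Complex.exp_pi_mul_I]
    push_cast
    ring
  have hE : ∀ w : ℂ, w + lam ≠ 0 → (1 - w) / ((1 - ((-Real.exp (-x) : ℝ) : ℂ)) * ((w + lam) * (1 + lam))) =
      ((1 / (1 + Real.exp (-x)) : ℝ) : ℂ) * ((w + lam)⁻¹ - ((1 / (1 + lam) : ℝ) : ℂ)) := by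
    intro w hw
    have h2 : ((1 : ℂ) + lam) ≠ 0 := by
      have : ((1 : ℂ) + lam) = ((1 + lam : ℝ) : ℂ) := by push_cast; rfl
      rw [this]; exact_mod_cast (by linarith : (1 + lam) ≠ 0)
    have h3 : ((1 : ℂ) + Complex.exp (-x)) ≠ 0 := by
      have : ((1 : ℂ) + Complex.exp (-x)) = ((1 + Real.exp (-x) : ℝ) : ℂ) := by push_cast; rfl
      rw [this]; exact_mod_cast (by positivity : (1 + Real.exp (-x)) ≠ 0)
    push_cast
    rw [sub_neg_eq_add]
    field_simp
    ring
  have hw := cexp_add_ne_zero hα hα' hl (v := x + (Real.pi : ℂ) * Complex.I) (by simp [hpi.le])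
  rw [stieltjesFun_of_ne hne, h1, hE _ hw, Complex.im_ofReal_mul, Complex.sub_im, Complex.ofReal_im,
    sub_zero, Complex.inv_im, Complex.normSq_apply]
  simp only [Complex.add_im, Complex.exp_im, Complex.ofReal_im, add_zero, Complex.add_re,
    Complex.exp_re, Complex.ofReal_re, Complex.mul_im, Complex.mul_re, Complex.I_re, Complex.I_im,
    mul_zero, mul_one, zero_add, zero_mul, sub_zero, sub_self]
  have h5 : Real.exp (-x) = (Real.exp x)⁻¹ := Real.exp_neg x
  have h6 : Real.exp x ^ α = Real.exp (α * x) := by rw [← Real.exp_mul, mul_comm]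
  rw [kdens, kern, h6, h5, mul_comm α Real.pi]
  set E := Real.exp (α * x) with hEdef
  have hden : (E * Real.cos (Real.pi * α) + lam) * (E * Real.cos (Real.pi * α) + lam) +
      E * Real.sin (Real.pi * α) * (E * Real.sin (Real.pi * α)) =
      E ^ 2 + 2 * lam * E * Real.cos (Real.pi * α) + lam ^ 2 := by
    linear_combination E ^ 2 * Real.sin_sq_add_cos_sq (Real.pi * α)
  rw [hden]
  have hdp := kern_den_pos hα hα' hl (Real.exp_pos (α * x)).le
  rw [← hEdef] at hdp
  have hx := Real.exp_pos x
  field_simp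

/-- Cauchy's theorem on `[-M, M] × [0, π]` for the function above. -/
theorem stieltjes_rect {α lam : ℝ} (hα : 0 < α) (hα' : α < 1) (hl : 0 < lam) (M : ℝ) :
    Real.pi * (∫ r in Real.exp (-M)..Real.exp M, kdens α lam r / (r + 1)) =
      (∫ y in (0 : ℝ)..Real.pi, stieltjesFun α lam (((-M : ℝ) : ℂ) + y * Complex.I)).re -
      (∫ y in (0 : ℝ)..Real.pi, stieltjesFun α lam ((M : ℂ) + y * Complex.I)).re := by
  have hpi := Real.pi_pos
  have hcont : ContinuousOn (stieltjesFun α lam) {v | v.im ∈ Icc 0 Real.pi} := fun v hv =>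
    (differentiableAt_stieltjesFun hα hα' hl hv).continuousAt.continuousWithinAt
  have hR := Complex.integral_boundary_rect_eq_zero_of_continuousOn_of_differentiableOn
    (stieltjesFun α lam) ⟨-M, 0⟩ ⟨M, Real.pi⟩ (by
      refine hcont.mono ?_
      rintro s ⟨_, h2⟩
      simp only [mem_preimage] at h2
      rwa [uIcc_of_le hpi.le] at h2) (by
      rintro s ⟨_, h2⟩
      simp only [mem_preimage] at h2
      rw [min_eq_left hpi.le, max_eq_right hpi.le] at h2
      exact (differentiableAt_stieltjesFun hα hα' hl ⟨h2.1.le, h2.2.le⟩).differentiableWithinAt)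
  simp only at hR
  have him : ∀ (y₀ : ℝ), y₀ ∈ Icc 0 Real.pi →
      (∫ x in (-M)..M, stieltjesFun α lam (x + (y₀ : ℂ) * Complex.I)).im =
        ∫ x in (-M)..M, (stieltjesFun α lam (x + (y₀ : ℂ) * Complex.I)).im := by
    intro y₀ hy
    refine (Complex.imCLM.intervalIntegral_comp_comm (ContinuousOn.intervalIntegrable ?_)).symm
    exact hcont.comp (by fun_prop) fun x _ => by simpa using hy
  have h4 := congrArg Complex.im hR
  simp only [Complex.add_im, Complex.sub_im, smul_eq_mul, Complex.I_mul_im, Complex.zero_im] at h4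
  rw [him 0 ⟨le_rfl, hpi.le⟩, him _ ⟨hpi.le, le_rfl⟩] at h4
  have h5 : (∫ x in (-M)..M, (stieltjesFun α lam (x + ((0 : ℝ) : ℂ) * Complex.I)).im) = 0 := by
    refine intervalIntegral.integral_zero_ae ?_
    have : ∀ᵐ x : ℝ, x ≠ 0 := by simp [ae_iff]
    filter_upwards [this] with x hx _
    simp only [Complex.ofReal_zero, zero_mul, add_zero]
    exact stieltjesFun_im_ofReal α lam hx
  simp only [stieltjesFun_im_add_pi hα hα' hl] at h4
  rw [h5, intervalIntegral.integral_neg, intervalIntegral.integral_const_mul] at h4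
  have h6 : (∫ x in (-M)..M, kdens α lam (Real.exp x) / (Real.exp x + 1) * Real.exp x) =
      ∫ r in Real.exp (-M)..Real.exp M, kdens α lam r / (r + 1) := by
    refine intervalIntegral.integral_comp_mul_deriv'' (f := Real.exp) (f' := Real.exp)
      (g := fun r => kdens α lam r / (r + 1)) (by fun_prop)
      (fun x _ => (Real.hasDerivAt_exp x).hasDerivWithinAt) (by fun_prop) ?_
    rintro r ⟨x, _, rfl⟩
    refine ContinuousAt.continuousWithinAt ?_
    have hx := Real.exp_pos x
    have hc : ContinuousAt (fun r : ℝ => r ^ α) (Real.exp x) :=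
      Real.continuousAt_rpow_const _ _ (Or.inl hx.ne')
    have hdp := kern_den_pos hα hα' hl (Real.rpow_pos_of_pos hx α).le
    unfold kdens kern
    refine ContinuousAt.div (continuousAt_const.mul (hc.div ?_ hdp.ne')) (by fun_prop) (by linarith)
    fun_prop
  rw [← h6]
  linarith

/-- The Stieltjes transform of the density at `1`. -/
theorem integral_kdens_div_add_one {α lam : ℝ} (hα : 0 < α) (hα' : α < 1) (hl : 0 < lam) :
    ∫ r in Ioi (0 : ℝ), kdens α lam r / (r + 1) = 1 / (1 + lam) := by
  have hpi := Real.pi_pos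
  have hint := integrableOn_kdens_div hα hα' hl zero_lt_one
  -- the left-hand side
  have hL : Tendsto (fun M : ℝ => ∫ r in Real.exp (-M)..Real.exp M, kdens α lam r / (r + 1)) atTop
      (𝓝 (∫ r in Ioi (0 : ℝ), kdens α lam r / (r + 1))) := by
    have h1 := intervalIntegral_tendsto_integral_Ioi 0 hint Real.tendsto_exp_atTop
    have hii : ∀ a b : ℝ, 0 ≤ a → 0 ≤ b → IntervalIntegrable (fun r => kdens α lam r / (r + 1)) volume a b := by
      intro a b ha hb
      rw [intervalIntegrable_iff]
      refine hint.mono_set fun x hx => ?_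
      exact (le_min ha hb).trans_lt hx.1
    have h2 : Tendsto (fun M : ℝ => ∫ r in (0 : ℝ)..Real.exp (-M), kdens α lam r / (r + 1)) atTop (𝓝 0) := by
      have hc := intervalIntegral.continuousOn_primitive_interval (μ := volume) (a := 0) (b := 1)
        (f := fun r => kdens α lam r / (r + 1)) (by
          rw [uIcc_of_le zero_le_one, integrableOn_Icc_iff_integrableOn_Ioc]
          exact hint.mono_set Ioc_subset_Ioi_self)
      have h3 := (hc 0 (by simp)).tendsto
      rw [intervalIntegral.integral_same] at h3
      refine h3.comp (tendsto_nhdsWithin_iff.2 ⟨Real.tendsto_exp_neg_atTop_nhds_zero, ?_⟩)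
      filter_upwards [eventually_ge_atTop (0 : ℝ)] with M hM
      rw [uIcc_of_le zero_le_one]
      exact ⟨(Real.exp_pos _).le, Real.exp_le_one_iff.2 (by linarith)⟩
    have h4 := h1.sub h2
    rw [sub_zero] at h4
    refine h4.congr fun M => ?_
    rw [intervalIntegral.integral_interval_sub_left (hii _ _ le_rfl (Real.exp_pos _).le)
      (hii _ _ le_rfl (Real.exp_pos _).le)]
  have hlc : ((1 : ℂ) + lam) = ((1 + lam : ℝ) : ℂ) := by push_cast; rfl
  have hl1 : ((1 : ℂ) + lam) ≠ 0 := by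
    rw [hlc]; exact_mod_cast (by linarith : (1 + lam) ≠ 0)
  have hnl : ‖(1 : ℂ) + lam‖ = 1 + lam := by
    rw [hlc, Complex.norm_real, Real.norm_eq_abs, abs_of_pos (by linarith)]
  have hexpa : Tendsto (fun M : ℝ => Real.exp (α * M)) atTop atTop :=
    Real.tendsto_exp_atTop.comp (tendsto_id.const_mul_atTop hα)
  have hexpn : Tendsto (fun M : ℝ => Real.exp (-M)) atTop (𝓝 0) := Real.tendsto_exp_neg_atTop_nhds_zero
  have hexpna : Tendsto (fun M : ℝ => Real.exp (-(α * M))) atTop (𝓝 0) :=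
    Real.tendsto_exp_neg_atTop_nhds_zero.comp (tendsto_id.const_mul_atTop hα)
  -- the left side of the rectangle
  have hleft : Tendsto (fun M : ℝ => ∫ y in (0 : ℝ)..Real.pi,
      stieltjesFun α lam (((-M : ℝ) : ℂ) + y * Complex.I)) atTop (𝓝 0) := by
    rw [tendsto_zero_iff_norm_tendsto_zero]
    have hb : Tendsto (fun M : ℝ => 2 / ((Real.exp M - 1) * ((lam - Real.exp (-(α * M))) * (1 + lam))) *
        |Real.pi - 0|) atTop (𝓝 0) := by
      have h1 : Tendsto (fun M : ℝ => (Real.exp M - 1) * ((lam - Real.exp (-(α * M))) * (1 + lam))) atTop atTop := by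
        refine Tendsto.atTop_mul_pos (C := (lam - 0) * (1 + lam)) (by nlinarith) ?_ ?_
        · exact tendsto_atTop_add_const_right _ _ Real.tendsto_exp_atTop
        · exact (tendsto_const_nhds.sub hexpna).mul_const _
      simpa using (tendsto_const_nhds.div_atTop h1).mul_const |Real.pi - 0|
    refine squeeze_zero' (Eventually.of_forall fun _ => norm_nonneg _) ?_ hb
    filter_upwards [eventually_gt_atTop (0 : ℝ), hexpna.eventually (gt_mem_nhds hl)] with M hM hM2
    refine intervalIntegral.norm_integral_le_of_norm_le_const fun y hy => ?_
    rw [uIoc_of_le hpi.le] at hy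
    set v : ℂ := ((-M : ℝ) : ℂ) + y * Complex.I with hv
    have hvre : v.re = -M := by simp [hv]
    have hv0 : v ≠ 0 := fun h => by rw [h] at hvre; simp at hvre; linarith
    have hE : ‖Complex.exp (α * v)‖ = Real.exp (-(α * M)) := by
      rw [Complex.norm_exp, Complex.re_ofReal_mul, hvre]; ring_nf
    have hE1 : ‖Complex.exp (-v)‖ = Real.exp M := by
      rw [Complex.norm_exp, Complex.neg_re, hvre, neg_neg]
    have n1 : Real.exp M - 1 ≤ ‖1 - Complex.exp (-v)‖ := by
      have := norm_sub_norm_le (Complex.exp (-v)) 1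
      rwa [hE1, norm_one, norm_sub_rev] at this
    have n2 : lam - Real.exp (-(α * M)) ≤ ‖Complex.exp (α * v) + lam‖ := by
      have := norm_sub_norm_le (lam : ℂ) (-Complex.exp (α * v))
      rwa [norm_neg, hE, Complex.norm_real, Real.norm_eq_abs, abs_of_pos hl, sub_neg_eq_add, add_comm] at this
    have n3 : ‖1 - Complex.exp (α * v)‖ ≤ 2 := by
      refine (norm_sub_le _ _).trans ?_
      rw [hE, norm_one]
      have : Real.exp (-(α * M)) ≤ 1 := Real.exp_le_one_iff.2 (by nlinarith)
      linarith
    have p1 : 0 < Real.exp M - 1 := by linarith [Real.one_lt_exp_iff.2 hM]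
    have p2 : 0 < lam - Real.exp (-(α * M)) := by linarith
    rw [stieltjesFun_of_ne hv0, norm_div, norm_mul, norm_mul, hnl]
    gcongr
  -- the right side of the rectangle
  have hright : Tendsto (fun M : ℝ => ∫ y in (0 : ℝ)..Real.pi,
      stieltjesFun α lam ((M : ℂ) + y * Complex.I)) atTop (𝓝 (-(Real.pi / (1 + lam) : ℝ))) := by
    rw [tendsto_iff_norm_sub_tendsto_zero]
    have hb : Tendsto (fun M : ℝ => (1 / ((1 - Real.exp (-M)) * (Real.exp (α * M) - lam)) +
        Real.exp (-M) / ((1 - Real.exp (-M)) * (1 + lam))) * |Real.pi - 0|) atTop (𝓝 0) := by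
      have h0 : Tendsto (fun M : ℝ => 1 - Real.exp (-M)) atTop (𝓝 1) := by
        simpa using (tendsto_const_nhds (x := (1 : ℝ))).sub hexpn
      have h1 : Tendsto (fun M : ℝ => (1 - Real.exp (-M)) * (Real.exp (α * M) - lam)) atTop atTop :=
        h0.pos_mul_atTop zero_lt_one (tendsto_atTop_add_const_right _ _ hexpa)
      have h2 : Tendsto (fun M : ℝ => Real.exp (-M) / ((1 - Real.exp (-M)) * (1 + lam))) atTop
          (𝓝 (0 / (1 * (1 + lam)))) := hexpn.div (h0.mul_const _) (by linarith)
      have h3 : Tendsto (fun M : ℝ => 1 / ((1 - Real.exp (-M)) * (Real.exp (α * M) - lam))) atTop (𝓝 0) :=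
        tendsto_const_nhds.div_atTop h1
      simpa using (h3.add h2).mul_const |Real.pi - 0|
    refine squeeze_zero' (Eventually.of_forall fun _ => norm_nonneg _) ?_ hb
    filter_upwards [eventually_gt_atTop (0 : ℝ), hexpa.eventually (eventually_gt_atTop lam)] with M hM hM2
    have hci : IntervalIntegrable (fun y : ℝ => stieltjesFun α lam ((M : ℂ) + y * Complex.I)) volume 0 Real.pi := by
      refine ContinuousOn.intervalIntegrable ?_
      intro y hy
      rw [uIcc_of_le hpi.le] at hy
      have h1 : ContinuousAt (stieltjesFun α lam) ((M : ℂ) + y * Complex.I) :=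
        (differentiableAt_stieltjesFun hα hα' hl (by simpa using hy)).continuousAt
      exact (h1.comp (f := fun y : ℝ => (M : ℂ) + y * Complex.I) (by fun_prop)).continuousWithinAt
    have hc : (-(Real.pi / (1 + lam) : ℝ) : ℂ) = ∫ y in (0 : ℝ)..Real.pi, -((1 + lam : ℂ))⁻¹ := by
      rw [intervalIntegral.integral_const]
      simp
      ring
    rw [hc, ← intervalIntegral.integral_sub hci (by simp)]
    refine intervalIntegral.norm_integral_le_of_norm_le_const fun y hy => ?_
    rw [uIoc_of_le hpi.le] at hy
    set v : ℂ := (M : ℂ) + y * Complex.I with hv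
    have hvre : v.re = M := by simp [hv]
    have hvim : v.im ∈ Icc 0 Real.pi := by simpa [hv] using Ioc_subset_Icc_self hy
    have hv0 : v ≠ 0 := fun h => by rw [h] at hvre; simp at hvre; linarith
    have hE : ‖Complex.exp (α * v)‖ = Real.exp (α * M) := by
      rw [Complex.norm_exp, Complex.re_ofReal_mul, hvre]
    have hE1 : ‖Complex.exp (-v)‖ = Real.exp (-M) := by
      rw [Complex.norm_exp, Complex.neg_re, hvre]
    have n1 : 1 - Real.exp (-M) ≤ ‖1 - Complex.exp (-v)‖ := by
      have := norm_sub_norm_le 1 (Complex.exp (-v))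
      rwa [hE1, norm_one] at this
    have n2 : Real.exp (α * M) - lam ≤ ‖Complex.exp (α * v) + lam‖ := by
      have := norm_sub_norm_le (Complex.exp (α * v)) (-(lam : ℂ))
      rwa [norm_neg, hE, Complex.norm_real, Real.norm_eq_abs, abs_of_pos hl, sub_neg_eq_add] at this
    have p1 : 0 < 1 - Real.exp (-M) := by linarith [Real.exp_lt_one_iff.2 (by linarith : -M < 0)]
    have p2 : 0 < Real.exp (α * M) - lam := by linarith
    have q1 := one_sub_cexp_neg_ne_zero hvim hv0
    have q2 := cexp_add_ne_zero hα hα' hl hvim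
    have e : stieltjesFun α lam v - -((1 + lam : ℂ))⁻¹ =
        1 / ((1 - Complex.exp (-v)) * (Complex.exp (α * v) + lam)) -
          Complex.exp (-v) / ((1 - Complex.exp (-v)) * (1 + lam)) := by
      rw [stieltjesFun_of_ne hv0]
      field_simp
      ring
    rw [e]
    refine (norm_sub_le _ _).trans ?_
    rw [norm_div, norm_div, norm_mul, norm_mul, hnl, norm_one, hE1]
    gcongr
  have hre : Continuous Complex.re := Complex.continuous_re
  have h1 : Tendsto (fun M : ℝ => Real.pi * ∫ r in Real.exp (-M)..Real.exp M, kdens α lam r / (r + 1)) atTop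
      (𝓝 (Real.pi / (1 + lam))) := by
    have h2 := ((hre.tendsto _).comp hleft).sub ((hre.tendsto _).comp hright)
    simp only [Complex.zero_re, zero_sub, Complex.neg_re, Complex.ofReal_re, neg_neg] at h2
    refine h2.congr' ?_
    filter_upwards with M
    exact (stieltjes_rect hα hα' hl M).symm
  have h2 := tendsto_nhds_unique h1 (hL.const_mul Real.pi)
  have h3 : Real.pi * (1 / (1 + lam)) = Real.pi * ∫ r in Ioi (0 : ℝ), kdens α lam r / (r + 1) := by
    rw [← h2]; ring
  exact (mul_left_cancel₀ hpi.ne' h3).symm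

theorem kern_mul (α : ℝ) {c : ℝ} (hc : c ≠ 0) (lam a : ℝ) :
    kern α (c * lam) (c * a) = c⁻¹ * kern α lam a := by
  unfold kern
  have : (c * a) ^ 2 + 2 * (c * lam) * (c * a) * Real.cos (Real.pi * α) + (c * lam) ^ 2 =
      c ^ 2 * (a ^ 2 + 2 * lam * a * Real.cos (Real.pi * α) + lam ^ 2) := by ring
  rw [this, sq, mul_assoc, mul_div_mul_left _ _ hc, mul_comm c, ← div_div]
  ring

theorem kdens_mul {α : ℝ} (lam : ℝ) {c r : ℝ} (hc : 0 < c) (hr : 0 ≤ r) :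
    kdens α (c ^ α * lam) (c * r) = c ^ (-α) * kdens α lam r := by
  unfold kdens
  rw [Real.mul_rpow hc.le hr, kern_mul _ (Real.rpow_pos_of_pos hc α).ne', Real.rpow_neg hc.le]

theorem integral_kdens_div_add {α lam s : ℝ} (hα : 0 < α) (hα' : α < 1) (hl : 0 < lam) (hs : 0 < s) :
    ∫ r in Ioi (0 : ℝ), kdens α lam r / (r + s) = 1 / (s ^ α + lam) := by
  have hp := Real.rpow_pos_of_pos hs α
  have h1 := integral_kdens_div_add_one hα hα' (lam := lam / s ^ α) (by positivity)
  have h2 := integral_comp_mul_left_Ioi (fun r => kdens α lam r / (r + s)) 0 hs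
  rw [mul_zero, smul_eq_mul] at h2
  have h3 : ∫ r in Ioi (0 : ℝ), kdens α lam (s * r) / (s * r + s) =
      ∫ r in Ioi (0 : ℝ), s⁻¹ * s ^ (-α) * (kdens α (lam / s ^ α) r / (r + 1)) := by
    refine setIntegral_congr_fun measurableSet_Ioi fun r hr => ?_
    have hr0 : (0 : ℝ) < r := hr
    have h4 := kdens_mul (α := α) (lam / s ^ α) hs hr0.le
    rw [mul_div_cancel₀ _ hp.ne'] at h4
    simp only [h4]
    field_simp
  rw [h3, integral_const_mul, h1] at h2
  have h5 : (∫ r in Ioi (0 : ℝ), kdens α lam r / (r + s)) = s ^ (-α) * (1 / (1 + lam / s ^ α)) := by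
    field_simp at h2 ⊢
    linarith
  rw [h5, Real.rpow_neg hs.le]
  field_simp

/-! ### The continuous resolvent kernel -/

/-- The resolvent kernel of the scalar equation `D^α u + lam u = f`, that is
`t^(α-1) E_{α,α}(-lam t^α)`, defined as the Laplace integral of its spectral density. Only its
values for `t > 0` matter. -/
noncomputable def resKernel (α lam t : ℝ) : ℝ :=
  ∫ r in Ioi (0 : ℝ), Real.exp (-(t * r)) * kdens α lam r

theorem integrableOn_exp_mul_kdens {α lam t : ℝ} (hα : 0 < α) (hα' : α < 1) (hl : 0 < lam) (ht : 0 < t) :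
    IntegrableOn (fun r => Real.exp (-(t * r)) * kdens α lam r) (Ioi (0 : ℝ)) := by
  obtain ⟨C, hC, h⟩ := exists_kdens_le hα hα'
  exact integrableOn_laplace (p := -α) (by linarith) ht (measurable_kdens α lam)
    fun r hr => (h lam r hl hr).2.1

theorem resKernel_nonneg {α lam : ℝ} (hα : 0 < α) (hα' : α < 1) (hl : 0 < lam) (t : ℝ) :
    0 ≤ resKernel α lam t :=
  setIntegral_nonneg measurableSet_Ioi fun _ hr =>
    mul_nonneg (Real.exp_pos _).le (kdens_nonneg hα hα' hl (le_of_lt hr))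

theorem measurable_resKernel (α lam : ℝ) : Measurable (resKernel α lam) := by
  have hk := measurable_kdens α lam
  have : StronglyMeasurable (Function.uncurry fun t r : ℝ => Real.exp (-(t * r)) * kdens α lam r) := by
    apply Measurable.stronglyMeasurable
    unfold Function.uncurry
    fun_prop
  exact (this.integral_prod_right (ν := volume.restrict (Ioi (0:ℝ)))).measurable

/-- The bounds `O(t^(α-1))` for the kernel and `O(t^(α-2))` for its derivative, the latter in the form of
a Lipschitz estimate, uniformly in `lam`. -/
theorem exists_resKernel_le {α : ℝ} (hα : 0 < α) (hα' : α < 1) : ∃ C : ℝ, 0 < C ∧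
    ∀ lam t : ℝ, 0 < lam → 0 < t → resKernel α lam t ≤ C * t ^ (α - 1) ∧
      ∀ t', t ≤ t' → |resKernel α lam t' - resKernel α lam t| ≤ C * (t' - t) * t ^ (α - 2) := by
  obtain ⟨C, hC, h⟩ := exists_kdens_le hα hα'
  have hG1 : 0 < Real.Gamma (-α + 1) := Real.Gamma_pos_of_pos (by linarith)
  have hG2 : 0 < Real.Gamma (1 - α + 1) := Real.Gamma_pos_of_pos (by linarith)
  refine ⟨C * Real.Gamma (-α + 1) + C * Real.Gamma (1 - α + 1), by positivity, fun lam t hl ht => ⟨?_, ?_⟩⟩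
  · have h1 := abs_laplace_le (p := -α) (by linarith) ht fun r hr => (h lam r hl hr).2.1
    rw [show -(-α + 1) = α - 1 by ring] at h1
    refine (le_abs_self _).trans (h1.trans ?_)
    have := Real.rpow_pos_of_pos ht (α - 1)
    gcongr
    nlinarith
  · intro t' htt'
    have e : resKernel α lam t' - resKernel α lam t =
        ∫ r in Ioi (0 : ℝ), Real.exp (-(t * r)) * ((Real.exp (-((t' - t) * r)) - 1) * kdens α lam r) := by
      unfold resKernel
      rw [← integral_sub (integrableOn_exp_mul_kdens hα hα' hl (by linarith))
        (integrableOn_exp_mul_kdens hα hα' hl ht)]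
      refine integral_congr_ae (Eventually.of_forall fun r => ?_)
      have : Real.exp (-(t' * r)) = Real.exp (-(t * r)) * Real.exp (-((t' - t) * r)) := by
        rw [← Real.exp_add]; ring_nf
      simp only [this]; ring
    rw [e]
    have h2 : ∀ r, 0 < r → |(Real.exp (-((t' - t) * r)) - 1) * kdens α lam r| ≤
        (C * (t' - t)) * r ^ (1 - α) := by
      intro r hr
      have h3 : |Real.exp (-((t' - t) * r)) - 1| ≤ (t' - t) * r := by
        have h4 : 0 ≤ (t' - t) * r := mul_nonneg (by linarith) hr.le
        have h5 : Real.exp (-((t' - t) * r)) ≤ 1 := Real.exp_le_one_iff.2 (by linarith)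
        have h6 := Real.add_one_le_exp (-((t' - t) * r))
        rw [abs_le]; constructor <;> linarith
      rw [abs_mul]
      calc _ ≤ ((t' - t) * r) * (C * r ^ (-α)) :=
            mul_le_mul h3 (h lam r hl hr).2.1 (abs_nonneg _) (mul_nonneg (by linarith) hr.le)
        _ = _ := by
          rw [show (1 - α) = 1 + -α by ring, Real.rpow_add hr, Real.rpow_one]; ring
    have h1 := abs_laplace_le (p := 1 - α) (by linarith) ht h2
    rw [show -(1 - α + 1) = α - 2 by ring] at h1
    have h7 : 0 ≤ t' - t := by linarith
    have h8 := Real.rpow_pos_of_pos ht (α - 2)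
    calc _ ≤ _ := h1
      _ = (C * Real.Gamma (1 - α + 1)) * ((t' - t) * t ^ (α - 2)) := by ring
      _ ≤ (C * Real.Gamma (-α + 1) + C * Real.Gamma (1 - α + 1)) * ((t' - t) * t ^ (α - 2)) :=
          mul_le_mul_of_nonneg_right (le_add_of_nonneg_left (by positivity)) (by positivity)
      _ = _ := by ring

theorem continuousOn_resKernel {α lam : ℝ} (hα : 0 < α) (hα' : α < 1) (hl : 0 < lam) :
    ContinuousOn (resKernel α lam) (Ioi 0) := by
  obtain ⟨C, hC, h⟩ := exists_resKernel_le hα hα'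
  intro x hx
  have hx0 : 0 < x := hx
  refine ContinuousAt.continuousWithinAt ?_
  have hb : ∀ y ∈ Ioi (x / 2), |resKernel α lam y - resKernel α lam x| ≤
      C * |y - x| * (x / 2) ^ (α - 2) := by
    intro y hy
    have hy0 : 0 < y := lt_trans (by positivity) hy
    have hm : ∀ z, x / 2 ≤ z → z ^ (α - 2) ≤ (x / 2) ^ (α - 2) := fun z hz =>
      Real.rpow_le_rpow_of_nonpos (by positivity) hz (by linarith)
    rcases le_total x y with hxy | hxy
    · rw [abs_of_nonneg (by linarith : 0 ≤ y - x)]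
      refine ((h lam x hl hx0).2 y hxy).trans ?_
      exact mul_le_mul_of_nonneg_left (hm x (by linarith)) (mul_nonneg hC.le (by linarith))
    · rw [abs_sub_comm, abs_sub_comm y x, abs_of_nonneg (by linarith : 0 ≤ x - y)]
      refine ((h lam y hl hy0).2 x hxy).trans ?_
      exact mul_le_mul_of_nonneg_left (hm y (le_of_lt hy)) (mul_nonneg hC.le (by linarith))
  rw [ContinuousAt, tendsto_iff_norm_sub_tendsto_zero]
  have hlim : Tendsto (fun y => C * |y - x| * (x / 2) ^ (α - 2)) (𝓝 x) (𝓝 0) := by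
    have : Continuous fun y : ℝ => C * |y - x| * (x / 2) ^ (α - 2) := by fun_prop
    simpa using this.tendsto x
  refine squeeze_zero' (Eventually.of_forall fun _ => norm_nonneg _) ?_ hlim
  filter_upwards [Ioi_mem_nhds (half_lt_self hx0)] with y hy
  exact hb y hy

theorem integrableOn_exp_mul_resKernel {α lam s : ℝ} (hα : 0 < α) (hα' : α < 1) (hl : 0 < lam) (hs : 0 < s) :
    IntegrableOn (fun t => Real.exp (-(s * t)) * resKernel α lam t) (Ioi 0) := by
  obtain ⟨C, hC, h⟩ := exists_resKernel_le hα hα'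
  refine integrableOn_laplace (p := α - 1) (C := C) (by linarith) hs (measurable_resKernel α lam) fun r hr => ?_
  rw [abs_of_nonneg (resKernel_nonneg hα hα' hl r)]
  exact (h lam r hl hr).1

theorem intervalIntegrable_resKernel {α lam : ℝ} (hα : 0 < α) (hα' : α < 1) (hl : 0 < lam) {a b : ℝ}
    (ha : 0 ≤ a) (hb : 0 ≤ b) :
    IntervalIntegrable (resKernel α lam) volume a b := by
  obtain ⟨C, hC, h⟩ := exists_resKernel_le hα hα'
  have h1 : IntervalIntegrable (fun t : ℝ => C * t ^ (α - 1)) volume a b :=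
    (intervalIntegral.intervalIntegrable_rpow' (by linarith)).const_mul C
  refine h1.mono_fun (measurable_resKernel α lam).aestronglyMeasurable ?_
  filter_upwards [ae_restrict_mem measurableSet_uIoc] with t ht
  have ht0 : 0 < t := (le_min ha hb).trans_lt ht.1
  rw [Real.norm_of_nonneg (resKernel_nonneg hα hα' hl t)]
  exact ((h lam t hl ht0).1).trans (le_abs_self _)

theorem integral_exp_mul_resKernel {α lam s : ℝ} (hα : 0 < α) (hα' : α < 1) (hl : 0 < lam) (hs : 0 < s) :
    ∫ t in Ioi (0 : ℝ), Real.exp (-(s * t)) * resKernel α lam t = 1 / (s ^ α + lam) := by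
  rw [← integral_kdens_div_add hα hα' hl hs]
  have hk := measurable_kdens α lam
  have hexp : ∀ r ∈ Ioi (0 : ℝ), ∫ t in Ioi (0 : ℝ), Real.exp (-(s * t)) * (Real.exp (-(t * r)) * kdens α lam r) =
      kdens α lam r / (r + s) := by
    intro r hr
    have hr0 : (0 : ℝ) < r := hr
    have e : ∀ t : ℝ, Real.exp (-(s * t)) * (Real.exp (-(t * r)) * kdens α lam r) =
        kdens α lam r * (t ^ (0 : ℝ) * Real.exp (-((r + s) * t))) := by
      intro t
      rw [← mul_assoc, ← Real.exp_add, Real.rpow_zero, one_mul, mul_comm]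
      ring_nf
    simp only [e]
    rw [integral_const_mul, integral_rpow_mul_exp (by norm_num) (by linarith)]
    norm_num [Real.rpow_neg_one]
    rfl
  have hint : ∀ r ∈ Ioi (0 : ℝ), IntegrableOn (fun t => Real.exp (-(s * t)) * (Real.exp (-(t * r)) * kdens α lam r)) (Ioi 0) := by
    intro r hr
    have hr0 : (0 : ℝ) < r := hr
    have e : (fun t : ℝ => Real.exp (-(s * t)) * (Real.exp (-(t * r)) * kdens α lam r)) =
        fun t => kdens α lam r * (t ^ (0 : ℝ) * Real.exp (-((r + s) * t))) := by
      ext t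
      rw [← mul_assoc, ← Real.exp_add, Real.rpow_zero, one_mul, mul_comm]
      ring_nf
    rw [e]
    exact (integrableOn_rpow_mul_exp (by norm_num) (by linarith)).const_mul _
  have hprod : Integrable (Function.uncurry fun t r : ℝ => Real.exp (-(s * t)) * (Real.exp (-(t * r)) * kdens α lam r))
      ((volume.restrict (Ioi 0)).prod (volume.restrict (Ioi 0))) := by
    rw [integrable_prod_iff']
    · refine ⟨?_, ?_⟩
      · filter_upwards [ae_restrict_mem measurableSet_Ioi] with r hr
        exact hint r hr
      · refine (integrableOn_kdens_div hα hα' hl hs).congr ?_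
        filter_upwards [ae_restrict_mem measurableSet_Ioi] with r hr
        rw [← hexp r hr]
        refine integral_congr_ae (Eventually.of_forall fun t => ?_)
        have := kdens_nonneg hα hα' hl (le_of_lt hr)
        simp only [Function.uncurry]
        rw [Real.norm_of_nonneg (by positivity)]
    · apply Measurable.aestronglyMeasurable
      unfold Function.uncurry
      fun_prop
  have e : ∀ t, Real.exp (-(s * t)) * resKernel α lam t =
      ∫ r in Ioi (0 : ℝ), Real.exp (-(s * t)) * (Real.exp (-(t * r)) * kdens α lam r) := by
    intro t; rw [integral_const_mul]; rfl
  simp only [e]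
  rw [integral_integral_swap hprod]
  exact setIntegral_congr_fun measurableSet_Ioi hexp

/-- `e_lam(τ x) = τ^(α-1) e_{lam τ^α}(x)`. -/
theorem resKernel_mul {α lam τ x : ℝ} (hτ : 0 < τ) :
    resKernel α lam (τ * x) = τ ^ (α - 1) * resKernel α (lam * τ ^ α) x := by
  unfold resKernel
  have h := integral_comp_mul_left_Ioi (fun r => Real.exp (-(x * r)) * kdens α (τ ^ α * lam) r) 0 hτ
  rw [mul_zero, smul_eq_mul] at h
  have e : ∫ r in Ioi (0 : ℝ), Real.exp (-(x * (τ * r))) * kdens α (τ ^ α * lam) (τ * r) =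
      τ ^ (-α) * ∫ r in Ioi (0 : ℝ), Real.exp (-(τ * x * r)) * kdens α lam r := by
    rw [← integral_const_mul]
    refine setIntegral_congr_fun measurableSet_Ioi fun r hr => ?_
    rw [kdens_mul lam hτ (le_of_lt hr)]
    ring_nf
  rw [e] at h
  rw [mul_comm lam, Real.rpow_sub hτ, Real.rpow_one]
  have hp := Real.rpow_pos_of_pos hτ α
  rw [Real.rpow_neg hτ.le] at h
  field_simp at h
  field_simp
  linear_combination h

/-- Uniqueness of the Laplace transform of a nonnegative function, in the case of the constant `1`. -/
theorem ae_eq_one_of_laplace {h : ℝ → ℝ} (hm : AEMeasurable h (volume.restrict (Ioi 0)))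
    (h0 : ∀ x, 0 < x → 0 ≤ h x)
    (hi : ∀ s : ℝ, 0 < s → IntegrableOn (fun x => Real.exp (-(s * x)) * h x) (Ioi 0))
    (hL : ∀ s : ℝ, 0 < s → ∫ x in Ioi (0 : ℝ), Real.exp (-(s * x)) * h x = 1 / s) :
    ∀ᵐ x ∂(volume.restrict (Ioi (0 : ℝ))), h x = 1 := by
  -- both functions are turned into finite measures, which have the same moment generating function
  have key : ∀ g : ℝ → ℝ, AEMeasurable g (volume.restrict (Ioi 0)) → (∀ x, 0 < x → 0 ≤ g x) →
      (∀ s : ℝ, 0 < s → IntegrableOn (fun x => Real.exp (-(s * x)) * g x) (Ioi 0)) →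
      (∀ s : ℝ, 0 < s → ∫ x in Ioi (0 : ℝ), Real.exp (-(s * x)) * g x = 1 / s) →
      ∃ m : Measure ℝ, m = (volume.restrict (Ioi (0 : ℝ))).withDensity
          (fun x => ENNReal.ofReal (Real.exp (-x) * g x)) ∧ IsFiniteMeasure m ∧ m ≠ 0 ∧
        (∀ t, t ∈ ProbabilityTheory.integrableExpSet id m ↔ t < 1) ∧
        ∀ t, ProbabilityTheory.mgf id m t = if t < 1 then 1 / (1 - t) else 0 := by
    intro g gm g0 gi gL
    have hd : AEMeasurable (fun x => ENNReal.ofReal (Real.exp (-x) * g x)) (volume.restrict (Ioi (0:ℝ))) := by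
      fun_prop
    have hfin : ∀ᵐ x ∂(volume.restrict (Ioi (0:ℝ))), ENNReal.ofReal (Real.exp (-x) * g x) < ⊤ :=
      Eventually.of_forall fun x => ENNReal.ofReal_lt_top
    set m := (volume.restrict (Ioi (0 : ℝ))).withDensity
          (fun x => ENNReal.ofReal (Real.exp (-x) * g x)) with hmdef
    have hcongr : ∀ t : ℝ, (fun x => (ENNReal.ofReal (Real.exp (-x) * g x)).toReal • Real.exp (t * x))
        =ᵐ[volume.restrict (Ioi (0:ℝ))] fun x => Real.exp (-((1 - t) * x)) * g x := by
      intro t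
      filter_upwards [ae_restrict_mem measurableSet_Ioi] with x hx
      have := g0 x hx
      rw [ENNReal.toReal_ofReal (by positivity), smul_eq_mul, mul_right_comm, ← Real.exp_add]
      ring_nf
    have hint : ∀ t : ℝ, Integrable (fun x => Real.exp (t * x)) m ↔
        IntegrableOn (fun x => Real.exp (-((1 - t) * x)) * g x) (Ioi 0) := by
      intro t
      rw [hmdef, integrable_withDensity_iff_integrable_smul₀' hd hfin]
      exact integrable_congr (hcongr t)
    have hval : ∀ t : ℝ, ∫ x, Real.exp (t * x) ∂m = ∫ x in Ioi (0:ℝ), Real.exp (-((1 - t) * x)) * g x := by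
      intro t
      rw [hmdef, integral_withDensity_eq_integral_toReal_smul₀ hd hfin]
      exact integral_congr_ae (hcongr t)
    have hset : ∀ t, Integrable (fun x => Real.exp (t * x)) m ↔ t < 1 := by
      intro t
      rw [hint]
      refine ⟨fun hI => ?_, fun ht => gi _ (by linarith)⟩
      by_contra hc
      push Not at hc
      set J := ∫ x in Ioi (0:ℝ), Real.exp (-((1 - t) * x)) * g x
      have hle : ∀ s : ℝ, 0 < s → 1 / s ≤ J := by
        intro s hs
        rw [← gL s hs]
        refine setIntegral_mono_on (gi s hs) hI measurableSet_Ioi fun x hx => ?_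
        have hx0 : (0:ℝ) < x := hx
        refine mul_le_mul_of_nonneg_right (Real.exp_le_exp.2 ?_) (g0 x hx)
        nlinarith
      have h1 : 0 < J := lt_of_lt_of_le (by norm_num) (hle 1 one_pos)
      have h2 := hle (1 / (J + 1)) (by positivity)
      rw [one_div_one_div] at h2
      linarith
    refine ⟨m, rfl, ⟨?_⟩, ?_, fun t => hset t, fun t => ?_⟩
    · rw [hmdef, withDensity_apply _ MeasurableSet.univ, Measure.restrict_univ]
      have := (gi 1 one_pos).lintegral_lt_top
      simpa using this
    · intro hz
      have h1 := hval 0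
      rw [hz, gL _ (by norm_num)] at h1
      norm_num at h1
    · simp only [ProbabilityTheory.mgf, id]
      split_ifs with ht
      · rw [hval, gL _ (by linarith)]
      · exact integral_undef fun hI => ht ((hset t).1 hI)
  obtain ⟨m, hmdef, hf, hne, hs, hmgf⟩ := key h hm h0 hi hL
  obtain ⟨m', hmdef', hf', hne', hs', hmgf'⟩ := key (fun _ => 1) aemeasurable_const (fun _ _ => zero_le_one)
    (fun s hs => by simpa using integrableOn_rpow_mul_exp (p := 0) (by norm_num) hs)
    (fun s hs => by
      have := integral_rpow_mul_exp (p := 0) (by norm_num) hs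
      simpa [Real.rpow_neg_one] using this)
  have heq : m = m' := by
    have h1 := ProbabilityTheory.eqOn_complexMGF_of_mgf' (X := id) (Y := id) (μ := m) (μ' := m')
      (by ext t; rw [hmgf, hmgf']) (by simp [hne, hne'])
    refine Measure.ext_of_charFun ?_
    ext t
    rw [← ProbabilityTheory.complexMGF_id_mul_I, ← ProbabilityTheory.complexMGF_id_mul_I]
    apply h1
    have : ProbabilityTheory.integrableExpSet id m = Iio 1 := by
      ext t; exact hs t
    simp [this]
  rw [hmdef, hmdef', withDensity_eq_iff_of_sigmaFinite (by fun_prop) (by fun_prop)] at heq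
  filter_upwards [heq, ae_restrict_mem measurableSet_Ioi] with x hx hx0
  have := h0 x hx0
  rw [ENNReal.ofReal_eq_ofReal_iff (by positivity) (by positivity)] at hx
  exact mul_left_cancel₀ (Real.exp_pos _).ne' hx

/-- The Caputo kernel `t^(-α) / Γ(1-α)`. -/
noncomputable def caputoKernel (α t : ℝ) : ℝ := t ^ (-α) / Real.Gamma (1 - α)

/-- The resolvent equation, in the form that the convolution of the resolvent kernel
with the Caputo kernel plus `lam` is the constant `1`. -/
theorem ae_integral_resKernel_mul {α lam : ℝ} (hα : 0 < α) (hα' : α < 1) (hl : 0 < lam) :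
    ∀ᵐ t ∂(volume.restrict (Ioi (0 : ℝ))),
      ∫ y in (0 : ℝ)..t, resKernel α lam y * (caputoKernel α (t - y) + lam) = 1 := by
  have hG : 0 < Real.Gamma (1 - α) := Real.Gamma_pos_of_pos (by linarith)
  have hgi : ∀ s : ℝ, 0 < s → IntegrableOn (fun t => Real.exp (-(s * t)) * (caputoKernel α t + lam)) (Ioi 0) := by
    intro s hs
    have h1 := ((integrableOn_rpow_mul_exp (p := -α) (by linarith) hs).div_const (Real.Gamma (1 - α))).add
      ((integrableOn_rpow_mul_exp (p := 0) (by norm_num) hs).mul_const lam)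
    refine h1.congr (Eventually.of_forall fun t => ?_)
    simp only [Pi.add_apply, Real.rpow_zero, caputoKernel]
    ring
  have hgL : ∀ s : ℝ, 0 < s → ∫ t in Ioi (0:ℝ), Real.exp (-(s * t)) * (caputoKernel α t + lam) =
      (s ^ α + lam) / s := by
    intro s hs
    have e : (fun t => Real.exp (-(s * t)) * (caputoKernel α t + lam)) =
        fun t => t ^ (-α) * Real.exp (-(s * t)) / (Real.Gamma (1 - α)) + t ^ (0:ℝ) * Real.exp (-(s * t)) * lam := by
      ext t
      simp only [Real.rpow_zero, caputoKernel]
      ring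
    rw [e, integral_add ((integrableOn_rpow_mul_exp (p := -α) (by linarith) hs).div_const _)
      ((integrableOn_rpow_mul_exp (p := 0) (by norm_num) hs).mul_const lam), integral_div, integral_mul_const,
      integral_rpow_mul_exp (by linarith) hs, integral_rpow_mul_exp (by norm_num) hs,
      show -α + 1 = 1 - α by ring, show -(1 - α) = α - 1 by ring, Real.rpow_sub hs, Real.rpow_one]
    norm_num [Real.rpow_neg_one]
    field_simp
  have hconv : ∀ s : ℝ, ∀ t : ℝ, ∫ y in (0:ℝ)..t, (ContinuousLinearMap.mul ℝ ℝ)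
        (Real.exp (-(s * y)) * resKernel α lam y) (Real.exp (-(s * (t - y))) * (caputoKernel α (t - y) + lam)) =
      Real.exp (-(s * t)) * ∫ y in (0 : ℝ)..t, resKernel α lam y * (caputoKernel α (t - y) + lam) := by
    intro s t
    rw [← intervalIntegral.integral_const_mul]
    refine intervalIntegral.integral_congr fun y _ => ?_
    have : Real.exp (-(s * t)) = Real.exp (-(s * y)) * Real.exp (-(s * (t - y))) := by
      rw [← Real.exp_add]; ring_nf
    simp only [this, ContinuousLinearMap.mul_apply']
    ring
  have hI : ∀ s : ℝ, 0 < s → IntegrableOn (fun t => Real.exp (-(s * t)) *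
      ∫ y in (0 : ℝ)..t, resKernel α lam y * (caputoKernel α (t - y) + lam)) (Ioi 0) := by
    intro s hs
    have h1 := (integrable_posConvolution (μ := volume) (ν := volume)
      (integrableOn_exp_mul_resKernel hα hα' hl hs) (hgi s hs) (ContinuousLinearMap.mul ℝ ℝ))
    refine h1.integrableOn.congr ?_
    filter_upwards [ae_restrict_mem measurableSet_Ioi] with t ht
    rw [posConvolution, indicator_of_mem ht, hconv]
  refine ae_eq_one_of_laplace ?_ ?_ hI ?_
  · have h1 := (hI 1 one_pos).aemeasurable
    have h2 : AEMeasurable (fun t : ℝ => Real.exp (1 * t)) (volume.restrict (Ioi (0:ℝ))) := by fun_prop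
    refine (h2.mul h1).congr (Eventually.of_forall fun t => ?_)
    simp only [Pi.mul_apply]
    rw [← mul_assoc, ← Real.exp_add]
    simp
  · intro t ht
    refine intervalIntegral.integral_nonneg ht.le fun y hy => mul_nonneg (resKernel_nonneg hα hα' hl y) ?_
    have : 0 ≤ t - y := by linarith [hy.2]
    unfold caputoKernel
    positivity
  · intro s hs
    have h1 := integral_posConvolution (μ := volume) (ν := volume)
      (integrableOn_exp_mul_resKernel hα hα' hl hs) (hgi s hs) (ContinuousLinearMap.mul ℝ ℝ)
    simp only [hconv] at h1
    rw [h1, ContinuousLinearMap.mul_apply', integral_exp_mul_resKernel hα hα' hl hs, hgL s hs]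
    have := Real.rpow_pos_of_pos hs α
    field_simp

/-! ### The source weights of the scheme -/

/-- The generating series `(3 - z)/2 · (1 - α/2 + α/2 z) · V(z)` of the weights with which the scheme
sees the integrals of the source over the time steps. -/
noncomputable def srcSeries (α lam : ℝ) : PowerSeries ℝ :=
  (PowerSeries.C (3 / 2) - PowerSeries.C (1 / 2) * PowerSeries.X) * (avgSeries α * resolvent α lam)

/-- The weights with which the scheme sees the integrals of the source over the time steps. -/
noncomputable def srcCoeff (α lam : ℝ) (n : ℕ) : ℝ := PowerSeries.coeff n (srcSeries α lam)

theorem one_add_mul_dens_le {C a lam r α : ℝ} (hα : 0 < α) (hl : 0 < lam) (hr : 0 < r) (h1 : r ≤ 1) (hC : 0 ≤ C)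
    (h : |a| ≤ C * (r ^ α / (r ^ α + lam) ^ 2)) : |a| ≤ 2 * C / (1 + lam) * r ^ (-α) := by
  have hp := Real.rpow_pos_of_pos hr α
  have hp1 : r ^ α ≤ 1 := Real.rpow_le_one hr.le h1 hα.le
  refine h.trans ?_
  rw [mul_comm 2 C, mul_div_assoc, mul_assoc]
  refine mul_le_mul_of_nonneg_left ?_ hC
  rw [Real.rpow_neg hr.le, ← div_eq_mul_inv, div_div, div_le_div_iff₀ (by positivity) (by positivity)]
  nlinarith [mul_nonneg hl.le (sub_nonneg.2 hp1), mul_pos hp hl, mul_pos hp hp, sq_nonneg lam,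
    mul_nonneg hp.le (sub_nonneg.2 hp1)]

/-- The representation of the resolvent coefficients holds for shifted coefficients, with
exponentially small corrections for the finitely many vanishing ones. -/
theorem exists_coeff_X_pow_mul_resolvent_eq {α : ℝ} (hα : 0 < α) (hα' : α < 1) (j : ℕ) : ∃ C : ℝ, 0 < C ∧
    ∀ lam : ℝ, 0 < lam → ∃ ε : ℕ → ℝ,
      (∀ n : ℕ, |ε n| ≤ C * Real.exp (-(n * cutLength α)) / (1 + lam)) ∧
      ∀ n : ℕ, PowerSeries.coeff n (PowerSeries.X ^ j * resolvent α lam) = (∫ r in (0 : ℝ)..cutLength α,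
        Real.exp (-(n * r)) * (Real.exp (j * r) * dens α lam r)) + ε n := by
  obtain ⟨C₁, hC₁, h1⟩ := exists_dens_le hα hα'
  obtain ⟨C₂, hC₂, h2⟩ := exists_resCoeff_eq hα hα'
  have hb := cutLength_pos hα'
  have hb1 := cutLength_le_one hα hα'
  have hG : 0 < Real.Gamma (-α + 1) := Real.Gamma_pos_of_pos (by linarith)
  set C₃ := Real.exp 1 * (Real.exp j * (2 * C₁)) * Real.Gamma (-α + 1) with hC₃
  have hC₃' : 0 < C₃ := by positivity
  refine ⟨Real.exp j * (C₂ + C₃), by positivity, fun lam hl => ?_⟩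
  obtain ⟨ε, hε, hv⟩ := h2 lam hl
  refine ⟨fun n => if j ≤ n then ε (n - j) else -∫ r in (0 : ℝ)..cutLength α,
        Real.exp (-(n * r)) * (Real.exp (j * r) * dens α lam r), fun n => ?_, fun n => ?_⟩
  · by_cases hn : j ≤ n
    · simp only [hn, if_true]
      refine (hε _).trans ?_
      have e : Real.exp (-(((n - j : ℕ) : ℝ) * cutLength α)) ≤ Real.exp j * Real.exp (-(n * cutLength α)) := by
        rw [Nat.cast_sub hn, ← Real.exp_add]
        refine Real.exp_le_exp.2 ?_
        have : (j : ℝ) * cutLength α ≤ j := mul_le_of_le_one_right (by positivity) hb1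
        linarith
      calc C₂ * Real.exp (-(((n - j : ℕ) : ℝ) * cutLength α)) / (1 + lam)
          ≤ C₂ * (Real.exp j * Real.exp (-(n * cutLength α))) / (1 + lam) := by gcongr
        _ ≤ (C₂ + C₃) * (Real.exp j * Real.exp (-(n * cutLength α))) / (1 + lam) := by
            gcongr; linarith
        _ = _ := by ring
    · simp only [hn, if_false, abs_neg]
      have h4 : ∀ r, 0 < r → r ≤ cutLength α → |Real.exp (j * r) * dens α lam r| ≤
          Real.exp j * (2 * C₁) / (1 + lam) * r ^ (-α) := by
        intro r hr hrb
        have h5 := one_add_mul_dens_le hα hl hr (hrb.trans hb1) hC₁.le (h1 lam r hl hr (hrb.trans hb1))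
        rw [abs_mul, abs_of_pos (Real.exp_pos _), mul_div_assoc, mul_assoc]
        have h6 : Real.exp (j * r) ≤ Real.exp j :=
          Real.exp_le_exp.2 (mul_le_of_le_one_right (by positivity) (hrb.trans hb1))
        gcongr
      have h5 := abs_intervalLaplace_le (p := -α) (by linarith) (by positivity) hb.le hb1 h4 n
      have h6 : ((n : ℝ) + 1) ^ (-(-α + 1)) ≤ 1 :=
        Real.rpow_le_one_of_one_le_of_nonpos (by linarith [Nat.cast_nonneg (α := ℝ) n]) (by linarith)
      have h7 : (1 : ℝ) ≤ Real.exp j * Real.exp (-(n * cutLength α)) := by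
        rw [← Real.exp_add]
        refine Real.one_le_exp ?_
        have : (n : ℝ) ≤ j := by exact_mod_cast (not_le.1 hn).le
        nlinarith [Nat.cast_nonneg (α := ℝ) n]
      calc _ ≤ _ := h5
        _ ≤ Real.exp 1 * (Real.exp j * (2 * C₁) / (1 + lam)) * Real.Gamma (-α + 1) * 1 := by gcongr
        _ = C₃ / (1 + lam) * 1 := by rw [hC₃]; ring
        _ ≤ C₃ / (1 + lam) * (Real.exp j * Real.exp (-(n * cutLength α))) := by gcongr
        _ ≤ (C₂ + C₃) / (1 + lam) * (Real.exp j * Real.exp (-(n * cutLength α))) := by gcongr; linarith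
        _ = _ := by ring
  · rw [PowerSeries.coeff_X_pow_mul']
    by_cases hn : j ≤ n
    · simp only [hn, if_true]
      have h3 := hv (n - j)
      rw [resCoeff] at h3
      rw [h3]
      congr 1
      refine intervalIntegral.integral_congr fun r _ => ?_
      simp only [dens]
      rw [← mul_assoc, ← Real.exp_add, Nat.cast_sub hn]
      ring_nf
    · simp [hn]

/-- The spectral density of the source weights. -/
noncomputable def srcDens (α lam r : ℝ) : ℝ := (3 - Real.exp r) / 2 * kern α lam (omega α r)

theorem measurable_srcDens (α lam : ℝ) : Measurable (srcDens α lam) := by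
  have h := (measurable_kern α lam).comp (measurable_omega α)
  have e : srcDens α lam = fun r => (3 - Real.exp r) / 2 * (kern α lam ∘ omega α) r := rfl
  rw [e]
  fun_prop

theorem srcSeries_eq (α lam : ℝ) : srcSeries α lam =
    PowerSeries.C (3 / 2 * (1 - α / 2)) * (PowerSeries.X ^ 0 * resolvent α lam) +
    PowerSeries.C (3 / 2 * (α / 2) - 1 / 2 * (1 - α / 2)) * (PowerSeries.X ^ 1 * resolvent α lam) +
    PowerSeries.C (-(1 / 2 * (α / 2))) * (PowerSeries.X ^ 2 * resolvent α lam) := by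
  rw [srcSeries, avgSeries]
  generalize (1 - α / 2) = u
  generalize α / 2 = v
  generalize (3 / 2 : ℝ) = p
  generalize (1 / 2 : ℝ) = q
  simp only [map_sub, map_mul, map_neg]
  ring

/-- The source weights are Laplace integrals of a density on the cut, up to an exponentially small
term: the polynomial factors of their generating series are evaluated at `e^r`. -/
theorem exists_srcCoeff_eq {α : ℝ} (hα : 0 < α) (hα' : α < 1) : ∃ C : ℝ, 0 < C ∧
    ∀ lam : ℝ, 0 < lam → ∃ ε : ℕ → ℝ,
      (∀ n : ℕ, |ε n| ≤ C * Real.exp (-(n * cutLength α)) / (1 + lam)) ∧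
      ∀ n : ℕ, srcCoeff α lam n = (∫ r in (0 : ℝ)..cutLength α,
        Real.exp (-(n * r)) * srcDens α lam r) + ε n := by
  obtain ⟨C₁, hC₁, h1⟩ := exists_dens_le hα hα'
  obtain ⟨A₀, hA₀, h0⟩ := exists_coeff_X_pow_mul_resolvent_eq hα hα' 0
  obtain ⟨A₁, hA₁, h1'⟩ := exists_coeff_X_pow_mul_resolvent_eq hα hα' 1
  obtain ⟨A₂, hA₂, h2⟩ := exists_coeff_X_pow_mul_resolvent_eq hα hα' 2
  have hb := cutLength_pos hα'
  have hb1 := cutLength_le_one hα hα'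
  refine ⟨2 * A₀ + 2 * A₁ + 2 * A₂, by positivity, fun lam hl => ?_⟩
  obtain ⟨ε₀, e0, g0⟩ := h0 lam hl
  obtain ⟨ε₁, e1, g1⟩ := h1' lam hl
  obtain ⟨ε₂, e2, g2⟩ := h2 lam hl
  refine ⟨fun n => 3 / 2 * (1 - α / 2) * ε₀ n + (3 / 2 * (α / 2) - 1 / 2 * (1 - α / 2)) * ε₁ n +
    (-(1 / 2 * (α / 2))) * ε₂ n, fun n => ?_, fun n => ?_⟩
  · have k : ∀ (c x y : ℝ), |c| ≤ 2 → |x| ≤ y → |c * x| ≤ 2 * y := fun c x y hc hx => by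
      rw [abs_mul]; exact mul_le_mul hc hx (abs_nonneg _) (by norm_num)
    have b0 := k (3 / 2 * (1 - α / 2)) _ _ (by rw [abs_le]; constructor <;> linarith) (e0 n)
    have b1 := k (3 / 2 * (α / 2) - 1 / 2 * (1 - α / 2)) _ _ (by rw [abs_le]; constructor <;> linarith) (e1 n)
    have b2 := k (-(1 / 2 * (α / 2))) _ _ (by rw [abs_le]; constructor <;> linarith) (e2 n)
    refine (abs_add_le _ _).trans ((add_le_add ((abs_add_le _ _).trans (add_le_add b0 b1)) b2).trans (le_of_eq ?_))
    ring
  · rw [srcCoeff, srcSeries_eq, map_add, map_add, PowerSeries.coeff_C_mul, PowerSeries.coeff_C_mul,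
      PowerSeries.coeff_C_mul, g0, g1, g2]
    have hI : ∀ j : ℕ, IntervalIntegrable (fun r => Real.exp (-(n * r)) * (Real.exp (j * r) * dens α lam r))
        volume 0 (cutLength α) := by
      intro j
      refine ((intervalIntegrable_dens hα hα' hl n).continuousOn_mul
        (g := fun r => Real.exp (j * r)) (by fun_prop)).congr (fun r _ => ?_)
      ring
    have key : (∫ r in (0 : ℝ)..cutLength α, Real.exp (-(n * r)) * srcDens α lam r) =
        3 / 2 * (1 - α / 2) * (∫ r in (0 : ℝ)..cutLength α, Real.exp (-(n * r)) * (Real.exp ((0:ℕ) * r) * dens α lam r)) +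
        (3 / 2 * (α / 2) - 1 / 2 * (1 - α / 2)) * (∫ r in (0 : ℝ)..cutLength α, Real.exp (-(n * r)) * (Real.exp ((1:ℕ) * r) * dens α lam r)) +
        (-(1 / 2 * (α / 2))) * (∫ r in (0 : ℝ)..cutLength α, Real.exp (-(n * r)) * (Real.exp ((2:ℕ) * r) * dens α lam r)) := by
      rw [← intervalIntegral.integral_const_mul, ← intervalIntegral.integral_const_mul,
        ← intervalIntegral.integral_const_mul, ← intervalIntegral.integral_add ((hI 0).const_mul _) ((hI 1).const_mul _),
        ← intervalIntegral.integral_add (((hI 0).const_mul _).add ((hI 1).const_mul _)) ((hI 2).const_mul _)]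
      refine intervalIntegral.integral_congr_ae (Eventually.of_forall fun r hr => ?_)
      rw [uIoc_of_le hb.le] at hr
      have h3 := avgExp_mem hα hα' hr.1 (hr.2.trans hb1)
      have h4 : kern α lam (omega α r) = avgExp α r * dens α lam r := by
        rw [dens, mul_div_cancel₀]; linarith
      have h5 : Real.exp ((2:ℕ) * r) = Real.exp r * Real.exp r := by
        rw [← Real.exp_add]; push_cast; ring_nf
      rw [srcDens, h4, avgExp, h5]
      simp only [Nat.cast_zero, zero_mul, Real.exp_zero, Nat.cast_one, one_mul]
      ring
    rw [key]
    ring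

/-! ### The kernel error -/

theorem exp_quot_mem {r : ℝ} (hr : 0 < r) :
    0 < (1 - Real.exp (-r)) / r ∧ (1 - Real.exp (-r)) / r ≤ 1 := by
  have h1 := Real.add_one_le_exp (-r)
  have h2 : Real.exp (-r) < 1 := Real.exp_lt_one_iff.2 (by linarith)
  exact ⟨div_pos (by linarith) hr, by rw [div_le_one hr]; linarith⟩

/-- On the level of spectral densities the scheme is second-order consistent for integrals over a
time step, and first-order consistent pointwise. -/
theorem exists_dens_sub_le {α : ℝ} (hα : 0 < α) (hα' : α < 1) : ∃ C : ℝ, 0 < C ∧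
    ∀ lam r : ℝ, 0 < lam → 0 < r →
      |(1 - Real.exp (-r)) / r * kdens α lam r - cutOff (cutLength α) (srcDens α lam) r| ≤
        C * (r ^ 2 * (r ^ α / (r ^ α + lam) ^ 2)) ∧
      |kdens α lam r - cutOff (cutLength α) (srcDens α lam) r| ≤
        C * (r * (r ^ α / (r ^ α + lam) ^ 2)) := by
  obtain ⟨C₁, hC₁, h1⟩ := kern_sub_le hα hα'
  obtain ⟨C₂, hC₂, h2⟩ := exists_kern_omega_le hα hα'
  obtain ⟨C₃, hC₃, h3⟩ := exists_kdens_le hα hα'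
  have hb := cutLength_pos hα'
  have hb1 := cutLength_le_one hα hα'
  set b := cutLength α with hbdef
  refine ⟨16 * C₁ + 6 * C₂ + C₃ + C₃ / b ^ 2 + C₃ / b, by positivity, fun lam r hl hr => ?_⟩
  have hp := Real.rpow_pos_of_pos hr α
  set q := r ^ α / (r ^ α + lam) ^ 2 with hq
  have hq0 : 0 < q := by positivity
  have hk := (h3 lam r hl hr).1
  have hk0 := kdens_nonneg hα hα' hl hr.le
  obtain ⟨hψ0, hψ1⟩ := exp_quot_mem hr
  set ψ := (1 - Real.exp (-r)) / r with hψ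
  by_cases hrb : r ≤ b
  · have hr1 : r ≤ 1 := hrb.trans hb1
    have hcut : cutOff b (srcDens α lam) r = srcDens α lam r := by
      rw [cutOff, indicator_of_mem (show r ∈ Ioc 0 b from ⟨hr, hrb⟩)]
    have hw := omega_mem hα hα' hr hr1
    set mlt := r * (3 - Real.exp r) / (2 * (1 - Real.exp (-r))) with hm
    have h1e : 1 - Real.exp (-r) ≠ 0 := by
      have : Real.exp (-r) < 1 := Real.exp_lt_one_iff.2 (by linarith)
      linarith
    have e1 : srcDens α lam r = ψ * (mlt * kern α lam (omega α r)) := by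
      rw [srcDens, hψ, hm]; field_simp
    have hmult := abs_multiplier_sub_one_le (r := r) (by rwa [abs_of_pos hr]) hr.ne'
    have hratio := abs_symbolRatio_sub_one_le hα hα' (r := r) (by rwa [abs_of_pos hr]) hr.ne'
    have hω : |r ^ α - omega α r| ≤ 8 * r ^ 2 * r ^ α := by
      have : r ^ α - omega α r = -(r ^ α * (symbolRatio α r - 1)) := by rw [omega]; ring
      rw [this, abs_neg, abs_mul, abs_of_pos hp, mul_comm]
      gcongr
    have hA : |kern α lam (r ^ α) - kern α lam (omega α r)| ≤ 16 * C₁ * (r ^ 2 * q) := by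
      refine (h1 lam (r ^ α) (omega α r) hl hp.le (by linarith)).trans ?_
      have : |r ^ α - omega α r| / ((r ^ α + lam) * (omega α r + lam)) ≤ 16 * (r ^ 2 * q) := by
        rw [hq, div_le_iff₀ (mul_pos (by linarith) (by linarith))]
        refine hω.trans ?_
        have h5 : (r ^ α + lam) ^ 2 ≤ 2 * ((r ^ α + lam) * (omega α r + lam)) := by
          nlinarith [mul_nonneg (by linarith : 0 ≤ r ^ α + lam) (by linarith : 0 ≤ 2 * omega α r + lam - r ^ α)]
        have h6 : (1 : ℝ) ≤ 2 * ((r ^ α + lam) * (omega α r + lam)) / (r ^ α + lam) ^ 2 := by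
          rwa [le_div_iff₀ (by positivity), one_mul]
        calc 8 * r ^ 2 * r ^ α = 8 * r ^ 2 * r ^ α * 1 := by ring
          _ ≤ 8 * r ^ 2 * r ^ α * (2 * ((r ^ α + lam) * (omega α r + lam)) / (r ^ α + lam) ^ 2) := by gcongr
          _ = _ := by ring
      nlinarith
    have hB : |(mlt - 1) * kern α lam (omega α r)| ≤ 6 * C₂ * (r ^ 2 * q) := by
      rw [abs_mul]
      calc _ ≤ (6 * r ^ 2) * (C₂ * q) := mul_le_mul hmult (h2 lam r hl hr hr1) (abs_nonneg _) (by positivity)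
        _ = _ := by ring
    have hfirst : |ψ * kdens α lam r - srcDens α lam r| ≤ (16 * C₁ + 6 * C₂) * (r ^ 2 * q) := by
      have : ψ * kdens α lam r - srcDens α lam r = ψ * ((kern α lam (r ^ α) - kern α lam (omega α r)) -
          (mlt - 1) * kern α lam (omega α r)) := by rw [e1, kdens]; ring
      rw [this, abs_mul, abs_of_pos hψ0]
      calc _ ≤ 1 * (16 * C₁ * (r ^ 2 * q) + 6 * C₂ * (r ^ 2 * q)) :=
            mul_le_mul hψ1 ((abs_sub _ _).trans (add_le_add hA hB)) (abs_nonneg _) zero_le_one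
        _ = _ := by ring
    rw [hcut]
    refine ⟨hfirst.trans ?_, ?_⟩
    · refine mul_le_mul_of_nonneg_right ?_ (by positivity)
      have : 0 < C₃ + C₃ / b ^ 2 + C₃ / b := by positivity
      linarith
    · have hψr : |1 - ψ| ≤ r := by
        have h5 := abs_le.1 (abs_exp_sub_one_sub_id_le_sq (r := -r) (by rw [abs_neg, abs_of_pos hr]; exact hr1))
        rw [abs_of_nonneg (by linarith), hψ, sub_le_comm, le_div_iff₀ hr]
        nlinarith [h5.2]
      have e2 : kdens α lam r - srcDens α lam r = (1 - ψ) * kdens α lam r + (ψ * kdens α lam r - srcDens α lam r) := by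
        ring
      rw [e2]
      refine (abs_add_le _ _).trans ?_
      have h6 : |(1 - ψ) * kdens α lam r| ≤ r * (C₃ * q) := by
        rw [abs_mul, abs_of_nonneg hk0]
        exact mul_le_mul hψr hk hk0 hr.le
      have h7 : r ^ 2 * q ≤ r * q := by
        refine mul_le_mul_of_nonneg_right ?_ hq0.le; nlinarith
      have h8 : (16 * C₁ + 6 * C₂) * (r ^ 2 * q) ≤ (16 * C₁ + 6 * C₂) * (r * q) := by gcongr
      have h9 : 0 ≤ (C₃ / b ^ 2 + C₃ / b) * (r * q) := by positivity
      linarith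
  · push Not at hrb
    have hcut : cutOff b (srcDens α lam) r = 0 := by
      rw [cutOff, indicator_of_notMem fun h => absurd h.2 (not_le.2 hrb)]
    rw [hcut, sub_zero, sub_zero, abs_of_nonneg hk0, abs_of_nonneg (by positivity)]
    have h5 : C₃ * q ≤ C₃ / b * (r * q) := by
      have : 1 ≤ r / b := by rw [le_div_iff₀ hb]; linarith
      calc C₃ * q = C₃ * q * 1 := by ring
        _ ≤ C₃ * q * (r / b) := by gcongr
        _ = _ := by ring
    have h6 : C₃ * q ≤ C₃ / b ^ 2 * (r ^ 2 * q) := by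
      have : 1 ≤ (r / b) ^ 2 := one_le_pow₀ (by rw [le_div_iff₀ hb]; linarith)
      calc C₃ * q = C₃ * q * 1 := by ring
        _ ≤ C₃ * q * (r / b) ^ 2 := by gcongr
        _ = _ := by ring
    have h7 : ψ * kdens α lam r ≤ kdens α lam r := mul_le_of_le_one_left hk0 hψ1
    refine ⟨(h7.trans (hk.trans h6)).trans ?_, (hk.trans h5).trans ?_⟩
    · refine mul_le_mul_of_nonneg_right ?_ (by positivity)
      have : 0 < 16 * C₁ + 6 * C₂ + C₃ + C₃ / b := by positivity
      linarith
    · refine mul_le_mul_of_nonneg_right ?_ (by positivity)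
      have : 0 < 16 * C₁ + 6 * C₂ + C₃ + C₃ / b ^ 2 := by positivity
      linarith

/-- The integral of the resolvent kernel over a time step. -/
theorem integral_resKernel_step {α lam : ℝ} (hα : 0 < α) (hα' : α < 1) (hl : 0 < lam) {m : ℝ} (hm : 0 < m) :
    ∫ x in m..(m + 1), resKernel α lam x =
      ∫ r in Ioi (0 : ℝ), Real.exp (-(m * r)) * ((1 - Real.exp (-r)) / r * kdens α lam r) := by
  obtain ⟨C, hC, h⟩ := exists_kdens_le hα hα'
  have hk := measurable_kdens α lam
  rw [intervalIntegral.integral_of_le (by linarith)]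
  have hprod : Integrable (Function.uncurry fun x r : ℝ => Real.exp (-(x * r)) * kdens α lam r)
      ((volume.restrict (Ioc m (m + 1))).prod (volume.restrict (Ioi 0))) := by
    have h1 : Integrable (fun z : ℝ × ℝ => (1 : ℝ) * (Real.exp (-(m * z.2)) * kdens α lam z.2))
        ((volume.restrict (Ioc m (m + 1))).prod (volume.restrict (Ioi 0))) :=
      Integrable.mul_prod (integrable_const 1) (integrableOn_exp_mul_kdens hα hα' hl hm)
    refine h1.mono' ?_ ?_
    · apply Measurable.aestronglyMeasurable
      unfold Function.uncurry
      fun_prop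
    · rw [Measure.prod_restrict]
      filter_upwards [ae_restrict_mem (measurableSet_Ioc.prod measurableSet_Ioi)] with z hz
      have h0 := kdens_nonneg hα hα' hl (le_of_lt hz.2)
      simp only [Function.uncurry]
      rw [Real.norm_of_nonneg (by positivity), one_mul]
      have hz2 : (0 : ℝ) < z.2 := hz.2
      have : Real.exp (-(z.1 * z.2)) ≤ Real.exp (-(m * z.2)) :=
        Real.exp_le_exp.2 (by nlinarith [hz.1.1])
      gcongr
  unfold resKernel
  rw [integral_integral_swap hprod]
  refine setIntegral_congr_fun measurableSet_Ioi fun r hr => ?_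
  have hr0 : (0 : ℝ) < r := hr
  rw [integral_mul_const, ← mul_assoc]
  congr 1
  rw [← intervalIntegral.integral_of_le (by linarith)]
  have hd : ∀ x ∈ uIcc m (m + 1), HasDerivAt (fun x => -(Real.exp (-(x * r)) / r)) (Real.exp (-(x * r))) x := by
    intro x _
    have h1 : HasDerivAt (fun x => -(Real.exp (-(x * r)) / r)) (-(Real.exp (-(x * r)) * (-(1 * r)) / r)) x :=
      ((((hasDerivAt_id x).mul_const r).neg.exp).div_const r).neg
    refine h1.congr_deriv ?_
    field_simp
  rw [intervalIntegral.integral_eq_sub_of_hasDerivAt hd (Continuous.intervalIntegrable (by fun_prop) _ _)]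
  have : Real.exp (-((m + 1) * r)) = Real.exp (-(m * r)) * Real.exp (-r) := by rw [← Real.exp_add]; ring_nf
  rw [this]
  field_simp
  ring

/-- The difference between the continuous kernel and the piecewise constant kernel of the scheme. -/
noncomputable def kernErr (α lam x : ℝ) : ℝ := resKernel α lam x - srcCoeff α lam ⌊x⌋₊

theorem exists_srcCoeff_le {α : ℝ} (hα : 0 < α) (hα' : α < 1) : ∃ C : ℝ, 0 < C ∧
    ∀ lam : ℝ, 0 < lam → ∀ n : ℕ, |srcCoeff α lam n| ≤ C / (1 + lam) := by
  obtain ⟨C₁, hC₁, h1⟩ := exists_kern_omega_le hα hα'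
  obtain ⟨C₂, hC₂, h2⟩ := exists_srcCoeff_eq hα hα'
  have hG : 0 < Real.Gamma (-α + 1) := Real.Gamma_pos_of_pos (by linarith)
  have hb := cutLength_pos hα'
  have hb1 := cutLength_le_one hα hα'
  refine ⟨Real.exp 1 * (4 * C₁) * Real.Gamma (-α + 1) + C₂, by positivity, fun lam hl n => ?_⟩
  obtain ⟨ε, hε, hv⟩ := h2 lam hl
  have h4 : ∀ r, 0 < r → r ≤ cutLength α → |srcDens α lam r| ≤ (4 * C₁) / (1 + lam) * r ^ (-α) := by
    intro r hr hrb
    have h5 := one_add_mul_dens_le hα hl hr (hrb.trans hb1) hC₁.le (h1 lam r hl hr (hrb.trans hb1))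
    have h6 : Real.exp r ≤ 3 := (Real.exp_le_exp.2 (hrb.trans hb1)).trans (by linarith [Real.exp_one_lt_d9])
    rw [srcDens, abs_mul, abs_of_nonneg (by linarith)]
    calc _ ≤ 2 * (2 * C₁ / (1 + lam) * r ^ (-α)) :=
          mul_le_mul (by linarith [Real.exp_pos r]) h5 (abs_nonneg _) (by norm_num)
      _ = _ := by ring
  have h5 := abs_intervalLaplace_le (p := -α) (by linarith) (by positivity) hb.le hb1 h4 n
  have h6 : ((n : ℝ) + 1) ^ (-(-α + 1)) ≤ 1 :=
    Real.rpow_le_one_of_one_le_of_nonpos (by linarith [Nat.cast_nonneg (α := ℝ) n]) (by linarith)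
  have h7 : Real.exp (-(n * cutLength α)) ≤ 1 := Real.exp_le_one_iff.2 (by
    have : 0 ≤ (n : ℝ) * cutLength α := by positivity
    linarith)
  rw [hv]
  calc _ ≤ _ := abs_add_le _ _
    _ ≤ Real.exp 1 * (4 * C₁ / (1 + lam)) * Real.Gamma (-α + 1) * 1 + C₂ * 1 / (1 + lam) := by
        refine add_le_add (h5.trans ?_) ((hε n).trans ?_) <;> gcongr
    _ = _ := by ring

/-- The kernel error is `O(x^{α-2})`; its integral over a time step is `O(m^{α-3})`, and
`O(m^{-3})` after multiplication by `lam`. -/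
theorem exists_kernErr_le {α : ℝ} (hα : 0 < α) (hα' : α < 1) : ∃ C : ℝ, 0 < C ∧
    ∀ lam : ℝ, 0 < lam → ∀ m : ℕ, 1 ≤ m →
      (∀ x : ℝ, m ≤ x → x < m + 1 → |kernErr α lam x| ≤ C * (m : ℝ) ^ (α - 2)) ∧
      |(∫ x in (m : ℝ)..(m + 1), resKernel α lam x) - srcCoeff α lam m| ≤ C * (m : ℝ) ^ (α - 3) ∧
      lam * |(∫ x in (m : ℝ)..(m + 1), resKernel α lam x) - srcCoeff α lam m| ≤ C * (m : ℝ) ^ (-3 : ℝ) := by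
  obtain ⟨C₁, hC₁, h1⟩ := exists_dens_sub_le hα hα'
  obtain ⟨C₂, hC₂, h2⟩ := exists_srcCoeff_eq hα hα'
  obtain ⟨C₃, hC₃, h3⟩ := exists_resKernel_le hα hα'
  obtain ⟨A, hA, hA'⟩ := exists_exp_le_rpow (cutLength_pos hα') (-3)
  have hb := cutLength_pos hα'
  have G1 : 0 < Real.Gamma (1 - α + 1) := Real.Gamma_pos_of_pos (by linarith)
  have G2 : 0 < Real.Gamma (2 - α + 1) := Real.Gamma_pos_of_pos (by linarith)
  have G3 : 0 < Real.Gamma (2 + 1) := Real.Gamma_pos_of_pos (by norm_num)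
  refine ⟨C₁ * Real.Gamma (1 - α + 1) + C₁ * Real.Gamma (2 - α + 1) + C₁ * Real.Gamma (2 + 1) + C₂ * A + C₃,
    by positivity, fun lam hl m hm => ?_⟩
  obtain ⟨ε, hε, hv⟩ := h2 lam hl
  have hm1 : (1 : ℝ) ≤ m := by exact_mod_cast hm
  have hm0 : (0 : ℝ) < m := by linarith
  have hεm : ∀ p : ℝ, -3 ≤ p → |ε m| ≤ C₂ * A * (m : ℝ) ^ p := fun p hp => by
    calc |ε m| ≤ C₂ * Real.exp (-(m * cutLength α)) / (1 + lam) := hε m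
      _ ≤ C₂ * Real.exp (-(m * cutLength α)) := div_le_self (by positivity) (by linarith)
      _ ≤ C₂ * (A * ((m : ℝ) + 1) ^ (-3 : ℝ)) := by gcongr; exact hA' m
      _ ≤ C₂ * (A * (m : ℝ) ^ (-3 : ℝ)) := mul_le_mul_of_nonneg_left (mul_le_mul_of_nonneg_left
          (Real.rpow_le_rpow_of_nonpos hm0 (by linarith) (by norm_num)) hA.le) hC₂.le
      _ ≤ C₂ * (A * (m : ℝ) ^ p) := by gcongr
      _ = _ := by ring
  have hlε : lam * |ε m| ≤ C₂ * A * (m : ℝ) ^ (-3 : ℝ) := by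
    calc lam * |ε m| ≤ lam * (C₂ * Real.exp (-(m * cutLength α)) / (1 + lam)) := by gcongr; exact hε m
      _ = C₂ * Real.exp (-(m * cutLength α)) * (lam / (1 + lam)) := by ring
      _ ≤ C₂ * Real.exp (-(m * cutLength α)) * 1 := by
          gcongr
          rw [div_le_one (by linarith)]; linarith
      _ ≤ C₂ * (A * ((m : ℝ) + 1) ^ (-3 : ℝ)) := by rw [mul_one]; gcongr; exact hA' m
      _ ≤ C₂ * (A * (m : ℝ) ^ (-3 : ℝ)) := mul_le_mul_of_nonneg_left (mul_le_mul_of_nonneg_left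
          (Real.rpow_le_rpow_of_nonpos hm0 (by linarith) (by norm_num)) hA.le) hC₂.le
      _ = _ := by ring
  have hsd : ∀ r, 0 < r → |cutOff (cutLength α) (srcDens α lam) r| ≤ (C₁ + C₁) * r ^ (1 - α) + |kdens α lam r| := by
    intro r hr
    have h4 := (h1 lam r hl hr).2
    have hp := Real.rpow_pos_of_pos hr α
    have h5 : r * (r ^ α / (r ^ α + lam) ^ 2) ≤ r ^ (1 - α) := by
      rw [Real.rpow_sub hr, Real.rpow_one, div_eq_mul_one_div r]
      exact mul_le_mul_of_nonneg_left (div_sq_le hp hl).1 hr.le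
    have h6 := abs_sub_abs_le_abs_sub (cutOff (cutLength α) (srcDens α lam) r) (kdens α lam r)
    rw [abs_sub_comm] at h6
    have h7 : C₁ * (r * (r ^ α / (r ^ α + lam) ^ 2)) ≤ (C₁ + C₁) * r ^ (1 - α) :=
      mul_le_mul (by linarith) h5 (by positivity) (by positivity)
    linarith
  have hIs : IntegrableOn (fun r => Real.exp (-(m * r)) * cutOff (cutLength α) (srcDens α lam) r) (Ioi (0:ℝ)) := by
    have i1 := (integrableOn_laplace (p := 1 - α) (C := C₁ + C₁) (f := fun r => (C₁ + C₁) * r ^ (1 - α)) (by linarith) hm0 (by fun_prop)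
      (fun r hr => by rw [abs_of_nonneg (by positivity)]))
    have i2 := (integrableOn_exp_mul_kdens hα hα' hl hm0)
    refine (i1.add i2).mono' ((by fun_prop : Measurable fun r : ℝ => Real.exp (-(m * r))).mul
      (measurable_cutOff _ (measurable_srcDens α lam))).aestronglyMeasurable ?_
    filter_upwards [ae_restrict_mem measurableSet_Ioi] with r hr
    rw [norm_mul, Real.norm_of_nonneg (Real.exp_pos _).le, Real.norm_eq_abs, Pi.add_apply, ← mul_add]
    gcongr
    refine (hsd r hr).trans (le_of_eq ?_)
    rw [abs_of_nonneg (kdens_nonneg hα hα' hl (le_of_lt hr))]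
  have hsrc : srcCoeff α lam m =
      (∫ r in Ioi (0:ℝ), Real.exp (-(m * r)) * cutOff (cutLength α) (srcDens α lam) r) + ε m := by
    rw [hv, intervalIntegral_eq_cutOff hb.le]
  have hIψ : IntegrableOn (fun r => Real.exp (-(m * r)) * ((1 - Real.exp (-r)) / r * kdens α lam r)) (Ioi (0:ℝ)) := by
    have hk := measurable_kdens α lam
    refine (integrableOn_exp_mul_kdens hα hα' hl hm0).mono' (by
      apply Measurable.aestronglyMeasurable; fun_prop) ?_
    filter_upwards [ae_restrict_mem measurableSet_Ioi] with r hr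
    have h4 := exp_quot_mem hr
    have h5 := kdens_nonneg hα hα' hl (le_of_lt hr)
    rw [Real.norm_of_nonneg (mul_nonneg (Real.exp_pos _).le (mul_nonneg h4.1.le h5))]
    gcongr
    exact mul_le_of_le_one_left h5 h4.2
  -- the cell integral of the kernel error, as a Laplace integral
  have hcell : (∫ x in (m : ℝ)..(m + 1), resKernel α lam x) - srcCoeff α lam m =
      (∫ r in Ioi (0:ℝ), Real.exp (-(m * r)) * ((1 - Real.exp (-r)) / r * kdens α lam r -
        cutOff (cutLength α) (srcDens α lam) r)) - ε m := by
    rw [integral_resKernel_step hα hα' hl hm0, hsrc, ← sub_sub, ← integral_sub hIψ hIs]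
    simp only [mul_sub]
  have hq : ∀ r, 0 < r → r ^ α / (r ^ α + lam) ^ 2 ≤ r ^ (-α) := fun r hr => by
    rw [Real.rpow_neg hr.le, ← one_div]
    exact (div_sq_le (Real.rpow_pos_of_pos hr α) hl).1
  refine ⟨fun x hx hx' => ?_, ?_, ?_⟩
  · have hfl : ⌊x⌋₊ = m := by
      rw [Nat.floor_eq_iff (by linarith)]; exact ⟨hx, hx'⟩
    have e1 : kernErr α lam x = (resKernel α lam x - resKernel α lam m) +
        ((∫ r in Ioi (0:ℝ), Real.exp (-(m * r)) * (kdens α lam r - cutOff (cutLength α) (srcDens α lam) r)) - ε m) := by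
      rw [kernErr, hfl, hsrc]
      have : (∫ r in Ioi (0:ℝ), Real.exp (-(m * r)) * (kdens α lam r - cutOff (cutLength α) (srcDens α lam) r)) =
          resKernel α lam m - ∫ r in Ioi (0:ℝ), Real.exp (-(m * r)) * cutOff (cutLength α) (srcDens α lam) r := by
        rw [resKernel, ← integral_sub (integrableOn_exp_mul_kdens hα hα' hl hm0) hIs]
        simp only [mul_sub]
      rw [this]; ring
    have b1 := (h3 lam m hl hm0).2 x hx
    have b2 := abs_laplace_le (p := 1 - α) (C := C₁) (by linarith) hm0
      (f := fun r => kdens α lam r - cutOff (cutLength α) (srcDens α lam) r) (fun r hr => by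
        refine (h1 lam r hl hr).2.trans ?_
        rw [show (1 - α) = 1 + -α by ring, Real.rpow_add hr, Real.rpow_one]
        gcongr
        exact hq r hr)
    rw [show -(1 - α + 1) = α - 2 by ring] at b2
    have b3 := hεm (α - 2) (by linarith)
    have hM := Real.rpow_pos_of_pos hm0 (α - 2)
    have b4 : C₃ * (x - m) * (m : ℝ) ^ (α - 2) ≤ C₃ * (m : ℝ) ^ (α - 2) := by
      refine mul_le_mul_of_nonneg_right ?_ hM.le
      nlinarith
    rw [e1]
    have b5 := abs_add_le (resKernel α lam x - resKernel α lam m)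
      ((∫ r in Ioi (0:ℝ), Real.exp (-(m * r)) * (kdens α lam r - cutOff (cutLength α) (srcDens α lam) r)) - ε m)
    have b6 := abs_sub (∫ r in Ioi (0:ℝ), Real.exp (-(m * r)) * (kdens α lam r - cutOff (cutLength α) (srcDens α lam) r)) (ε m)
    have b7 : 0 ≤ (C₁ * Real.Gamma (2 - α + 1) + C₁ * Real.Gamma (2 + 1)) * (m : ℝ) ^ (α - 2) := by positivity
    linarith
  · rw [hcell]
    have b2 := abs_laplace_le (p := 2 - α) (C := C₁) (by linarith) hm0
      (f := fun r => (1 - Real.exp (-r)) / r * kdens α lam r - cutOff (cutLength α) (srcDens α lam) r) (fun r hr => by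
        refine (h1 lam r hl hr).1.trans ?_
        rw [show (2 - α) = 2 + -α by ring, Real.rpow_add hr, Real.rpow_two]
        gcongr
        exact hq r hr)
    rw [show -(2 - α + 1) = α - 3 by ring] at b2
    have b3 := hεm (α - 3) (by linarith)
    have hM := Real.rpow_pos_of_pos hm0 (α - 3)
    refine (abs_sub _ _).trans ((add_le_add b2 b3).trans ?_)
    have b7 : 0 ≤ (C₁ * Real.Gamma (1 - α + 1) + C₁ * Real.Gamma (2 + 1) + C₃) * (m : ℝ) ^ (α - 3) := by positivity
    linarith
  · rw [hcell]
    have b2 := abs_laplace_le (p := 2) (C := C₁ / lam) (by norm_num) hm0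
      (f := fun r => (1 - Real.exp (-r)) / r * kdens α lam r - cutOff (cutLength α) (srcDens α lam) r) (fun r hr => by
        refine (h1 lam r hl hr).1.trans ?_
        rw [Real.rpow_two, div_mul_eq_mul_div, mul_div_assoc]
        refine mul_le_mul_of_nonneg_left ?_ hC₁.le
        rw [le_div_iff₀ hl, mul_assoc]
        refine mul_le_of_le_one_right (by positivity) ?_
        rw [mul_comm]
        exact (div_sq_le (Real.rpow_pos_of_pos hr α) hl).2.2)
    rw [show -((2:ℝ) + 1) = -3 by norm_num] at b2
    have hM := Real.rpow_pos_of_pos hm0 (-3)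
    refine (mul_le_mul_of_nonneg_left (abs_sub _ _) hl.le).trans ?_
    rw [mul_add]
    have b4 := mul_le_mul_of_nonneg_left b2 hl.le
    have b5 : lam * (C₁ / lam * Real.Gamma (2 + 1) * (m : ℝ) ^ (-3 : ℝ)) = C₁ * Real.Gamma (2 + 1) * (m : ℝ) ^ (-3 : ℝ) := by
      field_simp
    rw [b5] at b4
    have b7 : 0 ≤ (C₁ * Real.Gamma (1 - α + 1) + C₁ * Real.Gamma (2 - α + 1) + C₃) * (m : ℝ) ^ (-3 : ℝ) := by positivity
    linarith

/-! ### Vanishing moments of the kernel error -/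

/-- The power series `f` converges absolutely at `x`, with sum `y`. -/
structure HasAbsSum (f : PowerSeries ℝ) (x y : ℝ) : Prop where
  summable : Summable fun n => ‖PowerSeries.coeff n f * x ^ n‖
  hasSum : HasSum (fun n => PowerSeries.coeff n f * x ^ n) y

theorem HasAbsSum.of_hasSum {f : PowerSeries ℝ} {x y : ℝ}
    (h : HasSum (fun n => PowerSeries.coeff n f * x ^ n) y) : HasAbsSum f x y :=
  ⟨h.summable.norm, h⟩

theorem HasAbsSum.mul {f g : PowerSeries ℝ} {x y z : ℝ} (hf : HasAbsSum f x y) (hg : HasAbsSum g x z) :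
    HasAbsSum (f * g) x (y * z) := by
  have e : ∀ n, PowerSeries.coeff n (f * g) * x ^ n = ∑ p ∈ Finset.HasAntidiagonal.antidiagonal n,
      (PowerSeries.coeff p.1 f * x ^ p.1) * (PowerSeries.coeff p.2 g * x ^ p.2) := by
    intro n
    rw [PowerSeries.coeff_mul, Finset.sum_mul]
    refine Finset.sum_congr rfl fun p hp => ?_
    rw [← Finset.HasAntidiagonal.mem_antidiagonal.1 hp, pow_add]
    ring
  have hs := summable_norm_sum_mul_antidiagonal_of_summable_norm hf.summable hg.summable
  refine ⟨by simpa only [e] using hs, ?_⟩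
  have ht := tsum_mul_tsum_eq_tsum_sum_antidiagonal_of_summable_norm hf.summable hg.summable
  rw [hf.hasSum.tsum_eq, hg.hasSum.tsum_eq] at ht
  simp only [e]
  rw [ht]
  exact hs.of_norm.hasSum

theorem HasAbsSum.add {f g : PowerSeries ℝ} {x y z : ℝ} (hf : HasAbsSum f x y) (hg : HasAbsSum g x z) :
    HasAbsSum (f + g) x (y + z) :=
  .of_hasSum ((hf.hasSum.add hg.hasSum).congr_fun fun n => by rw [map_add, add_mul])

theorem HasAbsSum.sub {f g : PowerSeries ℝ} {x y z : ℝ} (hf : HasAbsSum f x y) (hg : HasAbsSum g x z) :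
    HasAbsSum (f - g) x (y - z) :=
  .of_hasSum ((hf.hasSum.sub hg.hasSum).congr_fun fun n => by rw [map_sub, sub_mul])

theorem hasAbsSum_C (c x : ℝ) : HasAbsSum (PowerSeries.C c) x c := by
  refine .of_hasSum ?_
  have h := hasSum_single (f := fun n => PowerSeries.coeff n (PowerSeries.C c) * x ^ n) 0 (fun n hn => by
    simp [PowerSeries.coeff_C, hn])
  simpa using h

theorem hasAbsSum_X (x : ℝ) : HasAbsSum PowerSeries.X x x := by
  refine .of_hasSum ?_
  have h := hasSum_single (f := fun n => PowerSeries.coeff n (PowerSeries.X : PowerSeries ℝ) * x ^ n) 1 (fun n hn => by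
    simp [PowerSeries.coeff_X, hn])
  simpa using h

theorem HasAbsSum.unique {f : PowerSeries ℝ} {x y z : ℝ} (h : HasAbsSum f x y) (h' : HasAbsSum f x z) : y = z :=
  h.hasSum.unique h'.hasSum

theorem hasAbsSum_glSeries (α : ℝ) {x : ℝ} (hx : |x| < 1) : HasAbsSum (glSeries α) x ((1 - x) ^ α) :=
  .of_hasSum ((hasSum_glWeight_real α hx).congr_fun fun n => by rw [glSeries, PowerSeries.coeff_mk])

theorem hasAbsSum_avgSeries (α x : ℝ) : HasAbsSum (avgSeries α) x (1 - α / 2 + α / 2 * x) :=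
  (hasAbsSum_C _ x).add ((hasAbsSum_C _ x).mul (hasAbsSum_X x))

theorem hasAbsSum_resolvent {α lam x : ℝ} (hα : 0 < α) (hα' : α < 1) (hl : 0 < lam) (hx0 : 0 ≤ x) (hx : x < 1) :
    HasAbsSum (resolvent α lam) x (1 / ((1 - x) ^ α + lam * (1 - α / 2 + α / 2 * x))) := by
  obtain ⟨C, hC, h⟩ := exists_resCoeff_le hα hα'
  have hs : Summable fun n => ‖PowerSeries.coeff n (resolvent α lam) * x ^ n‖ := by
    refine Summable.of_nonneg_of_le (fun n => norm_nonneg _) (fun n => ?_)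
      ((summable_geometric_of_lt_one hx0 hx).mul_left C)
    rw [norm_mul, norm_pow, Real.norm_of_nonneg hx0]
    have h1 := (h lam hl n).1
    have h2 : ((n : ℝ) + 1) ^ (α - 1) ≤ 1 :=
      Real.rpow_le_one_of_one_le_of_nonpos (by linarith [Nat.cast_nonneg (α := ℝ) n]) (by linarith)
    have h3 : ‖PowerSeries.coeff n (resolvent α lam)‖ ≤ C := by
      refine h1.trans ?_; nlinarith
    gcongr
  have hv : HasAbsSum (resolvent α lam) x (∑' n, PowerSeries.coeff n (resolvent α lam) * x ^ n) :=
    ⟨hs, hs.of_norm.hasSum⟩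
  have hx1 : |x| < 1 := by rwa [abs_of_nonneg hx0]
  have hp := ((hasAbsSum_glSeries α hx1).add ((hasAbsSum_C lam x).mul (hasAbsSum_avgSeries α x))).mul hv
  rw [symbol_mul_resolvent hα' hl.le] at hp
  have h1 := hp.unique (by simpa using hasAbsSum_C 1 x)
  have hpos : 0 < (1 - x) ^ α + lam * (1 - α / 2 + α / 2 * x) := by
    have := Real.rpow_nonneg (by linarith : 0 ≤ 1 - x) α
    have : 0 < 1 - α / 2 + α / 2 * x := by nlinarith
    positivity
  have h2 : (∑' n, PowerSeries.coeff n (resolvent α lam) * x ^ n) =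
      1 / ((1 - x) ^ α + lam * (1 - α / 2 + α / 2 * x)) := by
    rw [eq_div_iff hpos.ne', mul_comm]; exact h1
  rw [← h2]
  exact hv

theorem hasAbsSum_srcSeries {α lam x : ℝ} (hα : 0 < α) (hα' : α < 1) (hl : 0 < lam) (hx0 : 0 ≤ x) (hx : x < 1) :
    HasAbsSum (srcSeries α lam) x ((3 / 2 - 1 / 2 * x) * ((1 - α / 2 + α / 2 * x) *
      (1 / ((1 - x) ^ α + lam * (1 - α / 2 + α / 2 * x))))) :=
  ((hasAbsSum_C _ x).sub ((hasAbsSum_C _ x).mul (hasAbsSum_X x))).mul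
    ((hasAbsSum_avgSeries α x).mul (hasAbsSum_resolvent hα hα' hl hx0 hx))

theorem integral_floor_step {F : ℝ → ℕ → ℝ} (m : ℕ) :
    ∫ x in (m : ℝ)..(m + 1), F x ⌊x⌋₊ = ∫ x in (m : ℝ)..(m + 1), F x m := by
  rw [intervalIntegral.integral_of_le (by linarith), intervalIntegral.integral_of_le (by linarith),
    integral_Ioc_eq_integral_Ioo, integral_Ioc_eq_integral_Ioo]
  refine setIntegral_congr_fun measurableSet_Ioo fun x hx => ?_
  have : ⌊x⌋₊ = m := by
    rw [Nat.floor_eq_iff (by linarith [hx.1, Nat.cast_nonneg (α := ℝ) m])]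
    exact ⟨hx.1.le, hx.2⟩
  simp only [this]

theorem measurable_comp_floor (c : ℕ → ℝ) : Measurable fun x : ℝ => c ⌊x⌋₊ :=
  (measurable_from_top (f := c)).comp Nat.measurable_floor

theorem integral_exp_neg_step {s : ℝ} (hs : 0 < s) (m : ℝ) :
    ∫ x in m..(m + 1), Real.exp (-(s * x)) = (1 - Real.exp (-s)) / s * Real.exp (-(s * m)) := by
  have hd : ∀ x ∈ uIcc m (m + 1), HasDerivAt (fun x => -(Real.exp (-(s * x)) / s)) (Real.exp (-(s * x))) x := by
    intro x _
    have h1 : HasDerivAt (fun x => -(Real.exp (-(s * x)) / s)) (-(Real.exp (-(s * x)) * (-(s * 1)) / s)) x :=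
      ((((hasDerivAt_id x).const_mul s).neg.exp).div_const s).neg
    refine h1.congr_deriv ?_
    field_simp
  rw [intervalIntegral.integral_eq_sub_of_hasDerivAt hd (Continuous.intervalIntegrable (by fun_prop) _ _)]
  have : Real.exp (-(s * (m + 1))) = Real.exp (-(s * m)) * Real.exp (-s) := by rw [← Real.exp_add]; ring_nf
  rw [this]
  field_simp
  ring

/-- The Laplace transform of a bounded step function. -/
theorem integral_exp_mul_floor {c : ℕ → ℝ} {B s y : ℝ} (hs : 0 < s) (hc : ∀ n, |c n| ≤ B)
    (hy : HasSum (fun n => c n * Real.exp (-s) ^ n) y) :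
    IntegrableOn (fun x => Real.exp (-(s * x)) * c ⌊x⌋₊) (Ioi 0) ∧
    ∫ x in Ioi (0 : ℝ), Real.exp (-(s * x)) * c ⌊x⌋₊ = (1 - Real.exp (-s)) / s * y := by
  have hI : IntegrableOn (fun x => Real.exp (-(s * x)) * c ⌊x⌋₊) (Ioi 0) :=
    integrableOn_laplace (p := 0) (C := B) (by norm_num) hs (measurable_comp_floor c)
      fun r _ => by rw [Real.rpow_zero, mul_one]; exact hc _
  refine ⟨hI, ?_⟩
  have h1 : Tendsto (fun N : ℕ => ∫ x in (0:ℝ)..N, Real.exp (-(s * x)) * c ⌊x⌋₊) atTop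
      (𝓝 (∫ x in Ioi (0 : ℝ), Real.exp (-(s * x)) * c ⌊x⌋₊)) :=
    intervalIntegral_tendsto_integral_Ioi 0 hI tendsto_natCast_atTop_atTop
  have h2 : ∀ N : ℕ, ∫ x in (0:ℝ)..N, Real.exp (-(s * x)) * c ⌊x⌋₊ =
      (1 - Real.exp (-s)) / s * ∑ n ∈ Finset.range N, c n * Real.exp (-s) ^ n := by
    intro N
    have h3 := intervalIntegral.sum_integral_adjacent_intervals (μ := volume)
      (f := fun x => Real.exp (-(s * x)) * c ⌊x⌋₊) (a := fun n : ℕ => (n : ℝ)) (n := N) (fun k _ => by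
        have h4 : Measurable fun x : ℝ => Real.exp (-(s * x)) * c ⌊x⌋₊ := (by fun_prop : Measurable fun x : ℝ => Real.exp (-(s * x))).mul (measurable_comp_floor c)
        rw [intervalIntegrable_iff_integrableOn_Ioc_of_le (by simp)]
        refine hI.mono_set fun x hx => lt_of_le_of_lt (Nat.cast_nonneg k) hx.1)
    rw [Nat.cast_zero] at h3
    rw [← h3, Finset.mul_sum]
    refine Finset.sum_congr rfl fun n _ => ?_
    push_cast
    rw [integral_floor_step (F := fun x n => Real.exp (-(s * x)) * c n), intervalIntegral.integral_mul_const,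
      integral_exp_neg_step hs, ← Real.exp_nat_mul]
    ring_nf
  simp only [h2] at h1
  exact tendsto_nhds_unique h1 (hy.tendsto_sum_nat.const_mul _)

theorem measurable_kernErr (α lam : ℝ) : Measurable (kernErr α lam) :=
  (measurable_resKernel α lam).sub (measurable_comp_floor _)

theorem integrableOn_exp_mul_kernErr {α lam s : ℝ} (hα : 0 < α) (hα' : α < 1) (hl : 0 < lam) (hs : 0 < s) :
    IntegrableOn (fun x => Real.exp (-(s * x)) * kernErr α lam x) (Ioi 0) := by
  obtain ⟨C, hC, h⟩ := exists_srcCoeff_le hα hα'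
  have h1 := integrableOn_laplace (p := 0) (C := C / (1 + lam)) (by norm_num) hs
    (measurable_comp_floor (srcCoeff α lam)) fun r _ => by rw [Real.rpow_zero, mul_one]; exact h lam hl _
  refine ((integrableOn_exp_mul_resKernel hα hα' hl hs).sub h1).congr (Eventually.of_forall fun x => ?_)
  simp only [kernErr, Pi.sub_apply]
  ring

/-- The Laplace transform of the kernel error vanishes to second order at the origin. -/
theorem exists_laplace_kernErr_le {α lam : ℝ} (hα : 0 < α) (hα' : α < 1) (hl : 0 < lam) : ∃ C : ℝ,
    ∀ s : ℝ, 0 < s → s ≤ 1 → |∫ x in Ioi (0 : ℝ), Real.exp (-(s * x)) * kernErr α lam x| ≤ C * s ^ 2 := by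
  refine ⟨(10 + 2 * lam) / lam ^ 2, fun s hs hs1 => ?_⟩
  obtain ⟨C, hC, h⟩ := exists_srcCoeff_le hα hα'
  have hx : Real.exp (-s) < 1 := Real.exp_lt_one_iff.2 (by linarith)
  have hx0 := Real.exp_pos (-s)
  have hK := integral_exp_mul_floor hs (h lam hl) (hasAbsSum_srcSeries hα hα' hl hx0.le hx).hasSum
  have e : ∫ x in Ioi (0 : ℝ), Real.exp (-(s * x)) * kernErr α lam x =
      (∫ x in Ioi (0 : ℝ), Real.exp (-(s * x)) * resKernel α lam x) -
      ∫ x in Ioi (0 : ℝ), Real.exp (-(s * x)) * srcCoeff α lam ⌊x⌋₊ := by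
    rw [← integral_sub (integrableOn_exp_mul_resKernel hα hα' hl hs) hK.1]
    simp only [kernErr, mul_sub]
  rw [e, hK.2, integral_exp_mul_resKernel hα hα' hl hs]
  have hq := abs_le.1 (abs_expQuot_sub_le (r := -s) (by rw [abs_neg, abs_of_pos hs]; exact hs1) (by linarith))
  have hΩ := abs_symbolRatio_sub_one_le hα hα' (r := -s) (by rw [abs_neg, abs_of_pos hs]; exact hs1) (by linarith)
  have hq0 : 0 < expQuot (-s) := expQuot_pos (by linarith)
  have hexp : Real.exp (-s) = 1 - s * expQuot (-s) := by unfold expQuot; field_simp; ring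
  have hth : 0 < 1 + α / 2 * (Real.exp (-s) - 1) := by linarith [one_add_half_mul_exp_pos hα hα' (-s)]
  have hΩ0 : 0 < symbolRatio α (-s) := by
    unfold symbolRatio
    exact div_pos (Real.rpow_pos_of_pos hq0 _) hth
  have hsp := Real.rpow_pos_of_pos hs α
  have hsp1 : s ^ α ≤ 1 := Real.rpow_le_one hs.le hs1 hα.le
  set q := expQuot (-s) with hqdef
  set Ω := symbolRatio α (-s) with hΩdef
  have e1 : (1 - Real.exp (-s)) ^ α = s ^ α * (Ω * (1 + α / 2 * (Real.exp (-s) - 1))) := by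
    have : (1 - Real.exp (-s)) = s * q := by linarith
    rw [this, Real.mul_rpow hs.le hq0.le, hΩdef, symbolRatio, div_mul_cancel₀ _ hth.ne']
  have e2 : (1 - Real.exp (-s)) / s = q := by
    rw [hexp]; field_simp; ring
  have e3 : (1 - α / 2 + α / 2 * Real.exp (-s)) * (1 / ((1 - Real.exp (-s)) ^ α +
      lam * (1 - α / 2 + α / 2 * Real.exp (-s)))) = 1 / (s ^ α * Ω + lam) := by
    rw [e1, show 1 - α / 2 + α / 2 * Real.exp (-s) = 1 + α / 2 * (Real.exp (-s) - 1) by ring]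
    have h1 : 0 < s ^ α * Ω + lam := by positivity
    generalize 1 + α / 2 * (Real.exp (-s) - 1) = th at hth
    rw [mul_one_div, div_eq_div_iff (by positivity) h1.ne']
    ring
  rw [e3, e2]
  obtain ⟨M, hM⟩ : ∃ M, M = q * (3 / 2 - 1 / 2 * Real.exp (-s)) := ⟨_, rfl⟩
  clear_value q Ω
  have hq1 : q ≤ 1 := by
    have := Real.add_one_le_exp (-s)
    rw [← e2, div_le_one hs]; linarith
  have hM1 : |M - 1| ≤ 2 * s ^ 2 := by
    have e4 : M - 1 = (q - 1 - -s / 2) - s / 2 * ((1 - q) * (1 + q)) := by rw [hM, hexp]; ring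
    have hs2 : s ^ 2 ≤ s := by nlinarith
    rw [neg_sq] at hq
    have h5 : 1 - q ≤ s := by linarith [hq.1]
    have h6 : (1 - q) * (1 + q) ≤ s * 2 := mul_le_mul h5 (by linarith) (by linarith) hs.le
    have h7 : 0 ≤ (1 - q) * (1 + q) := mul_nonneg (by linarith) (by linarith)
    have h8 : s / 2 * ((1 - q) * (1 + q)) ≤ s / 2 * (s * 2) := mul_le_mul_of_nonneg_left h6 (by linarith)
    have h8' : s / 2 * (s * 2) = s ^ 2 := by ring
    have h9 : 0 ≤ s / 2 * ((1 - q) * (1 + q)) := by positivity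
    have h10 := sq_nonneg s
    rw [e4, abs_le]
    constructor <;> linarith [hq.1, hq.2]
  have hd1 : 0 < s ^ α + lam := by positivity
  have hd2 : 0 < s ^ α * Ω + lam := by positivity
  have e5 : 1 / (s ^ α + lam) - q * ((3 / 2 - 1 / 2 * Real.exp (-s)) * (1 / (s ^ α * Ω + lam))) =
      (s ^ α * (Ω - 1) - (M - 1) * (s ^ α + lam)) / ((s ^ α + lam) * (s ^ α * Ω + lam)) := by
    rw [← mul_assoc, ← hM]
    field_simp
    ring
  rw [e5, abs_div, abs_of_pos (mul_pos hd1 hd2), div_le_iff₀ (mul_pos hd1 hd2)]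
  have hnum : |s ^ α * (Ω - 1) - (M - 1) * (s ^ α + lam)| ≤ (10 + 2 * lam) * s ^ 2 := by
    refine (abs_sub _ _).trans ?_
    rw [abs_mul, abs_mul, abs_of_pos hsp, abs_of_pos hd1]
    have h1 : s ^ α * |Ω - 1| ≤ 1 * (8 * (-s) ^ 2) := mul_le_mul hsp1 hΩ (abs_nonneg _) zero_le_one
    have h2 : |M - 1| * (s ^ α + lam) ≤ (2 * s ^ 2) * (1 + lam) :=
      mul_le_mul hM1 (by linarith) hd1.le (by positivity)
    nlinarith
  refine hnum.trans ?_
  have h1 : lam ^ 2 ≤ (s ^ α + lam) * (s ^ α * Ω + lam) := by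
    have : 0 ≤ s ^ α * Ω := by positivity
    nlinarith [mul_nonneg hsp.le this]
  calc (10 + 2 * lam) * s ^ 2 = (10 + 2 * lam) / lam ^ 2 * s ^ 2 * lam ^ 2 := by field_simp
    _ ≤ _ := by gcongr

/-- An Abelian theorem: an integrable function has integral zero if its Laplace transform
vanishes at the origin. -/
theorem integral_eq_zero_of_laplace {f : ℝ → ℝ} {C : ℝ} (hf : IntegrableOn f (Ioi 0))
    (h : ∀ s : ℝ, 0 < s → s ≤ 1 → |∫ x in Ioi (0 : ℝ), Real.exp (-(s * x)) * f x| ≤ C * s) :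
    ∫ x in Ioi (0 : ℝ), f x = 0 := by
  have h1 : Tendsto (fun s : ℝ => ∫ x in Ioi (0 : ℝ), Real.exp (-(s * x)) * f x) (𝓝[>] 0)
      (𝓝 (∫ x in Ioi (0 : ℝ), f x)) := by
    refine tendsto_integral_filter_of_dominated_convergence (fun x => ‖f x‖) ?_ ?_ hf.norm ?_
    · exact Eventually.of_forall fun s =>
        (by fun_prop : Measurable fun x : ℝ => Real.exp (-(s * x))).aestronglyMeasurable.mul hf.1
    · filter_upwards [self_mem_nhdsWithin] with s hs
      filter_upwards [ae_restrict_mem measurableSet_Ioi] with x hx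
      rw [norm_mul, Real.norm_of_nonneg (Real.exp_pos _).le]
      refine mul_le_of_le_one_left (norm_nonneg _) (Real.exp_le_one_iff.2 ?_)
      have := mul_pos (show (0:ℝ) < s from hs) (show (0:ℝ) < x from hx)
      linarith
    · refine Eventually.of_forall fun x => ?_
      have : Continuous fun s : ℝ => Real.exp (-(s * x)) * f x := by fun_prop
      have h2 := this.tendsto 0
      simp only [zero_mul, neg_zero, Real.exp_zero, one_mul] at h2
      exact h2.mono_left nhdsWithin_le_nhds
  have h2 : Tendsto (fun s : ℝ => ∫ x in Ioi (0 : ℝ), Real.exp (-(s * x)) * f x) (𝓝[>] 0) (𝓝 0) := by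
    have h3 : Tendsto (fun s : ℝ => C * s) (𝓝[>] 0) (𝓝 0) := by
      have : Continuous fun s : ℝ => C * s := by fun_prop
      have h4 := this.tendsto 0
      simp only [mul_zero] at h4
      exact h4.mono_left nhdsWithin_le_nhds
    refine squeeze_zero_norm' ?_ h3
    filter_upwards [Ioc_mem_nhdsGT zero_lt_one] with s hs
    exact h s hs.1 hs.2
  exact tendsto_nhds_unique h1 h2

/-- The antiderivative of the kernel error that vanishes at `0`. -/
noncomputable def kernErrInt (α lam x : ℝ) : ℝ := ∫ y in (0 : ℝ)..x, kernErr α lam y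

/-- The second antiderivative of the kernel error. -/
noncomputable def kernErrInt2 (α lam x : ℝ) : ℝ := ∫ y in (0 : ℝ)..x, kernErrInt α lam y

theorem exists_kernErr_near_zero {α : ℝ} (hα : 0 < α) (hα' : α < 1) : ∃ C : ℝ, 0 < C ∧
    ∀ lam x : ℝ, 0 < lam → 0 < x → |kernErr α lam x| ≤ C * (x ^ (α - 1) + 1) := by
  obtain ⟨C, hC, h⟩ := exists_srcCoeff_le hα hα'
  obtain ⟨C', hC', h'⟩ := exists_resKernel_le hα hα'
  refine ⟨C + C', by positivity, fun lam x hl hx => ?_⟩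
  have h1 := h lam hl ⌊x⌋₊
  have h2 := (h' lam x hl hx).1
  have h3 := resKernel_nonneg hα hα' hl x
  have h4 : C / (1 + lam) ≤ C := div_le_self hC.le (by linarith)
  have h5 := Real.rpow_pos_of_pos hx (α - 1)
  refine (abs_sub _ _).trans ?_
  rw [abs_of_nonneg h3]
  nlinarith [mul_pos hC h5]

theorem intervalIntegrable_kernErr {α lam : ℝ} (hα : 0 < α) (hα' : α < 1) (hl : 0 < lam) {a b : ℝ}
    (ha : 0 ≤ a) (hb : 0 ≤ b) : IntervalIntegrable (kernErr α lam) volume a b := by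
  obtain ⟨C, hC, h⟩ := exists_kernErr_near_zero hα hα'
  have h1 : IntervalIntegrable (fun t : ℝ => C * (t ^ (α - 1) + 1)) volume a b :=
    ((intervalIntegral.intervalIntegrable_rpow' (by linarith)).add intervalIntegrable_const).const_mul C
  refine h1.mono_fun (measurable_kernErr α lam).aestronglyMeasurable ?_
  filter_upwards [ae_restrict_mem measurableSet_uIoc] with t ht
  exact (h lam t hl ((le_min ha hb).trans_lt ht.1)).trans (le_abs_self _)

theorem rpow_floor_le {x p : ℝ} (hx : 1 ≤ x) (hp : -2 ≤ p) (hp' : p ≤ 0) :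
    (⌊x⌋₊ : ℝ) ^ p ≤ 4 * x ^ p := by
  have h1 : x / 2 ≤ ⌊x⌋₊ := by
    have h2 := Nat.lt_floor_add_one x
    have h3 : (1 : ℝ) ≤ ⌊x⌋₊ := by exact_mod_cast Nat.le_floor (by simpa using hx)
    linarith
  refine (Real.rpow_le_rpow_of_nonpos (by linarith) h1 hp').trans ?_
  rw [Real.div_rpow (by linarith) (by norm_num), div_eq_mul_inv, mul_comm, ← Real.rpow_neg (by norm_num)]
  refine mul_le_mul_of_nonneg_right ?_ (by positivity)
  calc (2 : ℝ) ^ (-p) ≤ 2 ^ (2 : ℝ) := Real.rpow_le_rpow_of_exponent_le (by norm_num) (by linarith)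
    _ = 4 := by norm_num

/-- The tail of a convergent `p`-series. -/
theorem sum_Ico_rpow_le {p : ℝ} (hp : 1 < p) {n N : ℕ} (hn : 1 ≤ n) (hN : n ≤ N) :
    ∑ m ∈ Finset.Ico n N, (m : ℝ) ^ (-p) ≤ 2 ^ p / (p - 1) * (n : ℝ) ^ (1 - p) := by
  have hn1 : (1 : ℝ) ≤ n := by exact_mod_cast hn
  have hNn : (n : ℝ) ≤ N := by exact_mod_cast hN
  have h1 : ∑ m ∈ Finset.Ico n N, (((m + 1 : ℕ) : ℝ)) ^ (-p) ≤ ∫ x in (n : ℝ)..N, x ^ (-p) := by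
    refine AntitoneOn.sum_le_integral_Ico (f := fun x : ℝ => x ^ (-p)) hN fun x hx y hy hxy => ?_
    exact Real.rpow_le_rpow_of_nonpos (by linarith [hx.1]) hxy (by linarith)
  have h2 : ∫ x in (n : ℝ)..N, x ^ (-p) ≤ 1 / (p - 1) * (n : ℝ) ^ (1 - p) := by
    rw [integral_rpow (Or.inr ⟨by linarith, fun h => by
      rw [uIcc_of_le hNn] at h; linarith [h.1]⟩)]
    have h3 : 0 ≤ (N : ℝ) ^ (1 - p) := by positivity
    have h5 : ∀ a b : ℝ, (a - b) / (1 - p) = (p - 1)⁻¹ * (b - a) := fun a b => by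
      rw [← neg_sub p 1, div_neg]; ring
    rw [show -p + 1 = 1 - p by ring, h5, one_div]
    have h4 : 0 < (p - 1)⁻¹ := inv_pos.2 (by linarith)
    nlinarith
  calc ∑ m ∈ Finset.Ico n N, (m : ℝ) ^ (-p) ≤ ∑ m ∈ Finset.Ico n N, 2 ^ p * (((m + 1 : ℕ) : ℝ)) ^ (-p) := by
        refine Finset.sum_le_sum fun m hm => ?_
        have hm1 : (1 : ℝ) ≤ m := by exact_mod_cast hn.trans (Finset.mem_Ico.1 hm).1
        rw [Real.rpow_neg (by linarith), Real.rpow_neg (by positivity), ← div_eq_mul_inv, inv_eq_one_div,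
          div_le_div_iff₀ (by positivity) (by positivity), one_mul, ← Real.mul_rpow (by norm_num) (by linarith)]
        refine Real.rpow_le_rpow (by positivity) ?_ (by linarith)
        push_cast; linarith
    _ = 2 ^ p * ∑ m ∈ Finset.Ico n N, (((m + 1 : ℕ) : ℝ)) ^ (-p) := by rw [Finset.mul_sum]
    _ ≤ 2 ^ p * (1 / (p - 1) * (n : ℝ) ^ (1 - p)) := by gcongr; exact h1.trans h2
    _ = _ := by ring

theorem integrableOn_kernErr {α lam : ℝ} (hα : 0 < α) (hα' : α < 1) (hl : 0 < lam) :
    IntegrableOn (kernErr α lam) (Ioi 0) := by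
  obtain ⟨C, hC, h⟩ := exists_kernErr_near_zero hα hα'
  obtain ⟨C', hC', h'⟩ := exists_kernErr_le hα hα'
  refine integrableOn_Ioi_of_rpow_bounds (p := α - 1) (q := α - 2) (A := 2 * C) (B := 4 * C')
    (measurable_kernErr α lam).aestronglyMeasurable (by linarith) (by linarith) ?_ ?_
  · intro x hx hx1
    have h1 : 1 ≤ x ^ (α - 1) := Real.one_le_rpow_of_pos_of_le_one_of_nonpos hx hx1 (by linarith)
    refine (h lam x hl hx).trans ?_
    nlinarith
  · intro x hx
    have h1 := (h' lam hl ⌊x⌋₊ (Nat.le_floor (by simpa using hx.le))).1 x (Nat.floor_le (by linarith))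
      (Nat.lt_floor_add_one x)
    refine h1.trans ?_
    have := rpow_floor_le hx.le (p := α - 2) (by linarith) (by linarith)
    nlinarith

theorem kernErrInt_eq_sub_sum {α lam : ℝ} (hα : 0 < α) (hα' : α < 1) (hl : 0 < lam) {n N : ℕ} (hN : n ≤ N) :
    kernErrInt α lam n = kernErrInt α lam N -
      ∑ m ∈ Finset.Ico n N, ((∫ x in (m : ℝ)..(m + 1), resKernel α lam x) - srcCoeff α lam m) := by
  have hI : ∀ a b : ℕ, IntervalIntegrable (kernErr α lam) volume a b := fun a b =>
    intervalIntegrable_kernErr hα hα' hl (Nat.cast_nonneg a) (Nat.cast_nonneg b)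
  have h1 := intervalIntegral.sum_integral_adjacent_intervals_Ico (μ := volume) (f := kernErr α lam)
    (a := fun n : ℕ => (n : ℝ)) hN (fun k _ => hI _ _)
  have h0 : IntervalIntegrable (kernErr α lam) volume 0 n := by simpa using hI 0 n
  have h2 := intervalIntegral.integral_add_adjacent_intervals h0 (hI n N)
  have h3 : ∀ m : ℕ, ∫ x in (m : ℝ)..((m + 1 : ℕ) : ℝ), kernErr α lam x =
      (∫ x in (m : ℝ)..(m + 1), resKernel α lam x) - srcCoeff α lam m := by
    intro m
    push_cast
    unfold kernErr
    rw [integral_floor_step (F := fun x n => resKernel α lam x - srcCoeff α lam n),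
      intervalIntegral.integral_sub (intervalIntegrable_resKernel hα hα' hl (by positivity) (by positivity))
      intervalIntegrable_const, intervalIntegral.integral_const]
    simp
  simp only [h3] at h1
  unfold kernErrInt
  rw [h1]
  linarith

/-- The kernel error has integral zero: the scheme integrates constant sources exactly in the limit of
large times. -/
theorem integral_kernErr {α lam : ℝ} (hα : 0 < α) (hα' : α < 1) (hl : 0 < lam) :
    ∫ x in Ioi (0 : ℝ), kernErr α lam x = 0 := by
  obtain ⟨C, h⟩ := exists_laplace_kernErr_le hα hα' hl
  refine integral_eq_zero_of_laplace (C := |C|) (integrableOn_kernErr hα hα' hl) fun s hs hs1 => ?_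
  refine (h s hs hs1).trans ?_
  have : s ^ 2 ≤ s := by nlinarith
  calc C * s ^ 2 ≤ |C| * s ^ 2 := by gcongr; exact le_abs_self C
    _ ≤ |C| * s := by gcongr

theorem tendsto_kernErrInt {α lam : ℝ} (hα : 0 < α) (hα' : α < 1) (hl : 0 < lam) :
    Tendsto (fun N : ℕ => kernErrInt α lam N) atTop (𝓝 0) := by
  rw [← integral_kernErr hα hα' hl]
  exact intervalIntegral_tendsto_integral_Ioi 0 (integrableOn_kernErr hα hα' hl) tendsto_natCast_atTop_atTop

/-- Since the kernel error has integral zero, its antiderivative at `n` is minus the sum of the errors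
of the time steps from `n` on, which gains one power of `n`. -/
theorem exists_kernErrInt_nat_le {α : ℝ} (hα : 0 < α) (hα' : α < 1) : ∃ C : ℝ, 0 < C ∧
    ∀ lam : ℝ, 0 < lam → ∀ n : ℕ, 1 ≤ n →
      |kernErrInt α lam n| ≤ C * (n : ℝ) ^ (α - 2) ∧ lam * |kernErrInt α lam n| ≤ C * (n : ℝ) ^ (-2 : ℝ) := by
  obtain ⟨C, hC, h⟩ := exists_kernErr_le hα hα'
  have hα2 : 0 < 3 - α - 1 := by linarith
  have key : ∀ lam : ℝ, 0 < lam → ∀ n : ℕ, 1 ≤ n → ∀ c p : ℝ, 0 ≤ c → 1 < p →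
      (∀ m : ℕ, 1 ≤ m → c * |(∫ x in (m : ℝ)..(m + 1), resKernel α lam x) - srcCoeff α lam m| ≤ C * (m : ℝ) ^ (-p)) →
      c * |kernErrInt α lam n| ≤ C * (2 ^ p / (p - 1)) * (n : ℝ) ^ (1 - p) := by
    intro lam hl n hn c p hc hp hcp
    have h1 : Tendsto (fun N : ℕ => c * |kernErrInt α lam N| + C * (2 ^ p / (p - 1)) * (n : ℝ) ^ (1 - p)) atTop
        (𝓝 (c * |0| + C * (2 ^ p / (p - 1)) * (n : ℝ) ^ (1 - p))) :=
      ((tendsto_kernErrInt hα hα' hl).abs.const_mul c).add_const _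
    rw [abs_zero, mul_zero, zero_add] at h1
    refine ge_of_tendsto h1 ?_
    filter_upwards [eventually_ge_atTop n] with N hN
    rw [kernErrInt_eq_sub_sum hα hα' hl hN]
    refine (mul_le_mul_of_nonneg_left (abs_sub _ _) hc).trans ?_
    rw [mul_add]
    refine add_le_add le_rfl ?_
    calc _ ≤ c * ∑ m ∈ Finset.Ico n N, |(∫ x in (m : ℝ)..(m + 1), resKernel α lam x) - srcCoeff α lam m| := by
          gcongr; exact Finset.abs_sum_le_sum_abs _ _
      _ ≤ ∑ m ∈ Finset.Ico n N, C * (m : ℝ) ^ (-p) := by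
          rw [Finset.mul_sum]
          exact Finset.sum_le_sum fun m hm => hcp m (hn.trans (Finset.mem_Ico.1 hm).1)
      _ = C * ∑ m ∈ Finset.Ico n N, (m : ℝ) ^ (-p) := by rw [Finset.mul_sum]
      _ ≤ C * (2 ^ p / (p - 1) * (n : ℝ) ^ (1 - p)) := by gcongr; exact sum_Ico_rpow_le hp hn hN
      _ = _ := by ring
  refine ⟨C * (2 ^ (3 - α) / (3 - α - 1)) + C * (2 ^ (3:ℝ) / (3 - 1)), by positivity, fun lam hl n hn => ⟨?_, ?_⟩⟩
  · have h1 := key lam hl n hn 1 (3 - α) zero_le_one (by linarith) fun m hm => by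
      rw [one_mul, neg_sub]; exact (h lam hl m hm).2.1
    rw [one_mul, show 1 - (3 - α) = α - 2 by ring] at h1
    refine h1.trans ?_
    have : 0 ≤ C * (2 ^ (3:ℝ) / (3 - 1)) * (n : ℝ) ^ (α - 2) := by positivity
    linarith
  · have h1 := key lam hl n hn lam 3 hl.le (by norm_num) fun m hm => (h lam hl m hm).2.2
    rw [show (1 : ℝ) - 3 = -2 by norm_num] at h1
    refine h1.trans ?_
    have : 0 ≤ C * (2 ^ (3 - α) / (3 - α - 1)) * (n : ℝ) ^ (-2 : ℝ) := by positivity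
    linarith

/-- The decay of the antiderivative at integers extends to all `x`; near the origin the antiderivative is
bounded because the singularity `x^(α-1)` of the kernel error is integrable. -/
theorem exists_kernErrInt_le {α : ℝ} (hα : 0 < α) (hα' : α < 1) : ∃ C : ℝ, 0 < C ∧
    ∀ lam x : ℝ, 0 < lam → 0 < x →
      |kernErrInt α lam x| ≤ C * x ^ (α - 2) ∧ |kernErrInt α lam x| ≤ C := by
  obtain ⟨C₁, hC₁, h1⟩ := exists_kernErrInt_nat_le hα hα'
  obtain ⟨C₂, hC₂, h2⟩ := exists_kernErr_le hα hα'
  obtain ⟨C₃, hC₃, h3⟩ := exists_kernErr_near_zero hα hα'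
  refine ⟨4 * (C₁ + C₂) + C₃ * (1 / α + 1), by positivity, fun lam x hl hx => ?_⟩
  have hxp := Real.rpow_pos_of_pos hx (α - 2)
  by_cases hx1 : 1 ≤ x
  · have hn : 1 ≤ ⌊x⌋₊ := Nat.le_floor (by simpa using hx1)
    have hfl := Nat.floor_le hx.le
    have hfl' := Nat.lt_floor_add_one x
    have e : kernErrInt α lam x = kernErrInt α lam ⌊x⌋₊ + ∫ y in (⌊x⌋₊ : ℝ)..x, kernErr α lam y := by
      unfold kernErrInt
      rw [intervalIntegral.integral_add_adjacent_intervals] <;>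
      exact intervalIntegrable_kernErr hα hα' hl (by positivity) (by positivity)
    have h4 : ‖∫ y in (⌊x⌋₊ : ℝ)..x, kernErr α lam y‖ ≤ C₂ * (⌊x⌋₊ : ℝ) ^ (α - 2) * |x - ⌊x⌋₊| := by
      refine intervalIntegral.norm_integral_le_of_norm_le_const fun y hy => ?_
      rw [uIoc_of_le hfl] at hy
      exact (h2 lam hl _ hn).1 y hy.1.le (hy.2.trans_lt hfl')
    have h5 : |kernErrInt α lam x| ≤ (C₁ + C₂) * (⌊x⌋₊ : ℝ) ^ (α - 2) := by
      rw [e]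
      refine (abs_add_le _ _).trans ?_
      rw [add_mul]
      refine add_le_add (h1 lam hl _ hn).1 (h4.trans ?_)
      refine mul_le_of_le_one_right (by positivity) ?_
      rw [abs_of_nonneg (by linarith)]; linarith
    have h6 := rpow_floor_le hx1 (p := α - 2) (by linarith) (by linarith)
    have h7 : |kernErrInt α lam x| ≤ (4 * (C₁ + C₂) + C₃ * (1 / α + 1)) * x ^ (α - 2) := by
      calc _ ≤ (C₁ + C₂) * (4 * x ^ (α - 2)) := h5.trans (by gcongr)
        _ = 4 * (C₁ + C₂) * x ^ (α - 2) := by ring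
        _ ≤ _ := by
          refine mul_le_mul_of_nonneg_right ?_ hxp.le
          have : 0 ≤ C₃ * (1 / α + 1) := by positivity
          linarith
    refine ⟨h7, h7.trans (mul_le_of_le_one_right (by positivity) ?_)⟩
    exact Real.rpow_le_one_of_one_le_of_nonpos hx1 (by linarith)
  · push Not at hx1
    have h4 : |kernErrInt α lam x| ≤ C₃ * (1 / α + 1) := by
      have h5 : ‖∫ y in (0:ℝ)..x, kernErr α lam y‖ ≤ ∫ y in (0:ℝ)..x, C₃ * (y ^ (α - 1) + 1) := by
        refine intervalIntegral.norm_integral_le_of_norm_le hx.le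
          (Eventually.of_forall fun y hy => h3 lam y hl hy.1) ?_
        exact ((intervalIntegral.intervalIntegrable_rpow' (by linarith)).add intervalIntegrable_const).const_mul _
      rw [intervalIntegral.integral_const_mul, intervalIntegral.integral_add
        (intervalIntegral.intervalIntegrable_rpow' (by linarith)) intervalIntegrable_const,
        integral_rpow (Or.inl (by linarith)), intervalIntegral.integral_const, sub_add_cancel,
        Real.zero_rpow hα.ne'] at h5
      refine h5.trans ?_
      have h6 : x ^ α ≤ 1 := Real.rpow_le_one hx.le hx1.le hα.le
      simp only [sub_zero, smul_eq_mul, mul_one]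
      gcongr
    have h5 : C₃ * (1 / α + 1) ≤ 4 * (C₁ + C₂) + C₃ * (1 / α + 1) := by linarith
    refine ⟨?_, h4.trans h5⟩
    refine (h4.trans h5).trans (le_mul_of_one_le_right (by positivity) ?_)
    exact Real.one_le_rpow_of_pos_of_le_one_of_nonpos hx hx1.le (by linarith)

theorem kernErrInt_zero (α lam : ℝ) : kernErrInt α lam 0 = 0 := by simp [kernErrInt]

theorem aestronglyMeasurable_kernErrInt {α lam : ℝ} (hα : 0 < α) (hα' : α < 1) (hl : 0 < lam) :
    AEStronglyMeasurable (kernErrInt α lam) (volume.restrict (Ioi 0)) := by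
  have h := integrable_posConvolution (μ := volume) (ν := volume)
      (integrableOn_exp_mul_kernErr hα hα' hl one_pos) (integrableOn_rpow_mul_exp (p := 0) (by norm_num) one_pos)
      (ContinuousLinearMap.mul ℝ ℝ)
  have h1 := h.1.restrict (s := Ioi 0)
  have h2 : AEStronglyMeasurable (fun t : ℝ => Real.exp (1 * t)) (volume.restrict (Ioi (0:ℝ))) :=
    (by fun_prop : Measurable fun t : ℝ => Real.exp (1 * t)).aestronglyMeasurable
  refine (h2.mul h1).congr ?_
  filter_upwards [ae_restrict_mem measurableSet_Ioi] with t ht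
  rw [Pi.mul_apply, posConvolution, indicator_of_mem ht, ← intervalIntegral.integral_const_mul, kernErrInt]
  refine intervalIntegral.integral_congr fun y _ => ?_
  simp only [ContinuousLinearMap.mul_apply', Real.rpow_zero, one_mul]
  rw [mul_right_comm, ← mul_assoc, ← mul_assoc, ← Real.exp_add, ← Real.exp_add,
    show t + -y + -(t - y) = 0 by ring, Real.exp_zero, one_mul]

theorem integrableOn_kernErrInt {α lam : ℝ} (hα : 0 < α) (hα' : α < 1) (hl : 0 < lam) :
    IntegrableOn (kernErrInt α lam) (Ioi 0) := by
  obtain ⟨C, hC, h⟩ := exists_kernErrInt_le hα hα'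
  refine integrableOn_Ioi_of_rpow_bounds (p := 0) (q := α - 2) (A := C) (B := C)
    (aestronglyMeasurable_kernErrInt hα hα' hl) (by norm_num) (by linarith) ?_ ?_
  · intro x hx _
    rw [Real.rpow_zero, mul_one]; exact (h lam x hl hx).2
  · intro x hx
    exact (h lam x hl (by linarith)).1

/-- The antiderivative of the kernel error has integral zero as well: its Laplace transform is
that of the kernel error divided by `s`. -/
theorem integral_kernErrInt {α lam : ℝ} (hα : 0 < α) (hα' : α < 1) (hl : 0 < lam) :
    ∫ x in Ioi (0 : ℝ), kernErrInt α lam x = 0 := by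
  obtain ⟨C, h⟩ := exists_laplace_kernErr_le hα hα' hl
  refine integral_eq_zero_of_laplace (C := C) (integrableOn_kernErrInt hα hα' hl) fun s hs hs1 => ?_
  have h1 := integral_posConvolution (μ := volume) (ν := volume)
    (integrableOn_exp_mul_kernErr hα hα' hl hs) (integrableOn_rpow_mul_exp (p := 0) (by norm_num) hs)
    (ContinuousLinearMap.mul ℝ ℝ)
  have h2 : ∀ t : ℝ, ∫ y in (0:ℝ)..t, (ContinuousLinearMap.mul ℝ ℝ) (Real.exp (-(s * y)) * kernErr α lam y)
      ((t - y) ^ (0:ℝ) * Real.exp (-(s * (t - y)))) = Real.exp (-(s * t)) * kernErrInt α lam t := by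
    intro t
    rw [kernErrInt, ← intervalIntegral.integral_const_mul]
    refine intervalIntegral.integral_congr fun y _ => ?_
    simp only [ContinuousLinearMap.mul_apply', Real.rpow_zero, one_mul]
    rw [mul_right_comm, ← Real.exp_add]
    ring_nf
  simp only [h2] at h1
  rw [h1, ContinuousLinearMap.mul_apply', integral_rpow_mul_exp (by norm_num) hs, abs_mul]
  have h3 := h s hs hs1
  norm_num [Real.rpow_neg_one]
  rw [abs_of_pos hs, ← div_eq_mul_inv, div_le_iff₀ hs]
  linarith

/-- The second antiderivative is minus the tail integral of the first. -/
theorem exists_kernErrInt2_le {α : ℝ} (hα : 0 < α) (hα' : α < 1) : ∃ C : ℝ, 0 < C ∧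
    ∀ lam x : ℝ, 0 < lam → 0 < x → |kernErrInt2 α lam x| ≤ C * x ^ (α - 1) := by
  obtain ⟨C, hC, h⟩ := exists_kernErrInt_le hα hα'
  have hα1 : 0 < 1 - α := by linarith
  refine ⟨C + C / (1 - α), by positivity, fun lam x hl hx => ?_⟩
  have hI := integrableOn_kernErrInt hα hα' hl
  have hxp := Real.rpow_pos_of_pos hx (α - 1)
  by_cases hx1 : 1 ≤ x
  · have h1 : kernErrInt2 α lam x = -∫ y in Ioi x, kernErrInt α lam y := by
      have h2 := intervalIntegral.integral_Ioi_sub_Ioi hI hx.le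
      rw [integral_kernErrInt hα hα' hl] at h2
      rw [kernErrInt2, ← h2, zero_sub]
    have h2 : ‖∫ y in Ioi x, kernErrInt α lam y‖ ≤ ∫ y in Ioi x, C * y ^ (α - 2) := by
      refine norm_integral_le_of_norm_le ((integrableOn_Ioi_rpow_of_lt (by linarith) hx).const_mul C) ?_
      filter_upwards [ae_restrict_mem measurableSet_Ioi] with y hy
      exact (h lam y hl (hx.trans hy)).1
    rw [integral_const_mul, integral_Ioi_rpow_of_lt (by linarith) hx] at h2
    rw [h1, abs_neg]
    refine h2.trans ?_
    rw [show α - 2 + 1 = α - 1 by ring, neg_div, ← div_neg, neg_sub, mul_div_assoc', mul_div_right_comm]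
    have : 0 ≤ C * x ^ (α - 1) := by positivity
    linarith
  · push Not at hx1
    have h1 : ‖∫ y in (0:ℝ)..x, kernErrInt α lam y‖ ≤ C * |x - 0| := by
      refine intervalIntegral.norm_integral_le_of_norm_le_const fun y hy => ?_
      rw [uIoc_of_le hx.le] at hy
      exact (h lam y hl hy.1).2
    rw [sub_zero, abs_of_pos hx] at h1
    refine h1.trans ?_
    have h2 : x ≤ x ^ (α - 1) :=
      hx1.le.trans (Real.one_le_rpow_of_pos_of_le_one_of_nonpos hx hx1.le (by linarith))
    have : 0 ≤ C / (1 - α) * x ^ (α - 1) := by positivity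
    nlinarith

/-! ### Asymptotic expansions of coefficients -/

/-- The coefficients of `F` are `A n^γ + B n^(γ-1) + O(n^(γ-2))`. -/
def HasJet (F : PowerSeries ℝ) (γ A B : ℝ) : Prop :=
  (fun n : ℕ => PowerSeries.coeff n F - A * (n : ℝ) ^ γ - B * (n : ℝ) ^ (γ - 1)) =O[atTop]
    fun n : ℕ => (n : ℝ) ^ (γ - 2)

/-- The Taylor expansion of `(n - j)^γ` for large `n`. -/
theorem isBigO_sub_rpow (γ j : ℝ) (k : ℕ) :
    (fun n : ℕ => ((n : ℝ) - j) ^ γ - ∑ i ∈ Finset.range k, glWeight γ i * j ^ i * (n : ℝ) ^ (γ - i)) =O[atTop]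
      fun n : ℕ => (n : ℝ) ^ (γ - k) := by
  have h1 := (Real.one_add_rpow_hasFPowerSeriesAt_zero (a := γ)).isBigO_sub_partialSum_pow k
  have h2 : Tendsto (fun n : ℕ => -(j / (n : ℝ))) atTop (𝓝 0) := by
    have := (tendsto_const_div_atTop_nhds_zero_nat j).neg
    simpa using this
  have h3 := h1.comp_tendsto h2
  have h4 : (fun n : ℕ => ((n : ℝ) - j) ^ γ - ∑ i ∈ Finset.range k, glWeight γ i * j ^ i * (n : ℝ) ^ (γ - i)) =ᶠ[atTop]
      fun n : ℕ => (n : ℝ) ^ γ * ((fun y => (1 + (0 + y)) ^ γ - (binomialSeries ℝ γ).partialSum k y) ∘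
        fun n : ℕ => -(j / (n : ℝ))) n := by
    obtain ⟨N, hN⟩ := exists_nat_gt |j|
    filter_upwards [eventually_ge_atTop (N + 1)] with n hn
    have hn1 : (N : ℝ) + 1 ≤ n := by exact_mod_cast hn
    have hn0 : (0 : ℝ) < n := by linarith [Nat.cast_nonneg (α := ℝ) N]
    have hj : 0 ≤ 1 + (0 + -(j / (n : ℝ))) := by
      have : j / n ≤ 1 := by rw [div_le_one hn0]; linarith [le_abs_self j]
      linarith
    simp only [Function.comp, mul_sub]
    congr 1
    · rw [← Real.mul_rpow hn0.le hj]
      congr 1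
      field_simp
      ring
    · rw [FormalMultilinearSeries.partialSum, Finset.mul_sum]
      refine Finset.sum_congr rfl fun i _ => ?_
      simp only [binomialSeries_apply, List.ofFn_const, List.prod_replicate, smul_eq_mul]
      rw [glWeight_eq_choose, Real.rpow_sub hn0, Real.rpow_natCast, neg_pow (j / (n : ℝ)) i, div_pow]
      field_simp
  rw [Asymptotics.isBigO_congr h4 EventuallyEq.rfl]
  have h5 : (fun n : ℕ => (n : ℝ) ^ (γ - k)) =ᶠ[atTop] fun n : ℕ => (n : ℝ) ^ γ * ((n : ℝ) ^ k)⁻¹ := by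
    filter_upwards [eventually_ge_atTop 1] with n hn
    have hn0 : (0 : ℝ) < n := by exact_mod_cast hn
    rw [Real.rpow_sub hn0, Real.rpow_natCast, div_eq_mul_inv]
  rw [Asymptotics.isBigO_congr EventuallyEq.rfl h5]
  refine (Asymptotics.isBigO_refl _ _).mul (h3.trans ?_)
  refine Asymptotics.IsBigO.of_bound (|j| ^ k) (Eventually.of_forall fun n => ?_)
  simp only [Function.comp]
  rw [norm_pow, norm_norm, norm_neg, norm_div, norm_inv, norm_pow, div_pow, Real.norm_eq_abs, div_eq_mul_inv]

theorem isBigO_rpow_natCast {p q : ℝ} (h : p ≤ q) :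
    (fun n : ℕ => (n : ℝ) ^ p) =O[atTop] fun n : ℕ => (n : ℝ) ^ q := by
  refine Asymptotics.IsBigO.of_bound 1 ?_
  filter_upwards [eventually_ge_atTop 1] with n hn
  have hn1 : (1 : ℝ) ≤ n := by exact_mod_cast hn
  rw [one_mul, Real.norm_of_nonneg (by positivity), Real.norm_of_nonneg (by positivity)]
  exact Real.rpow_le_rpow_of_exponent_le hn1 h

theorem HasJet.add {F G : PowerSeries ℝ} {γ A B A' B' : ℝ} (hF : HasJet F γ A B) (hG : HasJet G γ A' B') :
    HasJet (F + G) γ (A + A') (B + B') := by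
  refine (Asymptotics.IsBigO.add hF hG).congr_left fun n => ?_
  rw [map_add]; ring

theorem HasJet.sub {F G : PowerSeries ℝ} {γ A B A' B' : ℝ} (hF : HasJet F γ A B) (hG : HasJet G γ A' B') :
    HasJet (F - G) γ (A - A') (B - B') := by
  refine (Asymptotics.IsBigO.sub hF hG).congr_left fun n => ?_
  rw [map_sub]; ring

theorem HasJet.C_mul {F : PowerSeries ℝ} {γ A B : ℝ} (hF : HasJet F γ A B) (c : ℝ) :
    HasJet (PowerSeries.C c * F) γ (c * A) (c * B) := by
  refine (Asymptotics.IsBigO.const_mul_left hF c).congr_left fun n => ?_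
  rw [PowerSeries.coeff_C_mul]; ring

theorem isBigO_pred_rpow (γ : ℝ) : (fun n : ℕ => ((n - 1 : ℕ) : ℝ) ^ γ) =O[atTop] fun n : ℕ => (n : ℝ) ^ γ := by
  have h := isBigO_sub_rpow γ 1 0
  simp only [Finset.range_zero, Finset.sum_empty, sub_zero, Nat.cast_zero] at h
  refine h.congr' ?_ EventuallyEq.rfl
  filter_upwards [eventually_ge_atTop 1] with n hn
  rw [Nat.cast_sub hn, Nat.cast_one]

theorem HasJet.X_mul {F : PowerSeries ℝ} {γ A B : ℝ} (hF : HasJet F γ A B) :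
    HasJet (PowerSeries.X * F) γ A (B - γ * A) := by
  have h1 := (hF.comp_tendsto (tendsto_sub_atTop_nat 1)).trans (isBigO_pred_rpow (γ - 2))
  have h2 := isBigO_sub_rpow γ 1 2
  have h3 := isBigO_sub_rpow (γ - 1) 1 1
  have e2 : γ - ((2 : ℕ) : ℝ) = γ - 2 := by norm_num
  have e3 : γ - 1 - ((1 : ℕ) : ℝ) = γ - 2 := by push_cast; ring
  rw [e2] at h2
  rw [e3] at h3
  have h4 := (h1.add (h2.const_mul_left A)).add (h3.const_mul_left B)
  refine h4.congr' ?_ EventuallyEq.rfl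
  filter_upwards [eventually_ge_atTop 1] with n hn
  obtain ⟨m, rfl⟩ := Nat.exists_eq_add_of_le' hn
  rw [PowerSeries.coeff_succ_X_mul]
  simp only [Function.comp, Finset.sum_range_succ, Finset.range_zero, Finset.sum_empty, glWeight,
    Nat.add_sub_cancel]
  push_cast
  simp only [sub_zero, one_pow, mul_one, zero_add, add_sub_cancel_right, div_one]
  ring

theorem HasJet.linear_mul {F : PowerSeries ℝ} {γ A B : ℝ} (hF : HasJet F γ A B) (u v : ℝ) :
    HasJet ((PowerSeries.C u + PowerSeries.C v * PowerSeries.X) * F) γ (u * A + v * A) (u * B + v * (B - γ * A)) := by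
  have h := (hF.C_mul u).add (hF.X_mul.C_mul v)
  rwa [← mul_assoc, ← add_mul] at h

theorem HasJet.congr {F : PowerSeries ℝ} {γ A B A' B' : ℝ} (hF : HasJet F γ A B) (h : A = A') (h' : B = B') :
    HasJet F γ A' B' := h ▸ h' ▸ hF

theorem HasJet.isBigO {F : PowerSeries ℝ} {γ : ℝ} (hF : HasJet F γ 0 0) :
    (fun n => PowerSeries.coeff n F) =O[atTop] fun n : ℕ => (n : ℝ) ^ (γ - 2) := by
  refine Asymptotics.IsBigO.congr_left hF fun n => ?_
  ring

theorem integral_rpow_mul_one_sub_rpow {u v : ℝ} (hu : 0 < u) (hv : 0 < v) :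
    ∫ x in Ioo (0 : ℝ) 1, x ^ (u - 1) * (1 - x) ^ (v - 1) =
      Real.Gamma u * Real.Gamma v / Real.Gamma (u + v) := by
  have h := ProbabilityTheory.beta_eq_betaIntegralReal u v hu hv
  rw [ProbabilityTheory.beta] at h
  rw [h, Complex.betaIntegral, ← integral_Ioc_eq_integral_Ioo,
    ← intervalIntegral.integral_of_le zero_le_one]
  have e : ∫ x in (0:ℝ)..1, (x : ℂ) ^ ((u : ℂ) - 1) * (1 - (x : ℂ)) ^ ((v : ℂ) - 1) =
      ∫ x in (0:ℝ)..1, ((x ^ (u - 1) * (1 - x) ^ (v - 1) : ℝ) : ℂ) := by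
    refine intervalIntegral.integral_congr fun x hx => ?_
    rw [uIcc_of_le zero_le_one] at hx
    rw [Complex.ofReal_mul, Complex.ofReal_cpow hx.1, Complex.ofReal_cpow (by linarith [hx.2])]
    push_cast
    rfl
  rw [e, intervalIntegral.integral_ofReal, Complex.ofReal_re]

/-- The Laplace representation of `Γ(n + 1 - α) / n!`. -/
theorem integral_exp_mul_exp_sub_one_rpow {α : ℝ} (hα : 0 < α) (hα' : α < 1) (n : ℕ) :
    ∫ r in Ioi (0 : ℝ), Real.exp (-(n * r)) * (Real.exp r - 1) ^ (α - 1) =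
      Real.Gamma (n + 1 - α) * Real.Gamma α / Real.Gamma (n + 1) := by
  have h := integral_rpow_mul_one_sub_rpow (u := n + 1 - α) (v := α)
    (by linarith [Nat.cast_nonneg (α := ℝ) n]) hα
  rw [sub_add_cancel] at h
  rw [← h]
  have himg : (fun r : ℝ => Real.exp (-r)) '' Ioi 0 = Ioo 0 1 := by
    ext x
    constructor
    · rintro ⟨r, hr, rfl⟩
      exact ⟨Real.exp_pos _, Real.exp_lt_one_iff.2 (by simpa using hr)⟩
    · rintro ⟨h0, h1⟩
      exact ⟨-Real.log x, by simpa using Real.log_neg h0 h1, by simp [Real.exp_log h0]⟩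
  rw [← himg, integral_image_eq_integral_deriv_smul_of_antitoneOn (f := fun r : ℝ => Real.exp (-r))
    (f' := fun r => -Real.exp (-r)) measurableSet_Ioi]
  · refine setIntegral_congr_fun measurableSet_Ioi fun r hr => ?_
    have hr0 : (0 : ℝ) < r := hr
    have h1 : 0 < Real.exp r - 1 := by linarith [Real.add_one_lt_exp hr0.ne']
    have e1 : 1 - Real.exp (-r) = Real.exp (-r) * (Real.exp r - 1) := by
      rw [mul_sub, ← Real.exp_add]; simp
    simp only [neg_neg, smul_eq_mul]
    rw [e1, Real.mul_rpow (Real.exp_pos _).le h1.le, ← Real.exp_mul, ← Real.exp_mul, ← mul_assoc, ← mul_assoc,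
      ← Real.exp_add, ← Real.exp_add]
    ring_nf
  · intro r _
    simpa using ((hasDerivAt_id r).neg.exp).hasDerivWithinAt
  · intro x _ y _ hxy
    exact Real.exp_le_exp.2 (by linarith)

theorem abs_exp_sub_one_rpow_sub_le {α : ℝ} (hα : 0 < α) (hα' : α < 1) : ∃ C : ℝ, 0 < C ∧ ∀ r : ℝ, 0 < r →
    |(Real.exp r - 1) ^ (α - 1) - r ^ (α - 1) + (1 - α) / 2 * r ^ α| ≤ C * r ^ (α + 1) := by
  refine ⟨20, by norm_num, fun r hr => ?_⟩
  have hp1 := Real.rpow_pos_of_pos hr (α - 1)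
  have e1 : r ^ α = r ^ (α - 1) * r := by
    rw [← Real.rpow_add_one hr.ne']; ring_nf
  have e2 : r ^ (α + 1) = r ^ (α - 1) * r ^ 2 := by
    rw [← Real.rpow_two, ← Real.rpow_add hr]; ring_nf
  have hq : 1 ≤ expQuot r := by
    unfold expQuot
    rw [le_div_iff₀ hr]; linarith [Real.add_one_le_exp r]
  have e3 : (Real.exp r - 1) ^ (α - 1) = r ^ (α - 1) * (expQuot r ^ (1 - α))⁻¹ := by
    rw [← Real.rpow_neg (by linarith), neg_sub, ← Real.mul_rpow hr.le (by linarith)]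
    congr 1
    unfold expQuot
    field_simp
  set w := expQuot r ^ (1 - α) with hw
  have hw1 : 1 ≤ w := Real.one_le_rpow hq (by linarith)
  have hwi : w⁻¹ ≤ 1 := inv_le_one_of_one_le₀ hw1
  have hwi0 : 0 < w⁻¹ := by positivity
  rw [e3, e1, e2, show r ^ (α - 1) * w⁻¹ - r ^ (α - 1) + (1 - α) / 2 * (r ^ (α - 1) * r) =
    r ^ (α - 1) * (w⁻¹ - 1 + (1 - α) / 2 * r) by ring, abs_mul, abs_of_pos hp1,
    show (20 : ℝ) * (r ^ (α - 1) * r ^ 2) = r ^ (α - 1) * (20 * r ^ 2) by ring]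
  refine mul_le_mul_of_nonneg_left ?_ hp1.le
  by_cases hr1 : r ≤ 1
  · have h1 := abs_le.1 (expQuot_rpow_expansion (α := 1 - α) (by linarith) (by linarith) (r := r)
      (by rwa [abs_of_pos hr]) hr.ne')
    rw [← hw] at h1
    -- `w = 1 + x` with `x` close to `(1 - α) r / 2`, and `1/w = 1 - x + x²/w`
    have h2 : w⁻¹ - 1 + (1 - α) / 2 * r = -(w - 1 - (1 - α) / 2 * r) + (w - 1) ^ 2 * w⁻¹ := by
      field_simp; ring
    have h3 : w - 1 ≤ 7 / 2 * r := by nlinarith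
    have h4 : (w - 1) ^ 2 * w⁻¹ ≤ 49 / 4 * r ^ 2 := by
      have h5 : (w - 1) ^ 2 ≤ (7 / 2 * r) ^ 2 := pow_le_pow_left₀ (by linarith) h3 2
      have := mul_le_mul h5 hwi hwi0.le (by positivity)
      nlinarith [sq_nonneg r]
    have h5 : 0 ≤ (w - 1) ^ 2 * w⁻¹ := by positivity
    rw [h2, abs_le]
    constructor <;> nlinarith [sq_nonneg r]
  · push Not at hr1
    rw [abs_le]
    have : r ≤ r ^ 2 := by nlinarith
    constructor <;> nlinarith

theorem glWeight_sub_one {α : ℝ} (hα' : α < 1) (n : ℕ) :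
    glWeight (α - 1) n = Real.Gamma (n + 1 - α) / Real.Gamma (n + 1) / Real.Gamma (1 - α) := by
  have hG : Real.Gamma (1 - α) ≠ 0 := (Real.Gamma_pos_of_pos (by linarith)).ne'
  induction n with
  | zero => simp [glWeight, hG]
  | succ n ih =>
    have h1 : (n : ℝ) + 1 - α ≠ 0 := by linarith [Nat.cast_nonneg (α := ℝ) n]
    have h2 : (n : ℝ) + 1 ≠ 0 := by positivity
    have h3 : Real.Gamma ((n : ℝ) + 1) ≠ 0 := (Real.Gamma_pos_of_pos (by positivity)).ne'
    rw [glWeight, ih]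
    push_cast
    rw [show (n : ℝ) + 1 + 1 - α = (n + 1 - α) + 1 by ring, Real.Gamma_add_one h1, Real.Gamma_add_one h2]
    field_simp
    ring

theorem glWeight_sub_three {α : ℝ} (hα' : α < 1) (n : ℕ) :
    glWeight (α - 3) n = (n + 2 - α) * (n + 1 - α) / ((2 - α) * (1 - α)) * glWeight (α - 1) n := by
  have h1 : 1 - α ≠ 0 := by linarith
  have h2 : 2 - α ≠ 0 := by linarith
  induction n with
  | zero => simp [glWeight, h1, h2]
  | succ n ih =>
    have h3 : (n : ℝ) + 1 ≠ 0 := by positivity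
    rw [glWeight, glWeight, ih]
    push_cast
    field_simp
    ring

/-- The weights of `(1 - z)^(α-1)` are Beta integrals, whose integrand is expanded at the origin. -/
theorem hasJet_glSeries_sub_one {α : ℝ} (hα : 0 < α) (hα' : α < 1) :
    HasJet (glSeries (α - 1)) (-α) (1 / Real.Gamma (1 - α)) (-(α * (1 - α) / 2) / Real.Gamma (1 - α)) := by
  obtain ⟨C, hC, h⟩ := abs_exp_sub_one_rpow_sub_le hα hα'
  have hG : 0 < Real.Gamma (1 - α) := Real.Gamma_pos_of_pos (by linarith)
  have hGα : 0 < Real.Gamma α := Real.Gamma_pos_of_pos hα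
  refine Asymptotics.IsBigO.of_bound (C * Real.Gamma (α + 1 + 1) / Real.Gamma α / Real.Gamma (1 - α)) ?_
  filter_upwards [eventually_ge_atTop 1] with n hn
  have hn0 : (0 : ℝ) < n := by exact_mod_cast hn
  have hb := abs_laplace_le (p := α + 1) (by linarith) hn0 h
  have i1 := integrableOn_rpow_mul_exp (p := α - 1) (x := n) (by linarith) hn0
  have i2 := integrableOn_rpow_mul_exp (p := α) (x := n) (by linarith) hn0
  have i3 : IntegrableOn (fun r => Real.exp (-(n * r)) * ((Real.exp r - 1) ^ (α - 1) - r ^ (α - 1) + (1 - α) / 2 * r ^ α)) (Ioi 0) :=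
    integrableOn_laplace (p := α + 1) (by linarith) hn0 (by fun_prop) h
  have e : ∫ r in Ioi (0 : ℝ), Real.exp (-(n * r)) * ((Real.exp r - 1) ^ (α - 1) - r ^ (α - 1) + (1 - α) / 2 * r ^ α) =
      (∫ r in Ioi (0 : ℝ), Real.exp (-(n * r)) * (Real.exp r - 1) ^ (α - 1)) -
      (∫ r in Ioi (0 : ℝ), r ^ (α - 1) * Real.exp (-(n * r))) +
      (1 - α) / 2 * ∫ r in Ioi (0 : ℝ), r ^ α * Real.exp (-(n * r)) := by
    have e2 : ∫ r in Ioi (0 : ℝ), Real.exp (-(n * r)) * (Real.exp r - 1) ^ (α - 1) =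
        ∫ r in Ioi (0 : ℝ), (Real.exp (-(n * r)) * ((Real.exp r - 1) ^ (α - 1) - r ^ (α - 1) + (1 - α) / 2 * r ^ α) +
          r ^ (α - 1) * Real.exp (-(n * r)) - (1 - α) / 2 * (r ^ α * Real.exp (-(n * r)))) := by
      refine integral_congr_ae (Eventually.of_forall fun r => ?_)
      simp only; ring
    have i4 : IntegrableOn (fun r => Real.exp (-(n * r)) * ((Real.exp r - 1) ^ (α - 1) - r ^ (α - 1) + (1 - α) / 2 * r ^ α) +
          r ^ (α - 1) * Real.exp (-(n * r))) (Ioi 0) := i3.add i1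
    rw [e2, integral_sub i4 (i2.const_mul _), integral_add i3 i1, integral_const_mul]
    ring
  rw [e, integral_exp_mul_exp_sub_one_rpow hα hα', integral_rpow_mul_exp (by linarith) hn0,
    integral_rpow_mul_exp (by linarith) hn0, Real.Gamma_add_one hα.ne', sub_add_cancel,
    show -(α + 1) = -α - 1 by ring, show -(α + 1 + 1) = -α - 2 by ring] at hb
  rw [glSeries, PowerSeries.coeff_mk, glWeight_sub_one hα', Real.norm_of_nonneg (by positivity : (0:ℝ) ≤ (n : ℝ) ^ (-α - 2))]
  have e3 : Real.Gamma (n + 1 - α) / Real.Gamma (n + 1) / Real.Gamma (1 - α) - 1 / Real.Gamma (1 - α) * (n : ℝ) ^ (-α) -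
      -(α * (1 - α) / 2) / Real.Gamma (1 - α) * (n : ℝ) ^ (-α - 1) =
      (Real.Gamma (n + 1 - α) * Real.Gamma α / Real.Gamma (n + 1) - Real.Gamma α * (n : ℝ) ^ (-α) +
        (1 - α) / 2 * (α * Real.Gamma α * (n : ℝ) ^ (-α - 1))) / Real.Gamma α / Real.Gamma (1 - α) := by
    field_simp
    ring
  rw [e3, norm_div, norm_div, Real.norm_of_nonneg hGα.le, Real.norm_of_nonneg hG.le, Real.norm_eq_abs]
  calc _ ≤ (C * Real.Gamma (α + 1 + 1) * (n : ℝ) ^ (-α - 2)) / Real.Gamma α / Real.Gamma (1 - α) := by gcongr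
    _ = _ := by ring

/-- The weights of `(1 - z)^(α-3)` are those of `(1 - z)^(α-1)` multiplied by a rational function of `n`. -/
theorem hasJet_glSeries_sub_three {α : ℝ} (hα : 0 < α) (hα' : α < 1) :
    HasJet (glSeries (α - 3)) (2 - α) (1 / Real.Gamma (3 - α))
      ((2 - α) * (3 - α) / 2 / Real.Gamma (3 - α)) := by
  have hG : 0 < Real.Gamma (1 - α) := Real.Gamma_pos_of_pos (by linarith)
  have h1 : 1 - α ≠ 0 := by linarith
  have h2 : 2 - α ≠ 0 := by linarith
  have hG3 : Real.Gamma (3 - α) = (2 - α) * (1 - α) * Real.Gamma (1 - α) := by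
    rw [show 3 - α = (2 - α) + 1 by ring, Real.Gamma_add_one h2, show 2 - α = (1 - α) + 1 by ring,
      Real.Gamma_add_one h1]
    ring
  have hj := hasJet_glSeries_sub_one hα hα'
  have hpoly : (fun n : ℕ => ((n : ℝ) + 2 - α) * (n + 1 - α) / ((2 - α) * (1 - α))) =O[atTop]
      fun n : ℕ => (n : ℝ) ^ (2 : ℝ) := by
    refine Asymptotics.IsBigO.of_bound (|((2 - α) * (1 - α))⁻¹| * 6) ?_
    filter_upwards [eventually_ge_atTop 1] with n hn
    have hn1 : (1 : ℝ) ≤ n := by exact_mod_cast hn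
    rw [div_eq_mul_inv, norm_mul, mul_comm, Real.norm_eq_abs, mul_assoc]
    refine mul_le_mul_of_nonneg_left ?_ (abs_nonneg _)
    rw [Real.norm_of_nonneg (mul_nonneg (by linarith) (by linarith)), Real.rpow_two,
      Real.norm_of_nonneg (by positivity)]
    nlinarith
  have hm := hpoly.mul hj
  have hm' : (fun n : ℕ => (n : ℝ) ^ (2 : ℝ) * (n : ℝ) ^ (-α - 2)) =ᶠ[atTop] fun n : ℕ => (n : ℝ) ^ (2 - α - 2) := by
    filter_upwards [eventually_ge_atTop 1] with n hn
    have hn0 : (0 : ℝ) < n := by exact_mod_cast hn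
    rw [← Real.rpow_add hn0]
    ring_nf
  have hm2 := hm.trans_eventuallyEq hm'
  have t1 := ((isBigO_rpow_natCast (le_refl (2 - α - 2))).const_mul_left
    (((2 - α) * (1 - α) + (3 - 2 * α) * (-(α * (1 - α) / 2))) / Real.Gamma (3 - α)))
  have t2 := ((isBigO_rpow_natCast (show -α - 1 ≤ 2 - α - 2 by linarith)).const_mul_left
    ((2 - α) * (1 - α) * (-(α * (1 - α) / 2)) / Real.Gamma (3 - α)))
  refine ((hm2.add t1).add t2).congr' ?_ EventuallyEq.rfl
  filter_upwards [eventually_ge_atTop 1] with n hn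
  have hn0 : (0 : ℝ) < n := by exact_mod_cast hn
  rw [glSeries, glSeries, PowerSeries.coeff_mk, PowerSeries.coeff_mk, glWeight_sub_three hα', hG3,
    show 2 - α - 2 = -α by ring, show 2 - α - 1 = -α + 1 by ring, show 2 - α = -α + 2 by ring,
    Real.rpow_add hn0, Real.rpow_add hn0, Real.rpow_sub hn0, Real.rpow_one, Real.rpow_two]
  have h2' : -α + 2 ≠ 0 := by linarith
  field_simp
  ring

/-! ### Convolution of decaying sequences -/

theorem exists_le_of_isBigO {a : ℕ → ℝ} {p : ℝ} (hp : p ≤ 0)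
    (h : a =O[atTop] fun n : ℕ => (n : ℝ) ^ p) : ∃ C : ℝ, 0 < C ∧ ∀ n : ℕ, |a n| ≤ C * ((n : ℝ) + 1) ^ p := by
  have h1 : (fun n : ℕ => (n : ℝ) ^ p) =O[atTop] fun n : ℕ => ((n : ℝ) + 1) ^ p := by
    refine Asymptotics.IsBigO.of_bound (2 ^ (-p)) ?_
    filter_upwards [eventually_ge_atTop 1] with n hn
    have hn1 : (1 : ℝ) ≤ n := by exact_mod_cast hn
    rw [Real.norm_of_nonneg (by positivity), Real.norm_of_nonneg (by positivity)]
    have h2 : (2 * (n : ℝ)) ^ p ≤ ((n : ℝ) + 1) ^ p :=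
      Real.rpow_le_rpow_of_nonpos (by positivity) (by linarith) hp
    calc (n : ℝ) ^ p = 2 ^ (-p) * (2 * (n : ℝ)) ^ p := by
          rw [Real.mul_rpow (by norm_num) (by positivity), ← mul_assoc, ← Real.rpow_add (by norm_num)]
          simp
      _ ≤ _ := by gcongr
  obtain ⟨C, hC, h2⟩ := Asymptotics.bound_of_isBigO_nat_atTop (h.trans h1)
  refine ⟨C, hC, fun n => ?_⟩
  have h3 : (0 : ℝ) < ((n : ℝ) + 1) ^ p := by positivity
  have := h2 (x := n) h3.ne'
  rwa [Real.norm_of_nonneg h3.le] at this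

/-- A null sequence is controlled by the sum of its later increments. -/
theorem exists_le_of_tendsto_zero {Q : ℕ → ℝ} {B p : ℝ} (hp : 1 < p) (hQ : Tendsto Q atTop (𝓝 0))
    (h : ∀ n, |Q (n + 1) - Q n| ≤ B * ((n : ℝ) + 1) ^ (-p)) :
    ∃ C : ℝ, 0 < C ∧ ∀ n : ℕ, |Q n| ≤ C * ((n : ℝ) + 1) ^ (1 - p) := by
  refine exists_le_of_isBigO (by linarith) (Asymptotics.IsBigO.of_bound (|B| * (2 ^ p / (p - 1))) ?_)
  filter_upwards [eventually_ge_atTop 1] with n hn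
  have hn1 : (1 : ℝ) ≤ n := by exact_mod_cast hn
  have h1 : Tendsto (fun N : ℕ => |Q N| + |B| * (2 ^ p / (p - 1) * (n : ℝ) ^ (1 - p))) atTop
      (𝓝 (|0| + |B| * (2 ^ p / (p - 1) * (n : ℝ) ^ (1 - p)))) := hQ.abs.add_const _
  rw [abs_zero, zero_add] at h1
  rw [Real.norm_of_nonneg (by positivity : (0:ℝ) ≤ (n : ℝ) ^ (1 - p)), mul_assoc]
  refine ge_of_tendsto h1 ?_
  filter_upwards [eventually_ge_atTop n] with N hN
  have e : Q n = Q N - ∑ k ∈ Finset.Ico n N, (Q (k + 1) - Q k) := by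
    rw [Finset.sum_Ico_sub Q hN]; ring
  rw [e]
  refine (norm_sub_le _ _).trans (add_le_add le_rfl ?_)
  calc ‖∑ k ∈ Finset.Ico n N, (Q (k + 1) - Q k)‖ ≤ ∑ k ∈ Finset.Ico n N, |B| * (k : ℝ) ^ (-p) := by
        refine (norm_sum_le _ _).trans (Finset.sum_le_sum fun k hk => (h k).trans ?_)
        have hk1 : (1 : ℝ) ≤ k := by exact_mod_cast hn.trans (Finset.mem_Ico.1 hk).1
        exact mul_le_mul (le_abs_self B) (Real.rpow_le_rpow_of_nonpos (by linarith) (by linarith) (by linarith))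
          (by positivity) (abs_nonneg _)
    _ = |B| * ∑ k ∈ Finset.Ico n N, (k : ℝ) ^ (-p) := by rw [Finset.mul_sum]
    _ ≤ _ := by gcongr; exact sum_Ico_rpow_le hp hn hN

theorem sum_range_add_one_rpow_le {β : ℝ} (hβ : 0 < β) (hβ' : β ≤ 1) (N : ℕ) :
    ∑ k ∈ Finset.range N, ((k : ℝ) + 1) ^ (β - 1) ≤ (N : ℝ) ^ β / β := by
  induction N with
  | zero => simp [Real.zero_rpow hβ.ne']
  | succ N ih =>
    rw [Finset.sum_range_succ]
    have hN : (0 : ℝ) < (N : ℝ) + 1 := by positivity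
    have h1 : (N : ℝ) ^ β ≤ ((N : ℝ) + 1) ^ β * (1 + β * (-(1 / ((N : ℝ) + 1)))) := by
      have h2 : (N : ℝ) = ((N : ℝ) + 1) * (1 + -(1 / ((N : ℝ) + 1))) := by field_simp; ring
      have h3 : -1 ≤ -(1 / ((N : ℝ) + 1)) := by
        rw [neg_le_neg_iff, div_le_one hN]; linarith [Nat.cast_nonneg (α := ℝ) N]
      have h4 := rpow_one_add_le_one_add_mul_self h3 hβ.le hβ'
      calc (N : ℝ) ^ β = (((N : ℝ) + 1) * (1 + -(1 / ((N : ℝ) + 1)))) ^ β := by rw [← h2]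
        _ = ((N : ℝ) + 1) ^ β * (1 + -(1 / ((N : ℝ) + 1))) ^ β := Real.mul_rpow hN.le (by linarith)
        _ ≤ _ := by gcongr
    have h5 : ((N : ℝ) + 1) ^ (β - 1) = ((N : ℝ) + 1) ^ β / ((N : ℝ) + 1) := by
      rw [Real.rpow_sub hN, Real.rpow_one]
    rw [h5]
    push_cast
    have h6 : (N : ℝ) ^ β / β ≤ (((N : ℝ) + 1) ^ β * (1 + β * (-(1 / ((N : ℝ) + 1))))) / β := by gcongr
    have h7 : (((N : ℝ) + 1) ^ β * (1 + β * (-(1 / ((N : ℝ) + 1))))) / β + ((N : ℝ) + 1) ^ β / ((N : ℝ) + 1) =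
        ((N : ℝ) + 1) ^ β / β := by field_simp; ring
    linarith

/-- Abel summation. -/
theorem sum_range_mul_eq (p a : ℕ → ℝ) (N : ℕ) : ∑ k ∈ Finset.range N, p k * a k =
    (∑ k ∈ Finset.range N, p k) * a N +
      ∑ k ∈ Finset.range N, (∑ j ∈ Finset.range (k + 1), p j) * (a k - a (k + 1)) := by
  induction N with
  | zero => simp
  | succ N ih =>
    rw [Finset.sum_range_succ, ih, Finset.sum_range_succ (fun k => (∑ j ∈ Finset.range (k + 1), p j) * _),
      Finset.sum_range_succ p]
    ring

/-- If `v` and its differences decay like `n^{α-1}`, `n^{α-2}`, `n^{α-3}`, and `p` and its iterated partial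
sums decay like `n^{-α-2}`, `n^{-α-1}`, `n^{-α}`, then the convolution of `p` and `v` decays like `n^{-2}`. -/
theorem abs_conv_le {α A B : ℝ} (hα : 0 < α) (hα' : α < 1) (hA : 0 < A) (hB : 0 < B) {p v : ℕ → ℝ}
    (hv : ∀ n : ℕ, |v n| ≤ A * ((n : ℝ) + 1) ^ (α - 1) ∧ |v (n + 1) - v n| ≤ A * ((n : ℝ) + 1) ^ (α - 2) ∧
      |v (n + 2) - 2 * v (n + 1) + v n| ≤ A * ((n : ℝ) + 1) ^ (α - 3))
    (hp : ∀ n : ℕ, |p n| ≤ B * ((n : ℝ) + 1) ^ (-α - 2))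
    (hQ1 : ∀ n : ℕ, |∑ k ∈ Finset.range n, p k| ≤ B * ((n : ℝ) + 1) ^ (-α - 1))
    (hQ2 : ∀ n : ℕ, |∑ j ∈ Finset.range n, ∑ k ∈ Finset.range j, p k| ≤ B * ((n : ℝ) + 1) ^ (-α))
    {n : ℕ} (hn : 1 ≤ n) :
    |∑ k ∈ Finset.range (n + 1), p k * v (n - k)| ≤ A * B * (8 + 8 / (1 - α) + 16 / α) * (n : ℝ) ^ (-2 : ℝ) := by
  have hn1 : (1 : ℝ) ≤ n := by exact_mod_cast hn
  have hn0 : (0 : ℝ) < n := by linarith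
  obtain ⟨N, hN⟩ : ∃ N, N = n / 2 := ⟨_, rfl⟩
  have hN2 : 2 * N ≤ n := by omega
  have hN3 : n ≤ 2 * N + 1 := by omega
  have hN2r : 2 * (N : ℝ) ≤ n := by exact_mod_cast hN2
  have hN3r : (n : ℝ) ≤ 2 * N + 1 := by exact_mod_cast hN3
  set y : ℝ := n / 2 with hy
  have hy0 : 0 < y := by positivity
  have hpow : ∀ x q : ℝ, y ≤ x → q ≤ 0 → x ^ q ≤ y ^ q := fun x q hx hq =>
    Real.rpow_le_rpow_of_nonpos hy0 hx hq
  have hy2 : y ^ (-2 : ℝ) = 4 * (n : ℝ) ^ (-2 : ℝ) := by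
    rw [hy, Real.div_rpow hn0.le (by norm_num), div_eq_mul_inv, ← Real.rpow_neg (by norm_num), neg_neg,
      Real.rpow_two, mul_comm]
    norm_num
  have hn2 : (0:ℝ) < (n : ℝ) ^ (-2 : ℝ) := by positivity
  set a : ℕ → ℝ := fun k => v (n - k) with ha
  set w : ℕ → ℝ := fun k => a k - a (k + 1) with hw
  set Q1 : ℕ → ℝ := fun m => ∑ k ∈ Finset.range m, p k with hQ1def
  have hQ2' : ∀ k, ∑ j ∈ Finset.range k, Q1 (j + 1) = ∑ j ∈ Finset.range (k + 1), ∑ i ∈ Finset.range j, p i := by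
    intro k
    rw [Finset.sum_range_succ' _ k]
    simp [hQ1def]
  -- the part `k < n/2`
  have hlow : |∑ k ∈ Finset.range N, p k * a k| ≤ A * B * (8 + 8 / (1 - α)) * (n : ℝ) ^ (-2 : ℝ) := by
    rw [sum_range_mul_eq, sum_range_mul_eq (fun k => Q1 (k + 1)) w]
    have t1 : |Q1 N * a N| ≤ 4 * (A * B) * (n : ℝ) ^ (-2 : ℝ) := by
      rw [abs_mul]
      have h1 : |Q1 N| ≤ B * y ^ (-α - 1) := (hQ1 N).trans (by
        exact mul_le_mul_of_nonneg_left (hpow _ _ (by rw [hy]; linarith) (by linarith)) hB.le)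
      have h2 : |a N| ≤ A * y ^ (α - 1) := (hv (n - N)).1.trans (by
        refine mul_le_mul_of_nonneg_left (hpow _ _ ?_ (by linarith)) hA.le
        rw [Nat.cast_sub (by omega), hy]; linarith)
      calc _ ≤ (B * y ^ (-α - 1)) * (A * y ^ (α - 1)) := mul_le_mul h1 h2 (abs_nonneg _) (by positivity)
        _ = A * B * y ^ (-2 : ℝ) := by
          rw [show (-2 : ℝ) = (-α - 1) + (α - 1) by ring, Real.rpow_add hy0]; ring
        _ = _ := by rw [hy2]; ring
    have t2 : |(∑ k ∈ Finset.range N, Q1 (k + 1)) * w N| ≤ 4 * (A * B) * (n : ℝ) ^ (-2 : ℝ) := by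
      rw [abs_mul, hQ2']
      have h1 : |∑ j ∈ Finset.range (N + 1), ∑ i ∈ Finset.range j, p i| ≤ B * y ^ (-α) := (hQ2 (N + 1)).trans (by
        refine mul_le_mul_of_nonneg_left (hpow _ _ ?_ (by linarith)) hB.le
        push_cast; rw [hy]; linarith)
      have h2 : |w N| ≤ A * y ^ (α - 2) := by
        obtain ⟨m, hm⟩ : ∃ m, n = N + 1 + m := Nat.exists_eq_add_of_le (by omega)
        have e1 : n - N = m + 1 := by omega
        have e2 : n - (N + 1) = m := by omega
        have hmr : (n : ℝ) = N + 1 + m := by exact_mod_cast hm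
        simp only [hw, ha, e1, e2]
        exact (hv m).2.1.trans
          (mul_le_mul_of_nonneg_left (hpow _ _ (by rw [hy]; linarith) (by linarith)) hA.le)
      calc _ ≤ (B * y ^ (-α)) * (A * y ^ (α - 2)) := mul_le_mul h1 h2 (abs_nonneg _) (by positivity)
        _ = A * B * y ^ (-2 : ℝ) := by
          rw [show (-2 : ℝ) = (-α) + (α - 2) by ring, Real.rpow_add hy0]; ring
        _ = _ := by rw [hy2]; ring
    have t3 : |∑ k ∈ Finset.range N, (∑ j ∈ Finset.range (k + 1), Q1 (j + 1)) * (w k - w (k + 1))| ≤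
        8 / (1 - α) * (A * B) * (n : ℝ) ^ (-2 : ℝ) := by
      have h1 : ∀ k ∈ Finset.range N, |(∑ j ∈ Finset.range (k + 1), Q1 (j + 1)) * (w k - w (k + 1))| ≤
          (A * B * y ^ (α - 3)) * ((k : ℝ) + 1) ^ ((1 - α) - 1) := by
        intro k hk
        have hkN : k < N := Finset.mem_range.1 hk
        rw [abs_mul, hQ2']
        have g1 : |∑ j ∈ Finset.range (k + 1 + 1), ∑ i ∈ Finset.range j, p i| ≤ B * ((k : ℝ) + 1) ^ ((1 - α) - 1) := by
          refine (hQ2 (k + 1 + 1)).trans ?_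
          rw [show (1 - α) - 1 = -α by ring]
          refine mul_le_mul_of_nonneg_left (Real.rpow_le_rpow_of_nonpos (by positivity) ?_ (by linarith)) hB.le
          push_cast; linarith
        have g2 : |w k - w (k + 1)| ≤ A * y ^ (α - 3) := by
          obtain ⟨m, hm⟩ : ∃ m, n = k + 2 + m := Nat.exists_eq_add_of_le (by omega)
          have e1 : n - k = m + 2 := by omega
          have e2 : n - (k + 1) = m + 1 := by omega
          have e3 : n - (k + 1 + 1) = m := by omega
          have hmr : (n : ℝ) = k + 2 + m := by exact_mod_cast hm
          have hkr : (k : ℝ) + 1 ≤ N := by exact_mod_cast hkN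
          simp only [hw, ha, e1, e2, e3]
          rw [show v (m + 2) - v (m + 1) - (v (m + 1) - v m) = v (m + 2) - 2 * v (m + 1) + v m by ring]
          exact (hv m).2.2.trans
            (mul_le_mul_of_nonneg_left (hpow _ _ (by rw [hy]; linarith) (by linarith)) hA.le)
        calc _ ≤ (B * ((k : ℝ) + 1) ^ ((1 - α) - 1)) * (A * y ^ (α - 3)) :=
              mul_le_mul g1 g2 (abs_nonneg _) (by positivity)
          _ = _ := by ring
      calc _ ≤ ∑ k ∈ Finset.range N, (A * B * y ^ (α - 3)) * ((k : ℝ) + 1) ^ ((1 - α) - 1) :=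
            (Finset.abs_sum_le_sum_abs _ _).trans (Finset.sum_le_sum h1)
        _ = (A * B * y ^ (α - 3)) * ∑ k ∈ Finset.range N, ((k : ℝ) + 1) ^ ((1 - α) - 1) := by rw [Finset.mul_sum]
        _ ≤ (A * B * y ^ (α - 3)) * ((2 * y) ^ (1 - α) / (1 - α)) := by
            refine mul_le_mul_of_nonneg_left ((sum_range_add_one_rpow_le (by linarith) (by linarith) N).trans ?_)
              (by positivity)
            have : 0 < 1 - α := by linarith
            gcongr
            rw [hy]; linarith [Nat.cast_nonneg (α := ℝ) N]
        _ = 2 ^ (1 - α) * (A * B / (1 - α)) * y ^ (-2 : ℝ) := by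
            rw [Real.mul_rpow (by norm_num) hy0.le, show (-2 : ℝ) = (α - 3) + (1 - α) by ring, Real.rpow_add hy0]; ring
        _ ≤ 2 * (A * B / (1 - α)) * y ^ (-2 : ℝ) := by
            have : (2:ℝ) ^ (1 - α) ≤ 2 ^ (1 : ℝ) := Real.rpow_le_rpow_of_exponent_le (by norm_num) (by linarith)
            rw [Real.rpow_one] at this
            have h3 : 0 < 1 - α := by linarith
            gcongr
        _ = _ := by rw [hy2]; ring
    calc _ ≤ |Q1 N * a N| + (|(∑ k ∈ Finset.range N, Q1 (k + 1)) * w N| +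
          |∑ k ∈ Finset.range N, (∑ j ∈ Finset.range (k + 1), Q1 (j + 1)) * (w k - w (k + 1))|) :=
          (abs_add_le _ _).trans (add_le_add le_rfl (abs_add_le _ _))
      _ ≤ _ := add_le_add t1 (add_le_add t2 t3)
      _ = _ := by ring
  have hhigh : |∑ k ∈ Finset.Ico N (n + 1), p k * a k| ≤ A * B * (16 / α) * (n : ℝ) ^ (-2 : ℝ) := by
    have h1 : ∀ k ∈ Finset.Ico N (n + 1), |p k * a k| ≤ (B * y ^ (-α - 2)) * (A * (((n - k : ℕ) : ℝ) + 1) ^ (α - 1)) := by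
      intro k hk
      have hk1 : (N : ℝ) ≤ k := by exact_mod_cast (Finset.mem_Ico.1 hk).1
      rw [abs_mul]
      exact mul_le_mul ((hp k).trans
        (mul_le_mul_of_nonneg_left (hpow _ _ (by rw [hy]; linarith) (by linarith)) hB.le))
        (hv (n - k)).1 (abs_nonneg _) (by positivity)
    have h2 : ∑ k ∈ Finset.Ico N (n + 1), (((n - k : ℕ) : ℝ) + 1) ^ (α - 1) ≤ 2 * (n : ℝ) ^ α / α := by
      calc ∑ k ∈ Finset.Ico N (n + 1), (((n - k : ℕ) : ℝ) + 1) ^ (α - 1)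
          ≤ ∑ k ∈ Finset.range (n + 1), (((n - k : ℕ) : ℝ) + 1) ^ (α - 1) := by
            refine Finset.sum_le_sum_of_subset_of_nonneg (fun k hk => ?_) (fun k _ _ => by positivity)
            exact Finset.mem_range.2 (Finset.mem_Ico.1 hk).2
        _ = ∑ k ∈ Finset.range (n + 1), ((k : ℝ) + 1) ^ (α - 1) := by
            rw [← Finset.sum_range_reflect (fun k => ((k : ℝ) + 1) ^ (α - 1))]
            refine Finset.sum_congr rfl fun k _ => ?_
            simp
        _ ≤ ((n + 1 : ℕ) : ℝ) ^ α / α := sum_range_add_one_rpow_le hα hα'.le _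
        _ ≤ (2 * (n : ℝ)) ^ α / α := by gcongr; push_cast; linarith
        _ ≤ 2 * (n : ℝ) ^ α / α := by
            rw [Real.mul_rpow (by norm_num) hn0.le]
            have : (2:ℝ) ^ α ≤ 2 ^ (1 : ℝ) := Real.rpow_le_rpow_of_exponent_le (by norm_num) hα'.le
            rw [Real.rpow_one] at this
            gcongr
    have hy3 : y ^ (-α - 2) ≤ 8 * (n : ℝ) ^ (-α - 2) := by
      rw [hy, Real.div_rpow hn0.le (by norm_num), div_eq_mul_inv, ← Real.rpow_neg (by norm_num), mul_comm]
      have : (2:ℝ) ^ (-(-α - 2)) ≤ 2 ^ (3 : ℝ) := Real.rpow_le_rpow_of_exponent_le (by norm_num) (by linarith)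
      have h8 : (2:ℝ) ^ (3:ℝ) = 8 := by norm_num
      rw [h8] at this
      gcongr
    calc _ ≤ ∑ k ∈ Finset.Ico N (n + 1), (B * y ^ (-α - 2)) * (A * (((n - k : ℕ) : ℝ) + 1) ^ (α - 1)) :=
          (Finset.abs_sum_le_sum_abs _ _).trans (Finset.sum_le_sum h1)
      _ = (B * y ^ (-α - 2)) * A * ∑ k ∈ Finset.Ico N (n + 1), (((n - k : ℕ) : ℝ) + 1) ^ (α - 1) := by
          rw [Finset.mul_sum]; exact Finset.sum_congr rfl fun _ _ => by ring
      _ ≤ (B * (8 * (n : ℝ) ^ (-α - 2))) * A * (2 * (n : ℝ) ^ α / α) := by gcongr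
      _ = A * B * (16 / α) * ((n : ℝ) ^ (-α - 2) * (n : ℝ) ^ α) := by ring
      _ = _ := by rw [← Real.rpow_add hn0]; ring_nf
  rw [← Finset.sum_range_add_sum_Ico _ (show N ≤ n + 1 by omega)]
  calc _ ≤ _ := abs_add_le _ _
    _ ≤ _ := add_le_add hlow hhigh
    _ = _ := by ring

/-! ### The error in the initial data -/

theorem coeff_succ_one_sub_X_mul (F : PowerSeries ℝ) (n : ℕ) : PowerSeries.coeff (n + 1) ((1 - PowerSeries.X) * F) =
    PowerSeries.coeff (n + 1) F - PowerSeries.coeff n F := by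
  rw [sub_mul, one_mul, map_sub, PowerSeries.coeff_succ_X_mul]

theorem coeff_zero_one_sub_X_mul (F : PowerSeries ℝ) : PowerSeries.coeff 0 ((1 - PowerSeries.X) * F) =
    PowerSeries.coeff 0 F := by
  rw [sub_mul, one_mul, map_sub, PowerSeries.coeff_zero_X_mul, sub_zero]

theorem sum_range_coeff_one_sub_X_mul (F : PowerSeries ℝ) (n : ℕ) :
    ∑ k ∈ Finset.range (n + 1), PowerSeries.coeff k ((1 - PowerSeries.X) * F) = PowerSeries.coeff n F := by
  induction n with
  | zero => simp
  | succ n ih => rw [Finset.sum_range_succ, ih, coeff_succ_one_sub_X_mul]; ring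

theorem glSeries_add_one (γ : ℝ) : glSeries (γ + 1) = (1 - PowerSeries.X) * glSeries γ := by
  ext n
  cases n with
  | zero => rw [coeff_zero_one_sub_X_mul]; simp [glSeries, glWeight]
  | succ n =>
    rw [coeff_succ_one_sub_X_mul]
    simp only [glSeries, PowerSeries.coeff_mk, glWeight_eq_choose, Ring.choose_succ_succ, pow_succ]
    ring

/-- The generating series of `n^{2-α} / Γ(3-α)`. -/
noncomputable def rhoSeries (α : ℝ) : PowerSeries ℝ :=
  PowerSeries.mk fun n => (n : ℝ) ^ (2 - α) / Real.Gamma (3 - α)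

/-- The generating series `(3 - X)/2` of the backward difference formula divided by `1 - X`. -/
noncomputable def bdfFactor : PowerSeries ℝ := PowerSeries.C (3 / 2) - PowerSeries.C (1 / 2) * PowerSeries.X

theorem bdfFactor_eq : bdfFactor = PowerSeries.C (3 / 2) + PowerSeries.C (-(1 / 2)) * PowerSeries.X := by
  rw [bdfFactor, map_neg]; ring

theorem hasJet_rhoSeries (α : ℝ) : HasJet (rhoSeries α) (2 - α) (1 / Real.Gamma (3 - α)) 0 := by
  refine (Asymptotics.isBigO_zero _ _).congr_left fun n => ?_
  rw [rhoSeries, PowerSeries.coeff_mk]; ring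

theorem Gamma_three_sub {α : ℝ} (hα' : α < 1) :
    Real.Gamma (3 - α) = (2 - α) * (1 - α) * Real.Gamma (1 - α) := by
  have h1 : 1 - α ≠ 0 := by linarith
  have h2 : 2 - α ≠ 0 := by linarith
  rw [show 3 - α = (2 - α) + 1 by ring, Real.Gamma_add_one h2, show 2 - α = (1 - α) + 1 by ring,
    Real.Gamma_add_one h1]
  ring

theorem hasJet_rhoSeries_diff {α : ℝ} (hα' : α < 1) : HasJet ((1 - PowerSeries.X) ^ 2 * rhoSeries α) (-α)
    (1 / Real.Gamma (1 - α)) (α / Real.Gamma (1 - α)) := by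
  have hG : 0 < Real.Gamma (1 - α) := Real.Gamma_pos_of_pos (by linarith)
  have h1 : 1 - α ≠ 0 := by linarith
  have h2 : 2 - α ≠ 0 := by linarith
  have t1 := (isBigO_sub_rpow (2 - α) 1 4).const_mul_left (-2 / Real.Gamma (3 - α))
  have t2 := (isBigO_sub_rpow (2 - α) 2 4).const_mul_left (1 / Real.Gamma (3 - α))
  have e : (2 - α) - ((4 : ℕ) : ℝ) = -α - 2 := by push_cast; ring
  have t := t1.add t2
  rw [e] at t
  refine t.congr' ?_ EventuallyEq.rfl
  filter_upwards [eventually_ge_atTop 2] with n hn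
  obtain ⟨m, rfl⟩ := Nat.exists_eq_add_of_le' hn
  have hn0 : (0 : ℝ) < ((m + 2 : ℕ) : ℝ) := by positivity
  rw [pow_two, mul_assoc, show m + 2 = m + 1 + 1 by ring, coeff_succ_one_sub_X_mul, coeff_succ_one_sub_X_mul,
    coeff_succ_one_sub_X_mul, rhoSeries, PowerSeries.coeff_mk, PowerSeries.coeff_mk, PowerSeries.coeff_mk,
    show m + 1 + 1 = m + 2 by ring]
  have c1 : ((m + 1 : ℕ) : ℝ) = ((m + 2 : ℕ) : ℝ) - 1 := by push_cast; ring
  have c2 : (m : ℝ) = ((m + 2 : ℕ) : ℝ) - 2 := by push_cast; ring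
  rw [c1, c2]
  generalize ((m + 2 : ℕ) : ℝ) = x at hn0
  generalize (x - 1) ^ (2 - α) = y₁
  generalize (x - 2) ^ (2 - α) = y₂
  simp only [Finset.sum_range_succ, Finset.range_zero, Finset.sum_empty, glWeight]
  push_cast
  rw [Gamma_three_sub hα', show 2 - α - 0 = -α + 2 by ring, show 2 - α - 1 = -α + 1 by ring,
    show 2 - α - 2 = -α by ring, show 2 - α - 3 = -α - 1 by ring, show 2 - α = -α + 2 by ring, Real.rpow_add hn0, Real.rpow_add hn0,
    Real.rpow_sub hn0, Real.rpow_one, Real.rpow_two]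
  have h2' : -α + 2 ≠ 0 := by linarith
  field_simp
  ring

/-- The generating series `(1-z)^{α-1} z (3-z)/2 - (1 - α/2 + α/2 z) δ(z)² ρ(z)`, where
`δ(z) = (1-z)(3-z)/2`; it measures the consistency of the treatment of the initial data. -/
noncomputable def initDefect (α : ℝ) : PowerSeries ℝ :=
  PowerSeries.X * (bdfFactor * glSeries (α - 1)) -
    avgSeries α * (bdfFactor * (bdfFactor * ((1 - PowerSeries.X) ^ 2 * rhoSeries α)))

/-- The second iterated partial sums of `initDefect`. -/
noncomputable def initDefectSum (α : ℝ) : PowerSeries ℝ :=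
  PowerSeries.X * (bdfFactor * glSeries (α - 3)) -
    avgSeries α * (bdfFactor * (bdfFactor * rhoSeries α))

theorem initDefect_eq (α : ℝ) :
    initDefect α = (1 - PowerSeries.X) * ((1 - PowerSeries.X) * initDefectSum α) := by
  have h : glSeries (α - 1) = (1 - PowerSeries.X) * ((1 - PowerSeries.X) * glSeries (α - 3)) := by
    rw [← glSeries_add_one, ← glSeries_add_one]; ring_nf
  rw [initDefect, initDefectSum, h]
  ring

/-- The terms of order `n^(-α)` and `n^(-α-1)` in the two parts of `initDefect` cancel. -/
theorem isBigO_initDefect {α : ℝ} (hα : 0 < α) (hα' : α < 1) :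
    (fun n => PowerSeries.coeff n (initDefect α)) =O[atTop] fun n : ℕ => (n : ℝ) ^ (-α - 2) := by
  have j1 := ((hasJet_glSeries_sub_one hα hα').linear_mul (3 / 2) (-(1 / 2))).X_mul
  have j2 := (((hasJet_rhoSeries_diff hα').linear_mul (3 / 2) (-(1 / 2))).linear_mul (3 / 2) (-(1 / 2))).linear_mul
    (1 - α / 2) (α / 2)
  rw [← bdfFactor_eq] at j1 j2
  refine HasJet.isBigO ((j1.sub j2).congr ?_ ?_) <;> ring

theorem isBigO_initDefectSum {α : ℝ} (hα : 0 < α) (hα' : α < 1) :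
    (fun n => PowerSeries.coeff n (initDefectSum α)) =O[atTop] fun n : ℕ => (n : ℝ) ^ (-α) := by
  have j1 := ((hasJet_glSeries_sub_three hα hα').linear_mul (3 / 2) (-(1 / 2))).X_mul
  have j2 := (((hasJet_rhoSeries α).linear_mul (3 / 2) (-(1 / 2))).linear_mul (3 / 2) (-(1 / 2))).linear_mul
    (1 - α / 2) (α / 2)
  rw [← bdfFactor_eq] at j1 j2
  have h := HasJet.isBigO ((j1.sub j2).congr (by ring) (by ring))
  rwa [show 2 - α - 2 = -α by ring] at h

/-- The double partial sums are the coefficients of `initDefectSum`, up to a shift, hence tend to zero. The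
simple partial sums are their differences, and are bounded by summing the terms from infinity. -/
theorem exists_initDefect_le {α : ℝ} (hα : 0 < α) (hα' : α < 1) : ∃ B : ℝ, 0 < B ∧
    (∀ n : ℕ, |PowerSeries.coeff n (initDefect α)| ≤ B * ((n : ℝ) + 1) ^ (-α - 2)) ∧
    (∀ n : ℕ, |∑ k ∈ Finset.range n, PowerSeries.coeff k (initDefect α)| ≤ B * ((n : ℝ) + 1) ^ (-α - 1)) ∧
    (∀ n : ℕ, |∑ j ∈ Finset.range n, ∑ k ∈ Finset.range j, PowerSeries.coeff k (initDefect α)| ≤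
      B * ((n : ℝ) + 1) ^ (-α)) := by
  set Q1 : ℕ → ℝ := fun n => ∑ k ∈ Finset.range n, PowerSeries.coeff k (initDefect α) with hQ1
  set Q2 : ℕ → ℝ := fun n => ∑ j ∈ Finset.range n, Q1 j with hQ2
  obtain ⟨B₀, hB₀, h0⟩ := exists_le_of_isBigO (by linarith) (isBigO_initDefect hα hα')
  have e1 : ∀ n, Q1 (n + 1) = PowerSeries.coeff n ((1 - PowerSeries.X) * initDefectSum α) := by
    intro n
    simp only [hQ1, initDefect_eq]
    rw [sum_range_coeff_one_sub_X_mul]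
  have e2 : ∀ n, Q2 (n + 2) = PowerSeries.coeff n (initDefectSum α) := by
    intro n
    simp only [hQ2]
    rw [Finset.sum_range_succ', ← sum_range_coeff_one_sub_X_mul]
    simp only [e1]
    simp [hQ1]
  have hlim2 : Tendsto Q2 atTop (𝓝 0) := by
    rw [← tendsto_add_atTop_iff_nat 2]
    simp only [e2]
    refine (isBigO_initDefectSum hα hα').trans_tendsto ?_
    exact (tendsto_rpow_neg_atTop hα).comp tendsto_natCast_atTop_atTop
  have hd2 : ∀ n, Q2 (n + 1) - Q2 n = Q1 n := by
    intro n
    simp only [hQ2]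
    rw [Finset.sum_range_succ]; ring
  have hlim1 : Tendsto Q1 atTop (𝓝 0) := by
    have := ((tendsto_add_atTop_iff_nat 1).2 hlim2).sub hlim2
    simpa only [hd2, sub_zero] using this
  have hd1 : ∀ n, |Q1 (n + 1) - Q1 n| ≤ B₀ * ((n : ℝ) + 1) ^ (-(α + 2)) := by
    intro n
    simp only [hQ1]
    rw [Finset.sum_range_succ, add_sub_cancel_left, neg_add']
    exact h0 n
  obtain ⟨B₁, hB₁, h1⟩ := exists_le_of_tendsto_zero (by linarith) hlim1 hd1
  rw [show 1 - (α + 2) = -α - 1 by ring] at h1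
  obtain ⟨B₂, hB₂, h2⟩ := exists_le_of_tendsto_zero (p := α + 1) (B := B₁) (by linarith) hlim2
    (fun n => by rw [hd2, neg_add']; exact h1 n)
  rw [show 1 - (α + 1) = -α by ring] at h2
  refine ⟨B₀ + B₁ + B₂, by positivity, fun n => (h0 n).trans ?_, fun n => (h1 n).trans ?_, fun n => (h2 n).trans ?_⟩
  all_goals
    refine mul_le_mul_of_nonneg_right ?_ (by positivity)
    linarith

/-- The factors with which the scheme propagates the initial value. -/
noncomputable def initCoeff (α lam : ℝ) (n : ℕ) : ℝ := PowerSeries.coeff n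
  (resolvent α lam * (avgSeries α * (bdfFactor * (bdfFactor * ((1 - PowerSeries.X) ^ 2 * rhoSeries α)))))

/-- The discrete counterpart of the identity behind the initial-value factors: `1 - lam ∑ K_m` differs from
the initial-value factor by the convolution of the resolvent coefficients with `initDefect`. -/
theorem one_sub_sum_srcCoeff {α lam : ℝ} (hα' : α < 1) (hl : 0 < lam) (n : ℕ) :
    1 - lam * ∑ m ∈ Finset.range n, srcCoeff α lam m - initCoeff α lam n =
      PowerSeries.coeff n (1 - PowerSeries.C (1 / 2) * PowerSeries.X) +
        PowerSeries.coeff n (resolvent α lam * initDefect α) := by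
  set G : PowerSeries ℝ := PowerSeries.mk fun n => 1 - lam * ∑ m ∈ Finset.range n, srcCoeff α lam m with hG
  have h1 : (1 - PowerSeries.X) * G = 1 - PowerSeries.C lam * (PowerSeries.X * srcSeries α lam) := by
    ext n
    cases n with
    | zero => rw [coeff_zero_one_sub_X_mul]; simp [hG]
    | succ n =>
      rw [coeff_succ_one_sub_X_mul, map_sub, PowerSeries.coeff_C_mul, PowerSeries.coeff_succ_X_mul, hG,
        PowerSeries.coeff_mk, PowerSeries.coeff_mk, Finset.sum_range_succ, PowerSeries.coeff_one, srcCoeff]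
      simp
      ring
  have h2 := symbol_mul_resolvent hα' hl.le
  have h3 : glSeries α = (1 - PowerSeries.X) * glSeries (α - 1) := by rw [← glSeries_add_one]; ring_nf
  rw [h3] at h2
  have hc : (PowerSeries.C (3 / 2 : ℝ) : PowerSeries ℝ) = 1 + PowerSeries.C (1 / 2) := by
    rw [← map_one (PowerSeries.C : ℝ →+* PowerSeries ℝ), ← map_add]; norm_num
  have hc2 : (PowerSeries.C (1 / 2 : ℝ) : PowerSeries ℝ) + PowerSeries.C (1 / 2) = 1 := by
    rw [← map_one (PowerSeries.C : ℝ →+* PowerSeries ℝ), ← map_add]; norm_num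
  have hne : (1 - PowerSeries.X : PowerSeries ℝ) ≠ 0 := by
    intro h
    have := congrArg (PowerSeries.coeff 0) h
    simp at this
  have key : G - resolvent α lam * (avgSeries α * (bdfFactor * (bdfFactor * ((1 - PowerSeries.X) ^ 2 * rhoSeries α)))) =
      (1 - PowerSeries.C (1 / 2) * PowerSeries.X) + resolvent α lam * initDefect α := by
    refine mul_left_cancel₀ hne ?_
    rw [mul_sub, h1, srcSeries, initDefect]
    have hb : PowerSeries.C (3 / 2) - PowerSeries.C (1 / 2) * PowerSeries.X = bdfFactor := rfl
    have hb2 : bdfFactor = 1 + PowerSeries.C (1 / 2) - PowerSeries.C (1 / 2) * PowerSeries.X := by rw [← hc]; rfl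
    rw [hb]
    have h4 : (1 : PowerSeries ℝ) - PowerSeries.X * bdfFactor = (1 - PowerSeries.X) * (1 - PowerSeries.C (1 / 2) * PowerSeries.X) := by
      rw [hb2]; ring
    linear_combination h4 - PowerSeries.X * bdfFactor * h2
  have := congrArg (PowerSeries.coeff n) key
  rw [map_sub, map_add, hG, PowerSeries.coeff_mk] at this
  exact this

/-- The scheme propagates the initial value with second-order accuracy. -/
theorem exists_initCoeff_sub_le {α : ℝ} (hα : 0 < α) (hα' : α < 1) : ∃ C : ℝ, 0 < C ∧
    ∀ lam : ℝ, 0 < lam → ∀ n : ℕ, 1 ≤ n →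
      |(1 - lam * ∫ x in (0 : ℝ)..n, resKernel α lam x) - initCoeff α lam n| ≤ C * (n : ℝ) ^ (-2 : ℝ) := by
  obtain ⟨A, hA, hv⟩ := exists_resCoeff_le hα hα'
  obtain ⟨B, hB, hp, hp1, hp2⟩ := exists_initDefect_le hα hα'
  obtain ⟨C₁, hC₁, h1⟩ := exists_kernErrInt_nat_le hα hα'
  have hα1 : 0 < 1 - α := by linarith
  refine ⟨C₁ + A * B * (8 + 8 / (1 - α) + 16 / α) + 1, by positivity, fun lam hl n hn => ?_⟩
  have e1 : kernErrInt α lam n = (∫ x in (0 : ℝ)..n, resKernel α lam x) - ∑ m ∈ Finset.range n, srcCoeff α lam m := by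
    have h2 := kernErrInt_eq_sub_sum hα hα' hl (Nat.zero_le n)
    rw [Nat.cast_zero, kernErrInt_zero, Finset.sum_sub_distrib, ← Finset.range_eq_Ico] at h2
    have h3 := intervalIntegral.sum_integral_adjacent_intervals (μ := volume) (f := resKernel α lam)
      (a := fun n : ℕ => (n : ℝ)) (n := n)
      (fun k _ => intervalIntegrable_resKernel hα hα' hl (Nat.cast_nonneg _) (Nat.cast_nonneg _))
    simp only [Nat.cast_zero, Nat.cast_add, Nat.cast_one] at h3
    linarith
  have e2 := one_sub_sum_srcCoeff hα' hl n
  have e3 : (1 - lam * ∫ x in (0 : ℝ)..n, resKernel α lam x) - initCoeff α lam n = -(lam * kernErrInt α lam n) +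
      (PowerSeries.coeff n (1 - PowerSeries.C (1 / 2) * PowerSeries.X) +
        PowerSeries.coeff n (resolvent α lam * initDefect α)) := by
    rw [← e2, e1]; ring
  have b1 : |-(lam * kernErrInt α lam n)| ≤ C₁ * (n : ℝ) ^ (-2 : ℝ) := by
    rw [abs_neg, abs_mul, abs_of_pos hl]; exact (h1 lam hl n hn).2
  have b2 : |PowerSeries.coeff n ((1 : PowerSeries ℝ) - PowerSeries.C (1 / 2) * PowerSeries.X)| ≤ (n : ℝ) ^ (-2 : ℝ) := by
    rw [map_sub, PowerSeries.coeff_C_mul, PowerSeries.coeff_one, PowerSeries.coeff_X, if_neg (by omega)]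
    by_cases h : n = 1
    · rw [if_pos h, h]; norm_num
    · rw [if_neg h]; norm_num
  have b3 : |PowerSeries.coeff n (resolvent α lam * initDefect α)| ≤
      A * B * (8 + 8 / (1 - α) + 16 / α) * (n : ℝ) ^ (-2 : ℝ) := by
    rw [mul_comm, PowerSeries.coeff_mul, Finset.Nat.sum_antidiagonal_eq_sum_range_succ
      (fun i j => PowerSeries.coeff i (initDefect α) * PowerSeries.coeff j (resolvent α lam))]
    exact abs_conv_le (v := resCoeff α lam) hα hα' hA hB (hv lam hl) hp hp1 hp2 hn
  rw [e3]
  calc _ ≤ _ := (abs_add_le _ _).trans (add_le_add b1 ((abs_add_le _ _).trans (add_le_add b2 b3)))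
    _ = _ := by ring

/-! ### The error in the source -/

theorem continuousWithinAt_kernErr {α lam x : ℝ} (hα : 0 < α) (hα' : α < 1) (hl : 0 < lam) (hx : 0 < x) :
    ContinuousWithinAt (kernErr α lam) (Ioi x) x := by
  have h1 : ContinuousWithinAt (resKernel α lam) (Ioi x) x :=
    ((continuousOn_resKernel hα hα' hl).continuousAt (Ioi_mem_nhds hx)).continuousWithinAt
  have h2 : ContinuousWithinAt (fun y : ℝ => srcCoeff α lam ⌊y⌋₊) (Ioi x) x := by
    refine ContinuousWithinAt.congr_of_eventuallyEq (continuousWithinAt_const (b := srcCoeff α lam ⌊x⌋₊)) ?_ rfl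
    have h3 : Ioo x (⌊x⌋₊ + 1 : ℝ) ∈ 𝓝[>] x := Ioo_mem_nhdsGT (Nat.lt_floor_add_one x)
    filter_upwards [h3] with y hy
    congr 1
    rw [Nat.floor_eq_iff (hx.le.trans hy.1.le)]
    exact ⟨(Nat.floor_le hx.le).trans hy.1.le, hy.2⟩
  exact h1.sub h2

theorem continuousOn_kernErrInt {α lam : ℝ} (hα : 0 < α) (hα' : α < 1) (hl : 0 < lam) {b : ℝ} (hb : 0 ≤ b) :
    ContinuousOn (kernErrInt α lam) (Icc 0 b) := by
  have h := intervalIntegral.continuousOn_primitive_interval' (a := (0 : ℝ))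
    (intervalIntegrable_kernErr hα hα' hl le_rfl hb) (by simp)
  rwa [uIcc_of_le hb] at h

theorem continuousOn_kernErrInt2 {α lam : ℝ} (hα : 0 < α) (hα' : α < 1) (hl : 0 < lam) {b : ℝ} (hb : 0 ≤ b) :
    ContinuousOn (kernErrInt2 α lam) (Icc 0 b) := by
  have h := intervalIntegral.continuousOn_primitive_interval' (a := (0 : ℝ))
    ((continuousOn_kernErrInt hα hα' hl hb).intervalIntegrable_of_Icc (μ := volume) hb) (by simp)
  rwa [uIcc_of_le hb] at h

theorem kernErrInt2_zero (α lam : ℝ) : kernErrInt2 α lam 0 = 0 := by simp [kernErrInt2]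

/-- Integration by parts against the kernel error, which is only piecewise continuous. -/
theorem integral_mul_kernErr {α lam : ℝ} (hα : 0 < α) (hα' : α < 1) (hl : 0 < lam) {b : ℝ} (hb : 0 ≤ b)
    {u u' : ℝ → ℝ} (hu : ContinuousOn u (Icc 0 b)) (hd : ∀ x ∈ Ioo 0 b, HasDerivAt u (u' x) x)
    (hi : IntervalIntegrable u' volume 0 b) :
    ∫ x in (0 : ℝ)..b, u x * kernErr α lam x =
      u b * kernErrInt α lam b - ∫ x in (0 : ℝ)..b, u' x * kernErrInt α lam x := by
  have h := intervalIntegral.integral_mul_deriv_eq_deriv_mul_of_hasDeriv_right (a := 0) (b := b)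
    (u := u) (v := kernErrInt α lam) (u' := u') (v' := kernErr α lam) (by rwa [uIcc_of_le hb])
    (by rw [uIcc_of_le hb]; exact continuousOn_kernErrInt hα hα' hl hb)
    (fun x hx => (hd x (by rwa [min_eq_left hb, max_eq_right hb] at hx)).hasDerivWithinAt)
    (fun x hx => by
      rw [min_eq_left hb, max_eq_right hb] at hx
      exact (intervalIntegral.integral_hasDerivWithinAt_right (s := Ici x) (t := Ioi x)
        (intervalIntegrable_kernErr hα hα' hl le_rfl hx.1.le)
        (measurable_kernErr α lam).stronglyMeasurable.stronglyMeasurableAtFilter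
        (continuousWithinAt_kernErr hα hα' hl hx.1)).mono Ioi_subset_Ici_self)
    hi (intervalIntegrable_kernErr hα hα' hl le_rfl hb)
  rw [h, kernErrInt_zero, mul_zero, sub_zero]

theorem integral_mul_kernErrInt {α lam : ℝ} (hα : 0 < α) (hα' : α < 1) (hl : 0 < lam) {b : ℝ} (hb : 0 ≤ b)
    {u u' : ℝ → ℝ} (hu : ContinuousOn u (Icc 0 b)) (hd : ∀ x ∈ Ioo 0 b, HasDerivAt u (u' x) x)
    (hi : IntervalIntegrable u' volume 0 b) :
    ∫ x in (0 : ℝ)..b, u x * kernErrInt α lam x =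
      u b * kernErrInt2 α lam b - ∫ x in (0 : ℝ)..b, u' x * kernErrInt2 α lam x := by
  have hc := continuousOn_kernErrInt hα hα' hl hb
  have h := intervalIntegral.integral_mul_deriv_eq_deriv_mul_of_hasDerivAt (a := 0) (b := b)
    (u := u) (v := kernErrInt2 α lam) (u' := u') (v' := kernErrInt α lam) (by rwa [uIcc_of_le hb])
    (by rw [uIcc_of_le hb]; exact continuousOn_kernErrInt2 hα hα' hl hb)
    (fun x hx => hd x (by rwa [min_eq_left hb, max_eq_right hb] at hx))
    (fun x hx => by
      rw [min_eq_left hb, max_eq_right hb] at hx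
      have hx1 : Icc 0 b ∈ 𝓝 x := Icc_mem_nhds hx.1 hx.2
      exact intervalIntegral.integral_hasDerivAt_right
        ((hc.mono (Icc_subset_Icc_right hx.2.le)).intervalIntegrable_of_Icc hx.1.le)
        ((hc.mono Ioo_subset_Icc_self).stronglyMeasurableAtFilter isOpen_Ioo x hx)
        (hc.continuousAt hx1))
    hi (hc.intervalIntegrable_of_Icc hb)
  rw [h, kernErrInt2_zero, mul_zero, sub_zero]

theorem rpow_le_two_rpow_mul {n y : ℝ} (hn : 0 < n) (hy : n / 2 ≤ y) (hy' : y ≤ n) (p : ℝ) :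
    y ^ p ≤ 2 ^ |p| * n ^ p := by
  have h0 : 0 < y := by linarith
  have h1 : (1 : ℝ) ≤ 2 ^ |p| := Real.one_le_rpow (by norm_num) (abs_nonneg p)
  rcases le_total 0 p with hp | hp
  · have h2 := Real.rpow_le_rpow h0.le hy' hp
    nlinarith [Real.rpow_pos_of_pos hn p]
  · have h2 := Real.rpow_le_rpow_of_nonpos (by positivity) hy hp
    rw [Real.div_rpow hn.le (by norm_num), div_eq_mul_inv, ← Real.rpow_neg (by norm_num), mul_comm] at h2
    rwa [abs_of_nonpos hp]

theorem intervalIntegrable_sub_rpow {n p a b : ℝ} (hp : -1 < p) :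
    IntervalIntegrable (fun x : ℝ => (n - x) ^ p) volume a b := by
  have h := (intervalIntegral.intervalIntegrable_rpow' (a := n - a) (b := n - b) hp).comp_sub_left n
  simpa using h

theorem integral_sub_rpow {n p : ℝ} (hp : -1 < p) :
    ∫ x in (0 : ℝ)..n, (n - x) ^ p = n ^ (p + 1) / (p + 1) := by
  rw [intervalIntegral.integral_comp_sub_left (fun x => x ^ p) n, sub_self, sub_zero, integral_rpow (Or.inl hp),
    Real.zero_rpow (by linarith), sub_zero]

/-- A bound of Beta type, with a factor `μ` that keeps it meaningful for `μ = 0`. -/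
theorem exists_integral_beta_le {α μ : ℝ} (hα : 0 < α) (hμ : 0 ≤ μ) : ∃ C : ℝ, 0 < C ∧
    ∀ n b : ℝ, 0 < n → 0 ≤ b → b ≤ n → ∀ F : ℝ → ℝ,
      (∀ x ∈ Ioo 0 b, |F x| ≤ μ * (n - x) ^ (μ - 1) * x ^ (α - 1)) →
      |∫ x in (0 : ℝ)..b, F x| ≤ C * n ^ (α + μ - 1) := by
  rcases hμ.eq_or_lt with h0 | h0
  · refine ⟨1, one_pos, fun n b hn hb hbn F hF => ?_⟩
    have : ∫ x in (0 : ℝ)..b, F x = ∫ x in (0 : ℝ)..b, (0 : ℝ) := by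
      refine intervalIntegral.integral_congr_ae ?_
      have hne : ∀ᵐ x : ℝ, x ≠ b := by simp [ae_iff]
      filter_upwards [hne] with x hxb hx
      rw [uIoc_of_le hb] at hx
      have := hF x ⟨hx.1, lt_of_le_of_ne hx.2 hxb⟩
      rw [← h0, zero_mul, zero_mul] at this
      exact abs_nonpos_iff.1 this
    rw [this]
    simp only [intervalIntegral.integral_zero, abs_zero]
    positivity
  · refine ⟨μ * (2 ^ |μ - 1| / α) + 2 ^ |α - 1|, by positivity, fun n b hn hb hbn F hF => ?_⟩
    set G : ℝ → ℝ := fun x => μ * (2 ^ |μ - 1| * n ^ (μ - 1)) * x ^ (α - 1) +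
      μ * (2 ^ |α - 1| * n ^ (α - 1)) * (n - x) ^ (μ - 1) with hG
    have i1 : ∀ b : ℝ, IntervalIntegrable (fun x : ℝ => x ^ (α - 1)) volume 0 b := fun b =>
      intervalIntegral.intervalIntegrable_rpow' (by linarith)
    have i2 : ∀ b : ℝ, IntervalIntegrable (fun x : ℝ => (n - x) ^ (μ - 1)) volume 0 b := fun b =>
      intervalIntegrable_sub_rpow (by linarith)
    have hGi : ∀ b : ℝ, IntervalIntegrable G volume 0 b := fun b =>
      ((i1 b).const_mul _).add ((i2 b).const_mul _)
    have hG0 : ∀ x ∈ Ioc 0 n, 0 ≤ G x := by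
      intro x hx
      have h1 : 0 ≤ n - x := by linarith [hx.2]
      have h2 := hx.1.le
      have h3 : 0 ≤ (n - x) ^ (μ - 1) := Real.rpow_nonneg h1 _
      have h4 : 0 ≤ x ^ (α - 1) := Real.rpow_nonneg h2 _
      positivity
    have hne : ∀ᵐ x : ℝ, x ≠ b := by simp [ae_iff]
    have hFG : ∀ᵐ x : ℝ, x ∈ Ioc 0 b → ‖F x‖ ≤ G x := by
      filter_upwards [hne] with x hxb hx
      have hxb' : x < b := lt_of_le_of_ne hx.2 hxb
      refine (hF x ⟨hx.1, hxb'⟩).trans ?_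
      have hx0 := hx.1
      have p1 : 0 < (n - x) ^ (μ - 1) := Real.rpow_pos_of_pos (by linarith) _
      have p2 : 0 < x ^ (α - 1) := Real.rpow_pos_of_pos hx.1 _
      rcases le_total x (n / 2) with h | h
      · have h1 := rpow_le_two_rpow_mul (y := n - x) hn (by linarith) (by linarith) (μ - 1)
        have h2 : μ * (n - x) ^ (μ - 1) * x ^ (α - 1) ≤ μ * (2 ^ |μ - 1| * n ^ (μ - 1)) * x ^ (α - 1) :=
          mul_le_mul_of_nonneg_right (mul_le_mul_of_nonneg_left h1 hμ) p2.le
        have h3 : 0 ≤ μ * (2 ^ |α - 1| * n ^ (α - 1)) * (n - x) ^ (μ - 1) := by positivity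
        simp only [hG]
        linarith
      · have h1 := rpow_le_two_rpow_mul (y := x) hn h (by linarith) (α - 1)
        have h2 : μ * (n - x) ^ (μ - 1) * x ^ (α - 1) ≤ μ * (n - x) ^ (μ - 1) * (2 ^ |α - 1| * n ^ (α - 1)) :=
          mul_le_mul_of_nonneg_left h1 (by positivity)
        have h3 : 0 ≤ μ * (2 ^ |μ - 1| * n ^ (μ - 1)) * x ^ (α - 1) := by positivity
        simp only [hG]
        linarith
    have e1 : ∫ x in (0 : ℝ)..n, x ^ (α - 1) = n ^ α / α := by
      rw [integral_rpow (Or.inl (by linarith)), sub_add_cancel, Real.zero_rpow hα.ne', sub_zero]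
    have e2 : ∫ x in (0 : ℝ)..n, (n - x) ^ (μ - 1) = n ^ μ / μ := by
      rw [integral_sub_rpow (by linarith), sub_add_cancel]
    have n1 : n ^ (μ - 1) * n ^ α = n ^ (α + μ - 1) := by rw [← Real.rpow_add hn]; ring_nf
    have n2 : n ^ (α - 1) * n ^ μ = n ^ (α + μ - 1) := by rw [← Real.rpow_add hn]; ring_nf
    calc |∫ x in (0 : ℝ)..b, F x| ≤ ∫ x in (0 : ℝ)..b, G x :=
          intervalIntegral.norm_integral_le_of_norm_le hb hFG (hGi b)
      _ ≤ ∫ x in (0 : ℝ)..n, G x := by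
          refine intervalIntegral.integral_mono_interval le_rfl hb hbn ?_ (hGi n)
          filter_upwards [ae_restrict_mem measurableSet_Ioc] with x hx using hG0 x hx
      _ = μ * (2 ^ |μ - 1| / α) * (n ^ (μ - 1) * n ^ α) + 2 ^ |α - 1| * (n ^ (α - 1) * n ^ μ) := by
          simp only [hG]
          rw [intervalIntegral.integral_add ((i1 n).const_mul _) ((i2 n).const_mul _),
            intervalIntegral.integral_const_mul, intervalIntegral.integral_const_mul, e1, e2]
          field_simp
      _ = _ := by rw [n1, n2]; ring

theorem hasDerivAt_sub_rpow {n x : ℝ} (hx : x < n) (p : ℝ) :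
    HasDerivAt (fun x : ℝ => (n - x) ^ p) (-(p * (n - x) ^ (p - 1))) x := by
  have h1 : HasDerivAt (fun x : ℝ => n - x) (-1) x := by simpa using (hasDerivAt_id x).const_sub n
  have h := h1.rpow_const (p := p) (Or.inl (by linarith))
  exact h.congr_deriv (by ring)

theorem continuous_sub_rpow (n : ℝ) {p : ℝ} (hp : 0 ≤ p) : Continuous fun x : ℝ => (n - x) ^ p :=
  (Real.continuous_rpow_const hp).comp (continuous_const.sub continuous_id)

/-- The error for the source `t^μ`. -/
theorem exists_integral_rpow_mul_kernErr_le {α μ : ℝ} (hα : 0 < α) (hα' : α < 1) (hμ : 0 ≤ μ) :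
    ∃ C : ℝ, 0 < C ∧ ∀ lam n : ℝ, 0 < lam → 0 < n →
      |∫ x in (0 : ℝ)..n, (n - x) ^ μ * kernErr α lam x| ≤ C * n ^ (α + μ - 2) := by
  obtain ⟨C₁, hC₁, h1⟩ := exists_kernErrInt_le hα hα'
  obtain ⟨C₂, hC₂, h2⟩ := exists_kernErrInt2_le hα hα'
  rcases hμ.eq_or_lt with h0 | h0
  · refine ⟨C₁, hC₁, fun lam n hl hn => ?_⟩
    simp only [← h0, Real.rpow_zero, one_mul, add_zero]
    exact (h1 lam n hl hn).1
  · refine ⟨μ * (2 ^ |μ - 1| * (C₂ * 2 ^ |α - 1|) + |μ - 1| * (2 ^ |μ - 2| * (C₂ / α))) +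
      C₁ * 2 ^ |α - 2|, by positivity, fun lam n hl hn => ?_⟩
    have hn2 : 0 < n / 2 := by positivity
    have hn2' : n / 2 ≤ n := by linarith
    have iβ : ∀ a b : ℝ, IntervalIntegrable (fun x : ℝ => (n - x) ^ (μ - 1)) volume a b := fun a b =>
      intervalIntegrable_sub_rpow (by linarith)
    have e1 := integral_mul_kernErr hα hα' hl hn.le (continuous_sub_rpow n hμ).continuousOn
      (fun x hx => hasDerivAt_sub_rpow hx.2 μ) ((iβ 0 n).const_mul μ).neg
    rw [sub_self, Real.zero_rpow h0.ne', zero_mul, zero_sub] at e1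
    have hc : ContinuousOn (kernErrInt α lam) (uIcc 0 n) := by
      rw [uIcc_of_le hn.le]; exact continuousOn_kernErrInt hα hα' hl hn.le
    have i0 : IntervalIntegrable (fun x => (n - x) ^ (μ - 1) * kernErrInt α lam x) volume 0 n :=
      (iβ 0 n).mul_continuousOn hc
    have hs1 : uIcc 0 (n / 2) ⊆ uIcc 0 n := by
      rw [uIcc_of_le hn.le, uIcc_of_le hn2.le]; exact Icc_subset_Icc_right hn2'
    have hs2 : uIcc (n / 2) n ⊆ uIcc 0 n := by
      rw [uIcc_of_le hn.le, uIcc_of_le hn2']; exact Icc_subset_Icc_left hn2.le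
    have e2 : ∫ x in (0 : ℝ)..n, (n - x) ^ μ * kernErr α lam x =
        μ * ((∫ x in (0 : ℝ)..(n / 2), (n - x) ^ (μ - 1) * kernErrInt α lam x) +
          ∫ x in (n / 2)..n, (n - x) ^ (μ - 1) * kernErrInt α lam x) := by
      rw [e1, intervalIntegral.integral_add_adjacent_intervals (i0.mono_set hs1) (i0.mono_set hs2),
        ← intervalIntegral.integral_const_mul, ← intervalIntegral.integral_neg]
      refine intervalIntegral.integral_congr fun x _ => ?_
      ring
    have hc3 : ContinuousOn (fun x : ℝ => (n - x) ^ (μ - 1)) (Icc 0 (n / 2)) := fun x hx =>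
      (hasDerivAt_sub_rpow (by linarith [hx.2]) _).continuousAt.continuousWithinAt
    have hc4 : ContinuousOn (fun x : ℝ => -((μ - 1) * (n - x) ^ (μ - 1 - 1))) (Icc 0 (n / 2)) := fun x hx =>
      ((hasDerivAt_sub_rpow (by linarith [hx.2]) _).continuousAt.const_mul _).neg.continuousWithinAt
    have e3 := integral_mul_kernErrInt hα hα' hl hn2.le hc3
      (fun x hx => hasDerivAt_sub_rpow (by linarith [hx.2]) (μ - 1)) (hc4.intervalIntegrable_of_Icc hn2.le)
    have b1 : |(n - n / 2) ^ (μ - 1) * kernErrInt2 α lam (n / 2)| ≤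
        2 ^ |μ - 1| * (C₂ * 2 ^ |α - 1|) * n ^ (α + μ - 2) := by
      have p : 0 ≤ (n - n / 2) ^ (μ - 1) := Real.rpow_nonneg (by linarith) _
      rw [abs_mul, abs_of_nonneg p]
      calc _ ≤ (2 ^ |μ - 1| * n ^ (μ - 1)) * (C₂ * (2 ^ |α - 1| * n ^ (α - 1))) := by
            refine mul_le_mul (rpow_le_two_rpow_mul hn (by linarith) (by linarith) _)
              ((h2 lam (n / 2) hl hn2).trans
                (mul_le_mul_of_nonneg_left (rpow_le_two_rpow_mul hn le_rfl hn2' _) hC₂.le))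
              (abs_nonneg _) (by positivity)
        _ = _ := by
            rw [show α + μ - 2 = (μ - 1) + (α - 1) by ring, Real.rpow_add hn]; ring
    have b2 : |∫ x in (0 : ℝ)..(n / 2), -((μ - 1) * (n - x) ^ (μ - 1 - 1)) * kernErrInt2 α lam x| ≤
        |μ - 1| * (2 ^ |μ - 2| * (C₂ / α)) * n ^ (α + μ - 2) := by
      have i1 : IntervalIntegrable (fun x : ℝ => x ^ (α - 1)) volume 0 (n / 2) :=
        intervalIntegral.intervalIntegrable_rpow' (by linarith)
      calc _ ≤ ∫ x in (0 : ℝ)..(n / 2), (|μ - 1| * (2 ^ |μ - 2| * n ^ (μ - 2)) * C₂) * x ^ (α - 1) := by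
            rw [← Real.norm_eq_abs]
            refine intervalIntegral.norm_integral_le_of_norm_le hn2.le (Eventually.of_forall fun x hx => ?_)
              (i1.const_mul _)
            have p : 0 ≤ (n - x) ^ (μ - 2) := Real.rpow_nonneg (by linarith [hx.2]) _
            rw [show μ - 1 - 1 = μ - 2 by ring, Real.norm_eq_abs, abs_mul, abs_neg, abs_mul, abs_of_nonneg p,
              mul_assoc (|μ - 1| * _) C₂]
            exact mul_le_mul (mul_le_mul_of_nonneg_left
              (rpow_le_two_rpow_mul hn (by linarith [hx.2]) (by linarith [hx.1]) _) (abs_nonneg _))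
              (h2 lam x hl hx.1) (abs_nonneg _) (by positivity)
        _ = (|μ - 1| * (2 ^ |μ - 2| * n ^ (μ - 2)) * C₂) * ((n / 2) ^ α / α) := by
            rw [intervalIntegral.integral_const_mul, integral_rpow (Or.inl (by linarith)), sub_add_cancel,
              Real.zero_rpow hα.ne', sub_zero]
        _ ≤ (|μ - 1| * (2 ^ |μ - 2| * n ^ (μ - 2)) * C₂) * (n ^ α / α) := by gcongr
        _ = _ := by rw [show α + μ - 2 = (μ - 2) + α by ring, Real.rpow_add hn]; ring
    have b3 : |∫ x in (n / 2)..n, (n - x) ^ (μ - 1) * kernErrInt α lam x| ≤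
        C₁ * 2 ^ |α - 2| / μ * n ^ (α + μ - 2) := by
      have g0 : ∀ x ∈ Ioc 0 n, 0 ≤ (C₁ * (2 ^ |α - 2| * n ^ (α - 2))) * (n - x) ^ (μ - 1) := fun x hx =>
        mul_nonneg (by positivity) (Real.rpow_nonneg (by linarith [hx.2]) _)
      calc _ ≤ ∫ x in (n / 2)..n, (C₁ * (2 ^ |α - 2| * n ^ (α - 2))) * (n - x) ^ (μ - 1) := by
            rw [← Real.norm_eq_abs]
            refine intervalIntegral.norm_integral_le_of_norm_le hn2' (Eventually.of_forall fun x hx => ?_)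
              ((iβ _ _).const_mul _)
            have p : 0 ≤ (n - x) ^ (μ - 1) := Real.rpow_nonneg (by linarith [hx.2]) _
            rw [Real.norm_eq_abs, abs_mul, abs_of_nonneg p, mul_comm]
            exact mul_le_mul_of_nonneg_right ((h1 lam x hl (hn2.trans hx.1)).1.trans
              (mul_le_mul_of_nonneg_left (rpow_le_two_rpow_mul hn hx.1.le hx.2 _) hC₁.le)) p
        _ ≤ ∫ x in (0 : ℝ)..n, (C₁ * (2 ^ |α - 2| * n ^ (α - 2))) * (n - x) ^ (μ - 1) := by
            refine intervalIntegral.integral_mono_interval hn2.le hn2' le_rfl ?_ ((iβ _ _).const_mul _)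
            filter_upwards [ae_restrict_mem measurableSet_Ioc] with x hx using g0 x hx
        _ = _ := by
            rw [intervalIntegral.integral_const_mul, integral_sub_rpow (by linarith), sub_add_cancel,
              show α + μ - 2 = (α - 2) + μ by ring, Real.rpow_add hn]
            ring
    rw [e2, abs_mul, abs_of_pos h0]
    calc _ ≤ μ * ((2 ^ |μ - 1| * (C₂ * 2 ^ |α - 1|) * n ^ (α + μ - 2) +
          |μ - 1| * (2 ^ |μ - 2| * (C₂ / α)) * n ^ (α + μ - 2)) + C₁ * 2 ^ |α - 2| / μ * n ^ (α + μ - 2)) := by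
          refine mul_le_mul_of_nonneg_left ((abs_add_le _ _).trans (add_le_add ?_ b3)) hμ
          rw [e3]
          exact (abs_sub _ _).trans (add_le_add b1 b2)
      _ = _ := by field_simp

/-- The error for the source `t^{μ+1}`. -/
theorem exists_integral_rpow_add_one_mul_kernErr_le {α μ : ℝ} (hα : 0 < α) (hα' : α < 1) (hμ : 0 ≤ μ) :
    ∃ C : ℝ, 0 < C ∧ ∀ lam n : ℝ, 0 < lam → 0 < n →
      |∫ x in (0 : ℝ)..n, (n - x) ^ (μ + 1) * kernErr α lam x| ≤ C * n ^ (α + μ - 1) := by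
  obtain ⟨C₂, hC₂, h2⟩ := exists_kernErrInt2_le hα hα'
  obtain ⟨C₃, hC₃, h3⟩ := exists_integral_beta_le hα hμ
  refine ⟨(μ + 1) * (C₂ + C₂ * C₃), by positivity, fun lam n hl hn => ?_⟩
  have e1 := integral_mul_kernErr hα hα' hl hn.le (continuous_sub_rpow n (by linarith : 0 ≤ μ + 1)).continuousOn
    (fun x hx => hasDerivAt_sub_rpow hx.2 (μ + 1))
    ((intervalIntegrable_sub_rpow (by linarith)).const_mul (μ + 1)).neg
  rw [sub_self, Real.zero_rpow (by linarith), zero_mul, zero_sub, add_sub_cancel_right] at e1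
  have e2 : ∫ x in (0 : ℝ)..n, (n - x) ^ (μ + 1) * kernErr α lam x =
      (μ + 1) * ∫ x in (0 : ℝ)..n, (n - x) ^ μ * kernErrInt α lam x := by
    rw [e1, ← intervalIntegral.integral_const_mul, ← intervalIntegral.integral_neg]
    refine intervalIntegral.integral_congr fun x _ => ?_
    ring
  have hi : IntervalIntegrable (fun x : ℝ => -(μ * (n - x) ^ (μ - 1))) volume 0 n := by
    rcases hμ.eq_or_lt with h0 | h0
    · simp [← h0]
    · exact ((intervalIntegrable_sub_rpow (by linarith)).const_mul μ).neg
  have e3 := integral_mul_kernErrInt hα hα' hl hn.le (continuous_sub_rpow n hμ).continuousOn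
    (fun x hx => hasDerivAt_sub_rpow hx.2 μ) hi
  have b1 : |(n - n) ^ μ * kernErrInt2 α lam n| ≤ C₂ * n ^ (α + μ - 1) := by
    rcases hμ.eq_or_lt with h0 | h0
    · rw [← h0, Real.rpow_zero, one_mul, add_zero]; exact h2 lam n hl hn
    · rw [sub_self, Real.zero_rpow h0.ne', zero_mul, abs_zero]; positivity
  have b2 : |∫ x in (0 : ℝ)..n, -(μ * (n - x) ^ (μ - 1)) * kernErrInt2 α lam x| ≤ C₂ * (C₃ * n ^ (α + μ - 1)) := by
    have := h3 n n hn hn.le le_rfl (fun x => C₂⁻¹ * (-(μ * (n - x) ^ (μ - 1)) * kernErrInt2 α lam x)) ?_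
    · rw [intervalIntegral.integral_const_mul, abs_mul, abs_of_pos (by positivity)] at this
      rwa [inv_mul_le_iff₀ hC₂] at this
    · intro x hx
      have p : 0 ≤ μ * (n - x) ^ (μ - 1) := mul_nonneg hμ (Real.rpow_nonneg (by linarith [hx.2]) _)
      rw [abs_mul, abs_mul, abs_neg, abs_of_nonneg p, abs_of_pos (by positivity), inv_mul_le_iff₀ hC₂]
      calc _ ≤ (μ * (n - x) ^ (μ - 1)) * (C₂ * x ^ (α - 1)) :=
            mul_le_mul_of_nonneg_left (h2 lam x hl hx.1) p
        _ = _ := by ring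
  rw [e2, abs_mul, abs_of_pos (by linarith), e3]
  calc _ ≤ (μ + 1) * (C₂ * n ^ (α + μ - 1) + C₂ * (C₃ * n ^ (α + μ - 1))) :=
        mul_le_mul_of_nonneg_left ((abs_sub _ _).trans (add_le_add b1 b2)) (by linarith)
    _ = _ := by ring

/-- The error at time `n` for the source that is `t^μ (t - s)` for `t > s`, and zero before. -/
noncomputable def peanoErr (α μ lam n s : ℝ) : ℝ :=
  ∫ x in (0 : ℝ)..(n - s), (n - x) ^ μ * (n - s - x) * kernErr α lam x

/-- Two integrations by parts move the derivatives from the second antiderivative of the kernel error to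
the weight `(n - x)^μ (n - s - x)`. -/
theorem exists_peanoErr_le {α μ : ℝ} (hα : 0 < α) (hα' : α < 1) (hμ : 0 ≤ μ) :
    ∃ C : ℝ, 0 < C ∧ ∀ lam n s : ℝ, 0 < lam → 0 < s → s < n →
      |peanoErr α μ lam n s| ≤ C * (n ^ (α + μ - 1) + (n - s) ^ (α - 1) * s ^ μ) := by
  obtain ⟨C₂, hC₂, h2⟩ := exists_kernErrInt2_le hα hα'
  obtain ⟨C₃, hC₃, h3⟩ := exists_integral_beta_le hα hμ
  set M := 2 + |μ - 1| with hM
  have hM0 : 0 < M := by positivity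
  refine ⟨C₂ + M * C₂ * C₃, by positivity, fun lam n s hl hs hsn => ?_⟩
  have hn : 0 < n := hs.trans hsn
  have hb : 0 ≤ n - s := by linarith
  have hd1 : ∀ x : ℝ, HasDerivAt (fun x : ℝ => n - s - x) (-1) x := fun x => by
    simpa using (hasDerivAt_id x).const_sub (n - s)
  set ψ : ℝ → ℝ := fun x => μ * (n - x) ^ (μ - 1) * (n - s - x) + (n - x) ^ μ with hψ
  set ψ' : ℝ → ℝ := fun x => -(2 * (μ * (n - x) ^ (μ - 1)) + μ * ((μ - 1) * (n - x) ^ (μ - 2)) * (n - s - x)) with hψ'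
  have hφd : ∀ x, x < n → HasDerivAt (fun x : ℝ => (n - x) ^ μ * (n - s - x)) (-ψ x) x := by
    intro x hx
    exact ((hasDerivAt_sub_rpow hx μ).mul (hd1 x)).congr_deriv (by simp only [hψ]; ring)
  have hψd : ∀ x, x < n → HasDerivAt ψ (ψ' x) x := by
    intro x hx
    have := (((hasDerivAt_sub_rpow hx (μ - 1)).const_mul μ).mul (hd1 x)).add (hasDerivAt_sub_rpow hx μ)
    refine this.congr_deriv ?_
    simp only [hψ']
    rw [show μ - 1 - 1 = μ - 2 by ring]; ring
  have hψ'c : ∀ x, x < n → ContinuousAt ψ' x := by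
    intro x hx
    exact (((((hasDerivAt_sub_rpow hx (μ - 1)).continuousAt.const_mul μ).const_mul 2).add
      ((((hasDerivAt_sub_rpow hx (μ - 2)).continuousAt.const_mul (μ - 1)).const_mul μ).mul (hd1 x).continuousAt))).neg
  have hlt : ∀ x ∈ Icc 0 (n - s), x < n := fun x hx => by linarith [hx.2]
  have e1 := integral_mul_kernErr hα hα' hl hb (fun x hx => (hφd x (hlt x hx)).continuousAt.continuousWithinAt)
    (fun x hx => hφd x (hlt x (Ioo_subset_Icc_self hx)))
    (ContinuousOn.intervalIntegrable_of_Icc hb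
      fun x hx => (hψd x (hlt x hx)).continuousAt.neg.continuousWithinAt)
  have e2 := integral_mul_kernErrInt hα hα' hl hb (fun x hx => (hψd x (hlt x hx)).continuousAt.continuousWithinAt)
    (fun x hx => hψd x (hlt x (Ioo_subset_Icc_self hx)))
    (ContinuousOn.intervalIntegrable_of_Icc hb fun x hx => (hψ'c x (hlt x hx)).continuousWithinAt)
  have e3 : peanoErr α μ lam n s = s ^ μ * kernErrInt2 α lam (n - s) -
      ∫ x in (0 : ℝ)..(n - s), ψ' x * kernErrInt2 α lam x := by
    rw [peanoErr, e1, sub_self, mul_zero, zero_mul, zero_sub]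
    simp only [neg_mul, intervalIntegral.integral_neg, neg_neg]
    rw [e2]
    simp [hψ]
  have b1 : |s ^ μ * kernErrInt2 α lam (n - s)| ≤ C₂ * ((n - s) ^ (α - 1) * s ^ μ) := by
    rw [abs_mul, abs_of_nonneg (by positivity)]
    calc _ ≤ s ^ μ * (C₂ * (n - s) ^ (α - 1)) :=
          mul_le_mul_of_nonneg_left (h2 lam _ hl (by linarith)) (by positivity)
      _ = _ := by ring
  have b2 : |∫ x in (0 : ℝ)..(n - s), ψ' x * kernErrInt2 α lam x| ≤ M * C₂ * (C₃ * n ^ (α + μ - 1)) := by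
    have := h3 n (n - s) hn hb (by linarith) (fun x => (M * C₂)⁻¹ * (ψ' x * kernErrInt2 α lam x)) ?_
    · rw [intervalIntegral.integral_const_mul, abs_mul, abs_of_pos (by positivity)] at this
      rwa [inv_mul_le_iff₀ (by positivity)] at this
    · intro x hx
      have hxn : 0 < n - x := by linarith [hx.2]
      have hψb : |ψ' x| ≤ M * (μ * (n - x) ^ (μ - 1)) := by
        have q1 : |μ * ((μ - 1) * (n - x) ^ (μ - 2)) * (n - s - x)| ≤ |μ - 1| * (μ * (n - x) ^ (μ - 1)) := by
          rw [abs_mul, abs_mul, abs_mul, abs_of_nonneg hμ, abs_of_pos (Real.rpow_pos_of_pos hxn _),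
            abs_of_pos (by linarith [hx.2] : 0 < n - s - x)]
          calc _ ≤ μ * (|μ - 1| * (n - x) ^ (μ - 2)) * (n - x) :=
                mul_le_mul_of_nonneg_left (by linarith) (by positivity)
            _ = _ := by
                rw [show μ - 1 = (μ - 2) + 1 by ring, Real.rpow_add_one hxn.ne']; ring
        rw [abs_neg]
        refine (abs_add_le _ _).trans ?_
        rw [abs_of_nonneg (by positivity : 0 ≤ 2 * (μ * (n - x) ^ (μ - 1))), hM, add_mul]
        linarith
      rw [abs_mul, abs_mul, abs_of_pos (by positivity), inv_mul_le_iff₀ (by positivity)]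
      calc _ ≤ (M * (μ * (n - x) ^ (μ - 1))) * (C₂ * x ^ (α - 1)) :=
            mul_le_mul hψb (h2 lam x hl hx.1) (abs_nonneg _) (by positivity)
        _ = _ := by ring
  rw [e3]
  have p1 : 0 ≤ n ^ (α + μ - 1) := by positivity
  have p2 : 0 ≤ (n - s) ^ (α - 1) * s ^ μ := by positivity
  calc _ ≤ C₂ * ((n - s) ^ (α - 1) * s ^ μ) + M * C₂ * (C₃ * n ^ (α + μ - 1)) :=
        (abs_sub _ _).trans (add_le_add b1 b2)
    _ ≤ _ := by
        have q1 : 0 ≤ C₂ * n ^ (α + μ - 1) := by positivity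
        have q2 : 0 ≤ M * C₂ * C₃ * ((n - s) ^ (α - 1) * s ^ μ) := by positivity
        linarith

theorem integral_max_mul {F G : ℝ → ℝ} {b c : ℝ} (hb : 0 ≤ b) (hbc : b ≤ c)
    (h : ∀ x ∈ Icc b c, F x = 0) (h' : ∀ x ∈ Icc 0 b, F x = G x) :
    ∫ x in (0 : ℝ)..c, F x = ∫ x in (0 : ℝ)..b, G x := by
  have e : ∀ x ∈ Ioc 0 c, F x = (Ioc 0 b).indicator G x := by
    intro x hx
    by_cases hxb : x ≤ b
    · rw [indicator_of_mem (show x ∈ Ioc 0 b from ⟨hx.1, hxb⟩), h' x ⟨hx.1.le, hxb⟩]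
    · rw [indicator_of_notMem (fun h => hxb h.2), h x ⟨(not_le.1 hxb).le, hx.2⟩]
  rw [intervalIntegral.integral_of_le (hb.trans hbc), intervalIntegral.integral_of_le hb,
    setIntegral_congr_fun measurableSet_Ioc e, setIntegral_indicator measurableSet_Ioc,
    inter_eq_self_of_subset_right (Ioc_subset_Ioc_right hbc)]

/-- The Peano representation of the error of the source discretisation, for a source
`t^μ g(t)` whose factor `g` is given by its Taylor expansion with integral remainder. -/
theorem integral_source_mul_kernErr {α μ lam n : ℝ} (hα : 0 < α) (hα' : α < 1) (hμ : 0 ≤ μ) (hl : 0 < lam) (hn : 0 < n)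
    {f q : ℝ → ℝ} {a₀ a₁ : ℝ} (hq : IntervalIntegrable q volume 0 n)
    (hf : ∀ y ∈ Icc 0 n, f y = y ^ μ * (a₀ + a₁ * y + ∫ s in (0 : ℝ)..y, (y - s) * q s)) :
    IntervalIntegrable (fun s => peanoErr α μ lam n s * q s) volume 0 n ∧
    ∫ x in (0 : ℝ)..n, f (n - x) * kernErr α lam x =
      a₀ * (∫ x in (0 : ℝ)..n, (n - x) ^ μ * kernErr α lam x) +
      a₁ * (∫ x in (0 : ℝ)..n, (n - x) ^ (μ + 1) * kernErr α lam x) +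
      ∫ s in (0 : ℝ)..n, peanoErr α μ lam n s * q s := by
  have hD := intervalIntegrable_kernErr hα hα' hl le_rfl hn.le
  have hD1 : Integrable (kernErr α lam) (volume.restrict (Ioc 0 n)) :=
    (intervalIntegrable_iff_integrableOn_Ioc_of_le hn.le).1 hD
  have hq1 : Integrable q (volume.restrict (Ioc 0 n)) :=
    (intervalIntegrable_iff_integrableOn_Ioc_of_le hn.le).1 hq
  set Φ : ℝ × ℝ → ℝ := fun z => ((n - z.1) ^ μ * max (n - z.1 - z.2) 0) * (kernErr α lam z.1 * q z.2) with hΦ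
  have hw : Continuous fun z : ℝ × ℝ => (n - z.1) ^ μ * max (n - z.1 - z.2) 0 := by
    have h1 := (continuous_sub_rpow n hμ).comp (continuous_fst (X := ℝ) (Y := ℝ))
    exact h1.mul (by fun_prop)
  have hΦi : Integrable Φ ((volume.restrict (Ioc 0 n)).prod (volume.restrict (Ioc 0 n))) := by
    refine (hD1.mul_prod hq1).bdd_mul (c := n ^ μ * n) hw.aestronglyMeasurable ?_
    rw [Measure.prod_restrict]
    filter_upwards [ae_restrict_mem (measurableSet_Ioc.prod measurableSet_Ioc)] with z hz
    have h1 : 0 ≤ n - z.1 := by linarith [hz.1.2]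
    have h2 : max (n - z.1 - z.2) 0 ≤ n := max_le (by linarith [hz.1.1, hz.2.1]) hn.le
    rw [Real.norm_of_nonneg (mul_nonneg (Real.rpow_nonneg h1 _) (le_max_right _ _))]
    exact mul_le_mul (Real.rpow_le_rpow h1 (by linarith [hz.1.1]) hμ) h2 (le_max_right _ _) (by positivity)
  have inner1 : ∀ x ∈ Icc 0 n, ∫ s in Ioc 0 n, Φ (x, s) =
      (n - x) ^ μ * (∫ s in (0 : ℝ)..(n - x), (n - x - s) * q s) * kernErr α lam x := by
    intro x hx
    have e := integral_max_mul (F := fun s => max (n - x - s) 0 * q s) (G := fun s => (n - x - s) * q s)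
      (b := n - x) (c := n) (by linarith [hx.2]) (by linarith [hx.1])
      (fun s hs => by rw [max_eq_right (by linarith [hs.1]), zero_mul])
      (fun s hs => by rw [max_eq_left (by linarith [hs.2])])
    rw [← e, intervalIntegral.integral_of_le hn.le, ← integral_const_mul, ← integral_mul_const]
    refine integral_congr_ae (Eventually.of_forall fun s => ?_)
    simp only [hΦ]; ring
  have inner2 : ∀ s ∈ Icc 0 n, ∫ x in Ioc 0 n, Φ (x, s) = peanoErr α μ lam n s * q s := by
    intro s hs
    have e := integral_max_mul (F := fun x => (n - x) ^ μ * max (n - x - s) 0 * kernErr α lam x)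
      (G := fun x => (n - x) ^ μ * (n - s - x) * kernErr α lam x)
      (b := n - s) (c := n) (by linarith [hs.2]) (by linarith [hs.1])
      (fun x hx => by rw [max_eq_right (by linarith [hx.1]), mul_zero, zero_mul])
      (fun x hx => by rw [max_eq_left (by linarith [hx.2])]; ring)
    rw [peanoErr, ← e, intervalIntegral.integral_of_le hn.le, ← integral_mul_const]
    refine integral_congr_ae (Eventually.of_forall fun x => ?_)
    simp only [hΦ]; ring
  have hr : Integrable (fun x => ∫ s in Ioc 0 n, Φ (x, s)) (volume.restrict (Ioc 0 n)) := hΦi.integral_prod_left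
  have hr2 : Integrable (fun s => ∫ x in Ioc 0 n, Φ (x, s)) (volume.restrict (Ioc 0 n)) := hΦi.integral_prod_right
  have hswap : ∫ x in Ioc 0 n, ∫ s in Ioc 0 n, Φ (x, s) = ∫ s in Ioc 0 n, ∫ x in Ioc 0 n, Φ (x, s) :=
    integral_integral_swap (f := fun x s => Φ (x, s)) hΦi
  have c1 : (fun s => ∫ x in Ioc 0 n, Φ (x, s)) =ᵐ[volume.restrict (Ioc 0 n)]
      fun s => peanoErr α μ lam n s * q s := by
    filter_upwards [ae_restrict_mem measurableSet_Ioc] with s hs using inner2 s ⟨hs.1.le, hs.2⟩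
  refine ⟨(intervalIntegrable_iff_integrableOn_Ioc_of_le hn.le).2 (hr2.congr c1), ?_⟩
  have i0 : Integrable (fun x => (n - x) ^ μ * kernErr α lam x) (volume.restrict (Ioc 0 n)) :=
    (intervalIntegrable_iff_integrableOn_Ioc_of_le hn.le).1
      (hD.continuousOn_mul (continuous_sub_rpow n hμ).continuousOn)
  have i1 : Integrable (fun x => (n - x) ^ (μ + 1) * kernErr α lam x) (volume.restrict (Ioc 0 n)) :=
    (intervalIntegrable_iff_integrableOn_Ioc_of_le hn.le).1
      (hD.continuousOn_mul (continuous_sub_rpow n (by linarith : 0 ≤ μ + 1)).continuousOn)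
  rw [intervalIntegral.integral_of_le hn.le, intervalIntegral.integral_of_le hn.le,
    intervalIntegral.integral_of_le hn.le, intervalIntegral.integral_of_le hn.le, ← integral_congr_ae c1, ← hswap,
    ← integral_const_mul, ← integral_const_mul, ← integral_add (i0.const_mul _) (i1.const_mul _)]
  have i3 : Integrable (fun x => a₀ * ((n - x) ^ μ * kernErr α lam x) + a₁ * ((n - x) ^ (μ + 1) * kernErr α lam x))
    (volume.restrict (Ioc 0 n)) := (i0.const_mul _).add (i1.const_mul _)
  rw [← integral_add i3 hr]
  refine integral_congr_ae ?_
  filter_upwards [ae_restrict_mem measurableSet_Ioc] with x hx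
  rw [inner1 x ⟨hx.1.le, hx.2⟩, hf (n - x) ⟨by linarith [hx.2], by linarith [hx.1]⟩]
  rw [Real.rpow_add_one' (by linarith [hx.2]) (by linarith)]
  ring

/-! ### The solution of the scheme -/

/-- A coefficient of a product depends only on the earlier coefficients of the factors. It is needed since
the scheme is defined for finitely many time steps only. -/
theorem coeff_mul_congr {A B : PowerSeries ℝ} {N : ℕ}
    (h : ∀ k, k ≤ N → PowerSeries.coeff k A = PowerSeries.coeff k B) (G : PowerSeries ℝ) {k : ℕ} (hk : k ≤ N) :
    PowerSeries.coeff k (G * A) = PowerSeries.coeff k (G * B) := by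
  rw [PowerSeries.coeff_mul, PowerSeries.coeff_mul]
  refine Finset.sum_congr rfl fun p hp => ?_
  rw [Finset.HasAntidiagonal.mem_antidiagonal] at hp
  rw [h p.2 (by omega)]

theorem coeff_succ_linear_mul (u v : ℝ) (S : PowerSeries ℝ) (n : ℕ) :
    PowerSeries.coeff (n + 1) ((PowerSeries.C u + PowerSeries.C v * PowerSeries.X) * S) =
      u * PowerSeries.coeff (n + 1) S + v * PowerSeries.coeff n S := by
  rw [add_mul, map_add, PowerSeries.coeff_C_mul, mul_assoc, PowerSeries.coeff_C_mul, PowerSeries.coeff_succ_X_mul]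

theorem coeff_zero_linear_mul (u v : ℝ) (S : PowerSeries ℝ) :
    PowerSeries.coeff 0 ((PowerSeries.C u + PowerSeries.C v * PowerSeries.X) * S) =
      u * PowerSeries.coeff 0 S := by
  rw [add_mul, map_add, PowerSeries.coeff_C_mul, mul_assoc, PowerSeries.coeff_C_mul, PowerSeries.coeff_zero_X_mul]
  ring

theorem bdf2_eq_coeff (τ : ℝ) {V : ℤ → ℝ} (hV : ∀ n : ℤ, n ≤ 0 → V n = 0) (n : ℕ) :
    bdf2 τ V n = τ⁻¹ * PowerSeries.coeff n (bdfFactor * ((1 - PowerSeries.X) * PowerSeries.mk fun k => V k)) := by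
  rw [bdf2, smul_eq_mul, smul_eq_mul, smul_eq_mul, smul_eq_mul, bdfFactor_eq]
  congr 1
  rcases n with _ | _ | n
  · rw [coeff_zero_linear_mul, coeff_zero_one_sub_X_mul, PowerSeries.coeff_mk, hV _ (by simp), hV _ (by simp),
      hV _ (by simp)]
    simp
  · rw [zero_add, coeff_succ_linear_mul, coeff_succ_one_sub_X_mul, coeff_zero_one_sub_X_mul,
      PowerSeries.coeff_mk, PowerSeries.coeff_mk, hV (((1 : ℕ) : ℤ) - 1) (by simp), hV (((1 : ℕ) : ℤ) - 2) (by simp),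
      hV ((0 : ℕ) : ℤ) (by simp)]
    simp
  · rw [coeff_succ_linear_mul, coeff_succ_one_sub_X_mul, coeff_succ_one_sub_X_mul,
      PowerSeries.coeff_mk, PowerSeries.coeff_mk, PowerSeries.coeff_mk,
      show (((n + 1 + 1 : ℕ) : ℤ) - 1) = ((n + 1 : ℕ) : ℤ) by push_cast; ring,
      show (((n + 1 + 1 : ℕ) : ℤ) - 2) = (n : ℤ) by push_cast; ring]
    ring

theorem initialKernel_nonpos {α τ : ℝ} (hα' : α < 1) (hτ : 0 < τ) (n : ℤ) (hn : n ≤ 0) : initialKernel α τ n = 0 := by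
  have h : (n : ℝ) * τ ≤ 0 := mul_nonpos_of_nonpos_of_nonneg (by exact_mod_cast hn) hτ.le
  rw [initialKernel, max_eq_right h, Real.zero_rpow (by linarith), zero_div]

theorem mk_initialKernel {α τ : ℝ} (hτ : 0 < τ) : (PowerSeries.mk fun k : ℕ => initialKernel α τ k) =
    PowerSeries.C (τ ^ (2 - α)) * rhoSeries α := by
  ext k
  have hk : (0 : ℝ) ≤ k := Nat.cast_nonneg k
  rw [PowerSeries.coeff_mk, PowerSeries.coeff_C_mul, rhoSeries, PowerSeries.coeff_mk, initialKernel, Int.cast_natCast,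
    max_eq_left (by positivity), Real.mul_rpow hk hτ.le]
  ring

/-- The scheme for a scalar equation, solved by generating series. -/
theorem IsCrankNicolsonI.eq_initCoeff_add {α lam τ : ℝ} (hα' : α < 1) (hl : 0 < lam) (hτ : 0 < τ) {N : ℕ} {F : ℝ → ℝ}
    {u₀ : ℝ} {U : ℤ → ℝ} {v : ℕ → ℝ} (h : IsCrankNicolsonI (fun x => lam * x) α τ N F u₀ U v) (hF : F 0 = 0)
    {n : ℕ} (hn : 1 ≤ n) (hnN : n ≤ N) :
    v n = initCoeff α (lam * τ ^ α) n * u₀ + τ ^ (α - 1) *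
      ∑ m ∈ Finset.range n, srcCoeff α (lam * τ ^ α) m * (F ((n - m : ℝ) * τ) - F ((n - m - 1 : ℝ) * τ)) := by
  set Us : PowerSeries ℝ := PowerSeries.mk fun k => U k with hUs
  set Fs : PowerSeries ℝ := PowerSeries.mk fun k => F ((k : ℝ) * τ) with hFs
  set V := resolvent α (lam * τ ^ α) with hV
  set R : PowerSeries ℝ := bdfFactor * ((1 - PowerSeries.X) * rhoSeries α) with hR
  have hτα : 0 < τ ^ α := Real.rpow_pos_of_pos hτ α
  have hb : ∀ k : ℕ, bdf2 τ (initialKernel α τ) k = τ ^ (1 - α) * PowerSeries.coeff k R := by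
    intro k
    rw [bdf2_eq_coeff τ (initialKernel_nonpos hα' hτ) k, mk_initialKernel hτ,
      show bdfFactor * ((1 - PowerSeries.X) * (PowerSeries.C (τ ^ (2 - α)) * rhoSeries α)) =
        PowerSeries.C (τ ^ (2 - α)) * R by rw [hR]; ring, PowerSeries.coeff_C_mul, ← mul_assoc,
      show 2 - α = (1 - α) + 1 by ring, Real.rpow_add_one hτ.ne']
    field_simp
  have havg : avgSeries α = PowerSeries.C (1 - α / 2) + PowerSeries.C (α / 2) * PowerSeries.X := rfl
  -- the scheme as an identity of generating series up to order `N`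
  have hstep : ∀ k, k ≤ N → PowerSeries.coeff k ((glSeries α + PowerSeries.C (lam * τ ^ α) * avgSeries α) * Us) =
      PowerSeries.coeff k (PowerSeries.C (τ ^ α) * (avgSeries α * (Fs + PowerSeries.C (τ ^ (1 - α) * u₀) * R))) := by
    intro k hk
    rw [add_mul, map_add, mul_assoc, PowerSeries.coeff_C_mul, PowerSeries.coeff_C_mul, havg]
    have hsum : PowerSeries.coeff k (glSeries α * Us) = ∑ j ∈ Finset.range (k + 1), glWeight α j * U ((k : ℤ) - (j : ℤ)) := by
      rw [PowerSeries.coeff_mul, Finset.Nat.sum_antidiagonal_eq_sum_range_succ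
        (fun i j => PowerSeries.coeff i (glSeries α) * PowerSeries.coeff j Us)]
      refine Finset.sum_congr rfl fun j hj => ?_
      have hjk : j ≤ k := by have := Finset.mem_range.1 hj; omega
      rw [glSeries, PowerSeries.coeff_mk, hUs, PowerSeries.coeff_mk, Nat.cast_sub hjk]
    rw [hsum]
    cases k with
    | zero =>
      have hR0 : PowerSeries.coeff 0 R = 0 := by
        have := hb 0
        rw [bdf2, initialKernel_nonpos hα' hτ _ (by simp), initialKernel_nonpos hα' hτ _ (by simp),
          initialKernel_nonpos hα' hτ _ (by simp)] at this
        have h2 : 0 < τ ^ (1 - α) := Real.rpow_pos_of_pos hτ _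
        simp only [smul_zero, sub_zero, add_zero] at this
        exact (mul_eq_zero.1 this.symm).resolve_left h2.ne'
      rw [coeff_zero_linear_mul, coeff_zero_linear_mul, map_add, PowerSeries.coeff_C_mul, hR0, hUs, hFs,
        PowerSeries.coeff_mk, PowerSeries.coeff_mk]
      have h0 : U 0 = 0 := h.nonpos 0 le_rfl
      simp [h0, hF]
    | succ k =>
      have e := h.step (k + 1) (by omega) hk
      have e1 : ((k + 1 : ℕ) : ℤ) - 1 = (k : ℤ) := by push_cast; ring
      have e2 : ((k + 1 : ℕ) : ℝ) - 1 = (k : ℝ) := by push_cast; ring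
      rw [e1, e2, hb, hb] at e
      simp only [smul_eq_mul] at e
      rw [coeff_succ_linear_mul, coeff_succ_linear_mul, map_add, map_add, PowerSeries.coeff_C_mul,
        PowerSeries.coeff_C_mul, hUs, hFs, PowerSeries.coeff_mk, PowerSeries.coeff_mk, PowerSeries.coeff_mk,
        PowerSeries.coeff_mk]
      have hττ : τ ^ α * τ ^ (-α) = 1 := by rw [← Real.rpow_add hτ]; simp
      set S := ∑ j ∈ Finset.range (k + 1 + 1), glWeight α j * U (((k + 1 : ℕ) : ℤ) - (j : ℤ)) with hS
      linear_combination τ ^ α * e - S * hττ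
  have hsym := symbol_mul_resolvent hα' (by positivity : 0 ≤ lam * τ ^ α)
  have hU : ∀ k, k ≤ N → PowerSeries.coeff k Us = PowerSeries.coeff k
      (V * (PowerSeries.C (τ ^ α) * (avgSeries α * (Fs + PowerSeries.C (τ ^ (1 - α) * u₀) * R)))) := by
    intro k hk
    rw [← coeff_mul_congr hstep V hk]
    congr 1
    linear_combination (-Us) * hsym
  have hτ1 : τ⁻¹ * τ ^ α = τ ^ (α - 1) := by rw [Real.rpow_sub_one hτ.ne']; ring
  have hτ2 : τ ^ (α - 1) * τ ^ (1 - α) = 1 := by rw [← Real.rpow_add hτ]; simp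
  have key : v n = τ ^ (α - 1) * PowerSeries.coeff n (srcSeries α (lam * τ ^ α) * ((1 - PowerSeries.X) * Fs)) +
      initCoeff α (lam * τ ^ α) n * u₀ := by
    rw [h.output n hn hnN, bdf2_eq_coeff τ h.nonpos n, ← mul_assoc bdfFactor, coeff_mul_congr hU _ hnN]
    have e : bdfFactor * (1 - PowerSeries.X) *
        (V * (PowerSeries.C (τ ^ α) * (avgSeries α * (Fs + PowerSeries.C (τ ^ (1 - α) * u₀) * R)))) =
        PowerSeries.C (τ ^ α) * (srcSeries α (lam * τ ^ α) * ((1 - PowerSeries.X) * Fs) +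
          PowerSeries.C (τ ^ (1 - α) * u₀) *
          (V * (avgSeries α * (bdfFactor * (bdfFactor * ((1 - PowerSeries.X) ^ 2 * rhoSeries α)))))) := by
      have : srcSeries α (lam * τ ^ α) = bdfFactor * (avgSeries α * V) := rfl
      rw [this, hR]; ring
    rw [e, PowerSeries.coeff_C_mul, map_add, PowerSeries.coeff_C_mul, initCoeff, ← mul_assoc, hτ1, mul_add]
    linear_combination u₀ * PowerSeries.coeff n
      (V * (avgSeries α * (bdfFactor * (bdfFactor * ((1 - PowerSeries.X) ^ 2 * rhoSeries α))))) * hτ2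
  rw [key, add_comm]
  congr 2
  rw [PowerSeries.coeff_mul, Finset.Nat.sum_antidiagonal_eq_sum_range_succ
    (fun i j => PowerSeries.coeff i (srcSeries α (lam * τ ^ α)) * PowerSeries.coeff j ((1 - PowerSeries.X) * Fs)),
    Finset.sum_range_succ, Nat.sub_self, coeff_zero_one_sub_X_mul, hFs, PowerSeries.coeff_mk, Nat.cast_zero, zero_mul,
    hF, mul_zero, add_zero]
  refine Finset.sum_congr rfl fun m hm => ?_
  obtain ⟨j, hj⟩ : ∃ j, n - m = j + 1 := ⟨n - m - 1, by have := Finset.mem_range.1 hm; omega⟩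
  have hjr : (n : ℝ) - m = j + 1 := by
    have h1 : n = j + 1 + m := by omega
    rw [h1]; push_cast; ring
  rw [hj, coeff_succ_one_sub_X_mul, PowerSeries.coeff_mk, PowerSeries.coeff_mk, hjr, srcCoeff]
  push_cast
  rw [add_sub_cancel_right]

/-- The contribution of the source to the scheme, as the integral of the source against a step function. -/
theorem sum_srcCoeff_mul_eq {α lam τ : ℝ} (hτ : 0 < τ) {f : ℝ → ℝ} {n : ℕ}
    (hf : IntervalIntegrable f volume 0 (n * τ)) :
    ∑ m ∈ Finset.range n, srcCoeff α lam m *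
      ((∫ y in (0 : ℝ)..((n - m : ℝ) * τ), f y) - ∫ y in (0 : ℝ)..((n - m - 1 : ℝ) * τ), f y) =
    τ * ∫ x in (0 : ℝ)..n, f (τ * (n - x)) * srcCoeff α lam ⌊x⌋₊ := by
  have hg : IntervalIntegrable (fun x => f (τ * (n - x))) volume 0 n := by
    have h1 := (hf.comp_mul_left (c := τ)).comp_sub_left n
    simp only [zero_div, sub_zero] at h1
    rw [mul_div_assoc, div_self hτ.ne', mul_one, sub_self] at h1
    exact h1.symm
  have hsub : ∀ {a b c d : ℝ}, 0 ≤ a → a ≤ b → b ≤ d → uIcc a b ⊆ uIcc 0 d := by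
    intro a b c d ha hab hbd
    rw [uIcc_of_le hab, uIcc_of_le (by linarith)]
    exact Icc_subset_Icc ha hbd
  have hcell : ∀ m, m < n → ∫ x in (m : ℝ)..(m + 1), f (τ * (n - x)) * srcCoeff α lam ⌊x⌋₊ =
      (∫ x in (m : ℝ)..(m + 1), f (τ * (n - x))) * srcCoeff α lam m := by
    intro m hm
    rw [integral_floor_step (F := fun x k => f (τ * (n - x)) * srcCoeff α lam k) m, intervalIntegral.integral_mul_const]
  have hcast : ∀ m : ℕ, m < n → (m : ℝ) + 1 ≤ n := fun m hm => by exact_mod_cast hm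
  have hcellg : ∀ m, m < n → IntervalIntegrable (fun x => f (τ * (n - x))) volume (m : ℝ) (m + 1) := fun m hm =>
    hg.mono_set (hsub (c := 0) (Nat.cast_nonneg m) (by linarith) (hcast m hm))
  have hcelli : ∀ m, m < n → IntervalIntegrable (fun x => f (τ * (n - x)) * srcCoeff α lam ⌊x⌋₊) volume
      (m : ℝ) ((m + 1 : ℕ) : ℝ) := by
    intro m hm
    have h1 := (hcellg m hm).mul_const (srcCoeff α lam m)
    rw [Nat.cast_add, Nat.cast_one]
    refine h1.congr_ae ?_
    rw [uIoc_of_le (by linarith), Filter.EventuallyEq, ae_restrict_iff' measurableSet_Ioc]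
    have hne : ∀ᵐ x : ℝ, x ≠ (m : ℝ) + 1 := by simp [ae_iff]
    filter_upwards [hne] with x hx hxm
    have : ⌊x⌋₊ = m := (Nat.floor_eq_iff ((Nat.cast_nonneg m).trans hxm.1.le)).2
      ⟨hxm.1.le, lt_of_le_of_ne hxm.2 hx⟩
    rw [this]
  have hs := intervalIntegral.sum_integral_adjacent_intervals (μ := volume)
    (f := fun x => f (τ * (n - x)) * srcCoeff α lam ⌊x⌋₊) (a := fun n : ℕ => (n : ℝ)) (n := n) hcelli
  rw [Nat.cast_zero] at hs
  rw [← hs, Finset.mul_sum]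
  refine Finset.sum_congr rfl fun m hm => ?_
  have hmn := Finset.mem_range.1 hm
  have hm1 := hcast m hmn
  have hm0 : (0 : ℝ) ≤ m := Nat.cast_nonneg m
  rw [Nat.cast_add, Nat.cast_one, hcell m hmn]
  have e1 : ∫ x in (m : ℝ)..(m + 1), f (τ * (n - x)) = τ⁻¹ * ∫ y in ((n - m - 1 : ℝ) * τ)..((n - m : ℝ) * τ), f y := by
    rw [intervalIntegral.integral_comp_sub_left (fun x => f (τ * x)) (n : ℝ),
      intervalIntegral.integral_comp_mul_left (fun x => f x) hτ.ne', smul_eq_mul]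
    congr 2 <;> ring
  have e2 : ((∫ y in (0 : ℝ)..((n - m : ℝ) * τ), f y) - ∫ y in (0 : ℝ)..((n - m - 1 : ℝ) * τ), f y) =
      ∫ y in ((n - m - 1 : ℝ) * τ)..((n - m : ℝ) * τ), f y := by
    have p1 : 0 ≤ ((n : ℝ) - m - 1) * τ := mul_nonneg (by linarith) hτ.le
    have p2 : ((n : ℝ) - m - 1) * τ ≤ (n - m) * τ := mul_le_mul_of_nonneg_right (by linarith) hτ.le
    have p3 : ((n : ℝ) - m) * τ ≤ n * τ := mul_le_mul_of_nonneg_right (by linarith) hτ.le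
    exact intervalIntegral.integral_interval_sub_left
      (hf.mono_set (hsub (c := 0) le_rfl (by linarith) p3)) (hf.mono_set (hsub (c := 0) le_rfl p1 (by linarith)))
  rw [e1, e2]
  field_simp

/-! ### The solution of the scalar equation -/

theorem caputoKernel_nonneg {α t : ℝ} (hα' : α < 1) (ht : 0 ≤ t) : 0 ≤ caputoKernel α t :=
  div_nonneg (Real.rpow_nonneg ht _) (Real.Gamma_pos_of_pos (by linarith)).le

theorem measurable_caputoKernel (α : ℝ) : Measurable (caputoKernel α) :=
  (measurable_id.pow_const _).div_const _

theorem intervalIntegrable_caputoKernel {α : ℝ} (hα' : α < 1) (a b : ℝ) :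
    IntervalIntegrable (caputoKernel α) volume a b :=
  (intervalIntegral.intervalIntegrable_rpow' (by linarith)).div_const _

theorem ae_intervalIntegrable_caputoKernel_mul {α T : ℝ} (hα' : α < 1) (hT : 0 ≤ T) {w : ℝ → ℝ}
    (hw : IntervalIntegrable w volume 0 T) :
    ∀ᵐ t ∂(volume.restrict (Ioc 0 T)), IntervalIntegrable (fun y => caputoKernel α (t - y) * w y) volume 0 t := by
  have h1 : Integrable ((Ioc 0 T).indicator w) :=
    (integrable_indicator_iff measurableSet_Ioc).2 ((intervalIntegrable_iff_integrableOn_Ioc_of_le hT).1 hw)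
  have h2 : Integrable ((Ioc 0 T).indicator (caputoKernel α)) :=
    (integrable_indicator_iff measurableSet_Ioc).2
      ((intervalIntegrable_iff_integrableOn_Ioc_of_le hT).1 (intervalIntegrable_caputoKernel hα' 0 T))
  have h3 := Integrable.ae_convolution_exists (ContinuousLinearMap.mul ℝ ℝ) h1 h2
  rw [ae_restrict_iff' measurableSet_Ioc]
  filter_upwards [h3] with t ht htT
  rw [intervalIntegrable_iff_integrableOn_Ioo_of_le htT.1.le]
  refine (IntegrableOn.congr_fun (f := fun y => (Ioc 0 T).indicator w y * (Ioc 0 T).indicator (caputoKernel α) (t - y))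
    ht.integrableOn (fun y hy => ?_) measurableSet_Ioo)
  have m1 : y ∈ Ioc 0 T := ⟨hy.1, hy.2.le.trans htT.2⟩
  have m2 : t - y ∈ Ioc 0 T := ⟨by linarith [hy.2], by linarith [hy.1, htT.2]⟩
  beta_reduce
  rw [indicator_of_mem m1, indicator_of_mem m2, mul_comm]

/-- The variation of constants formula. -/
theorem eq_of_caputo_equation {α lam T u₀ : ℝ} (hα : 0 < α) (hα' : α < 1) (hl : 0 < lam)
    {u w f : ℝ → ℝ} (hw : IntervalIntegrable w volume 0 T) (hu : ∀ t ∈ Icc 0 T, u t = u₀ + ∫ s in (0 : ℝ)..t, w s)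
    (hf : ContinuousOn f (Icc 0 T))
    (heq : ∀ᵐ t ∂(volume.restrict (Ioc 0 T)),
      (∫ s in (0 : ℝ)..t, caputoKernel α (t - s) * w s) + lam * u t = f t) {t : ℝ} (ht : t ∈ Ioc 0 T) :
    u t = (1 - lam * ∫ y in (0 : ℝ)..t, resKernel α lam y) * u₀ +
      ∫ y in (0 : ℝ)..t, f (t - y) * resKernel α lam y := by
  have ht0 := ht.1
  have hwt : IntervalIntegrable w volume 0 t := hw.mono_set (by
    rw [uIcc_of_le ht0.le, uIcc_of_le (ht0.le.trans ht.2)]; exact Icc_subset_Icc_right ht.2)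
  have hwt1 : Integrable w (volume.restrict (Ioc 0 t)) := (intervalIntegrable_iff_integrableOn_Ioc_of_le ht0.le).1 hwt
  set G : ℝ → ℝ → ℝ := fun s y => resKernel α lam (t - s) * (caputoKernel α (s - y) + lam) with hG
  have hGm : Measurable fun z : ℝ × ℝ => G z.1 z.2 := by
    have h1 := measurable_resKernel α lam
    have h2 := measurable_caputoKernel α
    simp only [hG]
    fun_prop
  set S : Set (ℝ × ℝ) := {z | z.2 < z.1} with hS
  have hSm : MeasurableSet S := measurableSet_lt measurable_snd measurable_fst
  set Ψ : ℝ × ℝ → ℝ := fun z => S.indicator (fun z => G z.1 z.2) z * w z.2 with hΨ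
  have hΨm : AEStronglyMeasurable Ψ ((volume.restrict (Ioc 0 t)).prod (volume.restrict (Ioc 0 t))) :=
    (hGm.indicator hSm).aestronglyMeasurable.mul hwt1.1.comp_snd
  have hG0 : ∀ s ∈ Ioc 0 t, ∀ y, 0 ≤ S.indicator (fun z => G z.1 z.2) (s, y) := by
    intro s _ y
    refine indicator_nonneg (fun z hz => ?_) _
    have hz' : z.2 < z.1 := hz
    exact mul_nonneg (resKernel_nonneg hα hα' hl _) (add_nonneg (caputoKernel_nonneg hα' (by linarith)) hl.le)
  -- the integral of the kernel in `s` is `1`, by the resolvent equation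
  have hone : ∀ᵐ y ∂(volume.restrict (Ioc 0 t)), Integrable (fun s => S.indicator (fun z => G z.1 z.2) (s, y))
      (volume.restrict (Ioc 0 t)) ∧ ∫ s in Ioc 0 t, S.indicator (fun z => G z.1 z.2) (s, y) = 1 := by
    have h1 := ae_integral_resKernel_mul hα hα' hl
    rw [ae_restrict_iff' measurableSet_Ioi] at h1
    have h2 := (quasiMeasurePreserving_sub_left (volume : Measure ℝ) t).ae h1
    have hne : ∀ᵐ y : ℝ, y ≠ t := by simp [ae_iff]
    rw [ae_restrict_iff' measurableSet_Ioc]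
    filter_upwards [h2, hne] with y hy hyt hy0
    have hlt : y < t := lt_of_le_of_ne hy0.2 hyt
    have h3 := hy (show 0 < t - y by linarith)
    have e : (fun s => S.indicator (fun z => G z.1 z.2) (s, y)) = (Ioi y).indicator fun s => G s y := by
      ext s
      by_cases hs : y < s
      · rw [indicator_of_mem (show (s, y) ∈ S from hs), indicator_of_mem (show s ∈ Ioi y from hs)]
      · rw [indicator_of_notMem (show (s, y) ∉ S from hs), indicator_of_notMem (show s ∉ Ioi y from hs)]
    have h4 : ∫ s in y..t, G s y = 1 := by
      rw [← h3]
      have h5 := intervalIntegral.integral_comp_sub_left (a := y) (b := t)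
        (fun x => resKernel α lam x * (caputoKernel α (t - y - x) + lam)) t
      rw [sub_self] at h5
      rw [← h5]
      refine intervalIntegral.integral_congr fun s _ => ?_
      simp only [hG]
      rw [show t - y - (t - s) = s - y by ring]
    have h6 : IntegrableOn (fun s => G s y) (Ioc y t) :=
      (intervalIntegrable_iff_integrableOn_Ioc_of_le hlt.le).1
        (intervalIntegral.intervalIntegrable_of_integral_ne_zero (by rw [h4]; exact one_ne_zero))
    have hset : Ioi y ∩ Ioc 0 t = Ioc y t := by
      ext s
      simp only [mem_inter_iff, mem_Ioi, mem_Ioc]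
      constructor
      · exact fun h => ⟨h.1, h.2.2⟩
      · exact fun h => ⟨h.1, hy0.1.trans h.1, h.2⟩
    rw [e]
    constructor
    · rw [integrable_indicator_iff measurableSet_Ioi, IntegrableOn, Measure.restrict_restrict measurableSet_Ioi, hset]
      exact h6
    · rw [integral_indicator measurableSet_Ioi, Measure.restrict_restrict measurableSet_Ioi, hset,
        ← intervalIntegral.integral_of_le hlt.le, h4]
  have hΨi : Integrable Ψ ((volume.restrict (Ioc 0 t)).prod (volume.restrict (Ioc 0 t))) := by
    rw [integrable_prod_iff' hΨm]
    constructor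
    · filter_upwards [hone] with y hy using hy.1.mul_const (w y)
    · refine hwt1.norm.congr ?_
      filter_upwards [hone] with y hy
      have : ∀ s ∈ Ioc 0 t, ‖Ψ (s, y)‖ = S.indicator (fun z => G z.1 z.2) (s, y) * ‖w y‖ := by
        intro s hs
        rw [hΨ, norm_mul, Real.norm_of_nonneg (hG0 s hs y)]
      rw [setIntegral_congr_fun measurableSet_Ioc this, integral_mul_const, hy.2, one_mul]
  have hswap : ∫ s in Ioc 0 t, ∫ y in Ioc 0 t, Ψ (s, y) = ∫ y in Ioc 0 t, ∫ s in Ioc 0 t, Ψ (s, y) :=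
    integral_integral_swap (f := fun s y => Ψ (s, y)) hΨi
  have hR : ∫ y in Ioc 0 t, ∫ s in Ioc 0 t, Ψ (s, y) = u t - u₀ := by
    rw [hu t ⟨ht0.le, ht.2⟩, add_sub_cancel_left, intervalIntegral.integral_of_le ht0.le]
    refine integral_congr_ae ?_
    filter_upwards [hone] with y hy
    simp only [hΨ]
    rw [integral_mul_const, hy.2, one_mul]
  have hsub : Ioc 0 t ⊆ Ioc 0 T := Ioc_subset_Ioc_right ht.2
  have hL : ∫ s in Ioc 0 t, ∫ y in Ioc 0 t, Ψ (s, y) = ∫ s in Ioc 0 t, resKernel α lam (t - s) * (f s - lam * u₀) := by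
    refine integral_congr_ae ?_
    filter_upwards [ae_restrict_of_ae_restrict_of_subset hsub heq,
      ae_restrict_of_ae_restrict_of_subset hsub (ae_intervalIntegrable_caputoKernel_mul hα' (ht0.le.trans ht.2) hw),
      ae_restrict_mem measurableSet_Ioc] with s h1 h2 hs
    have e : ∀ y ∈ Ioc 0 t, Ψ (s, y) =
        (Iio s).indicator (fun y => resKernel α lam (t - s) * (caputoKernel α (s - y) * w y + lam * w y)) y := by
      intro y _
      simp only [hΨ]
      by_cases hy : y < s
      · rw [indicator_of_mem (show (s, y) ∈ S from hy), indicator_of_mem (show y ∈ Iio s from hy)]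
        simp only [hG]; ring
      · rw [indicator_of_notMem (show (s, y) ∉ S from hy), indicator_of_notMem (show y ∉ Iio s from hy), zero_mul]
    have hset : Ioc 0 t ∩ Iio s = Ioo 0 s := by
      ext y
      simp only [mem_inter_iff, mem_Iio, mem_Ioc, mem_Ioo]
      constructor
      · exact fun h => ⟨h.1.1, h.2⟩
      · exact fun h => ⟨⟨h.1, h.2.le.trans hs.2⟩, h.2⟩
    have hws : IntervalIntegrable w volume 0 s := hwt.mono_set (by
      rw [uIcc_of_le ht0.le, uIcc_of_le hs.1.le]; exact Icc_subset_Icc_right hs.2)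
    rw [setIntegral_congr_fun measurableSet_Ioc e, setIntegral_indicator measurableSet_Iio, hset,
      integral_const_mul, ← integral_Ioc_eq_integral_Ioo, ← intervalIntegral.integral_of_le hs.1.le,
      intervalIntegral.integral_add h2 (hws.const_mul lam), intervalIntegral.integral_const_mul, ← h1,
      hu s ⟨hs.1.le, hs.2.trans ht.2⟩]
    ring
  have he := intervalIntegrable_resKernel hα hα' hl le_rfl ht0.le
  have hfe : IntervalIntegrable (fun y => f (t - y) * resKernel α lam y) volume 0 t := by
    refine he.continuousOn_mul ?_
    rw [uIcc_of_le ht0.le]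
    refine hf.comp (by fun_prop) fun y hy => ⟨by linarith [hy.2], by linarith [hy.1, ht.2]⟩
  have hfin : ∫ s in Ioc 0 t, resKernel α lam (t - s) * (f s - lam * u₀) =
      (∫ y in (0 : ℝ)..t, f (t - y) * resKernel α lam y) - lam * u₀ * ∫ y in (0 : ℝ)..t, resKernel α lam y := by
    rw [← intervalIntegral.integral_of_le ht0.le, ← intervalIntegral.integral_const_mul,
      ← intervalIntegral.integral_sub hfe (he.const_mul _)]
    have h5 := intervalIntegral.integral_comp_sub_left (a := 0) (b := t)
      (fun y => f (t - y) * resKernel α lam y - lam * u₀ * resKernel α lam y) t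
    rw [sub_self, sub_zero] at h5
    rw [← h5]
    refine intervalIntegral.integral_congr fun s _ => ?_
    rw [sub_sub_cancel]
    ring
  linear_combination hfin + hL - hswap - hR

/-! ### Weak derivatives in time -/

/-- Integration by parts against the primitive of an integrable function. -/
theorem integral_mul_eq_sub_integral_deriv_mul {a b : ℝ} {f q : ℝ → ℝ} (hf : ContDiff ℝ 1 f)
    (hq : IntervalIntegrable q volume a b) :
    ∫ x in a..b, f x * q x = f b * (∫ x in a..b, q x) - ∫ x in a..b, deriv f x * ∫ y in a..x, q y := by
  have h1 : AbsolutelyContinuousOnInterval f a b := hf.contDiffOn.absolutelyContinuousOnInterval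
  have h2 := hq.absolutelyContinuousOnInterval_intervalIntegral (c := a) (by simp)
  have h3 := h1.integral_mul_deriv_eq_deriv_mul h2
  rw [intervalIntegral.integral_same, mul_zero, sub_zero] at h3
  rw [← h3]
  refine intervalIntegral.integral_congr_ae ?_
  filter_upwards [hq.ae_hasDerivAt_integral] with x hx hxm
  rw [(hx (uIoc_subset_uIcc hxm) a (by simp)).deriv]

/-- The lemma of du Bois-Reymond. -/
theorem exists_ae_eq_const_of_integral_deriv_mul {T : ℝ} (hT : 0 < T) {h : ℝ → ℝ} (hh : IntegrableOn h (Ioo 0 T))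
    (H : ∀ φ : ℝ → ℝ, ContDiff ℝ ∞ φ → HasCompactSupport φ → tsupport φ ⊆ Ioo 0 T →
      ∫ t in Ioo 0 T, deriv φ t * h t = 0) : ∃ c : ℝ, ∀ᵐ t, t ∈ Ioo 0 T → h t = c := by
  have hT4 : 0 < T / 4 := by positivity
  let η₀ : ContDiffBump (T / 2) := ⟨T / 8, T / 4, by positivity, by linarith⟩
  set η := η₀.normed (volume : Measure ℝ) with hη
  have hη1 : ContDiff ℝ ∞ η := η₀.contDiff_normed
  have hη2 : HasCompactSupport η := η₀.hasCompactSupport_normed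
  have hη3 : tsupport η ⊆ Ioo 0 T := by
    rw [hη, η₀.tsupport_normed_eq, Real.closedBall_eq_Icc]
    intro x hx
    have h1 : T / 2 - T / 4 ≤ x := hx.1
    have h2 : x ≤ T / 2 + T / 4 := hx.2
    exact ⟨by linarith, by linarith⟩
  have hη4 : ∫ x, η x = 1 := η₀.integral_normed
  have hloc : LocallyIntegrableOn (fun t => h t - ∫ s in Ioo 0 T, η s * h s) (Ioo 0 T) :=
    (hh.sub (integrableOn_const (by simp))).locallyIntegrableOn
  -- functions that vanish outside the interval have the same integral over the line
  have hset : ∀ φ : ℝ → ℝ, tsupport φ ⊆ Ioo 0 T → ∀ F : ℝ → ℝ, ∫ t in Ioo 0 T, φ t * F t = ∫ t, φ t * F t := by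
    intro φ hφ F
    refine setIntegral_eq_integral_of_forall_compl_eq_zero fun x hx => ?_
    rw [image_eq_zero_of_notMem_tsupport fun hx' => hx (hφ hx'), zero_mul]
  have hint : ∀ φ : ℝ → ℝ, ContDiff ℝ ∞ φ → HasCompactSupport φ → IntegrableOn (fun t => φ t * h t) (Ioo 0 T) := by
    intro φ h1 h2
    obtain ⟨C, hC⟩ := h2.exists_bound_of_continuous h1.continuous
    exact hh.bdd_mul (c := C) h1.continuous.aestronglyMeasurable (Eventually.of_forall hC)
  refine ⟨∫ s in Ioo 0 T, η s * h s, ?_⟩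
  have key := isOpen_Ioo.ae_eq_zero_of_integral_contDiff_smul_eq_zero hloc (fun ψ p1 p2 p3 => by
    set m := ∫ x, ψ x with hm
    set θ : ℝ → ℝ := fun x => ψ x - m * η x with hθ
    have t1 : ContDiff ℝ ∞ θ := p1.sub (contDiff_const.mul hη1)
    have t3 : tsupport θ ⊆ Ioo 0 T := by
      have : Function.support θ ⊆ tsupport ψ ∪ tsupport η := by
        intro x hx
        by_contra hn
        rw [mem_union, not_or] at hn
        refine hx ?_
        simp only [hθ]
        rw [image_eq_zero_of_notMem_tsupport hn.1, image_eq_zero_of_notMem_tsupport hn.2]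
        ring
      exact (closure_minimal this ((isClosed_tsupport ψ).union (isClosed_tsupport η))).trans (union_subset p3 hη3)
    have t2 : HasCompactSupport θ := p2.sub (hη2.mul_left (f := fun _ => m))
    have tint : ∫ x, θ x = 0 := by
      rw [hθ, integral_sub (p1.continuous.integrable_of_hasCompactSupport p2)
        ((hη1.continuous.integrable_of_hasCompactSupport hη2).const_mul m), integral_const_mul, hη4]
      ring
    obtain ⟨a, b, ha, hb, hab⟩ : ∃ a b : ℝ, 0 < a ∧ b < T ∧ tsupport θ ⊆ Icc a b := by
      rcases (tsupport θ).eq_empty_or_nonempty with he | hne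
      · exact ⟨1, T - 1, one_pos, by linarith, by rw [he]; exact empty_subset _⟩
      · have hc : IsCompact (tsupport θ) := t2
        exact ⟨sInf (tsupport θ), sSup (tsupport θ), (t3 (hc.sInf_mem hne)).1, (t3 (hc.sSup_mem hne)).2,
          fun x hx => ⟨csInf_le hc.bddBelow hx, le_csSup hc.bddAbove hx⟩⟩
    have tz : ∀ x, x ∉ Icc a b → θ x = 0 := fun x hx => image_eq_zero_of_notMem_tsupport fun h' => hx (hab h')
    set φ : ℝ → ℝ := fun t => ∫ x in Iic t, θ x with hφ
    have hθi : Integrable θ := t1.continuous.integrable_of_hasCompactSupport t2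
    have hφ0 : ∀ t, t < a → φ t = 0 := fun t ht =>
      setIntegral_eq_zero_of_forall_eq_zero fun x hx => tz x fun h' => by linarith [h'.1, mem_Iic.1 hx]
    have hφe : ∀ t, φ t = ∫ x in (0 : ℝ)..t, θ x := by
      intro t
      rw [← intervalIntegral.integral_Iic_sub_Iic hθi.integrableOn hθi.integrableOn]
      have := hφ0 0 ha
      simp only [hφ] at this ⊢
      rw [this, sub_zero]
    have hφd : ∀ t, HasDerivAt φ (θ t) t := by
      intro t
      rw [show φ = fun t => ∫ x in (0 : ℝ)..t, θ x from funext hφe]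
      exact t1.continuous.integral_hasStrictDerivAt 0 t |>.hasDerivAt
    have hφderiv : deriv φ = θ := funext fun t => (hφd t).deriv
    have hφ1 : ∀ t, b ≤ t → φ t = 0 := by
      intro t ht
      have : ∫ x in Iic t, θ x = ∫ x, θ x :=
        setIntegral_eq_integral_of_forall_compl_eq_zero fun x hx => tz x fun h' =>
          hx (mem_Iic.2 (h'.2.trans ht))
      simp only [hφ]
      rw [this, tint]
    have hφs : tsupport φ ⊆ Icc a b := by
      refine closure_minimal (fun x hx => ?_) isClosed_Icc
      refine ⟨not_lt.1 fun h' => hx (hφ0 x h'), not_lt.1 fun h' => hx (hφ1 x h'.le)⟩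
    have hφc : ContDiff ℝ ∞ φ := by
      rw [contDiff_infty_iff_deriv, hφderiv]
      exact ⟨fun t => (hφd t).differentiableAt, t1⟩
    have h0 := H φ hφc (isCompact_Icc.of_isClosed_subset (isClosed_tsupport φ) hφs)
      (hφs.trans fun x hx => ⟨ha.trans_le hx.1, hx.2.trans_lt hb⟩)
    rw [hφderiv] at h0
    have e1 : ∫ t in Ioo 0 T, θ t * h t = (∫ t in Ioo 0 T, ψ t * h t) - m * ∫ t in Ioo 0 T, η t * h t := by
      rw [← integral_const_mul, ← integral_sub (hint ψ p1 p2) ((hint η hη1 hη2).const_mul m)]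
      refine integral_congr_ae (Eventually.of_forall fun t => ?_)
      simp only [hθ]; ring
    have e2 : ∫ t in Ioo 0 T, ψ t = m := by
      have := hset ψ p3 (fun _ => 1)
      simpa using this
    have hψi : IntegrableOn ψ (Ioo 0 T) := (p1.continuous.integrable_of_hasCompactSupport p2).integrableOn
    simp only [smul_eq_mul]
    rw [← hset ψ p3]
    have e3 : ∫ t in Ioo 0 T, ψ t * (h t - ∫ s in Ioo 0 T, η s * h s) =
        (∫ t in Ioo 0 T, ψ t * h t) - (∫ t in Ioo 0 T, ψ t) * ∫ s in Ioo 0 T, η s * h s := by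
      rw [← integral_mul_const, ← integral_sub (hint ψ p1 p2) (hψi.mul_const _)]
      refine integral_congr_ae (Eventually.of_forall fun t => ?_)
      ring
    rw [e3, e2]
    linarith)
  filter_upwards [key] with t ht htm
  exact sub_eq_zero.1 (ht htm)

/-- The continuous representative is the primitive of the weak derivative. -/
theorem HasTimeWeakDeriv.eq_add_integral {T : ℝ} (hT : 0 < T) {g g' : ℝ → ℝ} (h : HasTimeWeakDeriv T g g')
    (hg : ContinuousOn g (Icc 0 T)) {t : ℝ} (ht : t ∈ Icc 0 T) : g t = g 0 + ∫ s in (0 : ℝ)..t, g' s := by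
  have hi : IntervalIntegrable g' volume 0 T :=
    (intervalIntegrable_iff_integrableOn_Ioo_of_le hT.le).2 h.integrable_deriv
  have hPc : ContinuousOn (fun t => ∫ s in (0 : ℝ)..t, g' s) (Icc 0 T) := by
    have := intervalIntegral.continuousOn_primitive_interval' hi (a := (0 : ℝ)) (by simp)
    rwa [uIcc_of_le hT.le] at this
  have hPi : IntegrableOn (fun t => ∫ s in (0 : ℝ)..t, g' s) (Ioo 0 T) :=
    (hPc.integrableOn_Icc).mono_set Ioo_subset_Icc_self
  obtain ⟨c, hc⟩ := exists_ae_eq_const_of_integral_deriv_mul hT (h.integrable.sub hPi) (fun φ p1 p2 p3 => by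
    have e1 := h.integral_eq φ p1 p2 p3
    simp only [smul_eq_mul] at e1
    have hT0 : φ T = 0 := image_eq_zero_of_notMem_tsupport fun h' => lt_irrefl _ (p3 h').2
    have e2 := integral_mul_eq_sub_integral_deriv_mul (p1.of_le (by simp)) hi
    rw [hT0, zero_mul, zero_sub, intervalIntegral.integral_of_le hT.le, intervalIntegral.integral_of_le hT.le,
      integral_Ioc_eq_integral_Ioo, integral_Ioc_eq_integral_Ioo] at e2
    have hd : Continuous (deriv φ) := (p1.of_le (by simp : (1 : WithTop ℕ∞) ≤ _)).continuous_deriv le_rfl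
    obtain ⟨C, hC⟩ := p2.deriv.exists_bound_of_continuous hd
    have i1 := h.integrable.bdd_mul (c := C) hd.aestronglyMeasurable (Eventually.of_forall hC)
    have i2 := hPi.bdd_mul (c := C) hd.aestronglyMeasurable (Eventually.of_forall hC)
    simp only [Pi.sub_apply, mul_sub]
    rw [integral_sub i1 i2]
    linarith)
  have hEq : EqOn (fun t => g t - ∫ s in (0 : ℝ)..t, g' s) (fun _ => c) (Icc 0 T) := by
    have h1 : (fun t => g t - ∫ s in (0 : ℝ)..t, g' s) =ᵐ[volume.restrict (Icc 0 T)] fun _ => c := by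
      rw [← restrict_Ioo_eq_restrict_Icc, Filter.EventuallyEq, ae_restrict_iff' measurableSet_Ioo]
      exact hc
    exact Measure.eqOn_Icc_of_ae_eq volume hT.ne h1 (hg.sub hPc) continuousOn_const
  have h1 := hEq ht
  have h2 := hEq (show (0 : ℝ) ∈ Icc 0 T from ⟨le_rfl, hT.le⟩)
  simp only [intervalIntegral.integral_same, sub_zero] at h1 h2
  linarith

/-- Taylor's formula with integral remainder, for weak derivatives. -/
theorem HasTimeWeakDeriv.taylor {T : ℝ} (hT : 0 < T) {g g' g'' : ℝ → ℝ} (h : HasTimeWeakDeriv T g g')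
    (h' : HasTimeWeakDeriv T g' g'') (hg : ContinuousOn g (Icc 0 T)) (hg' : ContinuousOn g' (Icc 0 T)) {t : ℝ}
    (ht : t ∈ Icc 0 T) : g t = g 0 + g' 0 * t + ∫ s in (0 : ℝ)..t, (t - s) * g'' s := by
  have hi : IntervalIntegrable g'' volume 0 t :=
    ((intervalIntegrable_iff_integrableOn_Ioo_of_le hT.le).2 h'.integrable_deriv).mono_set (by
      rw [uIcc_of_le ht.1, uIcc_of_le hT.le]; exact Icc_subset_Icc_right ht.2)
  have hPi : IntervalIntegrable (fun t => ∫ s in (0 : ℝ)..t, g'' s) volume 0 t :=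
    (intervalIntegral.continuousOn_primitive_interval' hi (by simp)).intervalIntegrable
  have hd : deriv (fun s : ℝ => t - s) = fun _ => -1 := by
    ext s
    simp
  have e := integral_mul_eq_sub_integral_deriv_mul (f := fun s => t - s) (contDiff_const.sub contDiff_id) hi
  rw [hd, sub_self, zero_mul, zero_sub, intervalIntegral.integral_const_mul] at e
  have e2 : ∫ s in (0 : ℝ)..t, g' s = ∫ s in (0 : ℝ)..t, (g' 0 + ∫ r in (0 : ℝ)..s, g'' r) := by
    refine intervalIntegral.integral_congr fun s hs => ?_
    rw [uIcc_of_le ht.1] at hs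
    exact h'.eq_add_integral hT hg' ⟨hs.1, hs.2.trans ht.2⟩
  rw [h.eq_add_integral hT hg ht, e2, intervalIntegral.integral_add intervalIntegrable_const hPi,
    intervalIntegral.integral_const, e]
  simp only [smul_eq_mul]
  ring

/-- Bounded linear maps preserve weak derivatives. -/
theorem HasTimeWeakDeriv.clm_comp {X : Type*} [NormedAddCommGroup X] [NormedSpace ℝ X] [CompleteSpace X] {T : ℝ}
    {g g' : ℝ → X} (h : HasTimeWeakDeriv T g g') (ℓ : X →L[ℝ] ℝ) :
    HasTimeWeakDeriv T (fun t => ℓ (g t)) (fun t => ℓ (g' t)) where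
  integrable := ℓ.integrable_comp h.integrable
  integrable_deriv := ℓ.integrable_comp h.integrable_deriv
  integral_eq φ p1 p2 p3 := by
    have hd : Continuous (deriv φ) := (p1.of_le (by simp : (1 : WithTop ℕ∞) ≤ _)).continuous_deriv le_rfl
    obtain ⟨C, hC⟩ := p2.deriv.exists_bound_of_continuous hd
    obtain ⟨C', hC'⟩ := p2.exists_bound_of_continuous p1.continuous
    have i1 := Integrable.bdd_smul h.integrable C hd.aestronglyMeasurable (Eventually.of_forall hC)
    have i2 := Integrable.bdd_smul h.integrable_deriv C' p1.continuous.aestronglyMeasurable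
      (Eventually.of_forall hC')
    have e := congrArg ℓ (h.integral_eq φ p1 p2 p3)
    have e1 := ℓ.integral_comp_comm i1
    have e2 := ℓ.integral_comp_comm i2
    simp only [Pi.smul_apply', map_smul] at e1 e2
    rw [map_neg] at e
    rw [e1, e2]
    exact e

/-! ### Reduction to scalar equations -/

section Components

variable {V : Type*} [NormedAddCommGroup V] [NormedSpace ℝ V]

theorem absolutelyContinuousOnInterval_clm_comp {u : ℝ → V} {a b : ℝ} (hu : AbsolutelyContinuousOnInterval u a b)
    (ℓ : V →L[ℝ] ℝ) : AbsolutelyContinuousOnInterval (fun t => ℓ (u t)) a b := by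
  refine squeeze_zero (fun t => ?_) (fun t => ?_) (by simpa using Tendsto.const_mul ‖ℓ‖ hu)
  · exact Finset.sum_nonneg fun _ _ => dist_nonneg
  · rw [Finset.mul_sum]
    refine Finset.sum_le_sum fun i _ => ?_
    rw [dist_eq_norm, dist_eq_norm, ← map_sub]
    exact ℓ.le_opNorm _

theorem ae_deriv_clm_comp [FiniteDimensional ℝ V] {u : ℝ → V} {a b : ℝ} (hu : AbsolutelyContinuousOnInterval u a b)
    (ℓ : V →L[ℝ] ℝ) : ∀ᵐ t, t ∈ uIcc a b → deriv (fun t => ℓ (u t)) t = ℓ (deriv u t) := by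
  filter_upwards [hu.boundedVariationOn.ae_differentiableAt_of_mem_uIcc] with t ht htm
  exact (ℓ.hasFDerivAt.comp_hasDerivAt t (ht htm).hasDerivAt).deriv

theorem intervalIntegrable_clm_deriv [FiniteDimensional ℝ V] {u : ℝ → V} {a b : ℝ}
    (hu : AbsolutelyContinuousOnInterval u a b) (ℓ : V →L[ℝ] ℝ) :
    IntervalIntegrable (fun t => ℓ (deriv u t)) volume a b := by
  refine (absolutelyContinuousOnInterval_clm_comp hu ℓ).intervalIntegrable_deriv.congr_ae ?_
  rw [Filter.EventuallyEq, ae_restrict_iff' measurableSet_uIoc]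
  filter_upwards [ae_deriv_clm_comp hu ℓ] with t ht htm using ht (uIoc_subset_uIcc htm)

theorem clm_eq_add_integral_deriv [FiniteDimensional ℝ V] {u : ℝ → V} {a b : ℝ}
    (hu : AbsolutelyContinuousOnInterval u a b) (ℓ : V →L[ℝ] ℝ) :
    ℓ (u b) = ℓ (u a) + ∫ t in a..b, ℓ (deriv u t) := by
  have h := (absolutelyContinuousOnInterval_clm_comp hu ℓ).integral_deriv_eq_sub
  have e : ∫ t in a..b, deriv (fun t => ℓ (u t)) t = ∫ t in a..b, ℓ (deriv u t) := by
    refine intervalIntegral.integral_congr_ae ?_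
    filter_upwards [ae_deriv_clm_comp hu ℓ] with t ht htm using ht (uIoc_subset_uIcc htm)
  linarith

/-- A functional may be applied inside the Caputo derivative for almost every `t`, namely where the
singular integral converges; at other `t` the vector-valued integral has a junk value. -/
theorem ae_clm_caputoDeriv [FiniteDimensional ℝ V] {α T : ℝ} (hα' : α < 1) (hT : 0 ≤ T) {u : ℝ → V}
    (hu : AbsolutelyContinuousOnInterval u 0 T) (ℓ : V →L[ℝ] ℝ) : ∀ᵐ t ∂(volume.restrict (Ioc 0 T)),
      ℓ (caputoDeriv α u t) = ∫ s in (0 : ℝ)..t, caputoKernel α (t - s) * ℓ (deriv u s) := by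
  have hG : Real.Gamma (1 - α) ≠ 0 := (Real.Gamma_pos_of_pos (by linarith)).ne'
  let b := Module.finBasis ℝ V
  have h := ae_all_iff.2 fun j => ae_intervalIntegrable_caputoKernel_mul hα' hT
    (intervalIntegrable_clm_deriv hu (LinearMap.toContinuousLinearMap (b.coord j)))
  filter_upwards [h] with t ht
  have e : (fun s => (t - s) ^ (-α) • deriv u s) = fun s => ∑ j, (Real.Gamma (1 - α) *
      (caputoKernel α (t - s) * LinearMap.toContinuousLinearMap (b.coord j) (deriv u s))) • b j := by
    ext s
    conv_lhs => rw [← b.sum_repr (deriv u s), Finset.smul_sum]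
    refine Finset.sum_congr rfl fun j _ => ?_
    rw [smul_smul, caputoKernel]
    congr 1
    simp only [LinearMap.coe_toContinuousLinearMap', Module.Basis.coord_apply]
    field_simp
  have hi : IntervalIntegrable (fun s => (t - s) ^ (-α) • deriv u s) volume 0 t := by
    rw [e]
    have h1 := fun j => (ht j).const_mul (Real.Gamma (1 - α))
    exact ⟨integrable_finsetSum _ fun j _ => (h1 j).1.smul_const (b j),
      integrable_finsetSum _ fun j _ => (h1 j).2.smul_const (b j)⟩
  rw [caputoDeriv, map_smul, ← ℓ.intervalIntegral_comp_comm hi, smul_eq_mul, ← intervalIntegral.integral_const_mul]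
  refine intervalIntegral.integral_congr fun s _ => ?_
  simp only [map_smul, smul_eq_mul, caputoKernel]
  ring

theorem IsSubdiffusionSolution.clm_eq [FiniteDimensional ℝ V] {B : V → V} {α T lam : ℝ} {f : ℝ → V} {u₀ : V}
    {u : ℝ → V} (hα : 0 < α) (hα' : α < 1) (hl : 0 < lam) (h : IsSubdiffusionSolution B α T f u₀ u) {ℓ : V →L[ℝ] ℝ}
    (hℓ : ∀ x, ℓ (B x) = lam * ℓ x) (hf : ContinuousOn (fun t => ℓ (f t)) (Icc 0 T)) {t : ℝ} (ht : t ∈ Ioc 0 T) :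
    ℓ (u t) = (1 - lam * ∫ y in (0 : ℝ)..t, resKernel α lam y) * ℓ u₀ +
      ∫ y in (0 : ℝ)..t, ℓ (f (t - y)) * resKernel α lam y := by
  have hT : 0 ≤ T := ht.1.le.trans ht.2
  refine eq_of_caputo_equation (u := fun t => ℓ (u t)) (w := fun s => ℓ (deriv u s)) (f := fun t => ℓ (f t)) hα hα' hl
    (intervalIntegrable_clm_deriv h.absCont ℓ) (fun t ht => ?_) hf ?_ ht
  · have := clm_eq_add_integral_deriv (h.absCont.mono (c := 0) (d := t) (by
      rw [uIcc_of_le ht.1, uIcc_of_le hT]; exact Icc_subset_Icc_right ht.2)) ℓ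
    rwa [h.initial] at this
  · filter_upwards [ae_clm_caputoDeriv hα' hT h.absCont ℓ, h.equation] with t h1 h2
    rw [← h1, ← hℓ, ← map_add, h2]

theorem map_bdf2 (ℓ : V →L[ℝ] ℝ) (τ : ℝ) (W : ℤ → V) (n : ℤ) : ℓ (bdf2 τ W n) = bdf2 τ (fun n => ℓ (W n)) n := by
  simp only [bdf2, map_smul, map_add, map_sub]

theorem IsCrankNicolsonI.clm {B : V → V} {α τ lam : ℝ} {N : ℕ} {F : ℝ → V} {u₀ : V} {U : ℤ → V} {v : ℕ → V}
    (h : IsCrankNicolsonI B α τ N F u₀ U v) {ℓ : V →L[ℝ] ℝ} (hℓ : ∀ x, ℓ (B x) = lam * ℓ x) :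
    IsCrankNicolsonI (fun x => lam * x) α τ N (fun t => ℓ (F t)) (ℓ u₀) (fun n => ℓ (U n)) (fun n => ℓ (v n)) where
  nonpos n hn := by simp [h.nonpos n hn]
  step n h1 hn := by
    have := congrArg ℓ (h.step n h1 hn)
    simpa only [map_add, map_smul, map_sum, hℓ] using this
  output n h1 hn := by rw [h.output n h1 hn, map_bdf2]

end Components

/-- The error in the component of the solution that belongs to the eigenvalue `lam`. -/
theorem component_error_eq {V X : Type*} [NormedAddCommGroup V] [NormedSpace ℝ V] [FiniteDimensional ℝ V]
    [NormedAddCommGroup X] [NormedSpace ℝ X] [CompleteSpace X] {P : X →L[ℝ] V}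
    {α μ lam T τ : ℝ} (hα : 0 < α) (hα' : α < 1) (hμ : 0 ≤ μ) (hl : 0 < lam) (hτ : 0 < τ) {N : ℕ} (hT : T = N * τ)
    {B : V → V} {ℓ : V →L[ℝ] ℝ} (hℓ : ∀ x, ℓ (B x) = lam * ℓ x) {g g' g'' : ℝ → X}
    (hg : HasTimeWeakDeriv T g g') (hg' : HasTimeWeakDeriv T g' g'')
    (hgc : ContinuousOn g (Icc 0 T)) (hgc' : ContinuousOn g' (Icc 0 T)) {u₀ : V} {u : ℝ → V}
    (hu : IsSubdiffusionSolution B α T (fun t => P (t ^ μ • g t)) u₀ u) {U : ℤ → V} {v : ℕ → V}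
    (hU : IsCrankNicolsonI B α τ N (fun t => ∫ ζ in (0 : ℝ)..t, P (ζ ^ μ • g ζ)) u₀ U v) {n : ℕ} (hn : 1 ≤ n)
    (hnN : n ≤ N) :
    IntervalIntegrable (fun s => peanoErr α μ (lam * τ ^ α) n s * ℓ (P (g'' (τ * s)))) volume 0 n ∧
    ℓ (u (n * τ) - v n) =
      ((1 - lam * τ ^ α * ∫ x in (0 : ℝ)..n, resKernel α (lam * τ ^ α) x) - initCoeff α (lam * τ ^ α) n) * ℓ u₀ +
      τ ^ (α + μ) * ((∫ x in (0 : ℝ)..n, ((n : ℝ) - x) ^ μ * kernErr α (lam * τ ^ α) x) * ℓ (P (g 0))) +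
      τ ^ (α + μ + 1) * ((∫ x in (0 : ℝ)..n, ((n : ℝ) - x) ^ (μ + 1) * kernErr α (lam * τ ^ α) x) * ℓ (P (g' 0))) +
      τ ^ (α + μ + 2) * ∫ s in (0 : ℝ)..n, peanoErr α μ (lam * τ ^ α) n s * ℓ (P (g'' (τ * s))) := by
  set lam' := lam * τ ^ α with hlam'
  have hτα : 0 < τ ^ α := Real.rpow_pos_of_pos hτ α
  have hl' : 0 < lam' := mul_pos hl hτα
  have hn0 : (0 : ℝ) < n := by exact_mod_cast hn
  have hnNr : (n : ℝ) ≤ N := by exact_mod_cast hnN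
  have htT : n * τ ≤ T := by rw [hT]; exact mul_le_mul_of_nonneg_right hnNr hτ.le
  have ht0 : 0 < n * τ := mul_pos hn0 hτ
  have hT0 : 0 < T := ht0.trans_le htT
  set ℓP : X →L[ℝ] ℝ := ℓ.comp P with hℓP
  set f : ℝ → ℝ := fun t => t ^ μ * ℓP (g t) with hf
  have hfe : ∀ t, ℓ (P (t ^ μ • g t)) = f t := fun t => by simp [hf, hℓP]
  have hPgc : ContinuousOn (fun t => P (t ^ μ • g t)) (Icc 0 T) :=
    P.continuous.comp_continuousOn ((Real.continuous_rpow_const hμ).continuousOn.smul hgc)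
  have hfc : ContinuousOn f (Icc 0 T) := by
    refine (ℓ.continuous.comp_continuousOn hPgc).congr fun t _ => (hfe t).symm
  have hsub : ∀ t, t ∈ Icc 0 T → Icc 0 t ⊆ Icc 0 T := fun t ht => Icc_subset_Icc_right ht.2
  -- the solution of the scheme
  have e1 := (hU.clm hℓ).eq_initCoeff_add hα' hl hτ (by simp) hn hnN
  have hF : ∀ t, t ∈ Icc 0 T → ℓ (∫ ζ in (0 : ℝ)..t, P (ζ ^ μ • g ζ)) = ∫ y in (0 : ℝ)..t, f y := by
    intro t ht
    rw [← ℓ.intervalIntegral_comp_comm ((hPgc.mono (hsub t ht)).intervalIntegrable_of_Icc ht.1)]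
    exact intervalIntegral.integral_congr fun y _ => hfe y
  have e2 : ∑ m ∈ Finset.range n, srcCoeff α lam' m * (ℓ (∫ ζ in (0 : ℝ)..((n - m : ℝ) * τ), P (ζ ^ μ • g ζ)) -
      ℓ (∫ ζ in (0 : ℝ)..((n - m - 1 : ℝ) * τ), P (ζ ^ μ • g ζ))) =
      τ * ∫ x in (0 : ℝ)..n, f (τ * (n - x)) * srcCoeff α lam' ⌊x⌋₊ := by
    rw [← sum_srcCoeff_mul_eq hτ ((hfc.mono (hsub _ ⟨ht0.le, htT⟩)).intervalIntegrable_of_Icc ht0.le)]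
    refine Finset.sum_congr rfl fun m hm => ?_
    have hm1 : (m : ℝ) + 1 ≤ n := by exact_mod_cast Finset.mem_range.1 hm
    have hm0 : (0 : ℝ) ≤ m := Nat.cast_nonneg m
    have p1 : 0 ≤ ((n : ℝ) - m - 1) * τ := mul_nonneg (by linarith) hτ.le
    have p2 : ((n : ℝ) - m - 1) * τ ≤ (n - m) * τ := mul_le_mul_of_nonneg_right (by linarith) hτ.le
    have p3 : ((n : ℝ) - m) * τ ≤ n * τ := mul_le_mul_of_nonneg_right (by linarith) hτ.le
    rw [hF _ ⟨by linarith, by linarith⟩, hF _ ⟨p1, by linarith⟩]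
  rw [e2, ← mul_assoc, ← Real.rpow_add_one hτ.ne', sub_add_cancel] at e1
  -- the exact solution
  have e3 := hu.clm_eq hα hα' hl hℓ (hfc.congr fun t _ => hfe t) ⟨ht0, htT⟩
  simp only [hfe] at e3
  have hscale : ∀ G : ℝ → ℝ, ∫ y in (0 : ℝ)..(n * τ), G y = τ * ∫ x in (0 : ℝ)..n, G (τ * x) := by
    intro G
    have := intervalIntegral.integral_comp_mul_left (a := 0) (b := n) G hτ.ne'
    rw [this, mul_zero, smul_eq_mul, ← mul_assoc, mul_inv_cancel₀ hτ.ne', one_mul, mul_comm]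
  have hττ : τ * τ ^ (α - 1) = τ ^ α := by rw [mul_comm, ← Real.rpow_add_one hτ.ne', sub_add_cancel]
  have e4 : ∫ y in (0 : ℝ)..(n * τ), resKernel α lam y = τ ^ α * ∫ x in (0 : ℝ)..n, resKernel α lam' x := by
    rw [hscale]
    simp only [resKernel_mul hτ]
    rw [intervalIntegral.integral_const_mul, ← mul_assoc, hττ]
  have e5 : ∫ y in (0 : ℝ)..(n * τ), f (n * τ - y) * resKernel α lam y =
      τ ^ α * ∫ x in (0 : ℝ)..n, f (τ * (n - x)) * resKernel α lam' x := by
    rw [hscale]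
    have : ∀ x : ℝ, f (n * τ - τ * x) * resKernel α lam (τ * x) =
        τ ^ (α - 1) * (f (τ * (n - x)) * resKernel α lam' x) := by
      intro x
      rw [resKernel_mul hτ, show n * τ - τ * x = τ * (n - x) by ring]; ring
    simp only [this]
    rw [intervalIntegral.integral_const_mul, ← mul_assoc, hττ]
  rw [e4, e5] at e3
  -- the difference is the error of the kernel
  have hfc2 : ContinuousOn (fun x : ℝ => f (τ * (n - x))) (uIcc 0 (n : ℝ)) := by
    rw [uIcc_of_le hn0.le]
    refine hfc.comp (by fun_prop) fun x hx => ⟨mul_nonneg hτ.le (by linarith [hx.2]), ?_⟩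
    have : τ * (n - x) ≤ τ * n := mul_le_mul_of_nonneg_left (by linarith [hx.1]) hτ.le
    linarith
  have hi1 : IntervalIntegrable (fun x => f (τ * (n - x)) * resKernel α lam' x) volume 0 n :=
    (intervalIntegrable_resKernel hα hα' hl' le_rfl hn0.le).continuousOn_mul hfc2
  have hi2 : IntervalIntegrable (fun x => f (τ * (n - x)) * kernErr α lam' x) volume 0 n :=
    (intervalIntegrable_kernErr hα hα' hl' le_rfl hn0.le).continuousOn_mul hfc2
  have e6 : ∫ x in (0 : ℝ)..n, f (τ * (n - x)) * srcCoeff α lam' ⌊x⌋₊ =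
      (∫ x in (0 : ℝ)..n, f (τ * (n - x)) * resKernel α lam' x) -
        ∫ x in (0 : ℝ)..n, f (τ * (n - x)) * kernErr α lam' x := by
    rw [← intervalIntegral.integral_sub hi1 hi2]
    refine intervalIntegral.integral_congr fun x _ => ?_
    simp only [kernErr]; ring
  -- the Taylor expansion of the source
  set q : ℝ → ℝ := fun s => τ ^ (μ + 2) * ℓP (g'' (τ * s)) with hq
  have hgi : IntervalIntegrable (fun s => ℓP (g'' s)) volume 0 (n * τ) :=
    ((intervalIntegrable_iff_integrableOn_Ioo_of_le hT0.le).2 (ℓP.integrable_comp hg'.integrable_deriv)).mono_set (by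
      rw [uIcc_of_le ht0.le, uIcc_of_le hT0.le]; exact hsub _ ⟨ht0.le, htT⟩)
  have hqi0 : IntervalIntegrable (fun s => ℓP (g'' (τ * s))) volume 0 n := by
    have := hgi.comp_mul_left (c := τ)
    rwa [zero_div, mul_div_assoc, div_self hτ.ne', mul_one] at this
  have hτμ : τ ^ (μ + 2) = τ ^ μ * τ ^ 2 := by
    rw [Real.rpow_add hτ, Real.rpow_two]
  have hft : ∀ y ∈ Icc 0 (n : ℝ), f (τ * y) = y ^ μ * (τ ^ μ * ℓP (g 0) + τ ^ (μ + 1) * ℓP (g' 0) * y +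
      ∫ s in (0 : ℝ)..y, (y - s) * q s) := by
    intro y hy
    have hy1 : τ * y ∈ Icc 0 T :=
      ⟨mul_nonneg hτ.le hy.1, (mul_le_mul_of_nonneg_left hy.2 hτ.le).trans (by linarith)⟩
    have ht := (hg.clm_comp ℓP).taylor hT0 (hg'.clm_comp ℓP) (ℓP.continuous.comp_continuousOn hgc)
      (ℓP.continuous.comp_continuousOn hgc') hy1
    have hs := intervalIntegral.integral_comp_mul_left (a := 0) (b := y) (fun s => (τ * y - s) * ℓP (g'' s)) hτ.ne'
    have e7 : ∫ s in (0 : ℝ)..y, (y - s) * q s = τ ^ μ * ∫ s in (0 : ℝ)..(τ * y), (τ * y - s) * ℓP (g'' s) := by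
      rw [mul_zero, smul_eq_mul, eq_inv_mul_iff_mul_eq₀ hτ.ne'] at hs
      rw [← hs, ← intervalIntegral.integral_const_mul, ← intervalIntegral.integral_const_mul]
      refine intervalIntegral.integral_congr fun s _ => ?_
      simp only [hq, hτμ]; ring
    rw [e7, hf]
    beta_reduce
    rw [ht, Real.mul_rpow hτ.le hy.1, Real.rpow_add_one hτ.ne']
    ring
  obtain ⟨hP1, hP2⟩ := integral_source_mul_kernErr hα hα' hμ hl' hn0 (f := fun y => f (τ * y)) (q := q)
    (hqi0.const_mul (τ ^ (μ + 2))) hft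
  have hτμ0 : τ ^ (μ + 2) ≠ 0 := (Real.rpow_pos_of_pos hτ _).ne'
  have hq2 : ∀ s, peanoErr α μ lam' n s * q s = τ ^ (μ + 2) * (peanoErr α μ lam' n s * ℓ (P (g'' (τ * s)))) := by
    intro s; simp only [hq, hℓP, ContinuousLinearMap.comp_apply]; ring
  constructor
  · have := hP1.const_mul (τ ^ (μ + 2))⁻¹
    refine this.congr fun s _ => ?_
    exact (congrArg ((τ ^ (μ + 2))⁻¹ * ·) (hq2 s)).trans (inv_mul_cancel_left₀ hτμ0 _)
  · have hP3 := hP2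
    simp only [hq2, intervalIntegral.integral_const_mul] at hP3
    rw [map_sub, e3, e1, e6]
    have r1 : τ ^ (α + μ) = τ ^ α * τ ^ μ := Real.rpow_add hτ _ _
    have r2 : τ ^ (α + μ + 1) = τ ^ α * τ ^ (μ + 1) := by rw [← Real.rpow_add hτ]; ring_nf
    have r3 : τ ^ (α + μ + 2) = τ ^ α * τ ^ (μ + 2) := by rw [← Real.rpow_add hτ]; ring_nf
    rw [r1, r2, r3]
    simp only [hℓP, ContinuousLinearMap.comp_apply] at hP3
    linear_combination τ ^ α * hP3

/-! ### The error estimate -/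

/-- Bounds for the components with respect to an orthonormal basis give a bound for the norm, without a
dependence on the dimension. -/
theorem norm_sum_smul_le {ι V : Type*} [Fintype ι] [NormedAddCommGroup V] [InnerProductSpace ℝ V]
    (b : OrthonormalBasis ι ℝ V) {k : ι → ℝ} {C : ℝ} (hC : 0 ≤ C) (hk : ∀ i, |k i| ≤ C) (x : V) :
    ‖∑ i, (k i * inner ℝ (b i) x) • b i‖ ≤ C * ‖x‖ := by
  refine le_of_sq_le_sq ?_ (by positivity)
  rw [← b.sum_sq_norm_inner_right, mul_pow, ← b.sum_sq_norm_inner_right x, Finset.mul_sum]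
  refine Finset.sum_le_sum fun i _ => ?_
  rw [b.orthonormal.inner_right_fintype, norm_mul, mul_pow]
  exact mul_le_mul_of_nonneg_right (pow_le_pow_left₀ (abs_nonneg _) (hk i) 2) (by positivity)

/-- The error estimate for a symmetric positive definite operator on a finite-dimensional
inner product space. -/
theorem exists_error_le {α μ : ℝ} (hα : 0 < α) (hα' : α < 1) (hμ : 0 ≤ μ) : ∃ c : ℝ, 0 < c ∧
    ∀ {V X : Type} [NormedAddCommGroup V] [InnerProductSpace ℝ V] [FiniteDimensional ℝ V]
      [NormedAddCommGroup X] [NormedSpace ℝ X] [CompleteSpace X] {P : X →L[ℝ] V} (_ : ∀ x, ‖P x‖ ≤ ‖x‖)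
      {B : V →ₗ[ℝ] V} (_ : B.IsSymmetric) (_ : ∀ x, x ≠ 0 → 0 < inner ℝ (B x) x) {T τ : ℝ} {N : ℕ} (_ : 0 < τ)
      (_ : T = N * τ) {g g' g'' : ℝ → X} (_ : HasTimeWeakDeriv T g g') (_ : HasTimeWeakDeriv T g' g'')
      (_ : ContinuousOn g (Icc 0 T)) (_ : ContinuousOn g' (Icc 0 T)) {u₀ : X} {u : ℝ → V}
      (_ : IsSubdiffusionSolution B α T (fun t => P (t ^ μ • g t)) (P u₀) u) {U : ℤ → V} {v : ℕ → V}
      (_ : IsCrankNicolsonI B α τ N (fun t => ∫ ζ in (0 : ℝ)..t, P (ζ ^ μ • g ζ)) (P u₀) U v) {n : ℕ} (_ : 1 ≤ n)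
      (_ : n ≤ N) {t : ℝ} (_ : t = n * τ)
      (_ : IntervalIntegrable (fun ζ => (t - ζ) ^ (α - 1) * ζ ^ μ * ‖g'' ζ‖) volume 0 t),
      ‖u t - v n‖ ≤ c * τ ^ 2 *
        (t ^ (-2 : ℝ) * ‖u₀‖ + t ^ (α + μ - 2) * ‖g 0‖ + t ^ (α + μ - 1) * ‖g' 0‖
          + t ^ (α + μ - 1) * (∫ ζ in (0 : ℝ)..t, ‖g'' ζ‖)
          + ∫ ζ in (0 : ℝ)..t, (t - ζ) ^ (α - 1) * ζ ^ μ * ‖g'' ζ‖) := by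
  obtain ⟨C₀, hC₀, h0⟩ := exists_initCoeff_sub_le hα hα'
  obtain ⟨C₁, hC₁, h1⟩ := exists_integral_rpow_mul_kernErr_le hα hα' hμ
  obtain ⟨C₂, hC₂, h2⟩ := exists_integral_rpow_add_one_mul_kernErr_le hα hα' hμ
  obtain ⟨C₃, hC₃, h3⟩ := exists_peanoErr_le hα hα' hμ
  refine ⟨C₀ + C₁ + C₂ + C₃, by positivity, ?_⟩
  intro V X _ _ _ _ _ _ P hP B hB hpos T τ N hτ hT g g' g'' hg hg' hgc hgc' u₀ u hu U v hU n hn hnN t ht hint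
  have hn0 : (0 : ℝ) < n := by exact_mod_cast hn
  have hnNr : (n : ℝ) ≤ N := by exact_mod_cast hnN
  have htT : t ≤ T := by rw [hT, ht]; exact mul_le_mul_of_nonneg_right hnNr hτ.le
  have ht0 : 0 < t := by rw [ht]; exact mul_pos hn0 hτ
  have hT0 : 0 < T := ht0.trans_le htT
  -- the spectral decomposition of `B`
  set b := hB.eigenvectorBasis rfl with hb
  set lam := hB.eigenvalues rfl with hlam
  have hBb : ∀ i, B (b i) = lam i • b i := fun i => hB.apply_eigenvectorBasis rfl i
  have hl : ∀ i, 0 < lam i := by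
    intro i
    have h := hpos (b i) (b.orthonormal.ne_zero i)
    rwa [hBb, real_inner_smul_left, real_inner_self_eq_norm_sq, b.orthonormal.norm_eq_one, one_pow, mul_one] at h
  have hℓ : ∀ i x, innerSL ℝ (b i) (B x) = lam i * innerSL ℝ (b i) x := by
    intro i x
    rw [innerSL_apply_apply, innerSL_apply_apply, ← hB (b i) x, hBb, real_inner_smul_left]
  have hcomp := fun i => component_error_eq hα hα' hμ (hl i) hτ hT (hℓ i) hg hg' hgc hgc' hu hU hn hnN
  simp only [innerSL_apply_apply] at hcomp
  rw [← ht] at hcomp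
  have hl' : ∀ i, 0 < lam i * τ ^ α := fun i => mul_pos (hl i) (Real.rpow_pos_of_pos hτ α)
  set E₀ : _ → ℝ := fun i => (1 - lam i * τ ^ α * ∫ x in (0 : ℝ)..n, resKernel α (lam i * τ ^ α) x) -
    initCoeff α (lam i * τ ^ α) n with hE₀
  set E₁ : _ → ℝ := fun i => ∫ x in (0 : ℝ)..n, ((n : ℝ) - x) ^ μ * kernErr α (lam i * τ ^ α) x with hE₁
  set E₂ : _ → ℝ := fun i => ∫ x in (0 : ℝ)..n, ((n : ℝ) - x) ^ (μ + 1) * kernErr α (lam i * τ ^ α) x with hE₂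
  set W : ℝ → V := fun s => ∑ i, (peanoErr α μ (lam i * τ ^ α) n s * inner ℝ (b i) (P (g'' (τ * s)))) • b i with hW
  have hWint : ∫ s in (0 : ℝ)..n, W s =
      ∑ i, (∫ s in (0 : ℝ)..n, peanoErr α μ (lam i * τ ^ α) n s * inner ℝ (b i) (P (g'' (τ * s)))) • b i := by
    simp only [hW]
    rw [intervalIntegral.integral_finsetSum fun i _ => ⟨(hcomp i).1.1.smul_const _, (hcomp i).1.2.smul_const _⟩]
    simp only [intervalIntegral.integral_smul_const]
  have hdecomp : u t - v n = (∑ i, (E₀ i * inner ℝ (b i) (P u₀)) • b i) +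
      τ ^ (α + μ) • (∑ i, (E₁ i * inner ℝ (b i) (P (g 0))) • b i) +
      τ ^ (α + μ + 1) • (∑ i, (E₂ i * inner ℝ (b i) (P (g' 0))) • b i) +
      τ ^ (α + μ + 2) • ∫ s in (0 : ℝ)..n, W s := by
    rw [hWint, Finset.smul_sum, Finset.smul_sum, Finset.smul_sum, ← Finset.sum_add_distrib, ← Finset.sum_add_distrib,
      ← Finset.sum_add_distrib, ← b.sum_repr' (u t - v n)]
    refine Finset.sum_congr rfl fun i _ => ?_
    rw [(hcomp i).2, smul_smul, smul_smul, smul_smul, ← add_smul, ← add_smul, ← add_smul]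
  -- the integral remainder
  have hgn : IntervalIntegrable (fun s => ‖g'' s‖) volume 0 t :=
    ((intervalIntegrable_iff_integrableOn_Ioo_of_le hT0.le).2 hg'.integrable_deriv.norm).mono_set (by
      rw [uIcc_of_le ht0.le, uIcc_of_le hT0.le]; exact Icc_subset_Icc_right htT)
  have htn : t / τ = n := by rw [ht, mul_div_assoc, div_self hτ.ne', mul_one]
  have hscale : ∀ G : ℝ → ℝ, ∫ s in (0 : ℝ)..n, G (τ * s) = τ⁻¹ * ∫ y in (0 : ℝ)..t, G y := by
    intro G
    rw [intervalIntegral.integral_comp_mul_left G hτ.ne', mul_zero, smul_eq_mul, ht, mul_comm τ]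
  have i1 : IntervalIntegrable (fun s => ‖g'' (τ * s)‖) volume 0 n := by
    have := hgn.comp_mul_left (c := τ)
    rwa [zero_div, htn] at this
  have i2 : IntervalIntegrable (fun s => (t - τ * s) ^ (α - 1) * (τ * s) ^ μ * ‖g'' (τ * s)‖) volume 0 n := by
    have := hint.comp_mul_left (c := τ)
    rwa [zero_div, htn] at this
  have hW1 : ‖∫ s in (0 : ℝ)..n, W s‖ ≤ ∫ s in (0 : ℝ)..n, C₃ * ((n : ℝ) ^ (α + μ - 1) * ‖g'' (τ * s)‖ +
      τ ^ (-(α + μ - 1)) * ((t - τ * s) ^ (α - 1) * (τ * s) ^ μ * ‖g'' (τ * s)‖)) := by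
    refine intervalIntegral.norm_integral_le_of_norm_le hn0.le ?_
      (((i1.const_mul _).add (i2.const_mul _)).const_mul _)
    have hne : ∀ᵐ s : ℝ, s ≠ n := by simp [ae_iff]
    filter_upwards [hne] with s hsn hs
    have hlt : s < n := lt_of_le_of_ne hs.2 hsn
    have p1 : 0 ≤ ((n : ℝ) - s) ^ (α - 1) * s ^ μ :=
      mul_nonneg (Real.rpow_nonneg (by linarith) _) (Real.rpow_nonneg hs.1.le _)
    have e1 : τ ^ (-(α + μ - 1)) * ((t - τ * s) ^ (α - 1) * (τ * s) ^ μ * ‖g'' (τ * s)‖) =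
        (n - s) ^ (α - 1) * s ^ μ * ‖g'' (τ * s)‖ := by
      rw [ht, show n * τ - τ * s = τ * (n - s) by ring, Real.mul_rpow hτ.le (by linarith), Real.mul_rpow hτ.le hs.1.le]
      have : τ ^ (-(α + μ - 1)) * (τ ^ (α - 1) * τ ^ μ) = 1 := by
        rw [← Real.rpow_add hτ, ← Real.rpow_add hτ]
        ring_nf
        exact Real.rpow_zero τ
      linear_combination ((n - s) ^ (α - 1) * s ^ μ * ‖g'' (τ * s)‖) * this
    rw [e1]
    calc ‖W s‖ ≤ C₃ * ((n : ℝ) ^ (α + μ - 1) + (n - s) ^ (α - 1) * s ^ μ) * ‖P (g'' (τ * s))‖ :=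
          norm_sum_smul_le b (mul_nonneg hC₃.le (add_nonneg (by positivity) p1))
            (fun i => h3 _ _ _ (hl' i) hs.1 hlt) _
      _ ≤ C₃ * ((n : ℝ) ^ (α + μ - 1) + (n - s) ^ (α - 1) * s ^ μ) * ‖g'' (τ * s)‖ :=
          mul_le_mul_of_nonneg_left (hP _) (mul_nonneg hC₃.le (add_nonneg (by positivity) p1))
      _ = _ := by ring
  set J₁ := ∫ ζ in (0 : ℝ)..t, ‖g'' ζ‖ with hJ₁
  set J₂ := ∫ ζ in (0 : ℝ)..t, (t - ζ) ^ (α - 1) * ζ ^ μ * ‖g'' ζ‖ with hJ₂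
  have hJ₁0 : 0 ≤ J₁ := intervalIntegral.integral_nonneg ht0.le fun _ _ => norm_nonneg _
  have hJ₂0 : 0 ≤ J₂ := intervalIntegral.integral_nonneg ht0.le fun s hs =>
    mul_nonneg (mul_nonneg (Real.rpow_nonneg (by linarith [hs.2]) _) (Real.rpow_nonneg hs.1 _)) (norm_nonneg _)
  have hW2 : ‖∫ s in (0 : ℝ)..n, W s‖ ≤
      C₃ * ((n : ℝ) ^ (α + μ - 1) * (τ⁻¹ * J₁) + τ ^ (-(α + μ - 1)) * (τ⁻¹ * J₂)) := by
    refine hW1.trans_eq ?_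
    rw [intervalIntegral.integral_const_mul, intervalIntegral.integral_add (i1.const_mul _) (i2.const_mul _),
      intervalIntegral.integral_const_mul, intervalIntegral.integral_const_mul, hscale (fun ζ => ‖g'' ζ‖),
      hscale (fun ζ => (t - ζ) ^ (α - 1) * ζ ^ μ * ‖g'' ζ‖)]
  -- powers of `τ` and `n`
  have hp : ∀ p : ℝ, τ ^ 2 * t ^ p = τ ^ (p + 2) * (n : ℝ) ^ p := by
    intro p
    rw [ht, Real.mul_rpow hn0.le hτ.le, Real.rpow_add hτ, Real.rpow_two]; ring
  have q0 : (n : ℝ) ^ (-2 : ℝ) = τ ^ 2 * t ^ (-2 : ℝ) := by rw [hp]; norm_num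
  have q1 : τ ^ (α + μ) * (n : ℝ) ^ (α + μ - 2) = τ ^ 2 * t ^ (α + μ - 2) := by rw [hp, sub_add_cancel]
  have q2 : τ ^ (α + μ + 1) * (n : ℝ) ^ (α + μ - 1) = τ ^ 2 * t ^ (α + μ - 1) := by rw [hp]; ring_nf
  have q3 : τ ^ (α + μ + 2) * τ⁻¹ = τ ^ (α + μ + 1) := by
    rw [← Real.rpow_neg_one, ← Real.rpow_add hτ]; ring_nf
  have q4 : τ ^ (α + μ + 1) * τ ^ (-(α + μ - 1)) = τ ^ 2 := by
    rw [← Real.rpow_add hτ, ← Real.rpow_two]; ring_nf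
  have r0 : ‖∑ i, (E₀ i * inner ℝ (b i) (P u₀)) • b i‖ ≤ τ ^ 2 * (C₀ * (t ^ (-2 : ℝ) * ‖u₀‖)) := by
    refine (norm_sum_smul_le b (by positivity) (fun i => h0 _ (hl' i) n hn) _).trans ?_
    calc _ ≤ C₀ * (n : ℝ) ^ (-2 : ℝ) * ‖u₀‖ := mul_le_mul_of_nonneg_left (hP _) (by positivity)
      _ = _ := by rw [q0]; ring
  have r1 : ‖τ ^ (α + μ) • ∑ i, (E₁ i * inner ℝ (b i) (P (g 0))) • b i‖ ≤
      τ ^ 2 * (C₁ * (t ^ (α + μ - 2) * ‖g 0‖)) := by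
    rw [norm_smul, Real.norm_of_nonneg (by positivity)]
    calc _ ≤ τ ^ (α + μ) * (C₁ * (n : ℝ) ^ (α + μ - 2) * ‖P (g 0)‖) :=
          mul_le_mul_of_nonneg_left
            (norm_sum_smul_le b (by positivity) (fun i => h1 _ n (hl' i) hn0) _) (by positivity)
      _ ≤ τ ^ (α + μ) * (C₁ * (n : ℝ) ^ (α + μ - 2) * ‖g 0‖) :=
          mul_le_mul_of_nonneg_left (mul_le_mul_of_nonneg_left (hP _) (by positivity)) (by positivity)
      _ = C₁ * ‖g 0‖ * (τ ^ (α + μ) * (n : ℝ) ^ (α + μ - 2)) := by ring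
      _ = _ := by rw [q1]; ring
  have r2 : ‖τ ^ (α + μ + 1) • ∑ i, (E₂ i * inner ℝ (b i) (P (g' 0))) • b i‖ ≤
      τ ^ 2 * (C₂ * (t ^ (α + μ - 1) * ‖g' 0‖)) := by
    rw [norm_smul, Real.norm_of_nonneg (by positivity)]
    calc _ ≤ τ ^ (α + μ + 1) * (C₂ * (n : ℝ) ^ (α + μ - 1) * ‖P (g' 0)‖) :=
          mul_le_mul_of_nonneg_left
            (norm_sum_smul_le b (by positivity) (fun i => h2 _ n (hl' i) hn0) _) (by positivity)
      _ ≤ τ ^ (α + μ + 1) * (C₂ * (n : ℝ) ^ (α + μ - 1) * ‖g' 0‖) :=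
          mul_le_mul_of_nonneg_left (mul_le_mul_of_nonneg_left (hP _) (by positivity)) (by positivity)
      _ = C₂ * ‖g' 0‖ * (τ ^ (α + μ + 1) * (n : ℝ) ^ (α + μ - 1)) := by ring
      _ = _ := by rw [q2]; ring
  have r3 : ‖τ ^ (α + μ + 2) • ∫ s in (0 : ℝ)..n, W s‖ ≤ τ ^ 2 * (C₃ * (t ^ (α + μ - 1) * J₁ + J₂)) := by
    rw [norm_smul, Real.norm_of_nonneg (by positivity)]
    calc _ ≤ τ ^ (α + μ + 2) *
          (C₃ * ((n : ℝ) ^ (α + μ - 1) * (τ⁻¹ * J₁) + τ ^ (-(α + μ - 1)) * (τ⁻¹ * J₂))) :=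
          mul_le_mul_of_nonneg_left hW2 (by positivity)
      _ = C₃ * (((τ ^ (α + μ + 2) * τ⁻¹) * (n : ℝ) ^ (α + μ - 1)) * J₁ +
          ((τ ^ (α + μ + 2) * τ⁻¹) * τ ^ (-(α + μ - 1))) * J₂) := by ring
      _ = _ := by rw [q3, q2, q4]; ring
  have s0 : 0 ≤ t ^ (-2 : ℝ) * ‖u₀‖ := by positivity
  have s1 : 0 ≤ t ^ (α + μ - 2) * ‖g 0‖ := by positivity
  have s2 : 0 ≤ t ^ (α + μ - 1) * ‖g' 0‖ := by positivity
  have s3 : 0 ≤ t ^ (α + μ - 1) * J₁ := by positivity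
  rw [hdecomp]
  refine (norm_add_le _ _).trans ((add_le_add ((norm_add_le _ _).trans
    (add_le_add ((norm_add_le _ _).trans (add_le_add r0 r1)) r2)) r3).trans ?_)
  generalize t ^ (-2 : ℝ) * ‖u₀‖ = a₀ at *
  generalize t ^ (α + μ - 2) * ‖g 0‖ = a₁ at *
  generalize t ^ (α + μ - 1) * ‖g' 0‖ = a₂ at *
  generalize t ^ (α + μ - 1) * J₁ = a₃ at *
  have key : C₀ * a₀ + C₁ * a₁ + C₂ * a₂ + C₃ * (a₃ + J₂) ≤ (C₀ + C₁ + C₂ + C₃) * (a₀ + a₁ + a₂ + a₃ + J₂) := by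
    have k : ∀ {x y : ℝ}, 0 ≤ x → 0 ≤ y → 0 ≤ x * y := fun hx hy => mul_nonneg hx hy
    have k1 := k hC₀.le (by positivity : 0 ≤ a₁ + a₂ + a₃ + J₂)
    have k2 := k hC₁.le (by positivity : 0 ≤ a₀ + a₂ + a₃ + J₂)
    have k3 := k hC₂.le (by positivity : 0 ≤ a₀ + a₁ + a₃ + J₂)
    have k4 := k hC₃.le (by positivity : 0 ≤ a₀ + a₁ + a₂)
    linarith
  calc _ = τ ^ 2 * (C₀ * a₀ + C₁ * a₁ + C₂ * a₂ + C₃ * (a₃ + J₂)) := by ring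
    _ ≤ τ ^ 2 * ((C₀ + C₁ + C₂ + C₃) * (a₀ + a₁ + a₂ + a₃ + J₂)) := by gcongr
    _ = _ := by ring

/-- The discrete operator as a linear map. -/
noncomputable def discreteOpLinear {d : ℕ} {Ω : Opens (Space d)} (A : EllipticOperator Ω) (K : Triangulation Ω) :
    K.femSpace →ₗ[ℝ] K.femSpace where
  toFun := discreteOp A K
  map_add' φ φ' := by
    refine ext_inner_right ℝ fun ψ => ?_
    rw [inner_add_left, inner_discreteOp, inner_discreteOp, inner_discreteOp, A.form_symm, A.form_symm φ,
      A.form_symm φ', ← A.form_add_right _ φ.2.1 φ'.2.1]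
    rfl
  map_smul' r φ := by
    refine ext_inner_right ℝ fun ψ => ?_
    rw [RingHom.id_apply, real_inner_smul_left, inner_discreteOp, inner_discreteOp, A.form_symm, A.form_symm φ,
      ← A.form_smul_right _ φ.2.1]
    rfl

theorem isSymmetric_discreteOpLinear {d : ℕ} {Ω : Opens (Space d)} (A : EllipticOperator Ω) (K : Triangulation Ω) :
    (discreteOpLinear A K).IsSymmetric := by
  intro φ ψ
  exact (inner_discreteOp A K φ ψ).trans ((A.form_symm _ _).trans
    ((inner_discreteOp A K ψ φ).symm.trans (real_inner_comm _ _)))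

end SubDiffusion

theorem mainTheorem5 (α : ℝ) (hα : 0 < α) (hα' : α < 1) (μ : ℝ) (hμ : 0 ≤ μ) :
    ∃ c : ℝ, 0 < c ∧
      ∀ (d : ℕ) (_ : d = 1 ∨ d = 2) (Ω : TopologicalSpace.Opens (SubDiffusion.Space d))
        (_ : IsConnected (Ω : Set (SubDiffusion.Space d)))
        (_ : Bornology.IsBounded (Ω : Set (SubDiffusion.Space d)))
        (A : SubDiffusion.EllipticOperator Ω) (K : SubDiffusion.Triangulation Ω)
        (T : ℝ) (_ : 0 < T) (u₀ : SubDiffusion.L2 Ω)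
        -- `g`, its first and its second weak derivative in time
        (g g' g'' : ℝ → SubDiffusion.L2 Ω)
        (_ : SubDiffusion.MemW1Inf T g g')
        (_ : SubDiffusion.HasTimeWeakDeriv T g' g'')
        -- `g` and `g'` are the continuous representatives, so that `g(0)` and `g'(0)` make sense
        (_ : ContinuousOn g (Set.Icc 0 T)) (_ : ContinuousOn g' (Set.Icc 0 T))
        -- the semidiscrete solution for the source `f(t) = t^μ g(t)`
        (u : ℝ → K.femSpace)
        (_ : SubDiffusion.IsSubdiffusionSolution (SubDiffusion.discreteOp A K) α T
          (fun t => K.proj (t ^ μ • g t)) (K.proj u₀) u)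
        (N : ℕ) (_ : 1 ≤ N)
        -- the solution of the fully discrete scheme with step size `τ = T / N`
        (U : ℤ → K.femSpace) (v : ℕ → K.femSpace)
        (_ : SubDiffusion.IsCrankNicolsonI (SubDiffusion.discreteOp A K) α (T / N) N
          (fun t => ∫ ζ in (0 : ℝ)..t, K.proj (ζ ^ μ • g ζ)) (K.proj u₀) U v)
        (n : ℕ) (_ : 1 ≤ n) (_ : n ≤ N) (t : ℝ) (_ : t = n * (T / N))
        (_ : IntervalIntegrable (fun ζ => (t - ζ) ^ (α - 1) * ζ ^ μ * ‖g'' ζ‖)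
          MeasureTheory.volume 0 t),
        ‖u t - v n‖ ≤ c * (T / N) ^ 2 *
          (t ^ (-2 : ℝ) * ‖u₀‖ + t ^ (α + μ - 2) * ‖g 0‖ + t ^ (α + μ - 1) * ‖g' 0‖
            + t ^ (α + μ - 1) * (∫ ζ in (0 : ℝ)..t, ‖g'' ζ‖)
            + ∫ ζ in (0 : ℝ)..t, (t - ζ) ^ (α - 1) * ζ ^ μ * ‖g'' ζ‖) := by
  obtain ⟨c, hc, h⟩ := SubDiffusion.exists_error_le hα hα' hμ
  refine ⟨c, hc, ?_⟩
  intro d _ Ω _ _ A K T hT u₀ g g' g'' hg hg' hgc hgc' u hu N hN U v hU n hn hnN t ht hint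
  have hN0 : (0 : ℝ) < N := by exact_mod_cast hN
  exact h (P := K.proj) (B := SubDiffusion.discreteOpLinear A K)
    (K.femSpace.norm_orthogonalProjectionOnto_apply_le)
    (SubDiffusion.isSymmetric_discreteOpLinear A K)
    (fun φ hφ => (SubDiffusion.inner_discreteOp A K φ φ).symm ▸ A.posDef φ φ.2.1 (by simpa using hφ))
    (div_pos hT hN0) (by field_simp) hg.hasTimeWeakDeriv hg' hgc hgc' hu hU hn hnN ht hint
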